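/- **Setting.** Let $Q=[0,1)^3$, $Q'=[-\pi,\pi)^3$, $e_\kappa(x)=e^{i\kappa\cdot x}$. Let $\mu$ be a $Q$-periodic Borel measure on $\mathbb R^3$ with $\mu(Q)=1$, and for $\varepsilon>0$ put $\mu^\varepsilon(B)=\varepsilon^3\mu(\varepsilon^{-1}B)$. Let $A,\widetilde A$ be real, symmetric, bounded, uniformly positive definite, $Q$-periodic $3\times3$ matrix functions on $\mathbb R^3$, $A$ differentiable and $\widetilde A$ Borel measurable. $C^\infty_\#(Q)$ denotes smooth $Q$-periodic functions, and $C^\infty_{\#,0}(Q)$ those with $\int_Q\varphi\,d\mu=0$. *Spaces.* $H^1_{\mathrm{curl}\,A^{1/2}}(\mathbb R^3,d\mu^\varepsilon)$ is the closure in $L^2\oplus L^2$ of the pairs $(\varphi,\mathrm{curl}(A^{1/2}(\cdot/\varepsilon)\varphi))$ with $A^{1/2}(\cdot/\varepsilon)\varphi\in C_0^\infty(\mathbb R^3)$; $H^1_{\mathrm{curl}\,A^{1/2}}(Q,d\mu)$ is the closure of the pairs $(\varphi,\mathrm{curl}(A^{1/2}\varphi))$ with $A^{1/2}\varphi\in C^\infty_\#(Q)$;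 second components of elements are denoted $\mathrm{curl}(A^{1/2}\varphi)$. For $\psi\in H^1_{\#,0}(Q,d\mu)$, $\nabla(e_\kappa\psi)$ is obtained by closing the pairs $(\varphi,\nabla(e_\kappa\varphi))$, $\varphi\in C^\infty_{\#,0}(Q)$, in $L^2(Q,d\mu)\oplus L^2(Q,d\mu)$. A field $v\in L^2(Q,d\mu)$ is *$\kappa$-solenoidal* if $\int_Q A^{-1/2}e_\kappa v\cdot\overline{\nabla(e_\kappa\varphi)}\,d\mu=0$ for all $\varphi\in C^\infty_{\#,0}(Q)$, and *$\kappa$-irrotational* if $\int_Q A^{1/2}e_\kappa v\cdot\overline{\mathrm{curl}(e_\kappa\varphi)}\,d\mu=0$ for all vector fields $\varphi\in C^\infty_{\#,0}(Q)$. *Assumptions on $\mu$.* (i) $\int_Q\partial_j\varphi\,d\mu=0$ for all $\varphi\in C^\infty_\#(Q)$, $j=1,2,3$. (ii) For $\kappa\in Q'$, every $\kappa$-irrotational $v$ has the form $A^{-1/2}(\overline{e_\kappa}\nabla(e_\kappa\psi)+c)$ with $\psi\in H^1_{\#,0}(Q,d\mu)$, $c\in\mathbb C^3$. (iii) There is $C_P>0$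 such that $\|\varphi\|_{L^2(Q,d\mu)}\le C_P\|\mathrm{curl}(e_\kappa\varphi)\|_{L^2(Q,d\mu)}$ for all $\kappa\in Q'$ and all vector fields $\varphi\in C^\infty_{\#,0}(Q)$ with $\int_Q e_\kappa\varphi\cdot\overline{\nabla(e_\kappa\eta)}\,d\mu=0$ for all $\eta\in C^\infty_\#(Q)$. (iv) The set of $w\in H^1_{\mathrm{curl}\,A^{1/2}}(Q,d\mu)$ that are $0$-solenoidal embeds compactly (for the graph norm) into $L^2(Q,d\mu)$. *Homogenised quantities.* For $\kappa\in\mathbb R^3$ let $\Psi_\kappa=(\psi_1,\psi_2,\psi_3)$, $\psi_j\in H^1_{\#,0}(Q,d\mu)$, solve $$\int_Q A^{-1}\nabla(e_\kappa\psi_j)\cdot\overline{\nabla(e_\kappa\varphi)}\,d\mu=-\int_Q A^{-1}e_\kappa \mathbf e_j\cdot\overline{\nabla(e_\kappa\varphi)}\,d\mu\quad\forall\varphi\in C^\infty_{\#,0}(Q),$$ where $\mathbf e_j$ is the $j$-th basis vector, and let $\widehat A^{\rm hom}_\kappa=\int_Q A^{-1}(\overline{e_\kappa}\nabla(e_\kappa\Psi_\kappa)+I)\,d\mu$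 (the $j$-th column of $\nabla(e_\kappa\Psi_\kappa)$ being $\nabla(e_\kappa\psi_j)$). Let the columns of the matrix $N$ lie in $H^1_{\mathrm{curl}\,A^{1/2}}(Q,d\mu)$, be $0$-solenoidal, satisfy $\int_QA^{1/2}N\,d\mu=0$, and solve $$\int_Q\widetilde A\,\mathrm{curl}(A^{1/2}N)\cdot\overline{\mathrm{curl}(A^{1/2}\varphi)}\,d\mu=-\int_Q\widetilde A\,\overline{\mathrm{curl}(A^{1/2}\varphi)}\,d\mu$$ (column by column) for all $\varphi\in H^1_{\mathrm{curl}\,A^{1/2}}(Q,d\mu)$ with $\int_QA^{1/2}\varphi\,d\mu=0$. Write $\mathrm{curl}\,N$ for $\mathrm{curl}(A^{1/2}N)$, extended $Q$-periodically. Put $\widetilde A^{\rm hom}=\int_Q\widetilde A(\mathrm{curl}\,N+I)\,d\mu$ and let $\widetilde{\mathfrak A}^{\rm hom}_\theta$ be the matrix of $v\mapsto i\theta\times\bigl(\widetilde A^{\rm hom}\bigl(i\theta\times(\widehat A^{\rm hom}_{\varepsilon\theta})^{-1}v\bigr)\bigr)$. **Statement.** There is $C>0$, independent of $\varepsilon$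 and $g$, such that the following holds for all $\varepsilon>0$ and all $g\in L^2(\mathbb R^3,d\mu^\varepsilon)$ with $\mathrm{div}\,g=0$ (that is, $\int g\cdot\overline{\nabla\varphi}\,d\mu^\varepsilon=0$ for all $\varphi\in C_0^\infty(\mathbb R^3)$). Let $(\mathcal D_\varepsilon,\mathcal B_\varepsilon)$ solve $$\mathrm{curl}(A(\cdot/\varepsilon)\mathcal D_\varepsilon)+\mathcal B_\varepsilon=0,\qquad \mathrm{curl}(\widetilde A(\cdot/\varepsilon)\mathcal B_\varepsilon)-\mathcal D_\varepsilon=g,$$ in the sense that, with $D_\varepsilon=A^{1/2}(\cdot/\varepsilon)\mathcal D_\varepsilon$ and $\mathrm{curl}(A^{1/2}D_\varepsilon)=-\mathcal B_\varepsilon$, the pair $(D_\varepsilon,-\mathcal B_\varepsilon)$ lies in $H^1_{\mathrm{curl}\,A^{1/2}}(\mathbb R^3,d\mu^\varepsilon)$ and $\int\widetilde A\,\mathrm{curl}(A^{1/2}D_\varepsilon)\cdot\overline{\mathrm{curl}(A^{1/2}\varphi)}+\int D_\varepsilon\cdot\overline\varphi=-\int A^{1/2}g\cdot\overline\varphi$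 (integrals over $\mathbb R^3$ with respect to $\mu^\varepsilon$, coefficients at $x/\varepsilon$) for all elements $(\varphi,\mathrm{curl}(A^{1/2}\varphi))$ of that space. Let $\mathcal H_\varepsilon=\widetilde A(\cdot/\varepsilon)\mathcal B_\varepsilon$. Then $\widehat g(\theta)=(2\pi)^{-3/2}\int_{\mathbb R^3}g\,\overline{e_\theta}\,d\mu^\varepsilon$ (the $L^2_{\rm loc}(d\theta)$-limit of the integrals over $|x|<n$) and $$F_\varepsilon=(2\pi)^{-3/2}\int_{\mathbb R^3} i\theta\times\Bigl(\bigl(\widehat A^{\rm hom}_{\varepsilon\theta}\bigr)^{-1}\bigl(\widetilde{\mathfrak A}^{\rm hom}_\theta+I\bigr)^{-1}\widehat g(\theta)\Bigr)e_\theta\,d\theta$$ (the $L^2(\mathbb R^3,d\mu^\varepsilon)$-limit of the integrals over $|\theta|<n$) exist, and $$\bigl\|\mathcal B_\varepsilon-(\mathrm{curl}\,N(\cdot/\varepsilon)+I)F_\varepsilon\bigr\|_{L^2(\mathbb R^3,d\mu^\varepsilon)}\le C\varepsilon\|g\|_{L^2(\mathbb R^3,d\mu^\varepsilon)},$$ $$\bigl\|\mathcal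 H_\varepsilon-\widetilde A(\cdot/\varepsilon)(\mathrm{curl}\,N(\cdot/\varepsilon)+I)F_\varepsilon\bigr\|_{L^2(\mathbb R^3,d\mu^\varepsilon)}\le C\varepsilon\|g\|_{L^2(\mathbb R^3,d\mu^\varepsilon)}.$$ -/

import Mathlib

open MeasureTheory Filter Topology
open scoped MatrixOrder ContDiff

noncomputable section

namespace MaxwellHom

/-- Points `x`, quasimomenta `κ` and frequencies `θ` live in `ℝ³`. -/
abbrev R3 := EuclideanSpace ℝ (Fin 3)

/-- Values of the vector fields. -/
abbrev C3 := EuclideanSpace ℂ (Fin 3)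

abbrev RMat := Matrix (Fin 3) (Fin 3) ℝ

abbrev CMat := Matrix (Fin 3) (Fin 3) ℂ

/-- A real matrix regarded as a complex one. -/
def cx (M : RMat) : CMat := M.map (fun t : ℝ => (t : ℂ))

/-- Matrix times vector. -/
def mv (M : CMat) (v : C3) : C3 := WithLp.toLp 2 (M.mulVec v.ofLp)

/-- The `j`-th standard basis vector of `ℂ³`. -/
def basisVec (j : Fin 3) : C3 := EuclideanSpace.single j 1

/-- The `j`-th column of a matrix. -/
def col (M : CMat) (j : Fin 3) : C3 := WithLp.toLp 2 (fun i => M i j)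

/-- The matrix of `v ↦ iθ × v`. -/
def crossI (θ : R3) : CMat :=
  Complex.I • cx !![0, -θ 2, θ 1; θ 2, 0, -θ 0; -θ 1, θ 0, 0]

/-- The exponential `e_κ(x) = exp(iκ·x)`. -/
def expi (κ x : R3) : ℂ := Complex.exp (Complex.I * ((inner ℝ κ x : ℝ) : ℂ))

/-! ### Classical differential operators -/

/-- The partial derivative `∂_j f`. -/
def pd (j : Fin 3) (f : R3 → ℂ) (x : R3) : ℂ :=
  fderiv ℝ f x (EuclideanSpace.single j 1)

def grad (f : R3 → ℂ) (x : R3) : C3 := WithLp.toLp 2 (fun j => pd j f x)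

def curl (u : R3 → C3) (x : R3) : C3 :=
  WithLp.toLp 2 ![pd 1 (fun y => u y 2) x - pd 2 (fun y => u y 1) x,
    pd 2 (fun y => u y 0) x - pd 0 (fun y => u y 2) x,
    pd 0 (fun y => u y 1) x - pd 1 (fun y => u y 0) x]

/-! ### Periodicity, the cells, the measures -/

/-- Invariance under all integer translations. -/
def IsQPeriodic {β : Type*} (f : R3 → β) : Prop :=
  ∀ (x : R3) (n : Fin 3 → ℤ), f (x + WithLp.toLp 2 (fun i => (n i : ℝ))) = f x

/-- The unit cell `Q = [0,1)³`. -/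
def cellQ : Set R3 := {x | ∀ i, x i ∈ Set.Ico (0 : ℝ) 1}

/-- The dual cell `Q' = [-π,π)³`. -/
def dualCell : Set R3 := {κ | ∀ i, κ i ∈ Set.Ico (-Real.pi) Real.pi}

/-- A `Q`-periodic Borel measure on `ℝ³` with `μ(Q) = 1`. -/
def IsPeriodicMeasure (μ : Measure R3) : Prop :=
  (∀ n : Fin 3 → ℤ, μ.map (fun x => x + WithLp.toLp 2 (fun i => (n i : ℝ))) = μ) ∧ μ cellQ = 1

/-- `μ^ε(B) = ε³ μ(ε⁻¹ B)`. -/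
def scaledMeasure (μ : Measure R3) (ε : ℝ) : Measure R3 :=
  ENNReal.ofReal (ε ^ 3) • μ.map (fun x => ε • x)

/-- The `ε`-periodic rescaling `f(·/ε)`. -/
def rescale {β : Type*} (ε : ℝ) (f : R3 → β) : R3 → β := fun x => f (ε⁻¹ • x)

/-- A real, symmetric, bounded and uniformly positive definite matrix function. -/
def IsElliptic (A : R3 → RMat) : Prop :=
  (∀ x, (A x).IsSymm) ∧ ∃ α β : ℝ, 0 < α ∧ ∀ (x : R3) (ξ : Fin 3 → ℝ),
    α * (ξ ⬝ᵥ ξ) ≤ ξ ⬝ᵥ (A x).mulVec ξ ∧ ξ ⬝ᵥ (A x).mulVec ξ ≤ β * (ξ ⬝ᵥ ξ)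

/-- The pointwise positive square root `A^{1/2}`. -/
def sqrtM (A : R3 → RMat) : R3 → RMat := fun x => CFC.sqrt (A x)

/-! ### Test functions -/

/-- `C_0^∞(ℝ³)`, with values in `E`. -/
def testC {E : Type*} [NormedAddCommGroup E] [NormedSpace ℝ E] : Set (R3 → E) :=
  {φ | ContDiff ℝ ∞ φ ∧ HasCompactSupport φ}

/-- `C^∞_#(Q)`, with values in `E`. -/
def testP {E : Type*} [NormedAddCommGroup E] [NormedSpace ℝ E] : Set (R3 → E) :=
  {φ | ContDiff ℝ ∞ φ ∧ IsQPeriodic φ}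

/-- `C^∞_{#,0}(Q)`: periodic smooth functions with zero `μ`-mean over `Q`. -/
def testP0 {E : Type*} [NormedAddCommGroup E] [NormedSpace ℝ E] (μ : Measure R3) :
    Set (R3 → E) :=
  {φ | φ ∈ testP ∧ ∫ x in cellQ, φ x ∂μ = 0}

/-! ### Sobolev spaces with respect to a measure

The elements are pairs, because the gradient or curl need not be determined by the function. -/

/-- `(u, v)` belongs to `H¹_{curl S}`, with `S = A^{1/2}`: the closure in `L²(ν) ⊕ L²(ν)` of the
pairs `(φ, curl (S φ))`, where `S φ` ranges over the class `T` of smooth fields.  When `S` is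
smooth, asking that `S φ` be smooth is the same as asking that both `φ` and `S φ` be smooth. -/
def IsCurlPair (ν : Measure R3) (T : Set (R3 → C3)) (S : R3 → RMat) (u v : R3 → C3) : Prop :=
  MemLp u 2 ν ∧ MemLp v 2 ν ∧ ∃ φ : ℕ → R3 → C3,
    (∀ n, (fun x => mv (cx (S x)) (φ n x)) ∈ T) ∧
    Tendsto (fun n => eLpNorm (fun x => φ n x - u x) 2 ν) atTop (𝓝 0) ∧
    Tendsto (fun n => eLpNorm (fun x => curl (fun y => mv (cx (S y)) (φ n y)) x - v x) 2 ν)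
      atTop (𝓝 0)

/-- `H¹_{curl A^{1/2}}(Q, dμ)`. -/
def IsCurlPairQ (μ : Measure R3) (A : R3 → RMat) (u v : R3 → C3) : Prop :=
  IsCurlPair (μ.restrict cellQ) testP (sqrtM A) u v

/-- `ψ ∈ H¹_{#,0}(Q, dμ)` and `q` is a gradient `∇(e_κ ψ)`: the closure in `L² ⊕ L²` of the pairs
`(φ, ∇(e_κ φ))` with `φ ∈ C^∞_{#,0}(Q)`. -/
def IsQuasiGrad (μ : Measure R3) (κ : R3) (ψ : R3 → ℂ) (q : R3 → C3) : Prop :=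
  MemLp ψ 2 (μ.restrict cellQ) ∧ MemLp q 2 (μ.restrict cellQ) ∧ ∃ φ : ℕ → R3 → ℂ,
    (∀ n, φ n ∈ testP0 μ) ∧
    Tendsto (fun n => eLpNorm (fun x => φ n x - ψ x) 2 (μ.restrict cellQ)) atTop (𝓝 0) ∧
    Tendsto (fun n => eLpNorm (fun x => grad (fun y => expi κ y * φ n y) x - q x) 2
      (μ.restrict cellQ)) atTop (𝓝 0)

/-- Solenoidal: `∫_Q A^{-1/2} e_κ v · conj ∇(e_κ φ) = 0` for all `φ ∈ C^∞_{#,0}(Q)`. -/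
def IsSolenoidal (μ : Measure R3) (A : R3 → RMat) (κ : R3) (v : R3 → C3) : Prop :=
  ∀ φ ∈ testP0 (E := ℂ) μ, ∫ x in cellQ,
    inner ℂ (grad (fun y => expi κ y * φ y) x)
      (mv (cx (sqrtM A x)⁻¹) (expi κ x • v x)) ∂μ = 0

/-- Irrotational: `∫_Q A^{1/2} e_κ v · conj curl(e_κ φ) = 0` for all `φ ∈ C^∞_{#,0}(Q)`. -/
def IsIrrotational (μ : Measure R3) (A : R3 → RMat) (κ : R3) (v : R3 → C3) : Prop :=
  ∀ φ ∈ testP0 (E := C3) μ, ∫ x in cellQ,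
    inner ℂ (curl (fun y => expi κ y • φ y) x)
      (mv (cx (sqrtM A x)) (expi κ x • v x)) ∂μ = 0

/-! ### Standing assumptions on the measure -/

/-- `∫_Q ∂_j φ dμ = 0` for all `φ ∈ C^∞_#(Q)` and all `j`. -/
def GradMeanZero (μ : Measure R3) : Prop :=
  ∀ φ ∈ testP (E := ℂ), ∀ j, ∫ x in cellQ, pd j φ x ∂μ = 0

/-- Every irrotational field has the form `A^{-1/2}(conj e_κ ∇(e_κ ψ) + c)`. -/
def IrrotationalForm (μ : Measure R3) (A : R3 → RMat) : Prop :=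
  ∀ κ ∈ dualCell, ∀ v : R3 → C3, MemLp v 2 (μ.restrict cellQ) → IsIrrotational μ A κ v →
    ∃ (ψ : R3 → ℂ) (q : R3 → C3) (c : C3), IsQuasiGrad μ κ ψ q ∧
      ∀ᵐ x ∂(μ.restrict cellQ),
        v x = mv (cx (sqrtM A x)⁻¹) ((starRingEnd ℂ) (expi κ x) • q x + c)

/-- The Poincaré-type inequality for the curl on smooth mean-zero fields with
`conj e_κ div(e_κ φ) = 0`, uniform in `κ`. -/
def CurlPoincare (μ : Measure R3) : Prop :=
  ∃ C : ℝ, 0 < C ∧ ∀ κ ∈ dualCell, ∀ φ ∈ testP0 (E := C3) μ,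
    (∀ η ∈ testP (E := ℂ), ∫ x in cellQ,
      inner ℂ (grad (fun y => expi κ y * η y) x) (expi κ x • φ x) ∂μ = 0) →
    eLpNorm φ 2 (μ.restrict cellQ) ≤
      ENNReal.ofReal C * eLpNorm (curl (fun y => expi κ y • φ y)) 2 (μ.restrict cellQ)

/-- Compactness of `H¹_{curl A^{1/2}}(Q, dμ) ∩ {w : div A^{-1/2} w = 0} ⊂ L²(Q, dμ)`. -/
def CompactCurlEmbedding (μ : Measure R3) (A : R3 → RMat) : Prop :=
  ∀ w v : ℕ → R3 → C3, (∀ n, IsCurlPairQ μ A (w n) (v n)) →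
    (∀ n, IsSolenoidal μ A 0 (w n)) →
    (∃ K : ℝ, ∀ n, eLpNorm (w n) 2 (μ.restrict cellQ) ≤ ENNReal.ofReal K ∧
      eLpNorm (v n) 2 (μ.restrict cellQ) ≤ ENNReal.ofReal K) →
    ∃ (w' : R3 → C3) (σ : ℕ → ℕ), MemLp w' 2 (μ.restrict cellQ) ∧ StrictMono σ ∧
      Tendsto (fun n => eLpNorm (fun x => w (σ n) x - w' x) 2 (μ.restrict cellQ)) atTop (𝓝 0)

/-! ### Cell problems and homogenised matrices -/

/-- `M = Â^hom_κ = ∫_Q A⁻¹ (conj e_κ ∇(e_κ Ψ_κ) + I)`, where the `j`-th component `ψ j` of `Ψ_κ`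
lies in `H¹_{#,0}(Q, dμ)`, has `q j = ∇(e_κ ψ_j)`, and solves
`conj e_κ div A⁻¹ (∇(e_κ ψ_j) + e_κ e_j) = 0` in the weak sense. -/
def IsHatHom (μ : Measure R3) (A : R3 → RMat) (κ : R3) (M : CMat) : Prop :=
  ∃ (ψ : Fin 3 → R3 → ℂ) (q : Fin 3 → R3 → C3),
    (∀ j, IsQuasiGrad μ κ (ψ j) (q j)) ∧
    (∀ j, ∀ φ ∈ testP0 (E := ℂ) μ,
      ∫ x in cellQ, inner ℂ (grad (fun y => expi κ y * φ y) x) (mv (cx (A x)⁻¹) (q j x)) ∂μ =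
      -∫ x in cellQ, inner ℂ (grad (fun y => expi κ y * φ y) x)
        (mv (cx (A x)⁻¹) (expi κ x • basisVec j)) ∂μ) ∧
    ∀ j, col M j = ∫ x in cellQ,
      mv (cx (A x)⁻¹) ((starRingEnd ℂ) (expi κ x) • q j x + basisVec j) ∂μ

/-- `(N, W)` is the solution of the magnetic cell problem, `W = curl(A^{1/2} N)` (column-wise):
`A^{1/2} curl Ã curl A^{1/2} N = -A^{1/2} curl Ã`, `div A^{-1/2} N = 0`, `∫_Q A^{1/2} N = 0`,
in the weak sense; both are extended periodically to `ℝ³`. -/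
def IsCellSolution (μ : Measure R3) (A At : R3 → RMat) (N W : R3 → CMat) : Prop :=
  IsQPeriodic N ∧ IsQPeriodic W ∧ ∀ j,
    IsCurlPairQ μ A (fun x => col (N x) j) (fun x => col (W x) j) ∧
    IsSolenoidal μ A 0 (fun x => col (N x) j) ∧
    ∫ x in cellQ, mv (cx (sqrtM A x)) (col (N x) j) ∂μ = 0 ∧
    ∀ φ χ : R3 → C3, IsCurlPairQ μ A φ χ → ∫ x in cellQ, mv (cx (sqrtM A x)) (φ x) ∂μ = 0 →
      ∫ x in cellQ, inner ℂ (χ x) (mv (cx (At x)) (col (W x) j)) ∂μ =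
      -∫ x in cellQ, inner ℂ (χ x) (mv (cx (At x)) (basisVec j)) ∂μ

/-- `Ã^hom = ∫_Q Ã (curl(A^{1/2} N) + I)`. -/
def magneticHom (μ : Measure R3) (At : R3 → RMat) (W : R3 → CMat) : CMat :=
  Matrix.of fun i j => (∫ x in cellQ, mv (cx (At x)) (col (W x + 1) j) ∂μ) i

/-- The symbol `𝔄_θ = iθ × Ã^hom iθ × (Â^hom_{εθ})⁻¹`; the argument `M` stands for
`Â^hom_{εθ}`. -/
def frakA (Mt : CMat) (M : CMat) (θ : R3) : CMat := crossI θ * Mt * crossI θ * M⁻¹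

/-! ### The Maxwell system -/

/-- `g ∈ L²(ν)` is divergence free: `∫ g · conj ∇φ = 0` for all `φ ∈ C_0^∞(ℝ³)`. -/
def IsDivFree (ν : Measure R3) (g : R3 → C3) : Prop :=
  ∀ φ ∈ testC (E := ℂ), ∫ x, inner ℂ (grad φ x) (g x) ∂ν = 0

/-- `(𝒟, ℬ)` solves `curl(A(·/ε) 𝒟) + ℬ = 0`, `curl(Ã(·/ε) ℬ) - 𝒟 = g`.  With
`D = A^{1/2} 𝒟` and `curl(A^{1/2} D) = -ℬ` this means that `(D, -ℬ) ∈ H¹_{curl A^{1/2}}(ℝ³, dμ^ε)`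
and `∫ Ã curl(A^{1/2}D) · conj curl(A^{1/2}φ) + ∫ D · conj φ = -∫ A^{1/2} g · conj φ` for every
element `(φ, χ)`, `χ = curl(A^{1/2}φ)`, of that space. -/
def IsMaxwellSolution (μ : Measure R3) (A At : R3 → RMat) (ε : ℝ) (g Dd B : R3 → C3) : Prop :=
  let ν := scaledMeasure μ ε
  let S := rescale ε (sqrtM A)
  let D : R3 → C3 := fun x => mv (cx (S x)) (Dd x)
  IsCurlPair ν testC S D (fun x => -B x) ∧
    ∀ φ χ : R3 → C3, IsCurlPair ν testC S φ χ →
      ∫ x, inner ℂ (χ x) (mv (cx (rescale ε At x)) (-B x)) ∂ν + ∫ x, inner ℂ (φ x) (D x) ∂ν =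
      -∫ x, inner ℂ (φ x) (mv (cx (S x)) (g x)) ∂ν

/-! ### Fourier integrals of square-integrable functions -/

/-- `ĝ(θ) = (2π)^{-3/2} ∫ g(x) exp(-iθ·x) dν(x)` for `g ∈ L²(ν)`: the integrals over `|x| < n`
converge to `ĝ` in `L²` of every ball. -/
def IsFourierTransform (ν : Measure R3) (g gh : R3 → C3) : Prop :=
  ∀ R : ℝ, MemLp gh 2 (volume.restrict (Metric.ball 0 R)) ∧
    Tendsto (fun n : ℕ => eLpNorm (fun θ =>
      (((2 * Real.pi) ^ (-(3 / 2) : ℝ) : ℝ) : ℂ) •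
        (∫ x in Metric.ball (0 : R3) n, (starRingEnd ℂ) (expi θ x) • g x ∂ν) - gh θ) 2
      (volume.restrict (Metric.ball 0 R))) atTop (𝓝 0)

/-- `F(x) = (2π)^{-3/2} ∫ h(θ) exp(iθ·x) dθ` in `L²(ν)`: the integrals over `|θ| < n` converge to
`F` in `L²(ν)`. -/
def IsFourierSynthesis (ν : Measure R3) (h F : R3 → C3) : Prop :=
  (∀ R : ℝ, IntegrableOn h (Metric.ball 0 R)) ∧ MemLp F 2 ν ∧
    Tendsto (fun n : ℕ => eLpNorm (fun x =>
      (((2 * Real.pi) ^ (-(3 / 2) : ℝ) : ℝ) : ℂ) •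
        (∫ θ in Metric.ball (0 : R3) n, expi θ x • h θ) - F x) 2 ν) atTop (𝓝 0)

end MaxwellHom

end

open MaxwellHom

/-! Assumption (i) is very rigid. Tested with the exponentials `e_{2πm}` it annihilates every
nonzero Fourier coefficient of `μ` on the torus, and `μ(Q) = 1` fixes the remaining one; hence `μ`
is Lebesgue measure (`eq_volume_of_gradMeanZero`). The problem becomes periodic homogenisation on
`ℝ³`, with Plancherel's theorem at hand.

Put `U = -A 𝒟`. The system then reads `curl Ã curl U + A⁻¹ U = g` with `curl U = ℬ`. Its homogenised
form in frequency is `(iθ× Ã^hom iθ× + Â_{εθ}) h = ĝ`, and `iθ × h` is exactly the symbol that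
defines `F_ε` (`HomPair.symbol_eq`). Because `div g = 0`, the vector `ĝ(θ)` is orthogonal to `θ`,
and this transversality yields bounds for `h`, `|θ| h`, `iθ × h` and `|θ| iθ × h` by `|ĝ|`,
uniformly in `θ` and `ε` (`exists_homSol_bound`).

Low frequencies, `|θ| < 1/ε`. With `H` and `F` the synthesised low parts of `h` and `iθ × h`, the
trial field is `∑ H_j (∇ψ_j + e_j)(·/ε) + ε (ψ_j(·/ε) ∇H_j + F_j φ_j(·/ε))`, where `ψ_j`, `φ_j` are
smooth approximations of the electric and magnetic correctors. The periodic factors are controlled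
only in `L²(Q)`, but this suffices: the samples of a band-limited function on an `ε`-lattice are
Fourier coefficients, so Parseval gives `‖f w(·/ε)‖ = ‖f̂‖ ‖w‖_{L²(Q)}` (`tsum_norm_sq_fs`,
`l2_fs_smul_rescale`). The fluxes have potentials: assumption (ii) at `κ = 0` makes `Ã(curl N + I)`
minus its mean a gradient (`exists_potential`), and a Fourier series makes `A⁻¹(∇ψ + e)` minus its
mean a limit of curls (`exists_electric_approx`). Integration by parts turns both oscillating terms
into `O(ε)`. Replacing `Â_{εθ}` by `Â_0` costs `O(ε|θ|)`, which the weighted bound on `h` absorbs.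
The residual is thus `O(ε)` (`IsHomField.lowField_residual`), and coercivity converts it into an
`L²` bound for the curl (`l2_sub_le_of_residual`).

High frequencies. The theorem uses the untruncated `F_ε`, and `curl N + I` need not be bounded, so
even the product needs an argument. It is the multiplier inequality `‖f b(·/ε)‖ ≤ C (‖f‖ + ε ‖∇f‖)`
for `b` a column of `curl N + I` (`exists_multiplier`). Here `b` is solenoidal and `Ã b - c = ∇p`,
so `p` is a weak solution of a scalar elliptic equation; Stampacchia's level-set iteration shows
that `p` is bounded, and testing `div b = 0` with `p(·/ε) f²` gives the inequality. The high part of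
`F_ε` has `L²` norm `O(ε‖g‖)`, and its gradient, computed on finite frequency bands, is `O(‖g‖)`;
the product is therefore `O(ε)` (`l2_high_le`).

The estimate for `ℋ_ε` follows from the one for `ℬ_ε` because `Ã` is bounded. -/

open MaxwellHom

noncomputable section

namespace MaxwellHom

section
/-! ### The `L²` seminorm as a real number -/

section L2
variable {α E : Type*} [MeasurableSpace α] [NormedAddCommGroup E] {ν : Measure α}

/-- The `L²` seminorm. -/
def l2 (ν : Measure α) (f : α → E) : ℝ := (eLpNorm f 2 ν).toReal

lemma l2_nonneg (f : α → E) : 0 ≤ l2 ν f := ENNReal.toReal_nonneg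

lemma ofReal_l2 {f : α → E} (hf : MemLp f 2 ν) : ENNReal.ofReal (l2 ν f) = eLpNorm f 2 ν :=
  ENNReal.ofReal_toReal hf.eLpNorm_ne_top

lemma l2_add_le {f g : α → E} (hf : MemLp f 2 ν) (hg : MemLp g 2 ν) :
    l2 ν (fun x => f x + g x) ≤ l2 ν f + l2 ν g := by
  rw [l2, l2, l2, ← ENNReal.toReal_add hf.eLpNorm_ne_top hg.eLpNorm_ne_top]
  exact ENNReal.toReal_mono (ENNReal.add_ne_top.2 ⟨hf.eLpNorm_ne_top, hg.eLpNorm_ne_top⟩)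
    (eLpNorm_add_le hf.1 hg.1 (by norm_num))

lemma l2_neg (f : α → E) : l2 ν (fun x => -f x) = l2 ν f := by
  rw [l2, l2]; congr 1; exact eLpNorm_neg f 2 ν

lemma l2_sub_le {f g : α → E} (hf : MemLp f 2 ν) (hg : MemLp g 2 ν) :
    l2 ν (fun x => f x - g x) ≤ l2 ν f + l2 ν g := by
  have h := l2_add_le hf hg.neg
  simp only [Pi.neg_apply, ← sub_eq_add_neg] at h
  exact h.trans (by rw [← l2_neg g]; rfl)

lemma l2_le_add_sub {f g : α → E} (hf : MemLp f 2 ν) (hg : MemLp g 2 ν) :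
    l2 ν f ≤ l2 ν g + l2 ν (fun x => f x - g x) := by
  have h := l2_add_le hg (hf.sub hg)
  simp only [Pi.sub_apply, add_sub_cancel] at h
  exact h

lemma l2_sub_comm (f g : α → E) : l2 ν (fun x => f x - g x) = l2 ν (fun x => g x - f x) := by
  rw [← l2_neg]; simp

lemma l2_const_smul {𝕜 : Type*} [NormedField 𝕜] [NormedSpace 𝕜 E] (c : 𝕜) (f : α → E) :
    l2 ν (fun x => c • f x) = ‖c‖ * l2 ν f := by
  rw [l2, l2]
  have : eLpNorm (fun x => c • f x) 2 ν = ‖c‖ₑ * eLpNorm f 2 ν := eLpNorm_const_smul c f 2 ν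
  rw [this, ENNReal.toReal_mul]; simp

lemma l2_congr {f g : α → E} (h : f =ᵐ[ν] g) : l2 ν f = l2 ν g := by
  rw [l2, l2, eLpNorm_congr_ae h]

lemma l2_mono {F : Type*} [NormedAddCommGroup F] {f : α → E} {g : α → F} {K : ℝ} (hK : 0 ≤ K)
    (hg : MemLp g 2 ν) (h : ∀ᵐ x ∂ν, ‖f x‖ ≤ K * ‖g x‖) : l2 ν f ≤ K * l2 ν g := by
  have h1 : eLpNorm f 2 ν ≤ ENNReal.ofReal K * eLpNorm g 2 ν :=
    eLpNorm_le_mul_eLpNorm_of_ae_le_mul h 2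
  have := ENNReal.toReal_mono (ENNReal.mul_ne_top ENNReal.ofReal_ne_top hg.eLpNorm_ne_top) h1
  rwa [ENNReal.toReal_mul, ENNReal.toReal_ofReal hK] at this

lemma l2_sum_le {ι : Type*} (s : Finset ι) {f : ι → α → E} (hf : ∀ i ∈ s, MemLp (f i) 2 ν) :
    l2 ν (fun x => ∑ i ∈ s, f i x) ≤ ∑ i ∈ s, l2 ν (f i) := by
  classical
  induction s using Finset.induction_on with
  | empty => simp [l2]
  | insert a s ha ih =>
    simp only [Finset.sum_insert ha]
    refine (l2_add_le (hf a (by simp)) ?_).trans ?_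
    · exact memLp_finsetSum _ fun i hi => hf i (by simp [hi])
    · gcongr; exact ih fun i hi => hf i (by simp [hi])

lemma l2_sq {f : α → E} (hf : MemLp f 2 ν) : l2 ν f ^ 2 = ∫ x, ‖f x‖ ^ 2 ∂ν := by
  have h := hf.eLpNorm_eq_integral_rpow_norm (by norm_num) (by norm_num)
  have h0 : 0 ≤ ∫ x, ‖f x‖ ^ 2 ∂ν := integral_nonneg fun x => by positivity
  rw [l2, h, ENNReal.toReal_ofReal (by positivity)]
  simp only [ENNReal.toReal_ofNat, Real.rpow_ofNat]
  rw [← Real.rpow_natCast, ← Real.rpow_mul h0]; norm_num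

lemma integrable_norm_sq {f : α → E} (hf : MemLp f 2 ν) : Integrable (fun x => ‖f x‖ ^ 2) ν :=
  hf.integrable_norm_pow (by norm_num)

lemma eLpNorm_le_of_l2_le {f : α → E} (hf : MemLp f 2 ν) {K : ℝ} (h : l2 ν f ≤ K) :
    eLpNorm f 2 ν ≤ ENNReal.ofReal K := by
  rw [← ofReal_l2 hf]; exact ENNReal.ofReal_le_ofReal h

lemma tendsto_l2_of_eLpNorm {f : ℕ → α → E} (h : Tendsto (fun n => eLpNorm (f n) 2 ν) atTop (𝓝 0)) :
    Tendsto (fun n => l2 ν (f n)) atTop (𝓝 0) := by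
  have := (ENNReal.tendsto_toReal ENNReal.zero_ne_top).comp h
  simpa [l2, Function.comp_def] using this

lemma tendsto_eLpNorm_of_l2 {f : ℕ → α → E} (hf : ∀ n, MemLp (f n) 2 ν)
    (h : Tendsto (fun n => l2 ν (f n)) atTop (𝓝 0)) :
    Tendsto (fun n => eLpNorm (f n) 2 ν) atTop (𝓝 0) := by
  have := ENNReal.tendsto_ofReal h
  simpa [ofReal_l2 (hf _)] using this

variable {𝕜 : Type*} [RCLike 𝕜] [InnerProductSpace 𝕜 E]

lemma integrable_inner {f g : α → E} (hf : MemLp f 2 ν) (hg : MemLp g 2 ν) :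
    Integrable (fun x => inner 𝕜 (f x) (g x)) ν := by
  have := L2.integrable_inner (𝕜 := 𝕜) hf.toLp hg.toLp
  refine this.congr ?_
  filter_upwards [hf.coeFn_toLp, hg.coeFn_toLp] with x h1 h2
  rw [h1, h2]

lemma norm_integral_inner_le {f g : α → E} (hf : MemLp f 2 ν) (hg : MemLp g 2 ν) :
    ‖∫ x, inner 𝕜 (f x) (g x) ∂ν‖ ≤ l2 ν f * l2 ν g := by
  have h : ∫ x, inner 𝕜 (f x) (g x) ∂ν = inner 𝕜 hf.toLp hg.toLp := by
    rw [L2.inner_def]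
    refine integral_congr_ae ?_
    filter_upwards [hf.coeFn_toLp, hg.coeFn_toLp] with x h1 h2
    rw [h1, h2]
  rw [h]
  refine (norm_inner_le_norm _ _).trans (le_of_eq ?_)
  rw [Lp.norm_toLp, Lp.norm_toLp]; rfl

lemma integral_inner_self {f : α → E} (hf : MemLp f 2 ν) :
    RCLike.re (∫ x, inner 𝕜 (f x) (f x) ∂ν) = l2 ν f ^ 2 := by
  rw [l2_sq hf, ← integral_re (integrable_inner hf hf)]
  simp

lemma integral_inner_sub_left {f f' g : α → E} (hf : MemLp f 2 ν) (hf' : MemLp f' 2 ν)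
    (hg : MemLp g 2 ν) : ∫ x, inner 𝕜 (f x - f' x) (g x) ∂ν =
      ∫ x, inner 𝕜 (f x) (g x) ∂ν - ∫ x, inner 𝕜 (f' x) (g x) ∂ν := by
  simp_rw [inner_sub_left]
  exact integral_sub (integrable_inner hf hg) (integrable_inner hf' hg)

lemma integral_inner_sub_right {f g g' : α → E} (hf : MemLp f 2 ν) (hg : MemLp g 2 ν)
    (hg' : MemLp g' 2 ν) : ∫ x, inner 𝕜 (f x) (g x - g' x) ∂ν =
      ∫ x, inner 𝕜 (f x) (g x) ∂ν - ∫ x, inner 𝕜 (f x) (g' x) ∂ν := by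
  simp_rw [inner_sub_right]
  exact integral_sub (integrable_inner hf hg) (integrable_inner hf hg')

lemma integral_inner_add_left {f f' g : α → E} (hf : MemLp f 2 ν) (hf' : MemLp f' 2 ν)
    (hg : MemLp g 2 ν) : ∫ x, inner 𝕜 (f x + f' x) (g x) ∂ν =
      ∫ x, inner 𝕜 (f x) (g x) ∂ν + ∫ x, inner 𝕜 (f' x) (g x) ∂ν := by
  simp_rw [inner_add_left]
  exact integral_add (integrable_inner hf hg) (integrable_inner hf' hg)

lemma integral_inner_add_right {f g g' : α → E} (hf : MemLp f 2 ν) (hg : MemLp g 2 ν)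
    (hg' : MemLp g' 2 ν) : ∫ x, inner 𝕜 (f x) (g x + g' x) ∂ν =
      ∫ x, inner 𝕜 (f x) (g x) ∂ν + ∫ x, inner 𝕜 (f x) (g' x) ∂ν := by
  simp_rw [inner_add_right]
  exact integral_add (integrable_inner hf hg) (integrable_inner hf hg')

lemma tendsto_integral_inner_left {f : ℕ → α → E} {u g : α → E} (hf : ∀ᶠ n in atTop, MemLp (f n) 2 ν)
    (hu : MemLp u 2 ν) (hg : MemLp g 2 ν)
    (h : Tendsto (fun n => eLpNorm (fun x => f n x - u x) 2 ν) atTop (𝓝 0)) :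
    Tendsto (fun n => ∫ x, inner 𝕜 (f n x) (g x) ∂ν) atTop (𝓝 (∫ x, inner 𝕜 (u x) (g x) ∂ν)) := by
  rw [tendsto_iff_norm_sub_tendsto_zero]
  have h1 := (tendsto_l2_of_eLpNorm h).mul_const (l2 ν g)
  rw [zero_mul] at h1
  refine squeeze_zero' (.of_forall fun n => norm_nonneg _) ?_ h1
  filter_upwards [hf] with n hn
  rw [← integral_inner_sub_left hn hu hg]
  exact norm_integral_inner_le (hn.sub hu) hg

lemma integral_inner_conj (f g : α → E) :
    ∫ x, inner 𝕜 (f x) (g x) ∂ν = (starRingEnd 𝕜) (∫ x, inner 𝕜 (g x) (f x) ∂ν) := by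
  rw [← integral_conj]; simp [inner_conj_symm]

lemma tendsto_integral_inner_right {f : ℕ → α → E} {u g : α → E}
    (hf : ∀ᶠ n in atTop, MemLp (f n) 2 ν) (hu : MemLp u 2 ν) (hg : MemLp g 2 ν)
    (h : Tendsto (fun n => eLpNorm (fun x => f n x - u x) 2 ν) atTop (𝓝 0)) :
    Tendsto (fun n => ∫ x, inner 𝕜 (g x) (f n x) ∂ν) atTop (𝓝 (∫ x, inner 𝕜 (g x) (u x) ∂ν)) := by
  simp_rw [integral_inner_conj g]
  exact (RCLike.continuous_conj.tendsto _).comp (tendsto_integral_inner_left hf hu hg h)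

end L2

/-! ### Matrices acting on `ℂ³` -/

/-- Matrix-vector multiplication as a continuous linear map. -/
def mvL (M : CMat) : C3 →L[ℂ] C3 := Matrix.toEuclideanCLM (𝕜 := ℂ) M

lemma mvL_apply (M : CMat) (v : C3) : mvL M v = mv M v := rfl

lemma mv_apply (M : CMat) (v : C3) (i : Fin 3) : mv M v i = ∑ j, M i j * v j := rfl

lemma mv_add (M : CMat) (u v : C3) : mv M (u + v) = mv M u + mv M v := (mvL M).map_add u v
lemma mv_sub (M : CMat) (u v : C3) : mv M (u - v) = mv M u - mv M v := (mvL M).map_sub u v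
lemma mv_smul (M : CMat) (c : ℂ) (v : C3) : mv M (c • v) = c • mv M v := (mvL M).map_smul c v
lemma mv_zero (M : CMat) : mv M 0 = 0 := (mvL M).map_zero
lemma mv_sum {ι : Type*} (M : CMat) (s : Finset ι) (f : ι → C3) :
    mv M (∑ i ∈ s, f i) = ∑ i ∈ s, mv M (f i) := map_sum (mvL M) f s

lemma mv_mul (M N : CMat) (v : C3) : mv (M * N) v = mv M (mv N v) := by
  simp [mv, Matrix.mulVec_mulVec]

lemma mv_one (v : C3) : mv 1 v = v := by simp [mv]

lemma add_mv (M N : CMat) (v : C3) : mv (M + N) v = mv M v + mv N v := by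
  simp [mv, Matrix.add_mulVec]

lemma mv_inv_cancel {M : CMat} (h : IsUnit M.det) (v : C3) : mv M (mv M⁻¹ v) = v := by
  rw [← mv_mul, Matrix.mul_nonsing_inv _ h, mv_one]

lemma inv_mv_cancel {M : CMat} (h : IsUnit M.det) (v : C3) : mv M⁻¹ (mv M v) = v := by
  rw [← mv_mul, Matrix.nonsing_inv_mul _ h, mv_one]

lemma mv_eq_sum_col (M : CMat) (v : C3) : mv M v = ∑ j, v j • col M j := by
  ext i; simp [mv_apply, col, mul_comm]

lemma mv_basisVec (M : CMat) (j : Fin 3) : mv M (basisVec j) = col M j := by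
  ext i; simp [mv_apply, col, basisVec]

lemma sum_basisVec (v : C3) : ∑ j, v j • basisVec j = v := by
  ext i; simp [basisVec, Pi.single_apply]

lemma col_one (j : Fin 3) : col 1 j = basisVec j := by
  ext i; simp [col, basisVec, Matrix.one_apply]

lemma col_add (M N : CMat) (j : Fin 3) : col (M + N) j = col M j + col N j := by
  ext i; simp [col]

lemma inner_mv_left (M : CMat) (u v : C3) : inner ℂ (mv M u) v = inner ℂ u (mv M.conjTranspose v) := by
  have h : mvL M.conjTranspose = ContinuousLinearMap.adjoint (mvL M) := by
    rw [mvL, ← Matrix.star_eq_conjTranspose, map_star]; rfl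
  rw [← mvL_apply, ← mvL_apply, h, ContinuousLinearMap.adjoint_inner_right]

lemma inner_mv_of_isHermitian {M : CMat} (h : M.IsHermitian) (u v : C3) :
    inner ℂ (mv M u) v = inner ℂ u (mv M v) := by rw [inner_mv_left, h.eq]

lemma norm_apply_le (v : C3) (i : Fin 3) : ‖v i‖ ≤ ‖v‖ := PiLp.norm_apply_le v i

lemma norm_le_sum (v : C3) : ‖v‖ ≤ ∑ i, ‖v i‖ := by
  conv_lhs => rw [← sum_basisVec v]
  refine (norm_sum_le _ _).trans (le_of_eq ?_)
  simp [norm_smul, basisVec]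

lemma norm_basisVec (j : Fin 3) : ‖basisVec j‖ = 1 := by simp [basisVec]

lemma isUnit_det_of_coercive {M : CMat} {α : ℝ} (hα : 0 < α)
    (h : ∀ v, α * ‖v‖ ^ 2 ≤ (inner ℂ v (mv M v)).re) : IsUnit M.det := by
  rw [isUnit_iff_ne_zero]
  intro h0
  obtain ⟨v, hv, hMv⟩ := Matrix.exists_mulVec_eq_zero_iff.2 h0
  have h1 := h (WithLp.toLp 2 v)
  have h2 : mv M (WithLp.toLp 2 v) = 0 := by simp [mv, hMv]
  rw [h2, inner_zero_right, Complex.zero_re] at h1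
  have h3 : ‖(WithLp.toLp 2 v : C3)‖ ≠ 0 := by
    rw [norm_ne_zero_iff]; intro h; apply hv; simpa using h
  have : 0 < ‖(WithLp.toLp 2 v : C3)‖ ^ 2 := by positivity
  nlinarith

/-- A measurable, periodic, Hermitian, bounded and uniformly positive definite coefficient. -/
structure Coef (T : R3 → CMat) (α β : ℝ) : Prop where
  meas : ∀ i j, Measurable fun x => T x i j
  per : IsQPeriodic T
  herm : ∀ x, (T x).IsHermitian
  pos : 0 < α
  bdd_pos : 0 < β
  bdd : ∀ x v, ‖mv (T x) v‖ ≤ β * ‖v‖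
  coer : ∀ x v, α * ‖v‖ ^ 2 ≤ (inner ℂ v (mv (T x) v)).re

lemma Coef.isUnit {T : R3 → CMat} {α β : ℝ} (h : Coef T α β) (x : R3) : IsUnit (T x).det :=
  isUnit_det_of_coercive h.pos (h.coer x)

lemma aestronglyMeasurable_toLp {α : Type*} [MeasurableSpace α] {ν : Measure α} {f : α → C3}
    (h : ∀ i, AEStronglyMeasurable (fun x => f x i) ν) : AEStronglyMeasurable f ν := by
  have : f = fun x => ∑ j, f x j • basisVec j := by ext1 x; rw [sum_basisVec]
  rw [this]
  exact Finset.aestronglyMeasurable_fun_sum _ fun i _ => (h i).smul_const _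

lemma aestronglyMeasurable_apply {α : Type*} [MeasurableSpace α] {ν : Measure α} {f : α → C3}
    (h : AEStronglyMeasurable f ν) (i : Fin 3) : AEStronglyMeasurable (fun x => f x i) ν :=
  (EuclideanSpace.proj (𝕜 := ℂ) i).continuous.comp_aestronglyMeasurable h

lemma aestronglyMeasurable_mv {α : Type*} [MeasurableSpace α] {ν : Measure α} {T : α → CMat}
    {f : α → C3} (hT : ∀ i j, AEStronglyMeasurable (fun x => T x i j) ν)
    (h : AEStronglyMeasurable f ν) : AEStronglyMeasurable (fun x => mv (T x) (f x)) ν := by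
  refine aestronglyMeasurable_toLp fun i => ?_
  simp_rw [mv_apply]
  exact Finset.aestronglyMeasurable_fun_sum _ fun j _ =>
    (hT i j).mul (aestronglyMeasurable_apply h j)

lemma memLp_apply {α : Type*} [MeasurableSpace α] {ν : Measure α} {f : α → C3}
    (h : MemLp f 2 ν) (i : Fin 3) : MemLp (fun x => f x i) 2 ν :=
  h.mono (aestronglyMeasurable_apply h.1 i) (.of_forall fun x => norm_apply_le _ _)

lemma memLp_of_apply {α : Type*} [MeasurableSpace α] {ν : Measure α} {f : α → C3}
    (h : ∀ i, MemLp (fun x => f x i) 2 ν) : MemLp f 2 ν := by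
  have : f = fun x => ∑ j, f x j • basisVec j := by ext1 x; rw [sum_basisVec]
  rw [this]
  refine memLp_finsetSum _ fun i _ => ?_
  exact (h i).mono ((h i).1.smul_const _) (.of_forall fun x => by simp [norm_smul, norm_basisVec])

lemma l2_le_sum_apply {α : Type*} [MeasurableSpace α] {ν : Measure α} {f : α → C3}
    (h : MemLp f 2 ν) : l2 ν f ≤ ∑ i, l2 ν (fun x => f x i) := by
  have h1 : l2 ν f ≤ l2 ν (fun x => ∑ i, ‖f x i‖) := by
    have hm : MemLp (fun x => ∑ i, ‖f x i‖) 2 ν := memLp_finsetSum _ fun i _ => (memLp_apply h i).norm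
    simpa using l2_mono (f := f) zero_le_one hm (.of_forall fun _ => by
      rw [one_mul]; exact (norm_le_sum _).trans (le_abs_self _))
  refine h1.trans ((l2_sum_le _ fun i _ => (memLp_apply h i).norm).trans (le_of_eq ?_))
  refine Finset.sum_congr rfl fun i _ => ?_
  rw [l2, l2, eLpNorm_norm]

section
variable {α : Type*} [MeasurableSpace α] {ν : Measure α} {a b : ℝ}

lemma memLp_mv {T : α → CMat} {f : α → C3} {K : ℝ}
    (hT : ∀ i j, AEStronglyMeasurable (fun x => T x i j) ν)
    (hK : ∀ x v, ‖mv (T x) v‖ ≤ K * ‖v‖) (h : MemLp f 2 ν) :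
    MemLp (fun x => mv (T x) (f x)) 2 ν :=
  h.of_le_mul (aestronglyMeasurable_mv hT h.1) (.of_forall fun _ => hK _ _)

lemma Coef.memLp {T : R3 → CMat} (hT : Coef T a b) {ν : Measure R3} {f : R3 → C3}
    (h : MemLp f 2 ν) : MemLp (fun x => mv (T x) (f x)) 2 ν :=
  memLp_mv (fun i j => (hT.meas i j).aestronglyMeasurable) hT.bdd h

lemma Coef.l2_le {T : R3 → CMat} (hT : Coef T a b) {ν : Measure R3} {f : R3 → C3}
    (h : MemLp f 2 ν) : l2 ν (fun x => mv (T x) (f x)) ≤ b * l2 ν f :=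
  l2_mono hT.bdd_pos.le h (.of_forall fun _ => hT.bdd _ _)

lemma Coef.inner_comm {T : R3 → CMat} (hT : Coef T a b) (x : R3) (u v : C3) :
    inner ℂ (mv (T x) u) v = inner ℂ u (mv (T x) v) := inner_mv_of_isHermitian (hT.herm x) u v

lemma Coef.coercive {T : R3 → CMat} (hT : Coef T a b) {ν : Measure R3} {f : R3 → C3}
    (h : MemLp f 2 ν) : a * l2 ν f ^ 2 ≤ (∫ x, inner ℂ (f x) (mv (T x) (f x)) ∂ν).re := by
  have hi := integrable_inner (𝕜 := ℂ) h (hT.memLp h)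
  have h1 := integral_re hi
  simp only [RCLike.re_to_complex] at h1
  rw [l2_sq h, ← h1, ← integral_const_mul]
  exact integral_mono ((integrable_norm_sq h).const_mul _) hi.re fun x => hT.coer _ _
end

lemma measurable_inv_entries {T : R3 → CMat} (h : ∀ i j, Measurable fun x => T x i j) (i j : Fin 3) :
    Measurable fun x => (T x)⁻¹ i j := by
  have hd : Measurable fun x => (T x).det := by
    simp_rw [Matrix.det_fin_three]
    fun_prop
  have ha : Measurable fun x => (T x).adjugate i j := by
    simp_rw [Matrix.adjugate_fin_three]
    fin_cases i <;> fin_cases j <;> simp <;> fun_prop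
  simp_rw [Matrix.inv_def, Matrix.smul_apply, Ring.inverse_eq_inv', smul_eq_mul]
  exact hd.inv.mul ha

/-- Put `w = T⁻¹ v`. Coercivity gives `α‖w‖² ≤ ‖w‖ ‖v‖`, hence the bound `α⁻¹`; and `‖v‖ ≤ β‖w‖`
inserted into `α‖w‖² ≤ Re ⟨v, w⟩` gives the coercivity constant `α / β²`. -/
lemma Coef.inv {T : R3 → CMat} {α β : ℝ} (h : Coef T α β) :
    Coef (fun x => (T x)⁻¹) (α / β ^ 2) α⁻¹ where
  meas := measurable_inv_entries h.meas
  per x n := by simp [h.per x n]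
  herm x := (h.herm x).inv
  pos := by have := h.pos; have := h.bdd_pos; positivity
  bdd_pos := inv_pos.2 h.pos
  bdd x v := by
    have h1 := h.coer x (mv (T x)⁻¹ v)
    rw [mv_inv_cancel (h.isUnit x)] at h1
    have h2 : (inner ℂ (mv (T x)⁻¹ v) v).re ≤ ‖mv (T x)⁻¹ v‖ * ‖v‖ :=
      (Complex.re_le_norm _).trans (norm_inner_le_norm _ _)
    rcases eq_or_lt_of_le (norm_nonneg (mv (T x)⁻¹ v)) with h0 | h0
    · rw [← h0]; have := h.pos; positivity
    · rw [← mul_le_mul_iff_right₀ h.pos, ← mul_assoc, mul_inv_cancel₀ h.pos.ne', one_mul]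
      nlinarith
  coer x v := by
    have h1 := h.coer x (mv (T x)⁻¹ v)
    rw [mv_inv_cancel (h.isUnit x), inner_mv_of_isHermitian (h.herm x).inv] at h1
    have h2 := h.bdd x (mv (T x)⁻¹ v)
    rw [mv_inv_cancel (h.isUnit x)] at h2
    refine le_trans ?_ h1
    rw [div_mul_eq_mul_div, mul_div_assoc]
    refine mul_le_mul_of_nonneg_left ?_ h.pos.le
    rw [div_le_iff₀ (by have := h.bdd_pos; positivity)]
    calc ‖v‖ ^ 2 ≤ (β * ‖mv (T x)⁻¹ v‖) ^ 2 := by gcongr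
      _ = _ := by ring

lemma cx_mul (M N : RMat) : cx (M * N) = cx M * cx N := by
  ext i j; simp [cx, Matrix.mul_apply]

lemma cx_inv (M : RMat) : cx M⁻¹ = (cx M)⁻¹ := by
  have hd : (cx M).det = (M.det : ℂ) := (RingHom.map_det Complex.ofRealHom M).symm
  by_cases h : IsUnit M.det
  · symm
    refine Matrix.inv_eq_right_inv ?_
    rw [← cx_mul, Matrix.mul_nonsing_inv _ h]
    ext i j; simp [cx, Matrix.one_apply]; split_ifs <;> simp
  -- The inverse of a singular matrix is zero by convention, over the reals and over the complex
  -- numbers alike.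
  · have h0 : M.det = 0 := by simpa [isUnit_iff_ne_zero] using h
    rw [Matrix.nonsing_inv_apply_not_isUnit _ h, Matrix.nonsing_inv_apply_not_isUnit]
    · ext i j; simp [cx]
    · rw [hd, h0]; simp

lemma cx_isHermitian {M : RMat} (h : M.IsSymm) : (cx M).IsHermitian := by
  ext i j
  simp [cx, Matrix.conjTranspose_apply, h.apply i j]

/-- The real quadratic form controls the complex one. -/
lemma re_inner_cx {M : RMat} (h : M.IsSymm) (v : C3) : (inner ℂ v (mv (cx M) v)).re =
    (fun i => (v i).re) ⬝ᵥ M.mulVec (fun i => (v i).re) +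
    (fun i => (v i).im) ⬝ᵥ M.mulVec (fun i => (v i).im) := by
  have h01 := h.apply 0 1
  have h02 := h.apply 0 2
  have h12 := h.apply 1 2
  simp [PiLp.inner_apply, mv_apply, cx, Fin.sum_univ_three, dotProduct, Matrix.mulVec,
    Complex.mul_re, Complex.mul_im]
  rw [h01, h02, h12]
  ring

lemma norm_sq_eq_dot (v : C3) : ‖v‖ ^ 2 = (fun i => (v i).re) ⬝ᵥ (fun i => (v i).re) +
    (fun i => (v i).im) ⬝ᵥ (fun i => (v i).im) := by
  rw [EuclideanSpace.norm_sq_eq]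
  simp [Fin.sum_univ_three, dotProduct, Complex.sq_norm, Complex.normSq_apply]
  ring
end

/-! ### Elliptic matrices and their square roots -/

lemma mem_Icc_of_mem_spectrum {M : RMat} {α β : ℝ}
    (h : ∀ ξ : Fin 3 → ℝ, α * (ξ ⬝ᵥ ξ) ≤ ξ ⬝ᵥ M.mulVec ξ ∧ ξ ⬝ᵥ M.mulVec ξ ≤ β * (ξ ⬝ᵥ ξ))
    {t : ℝ} (ht : t ∈ spectrum ℝ M) : t ∈ Set.Icc α β := by
  rw [← Matrix.spectrum_toLin', ← Module.End.hasEigenvalue_iff_mem_spectrum] at ht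
  obtain ⟨v, hv⟩ := ht.exists_hasEigenvector
  have h1 : M.mulVec v = t • v := by simpa using hv.apply_eq_smul
  have h2 := h v
  rw [h1, dotProduct_smul, smul_eq_mul] at h2
  have h3 : 0 < v ⬝ᵥ v := by
    have h4 : 0 ≤ v ⬝ᵥ v := Finset.sum_nonneg fun i _ => mul_self_nonneg _
    exact lt_of_le_of_ne h4 fun h5 => hv.2 (dotProduct_self_eq_zero.1 h5.symm)
  exact ⟨le_of_mul_le_mul_right h2.1 h3, le_of_mul_le_mul_right h2.2 h3⟩

lemma posSemidef_of_form {M : RMat} (hs : M.IsSymm) {α : ℝ} (hα : 0 ≤ α)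
    (h : ∀ ξ : Fin 3 → ℝ, α * (ξ ⬝ᵥ ξ) ≤ ξ ⬝ᵥ M.mulVec ξ) : M.PosSemidef := by
  refine Matrix.PosSemidef.of_dotProduct_mulVec_nonneg ?_ fun v => ?_
  · ext i j; simp [Matrix.conjTranspose_apply, hs.apply i j]
  · refine le_trans ?_ (h v)
    exact mul_nonneg hα (Finset.sum_nonneg fun i _ => mul_self_nonneg _)

/-- The spectra of all the matrices `A x` lie in one interval `[α, β]`. Polynomials converging
uniformly to the square root there, applied to `A x`, have measurable entries and converge pointwise
to the square root. -/
lemma measurable_sqrtM {A : R3 → RMat} (hA : IsElliptic A)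
    (hm : ∀ i j, Measurable fun x => A x i j) (i j : Fin 3) :
    Measurable fun x => sqrtM A x i j := by
  obtain ⟨hs, α, β, hα, h⟩ := hA
  have hp : ∀ n : ℕ, ∃ p : Polynomial ℝ, ∀ t ∈ Set.Icc α β, |p.eval t - √t| < 1 / (n + 1 : ℝ) :=
    fun n => exists_polynomial_near_of_continuousOn α β _ Real.continuous_sqrt.continuousOn _
      (by positivity)
  choose p hp using hp
  have hmA : Measurable fun x => (fun i j => A x i j : Fin 3 → Fin 3 → ℝ) :=
    measurable_pi_lambda _ fun i => measurable_pi_lambda _ fun j => hm i j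
  refine measurable_of_tendsto_metrizable (f := fun n x => (Polynomial.aeval (A x) (p n)) i j)
    (fun n => ?_) ?_
  · have : Continuous fun M : Fin 3 → Fin 3 → ℝ =>
        Polynomial.aeval (Matrix.of M : RMat) (p n) i j :=
      (((p n).continuous_aeval (A := RMat)).comp continuous_id).matrix_elem i j
    exact this.measurable.comp hmA
  · rw [tendsto_pi_nhds]
    intro x
    have hps := posSemidef_of_form (hs x) hα.le fun ξ => (h x ξ).1
    have hsa : IsSelfAdjoint (A x) := hps.1
    have h1 : sqrtM A x = cfc Real.sqrt (A x) := by
      rw [sqrtM, CFC.sqrt_eq_real_sqrt _ hps.nonneg, cfcₙ_eq_cfc]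
    have h2 : ∀ n, Polynomial.aeval (A x) (p n) = cfc (p n).eval (A x) := fun n =>
      (cfc_polynomial (p n) (A x) hsa).symm
    have h3 : Tendsto (fun n => cfc (p n).eval (A x)) atTop (𝓝 (cfc Real.sqrt (A x))) := by
      refine tendsto_cfc_fun ?_ (.of_forall fun n => (p n).continuous.continuousOn)
      rw [Metric.tendstoUniformlyOn_iff]
      intro e he
      obtain ⟨N, hN⟩ := exists_nat_one_div_lt he
      filter_upwards [eventually_ge_atTop N] with n hn t ht
      rw [dist_comm, Real.dist_eq]
      refine (hp n t (mem_Icc_of_mem_spectrum (h x) ht)).trans (lt_of_le_of_lt ?_ hN)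
      gcongr
    rw [h1]
    simp_rw [h2]
    exact ((continuous_id.matrix_elem i j).tendsto _).comp h3

lemma sqrtM_mul_self {A : R3 → RMat} (hA : IsElliptic A) (x : R3) :
    sqrtM A x * sqrtM A x = A x := by
  obtain ⟨hs, α, β, hα, h⟩ := hA
  exact CFC.sqrt_mul_sqrt_self _ (posSemidef_of_form (hs x) hα.le fun ξ => (h x ξ).1).nonneg

lemma sqrtM_isSymm (A : R3 → RMat) (x : R3) : (sqrtM A x).IsSymm := by
  have h : (sqrtM A x).IsHermitian := (Matrix.nonneg_iff_posSemidef.1 (CFC.sqrt_nonneg (A x))).1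
  ext i j
  simpa using h.apply i j

lemma mv_sqrtM_sqrtM {A : R3 → RMat} (hA : IsElliptic A) (x : R3) (v : C3) :
    mv (cx (sqrtM A x)) (mv (cx (sqrtM A x)) v) = mv (cx (A x)) v := by
  rw [← mv_mul, ← cx_mul, sqrtM_mul_self hA]

lemma inner_sqrtM (A : R3 → RMat) (x : R3) (u v : C3) :
    inner ℂ (mv (cx (sqrtM A x)) u) v = inner ℂ u (mv (cx (sqrtM A x)) v) :=
  inner_mv_of_isHermitian (cx_isHermitian (sqrtM_isSymm A x)) u v

lemma norm_sqrtM_sq {A : R3 → RMat} (hA : IsElliptic A) (x : R3) (v : C3) :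
    ‖mv (cx (sqrtM A x)) v‖ ^ 2 = (inner ℂ v (mv (cx (A x)) v)).re := by
  rw [← mv_sqrtM_sqrtM hA, ← inner_sqrtM, ← inner_self_eq_norm_sq (𝕜 := ℂ)]; rfl

lemma norm_sqrtM_bounds {A : R3 → RMat} (hA : IsElliptic A) : ∃ α β : ℝ, 0 < α ∧ 0 < β ∧
    ∀ x v, α * ‖v‖ ^ 2 ≤ ‖mv (cx (sqrtM A x)) v‖ ^ 2 ∧
      ‖mv (cx (sqrtM A x)) v‖ ^ 2 ≤ β * ‖v‖ ^ 2 := by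
  obtain ⟨hs, α, β, hα, h⟩ := id hA
  refine ⟨α, max β 1, hα, by positivity, fun x v => ?_⟩
  rw [norm_sqrtM_sq hA, re_inner_cx (hs x), norm_sq_eq_dot]
  have h1 := h x fun i => (v i).re
  have h2 := h x fun i => (v i).im
  have h3 : 0 ≤ (fun i => (v i).re) ⬝ᵥ (fun i => (v i).re) :=
    Finset.sum_nonneg fun i _ => mul_self_nonneg _
  have h4 : 0 ≤ (fun i => (v i).im) ⬝ᵥ (fun i => (v i).im) :=
    Finset.sum_nonneg fun i _ => mul_self_nonneg _
  have h5 := le_max_left β 1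
  constructor <;> nlinarith

lemma Coef.of_isElliptic {A : R3 → RMat} (hA : IsElliptic A) (hp : IsQPeriodic A)
    (hm : ∀ i j, Measurable fun x => A x i j) : ∃ α β, Coef (fun x => cx (A x)) α β := by
  obtain ⟨α, β, hα, hβ, h⟩ := norm_sqrtM_bounds hA
  refine ⟨α, β, ⟨fun i j => ?_, fun x n => by simp only [hp x n],
    fun x => cx_isHermitian (hA.1 x), hα, hβ, fun x v => ?_, fun x v => ?_⟩⟩
  · exact Complex.continuous_ofReal.measurable.comp (hm i j)
  · rw [← mv_sqrtM_sqrtM hA]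
    have h1 := (h x (mv (cx (sqrtM A x)) v)).2
    have h2 := (h x v).2
    refine le_of_sq_le_sq ?_ (by positivity)
    nlinarith
  · rw [← norm_sqrtM_sq hA]; exact (h x v).1

lemma isUnit_sqrtM {A : R3 → RMat} (hA : IsElliptic A) (x : R3) :
    IsUnit (cx (sqrtM A x)).det := by
  obtain ⟨α, β, hα, hβ, h⟩ := norm_sqrtM_bounds hA
  rw [isUnit_iff_ne_zero]
  intro h0
  obtain ⟨v, hv, hMv⟩ := Matrix.exists_mulVec_eq_zero_iff.2 h0
  have h1 := (h x (WithLp.toLp 2 v)).1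
  have h2 : mv (cx (sqrtM A x)) (WithLp.toLp 2 v) = 0 := by simp [mv, hMv]
  have h3 : 0 < ‖(WithLp.toLp 2 v : C3)‖ := by
    rw [norm_pos_iff]; intro h; apply hv; simpa using h
  rw [h2, norm_zero] at h1
  have : 0 < α * ‖(WithLp.toLp 2 v : C3)‖ ^ 2 := by positivity
  simp at h1
  linarith

/-- The inverse square root `A^{-1/2}` applied to a field. -/
def invSqrt (A : R3 → RMat) (u : R3 → C3) : R3 → C3 := fun x => mv (cx (sqrtM A x))⁻¹ (u x)

lemma mv_sqrtM_invSqrt {A : R3 → RMat} (hA : IsElliptic A) (u : R3 → C3) (x : R3) :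
    mv (cx (sqrtM A x)) (invSqrt A u x) = u x := mv_inv_cancel (isUnit_sqrtM hA x) _

/-- The constant is the larger of `√β`, for the root, and `1/√α`, for its inverse, so that one `K`
serves in both directions. -/
lemma norm_sqrtM_le {A : R3 → RMat} (hA : IsElliptic A) :
    ∃ K : ℝ, 0 < K ∧ (∀ x v, ‖mv (cx (sqrtM A x)) v‖ ≤ K * ‖v‖) ∧
      ∀ x v, ‖mv (cx (sqrtM A x))⁻¹ v‖ ≤ K * ‖v‖ := by
  obtain ⟨α, β, hα, hβ, h⟩ := norm_sqrtM_bounds hA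
  refine ⟨max √β (√α)⁻¹, by positivity, fun x v => ?_, fun x v => ?_⟩
  · refine le_trans ?_ (mul_le_mul_of_nonneg_right (le_max_left _ _) (norm_nonneg v))
    refine le_of_sq_le_sq ?_ (by positivity)
    rw [mul_pow, Real.sq_sqrt hβ.le]; exact (h x v).2
  · refine le_trans ?_ (mul_le_mul_of_nonneg_right (le_max_right _ _) (norm_nonneg v))
    refine le_of_sq_le_sq ?_ (by positivity)
    have h1 := (h x (mv (cx (sqrtM A x))⁻¹ v)).1
    rw [mv_inv_cancel (isUnit_sqrtM hA x)] at h1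
    rw [mul_pow, inv_pow, Real.sq_sqrt hα.le, inv_mul_eq_div, le_div_iff₀ hα]
    linarith

lemma measurable_cx_sqrtM {A : R3 → RMat} (hA : IsElliptic A)
    (hm : ∀ i j, Measurable fun x => A x i j) (i j : Fin 3) :
    Measurable fun x => cx (sqrtM A x) i j :=
  Complex.continuous_ofReal.measurable.comp (measurable_sqrtM hA hm i j)

lemma memLp_invSqrt {A : R3 → RMat} (hA : IsElliptic A) (hm : ∀ i j, Measurable fun x => A x i j)
    {ν : Measure R3} {u : R3 → C3} (hu : MemLp u 2 ν) : MemLp (invSqrt A u) 2 ν := by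
  obtain ⟨K, -, -, hK⟩ := norm_sqrtM_le hA
  exact memLp_mv (fun i j => (measurable_inv_entries (measurable_cx_sqrtM hA hm) i
    j).aestronglyMeasurable) hK hu

section
/-! ### The integer lattice and the unit cell -/

/-- An integer vector as a point of `ℝ³`. -/
def ivec (n : Fin 3 → ℤ) : R3 := WithLp.toLp 2 fun i => (n i : ℝ)

@[simp] lemma ivec_apply (n : Fin 3 → ℤ) (i : Fin 3) : ivec n i = n i := rfl

lemma measurableSet_cellQ : MeasurableSet cellQ := by
  have : cellQ = ⋂ i, (fun x : R3 => x i) ⁻¹' Set.Ico 0 1 := by ext; simp [cellQ]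
  rw [this]
  exact MeasurableSet.iInter fun i => measurableSet_Ico.preimage (by fun_prop)

/-- The translate `Q + n`. -/
def cellT (n : Fin 3 → ℤ) : Set R3 := (fun x => x - ivec n) ⁻¹' cellQ

lemma mem_cellT {n : Fin 3 → ℤ} {x : R3} : x ∈ cellT n ↔ ∀ i, n i = ⌊x i⌋ := by
  simp only [cellT, cellQ, Set.mem_preimage, Set.mem_ofPred_eq, Set.mem_Ico, PiLp.sub_apply,
    ivec_apply]
  refine forall_congr' fun i => ?_
  rw [eq_comm, Int.floor_eq_iff]
  constructor <;> rintro ⟨h1, h2⟩ <;> constructor <;> linarith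

lemma measurableSet_cellT (n : Fin 3 → ℤ) : MeasurableSet (cellT n) :=
  measurableSet_cellQ.preimage (by fun_prop)

lemma iUnion_cellT : ⋃ n, cellT n = Set.univ := by
  ext x; simp only [Set.mem_iUnion, Set.mem_univ, iff_true]
  exact ⟨fun i => ⌊x i⌋, mem_cellT.2 fun i => rfl⟩

lemma disjoint_cellT : Pairwise (Function.onFun Disjoint cellT) := by
  intro m n hmn
  rw [Function.onFun, Set.disjoint_left]
  intro x h1 h2
  exact hmn (funext fun i => by rw [mem_cellT.1 h1 i, mem_cellT.1 h2 i])

/-- Invariance under integer translations. -/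
def IsLatticeInvariant (μ : Measure R3) : Prop := ∀ n, μ.map (fun x => x + ivec n) = μ

lemma isLatticeInvariant_volume : IsLatticeInvariant volume := fun _ => map_add_right_eq_self _ _

lemma setLIntegral_cellT {μ : Measure R3} (hμ : IsLatticeInvariant μ) (f : R3 → ENNReal)
    (n : Fin 3 → ℤ) : ∫⁻ x in cellT n, f x ∂μ = ∫⁻ x in cellQ, f (x + ivec n) ∂μ := by
  have h : MeasurePreserving (fun x => x + ivec n) μ μ := ⟨by fun_prop, hμ n⟩
  have he : MeasurableEmbedding (fun x : R3 => x + ivec n) := measurableEmbedding_addRight _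
  rw [← h.setLIntegral_comp_preimage_emb he]
  congr 2
  ext x; simp [cellT]

lemma lintegral_eq_tsum_cellQ {μ : Measure R3} (hμ : IsLatticeInvariant μ) (f : R3 → ENNReal) :
    ∫⁻ x, f x ∂μ = ∑' n, ∫⁻ x in cellQ, f (x + ivec n) ∂μ := by
  rw [← setLIntegral_univ, ← iUnion_cellT, lintegral_iUnion measurableSet_cellT disjoint_cellT]
  exact tsum_congr fun n => setLIntegral_cellT hμ f n

lemma measure_eq_of_restrict_cellQ {μ ν : Measure R3} (hμ : IsLatticeInvariant μ)
    (hν : IsLatticeInvariant ν) (h : μ.restrict cellQ = ν.restrict cellQ) : μ = ν := by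
  ext s hs
  rw [← lintegral_indicator_one hs, ← lintegral_indicator_one hs, lintegral_eq_tsum_cellQ hμ,
    lintegral_eq_tsum_cellQ hν, h]

lemma volume_cellQ : volume cellQ = 1 := by
  have h : cellQ = (WithLp.ofLp : R3 → Fin 3 → ℝ) ⁻¹' Set.pi Set.univ fun _ => Set.Ico (0 : ℝ) 1 := by
    ext x; simp [cellQ]
  rw [h, (PiLp.volume_preserving_ofLp (Fin 3)).measure_preimage
    (MeasurableSet.univ_pi fun _ => measurableSet_Ico).nullMeasurableSet, Real.volume_pi_Ico]
  simp

/-- Lebesgue measure on the unit cell. -/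
abbrev volQ : Measure R3 := volume.restrict cellQ

instance isProbabilityMeasure_volQ : IsProbabilityMeasure volQ := ⟨by simp [volume_cellQ]⟩

/-! ### The torus -/

/-- The covering map. -/
def toTorus (x : R3) : UnitAddTorus (Fin 3) := fun i => (x i : UnitAddCircle)

/-- The section of the covering map with values in the unit cell. -/
def ofTorus (t : UnitAddTorus (Fin 3)) : R3 :=
  WithLp.toLp 2 fun i => (AddCircle.measurableEquivIco 1 0 (t i) : ℝ)

lemma continuous_toTorus : Continuous toTorus :=
  continuous_pi fun i => (AddCircle.continuous_mk' 1).comp (by fun_prop)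

lemma measurable_toTorus : Measurable toTorus := continuous_toTorus.measurable

lemma measurable_ofTorus : Measurable ofTorus := by
  refine (WithLp.measurable_toLp 2 _).comp (measurable_pi_lambda _ fun i => ?_)
  exact measurable_subtype_coe.comp
    ((AddCircle.measurableEquivIco 1 0).measurable.comp (measurable_pi_apply i))

lemma ofTorus_toTorus {x : R3} (hx : x ∈ cellQ) : ofTorus (toTorus x) = x := by
  ext i
  have : x i ∈ Set.Ico (0 : ℝ) (0 + 1) := by simpa using hx i
  exact congrArg Subtype.val (AddCircle.equivIco_coe_eq (p := (1 : ℝ)) this)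

/-- The half-open cell is a Borel section of the covering map. Nothing is lost by passing to the
compact torus, where trigonometric polynomials are dense in the continuous functions. -/
lemma restrict_cellQ_eq_map (μ : Measure R3) :
    μ.restrict cellQ = ((μ.restrict cellQ).map toTorus).map ofTorus := by
  rw [Measure.map_map measurable_ofTorus measurable_toTorus]
  conv_lhs => rw [← Measure.map_id (μ := μ.restrict cellQ)]
  refine Measure.map_congr ?_
  filter_upwards [ae_restrict_mem measurableSet_cellQ] with x hx
  exact (ofTorus_toTorus hx).symm

/-- The dual lattice vector `2πm`. -/
def dvec (m : Fin 3 → ℤ) : R3 := (2 * Real.pi) • ivec m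

lemma expi_eq_prod (κ x : R3) : expi κ x = ∏ i, Complex.exp (Complex.I * (κ i * x i : ℝ)) := by
  rw [expi, ← Complex.exp_sum]
  congr 1
  simp [PiLp.inner_apply, Fin.sum_univ_three]
  ring

lemma mFourier_toTorus (m : Fin 3 → ℤ) (x : R3) :
    UnitAddTorus.mFourier m (toTorus x) = expi (dvec m) x := by
  rw [expi_eq_prod]
  simp only [UnitAddTorus.mFourier, ContinuousMap.coe_mk, toTorus, fourier_coe_apply]
  refine Finset.prod_congr rfl fun i _ => ?_
  congr 1
  simp [dvec]
  ring

lemma norm_expi (κ x : R3) : ‖expi κ x‖ = 1 := by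
  rw [expi, mul_comm, Complex.norm_exp_ofReal_mul_I]

lemma expi_add_right (κ x y : R3) : expi κ (x + y) = expi κ x * expi κ y := by
  simp [expi, inner_add_right, mul_add, Complex.exp_add]

lemma expi_add_left (κ κ' x : R3) : expi (κ + κ') x = expi κ x * expi κ' x := by
  simp [expi, inner_add_left, mul_add, Complex.exp_add]

lemma expi_neg_left (κ x : R3) : expi (-κ) x = (starRingEnd ℂ) (expi κ x) := by
  simp [expi, ← Complex.exp_conj]

lemma expi_comm (κ x : R3) : expi κ x = expi x κ := by simp [expi, real_inner_comm]

@[simp] lemma expi_zero_left (x : R3) : expi 0 x = 1 := by simp [expi]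

lemma conj_expi_mul (κ x : R3) : (starRingEnd ℂ) (expi κ x) * expi κ x = 1 := by
  rw [← expi_neg_left, ← expi_add_left]; simp

lemma expi_dvec_ivec (m n : Fin 3 → ℤ) : expi (dvec m) (ivec n) = 1 := by
  rw [expi_eq_prod]
  refine Finset.prod_eq_one fun i _ => ?_
  rw [Complex.exp_eq_one_iff]
  exact ⟨m i * n i, by simp [dvec]; ring⟩

lemma continuous_expi_right (κ : R3) : Continuous (expi κ) := by unfold expi; fun_prop

lemma contDiff_expi (κ : R3) : ContDiff ℝ ∞ (expi κ) := by
  unfold expi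
  have : ContDiff ℝ ∞ fun x : R3 => ((inner ℝ κ x : ℝ) : ℂ) :=
    Complex.ofRealCLM.contDiff.comp (contDiff_const.inner ℝ contDiff_id)
  exact (contDiff_const.mul this).cexp

lemma expi_dvec_mem_testP (m : Fin 3 → ℤ) : expi (dvec m) ∈ testP (E := ℂ) :=
  ⟨contDiff_expi _, fun x n => by
    have := expi_add_right (dvec m) x (ivec n)
    rw [expi_dvec_ivec, mul_one] at this; exact this⟩

lemma hasFDerivAt_expi (κ x : R3) : HasFDerivAt (expi κ)
    ((Complex.I * expi κ x) • (Complex.ofRealCLM ∘L innerSL ℝ κ)) x := by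
  have h : HasFDerivAt (fun x : R3 => Complex.I * ((inner ℝ κ x : ℝ) : ℂ))
      (Complex.I • (Complex.ofRealCLM ∘L innerSL ℝ κ)) x :=
    ((Complex.ofRealCLM ∘L innerSL ℝ κ).hasFDerivAt).const_mul _
  convert! h.cexp using 1
  rw [smul_smul, mul_comm]; rfl

lemma pd_expi (κ x : R3) (j : Fin 3) : pd j (expi κ) x = Complex.I * κ j * expi κ x := by
  rw [pd, (hasFDerivAt_expi κ x).fderiv]
  simp [EuclideanSpace.inner_single_right]; ring

/-- Finite measures on the torus are determined by their Fourier coefficients. -/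
lemma torus_measure_ext {ρ ρ' : Measure (UnitAddTorus (Fin 3))} [IsFiniteMeasure ρ]
    [IsFiniteMeasure ρ'] (h : ∀ m, ∫ t, UnitAddTorus.mFourier m t ∂ρ =
      ∫ t, UnitAddTorus.mFourier m t ∂ρ') : ρ = ρ' := by
  have hi : ∀ (σ : Measure (UnitAddTorus (Fin 3))) [IsFiniteMeasure σ]
      (f : C(UnitAddTorus (Fin 3), ℂ)), Integrable f σ := fun σ _ f =>
    (BoundedContinuousFunction.mkOfCompact f).integrable σ
  have hc : ∀ (σ : Measure (UnitAddTorus (Fin 3))) [IsFiniteMeasure σ],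
      Continuous fun f : C(UnitAddTorus (Fin 3), ℂ) => ∫ t, f t ∂σ := fun σ _ => by
    have h1 : Continuous fun f : C(UnitAddTorus (Fin 3), ℂ) => ∫ t, f.toLp 1 σ ℂ t ∂σ :=
      continuous_integral.comp ((ContinuousMap.toLp (E := ℂ) 1 σ ℂ).continuous) |>.congr fun f => by
        rfl
    exact h1.congr fun f => integral_congr_ae (ContinuousMap.coeFn_toLp σ f)
  -- Equality of the two integrals is a closed linear condition on `f`, and the characters span a
  -- dense subspace.
  have key : ∀ f : C(UnitAddTorus (Fin 3), ℂ), ∫ t, f t ∂ρ = ∫ t, f t ∂ρ' := by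
    intro f
    have hf : f ∈ (Submodule.span ℂ (Set.range (UnitAddTorus.mFourier (d := Fin 3)))).topologicalClosure
        := by rw [UnitAddTorus.span_mFourier_closure_eq_top]; trivial
    have hcl : IsClosed {f : C(UnitAddTorus (Fin 3), ℂ) | ∫ t, f t ∂ρ = ∫ t, f t ∂ρ'} :=
      isClosed_eq (hc ρ) (hc ρ')
    refine closure_minimal (fun g hg => ?_) hcl hf
    induction hg using Submodule.span_induction with
    | mem g hg => obtain ⟨m, rfl⟩ := hg; exact h m
    | zero => simp
    | add f g _ _ hf hg =>
      simp only [Set.mem_ofPred_eq, ContinuousMap.add_apply] at *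
      rw [integral_add (hi _ _) (hi _ _), integral_add (hi _ _) (hi _ _), hf, hg]
    | smul c f _ hf =>
      simp only [Set.mem_ofPred_eq, ContinuousMap.smul_apply] at *
      rw [integral_smul, integral_smul, hf]
  refine ext_of_forall_integral_eq_of_IsFiniteMeasure fun f => ?_
  have h1 := key ⟨fun t => (f t : ℂ), by fun_prop⟩
  simp only [ContinuousMap.coe_mk] at h1
  rw [integral_complex_ofReal, integral_complex_ofReal] at h1
  exact_mod_cast h1

lemma integral_volQ_prod (f : Fin 3 → ℝ → ℂ) :
    ∫ x in cellQ, ∏ i, f i (x i) = ∏ i, ∫ t in Set.Ico (0 : ℝ) 1, f i t := by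
  have h : cellQ = (WithLp.ofLp : R3 → Fin 3 → ℝ) ⁻¹' Set.pi Set.univ fun _ => Set.Ico (0 : ℝ) 1 := by
    ext x; simp [cellQ]
  have h1 := (PiLp.volume_preserving_ofLp (Fin 3)).setIntegral_preimage_emb
    (MeasurableEquiv.toLp 2 (Fin 3 → ℝ)).symm.measurableEmbedding
    (fun y => ∏ i, f i (y i)) (Set.pi Set.univ fun _ => Set.Ico (0 : ℝ) 1)
  rw [h]
  refine h1.trans ?_
  rw [volume_pi, Measure.restrict_pi_pi]
  exact integral_fintype_prod_eq_prod f

lemma integral_volQ_expi (m : Fin 3 → ℤ) :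
    ∫ x in cellQ, expi (dvec m) x = if m = 0 then 1 else 0 := by
  split_ifs with hm
  · subst hm
    have : dvec 0 = 0 := by ext i; simp [dvec]
    simp [this, Measure.real]
  · simp_rw [expi_eq_prod]
    rw [integral_volQ_prod fun i t => Complex.exp (Complex.I * (dvec m i * t : ℝ))]
    obtain ⟨i, hi⟩ := Function.ne_iff.1 hm
    refine Finset.prod_eq_zero (Finset.mem_univ i) ?_
    have hc : Complex.I * (dvec m i : ℂ) ≠ 0 := by
      simp only [dvec, PiLp.smul_apply, ivec_apply, smul_eq_mul, Complex.ofReal_mul]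
      simp only [Pi.zero_apply] at hi
      simp [Real.pi_ne_zero, hi]
    have h2 := integral_exp_mul_complex (a := 0) (b := 1) hc
    rw [integral_Ico_eq_integral_Ioc, ← intervalIntegral.integral_of_le zero_le_one]
    simp_rw [Complex.ofReal_mul, ← mul_assoc]
    rw [h2]
    have h3 : Complex.exp (Complex.I * (dvec m i : ℂ) * (1 : ℝ)) = 1 := by
      rw [Complex.exp_eq_one_iff]; exact ⟨m i, by simp [dvec]; ring⟩
    rw [h3]; simp

/-- A periodic measure for which gradients of periodic functions have mean zero is Lebesgue
measure. -/
lemma eq_volume_of_gradMeanZero {μ : Measure R3} (hμ : IsPeriodicMeasure μ)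
    (h : GradMeanZero μ) : μ = volume := by
  have hfin : IsProbabilityMeasure (μ.restrict cellQ) := ⟨by simp [hμ.2]⟩
  refine measure_eq_of_restrict_cellQ hμ.1 isLatticeInvariant_volume ?_
  rw [restrict_cellQ_eq_map μ, restrict_cellQ_eq_map volume]
  congr 1
  have := Measure.isProbabilityMeasure_map (μ := μ.restrict cellQ) measurable_toTorus.aemeasurable
  have := Measure.isProbabilityMeasure_map (μ := volQ) measurable_toTorus.aemeasurable
  refine torus_measure_ext fun m => ?_
  rw [integral_map measurable_toTorus.aemeasurable
    (ContinuousMap.continuous _).aestronglyMeasurable,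
    integral_map measurable_toTorus.aemeasurable (ContinuousMap.continuous _).aestronglyMeasurable]
  simp_rw [mFourier_toTorus]
  rw [integral_volQ_expi]
  split_ifs with hm
  · subst hm
    have : dvec 0 = 0 := by ext i; simp [dvec]
    simp [this, Measure.real]
  -- If `m i ≠ 0`, then `∂_i e_{2πm} = 2πi m_i e_{2πm}` has mean zero by hypothesis, and dividing by
  -- the nonzero factor gives the vanishing of the coefficient.
  · obtain ⟨i, hi⟩ := Function.ne_iff.1 hm
    have h1 := h _ (expi_dvec_mem_testP m) i
    simp_rw [pd_expi] at h1
    rw [integral_const_mul] at h1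
    refine (mul_eq_zero.1 h1).resolve_left ?_
    simp only [Pi.zero_apply] at hi
    simp [dvec, Real.pi_ne_zero, hi]

/-! ### Fourier series on the unit cell -/

/-- The Lebesgue measure of the torus. -/
def torusM : Measure (UnitAddTorus (Fin 3)) := volQ.map toTorus

instance : IsProbabilityMeasure torusM :=
  Measure.isProbabilityMeasure_map measurable_toTorus.aemeasurable

lemma measurePreserving_toTorus : MeasurePreserving toTorus volQ torusM := ⟨measurable_toTorus, rfl⟩

lemma measurePreserving_ofTorus : MeasurePreserving ofTorus torusM volQ :=
  ⟨measurable_ofTorus, (restrict_cellQ_eq_map volume).symm⟩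

/-- The monomials in `L²` of the torus. -/
def monoLp (m : Fin 3 → ℤ) : Lp ℂ 2 torusM := (UnitAddTorus.mFourier m).toLp 2 torusM ℂ

lemma orthonormal_monoLp : Orthonormal ℂ monoLp := by
  rw [orthonormal_iff_ite]
  intro m n
  simp only [monoLp, ContinuousMap.inner_toLp, ← UnitAddTorus.mFourier_neg,
    ← UnitAddTorus.mFourier_add]
  rw [torusM, integral_map measurable_toTorus.aemeasurable
    (ContinuousMap.continuous _).aestronglyMeasurable]
  simp_rw [mFourier_toTorus]
  rw [integral_volQ_expi]
  simp only [add_neg_eq_zero, eq_comm]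

lemma span_monoLp : (Submodule.span ℂ (Set.range monoLp)).topologicalClosure = ⊤ := by
  have := (ContinuousMap.toLp_denseRange ℂ torusM ℂ (p := 2) (by simp)).topologicalClosure_map_submodule
    (UnitAddTorus.span_mFourier_closure_eq_top (d := Fin 3))
  simpa only [Submodule.map_span, ContinuousLinearMap.coe_coe, ← Set.range_comp,
    Function.comp_def] using! this

/-- The Fourier basis. -/
def monoBasis : HilbertBasis (Fin 3 → ℤ) ℂ (Lp ℂ 2 torusM) :=
  HilbertBasis.mk orthonormal_monoLp span_monoLp.ge

/-- The Fourier coefficients of a function on the unit cell. -/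
def fcoef (w : R3 → ℂ) (m : Fin 3 → ℤ) : ℂ := ∫ x in cellQ, (starRingEnd ℂ) (expi (dvec m) x) * w x

lemma memLp_expi (κ : R3) : MemLp (expi κ) 2 volQ :=
  MemLp.of_bound (continuous_expi_right κ).aestronglyMeasurable 1
    (.of_forall fun x => (norm_expi κ x).le)

section
variable {w : R3 → ℂ}

/-- A function on the cell as an element of `L²` of the torus. -/
def torLp (hw : MemLp w 2 volQ) : Lp ℂ 2 torusM :=
  (hw.comp_measurePreserving measurePreserving_ofTorus).toLp

lemma torLp_toTorus (hw : MemLp w 2 volQ) : (fun x => torLp hw (toTorus x)) =ᵐ[volQ] w := by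
  have h := measurePreserving_toTorus.quasiMeasurePreserving.ae_eq_comp
    (hw.comp_measurePreserving measurePreserving_ofTorus).coeFn_toLp
  filter_upwards [h, ae_restrict_mem measurableSet_cellQ] with x hx hQ
  refine hx.trans ?_
  simp [ofTorus_toTorus hQ]

lemma monoLp_toTorus (m : Fin 3 → ℤ) :
    (fun x => monoLp m (toTorus x)) =ᵐ[volQ] expi (dvec m) := by
  have h := measurePreserving_toTorus.quasiMeasurePreserving.ae_eq_comp
    (ContinuousMap.coeFn_toLp (p := 2) (𝕜 := ℂ) torusM (UnitAddTorus.mFourier m))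
  filter_upwards [h] with x hx
  exact hx.trans (mFourier_toTorus m x)

lemma norm_torus (F : Lp ℂ 2 torusM) : ‖F‖ = l2 volQ fun x => F (toTorus x) := by
  rw [Lp.norm_def, l2, ← eLpNorm_comp_measurePreserving (Lp.aestronglyMeasurable F)
    measurePreserving_toTorus]
  rfl

lemma monoBasis_repr (hw : MemLp w 2 volQ) (m : Fin 3 → ℤ) :
    monoBasis.repr (torLp hw) m = fcoef w m := by
  rw [HilbertBasis.repr_apply_apply, monoBasis, HilbertBasis.coe_mk, L2.inner_def]
  refine (integral_map measurable_toTorus.aemeasurable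
    (L2.integrable_inner (𝕜 := ℂ) (monoLp m) (torLp hw)).1).trans ?_
  refine integral_congr_ae ?_
  filter_upwards [torLp_toTorus hw, monoLp_toTorus m] with x h1 h2
  rw [h1, h2]
  simp [mul_comm]

/-- **Parseval's identity** on the unit cell. -/
lemma hasSum_sq_fcoef (hw : MemLp w 2 volQ) : HasSum (fun m => ‖fcoef w m‖ ^ 2) (l2 volQ w ^ 2) := by
  have h := monoBasis.hasSum_inner_mul_inner (torLp hw) (torLp hw)
  have h2 : l2 volQ w = ‖torLp hw‖ := by rw [norm_torus, l2_congr (torLp_toTorus hw)]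
  rw [inner_self_eq_norm_sq_to_K, ← h2] at h
  have h3 := Complex.hasSum_re h
  simp_rw [← HilbertBasis.repr_apply_apply, ← inner_conj_symm (torLp hw),
    ← HilbertBasis.repr_apply_apply, monoBasis_repr hw] at h3
  convert! h3 using 1
  · ext m; rw [mul_comm, Complex.mul_conj, Complex.normSq_eq_norm_sq, Complex.ofReal_re]
  · simp [← Complex.ofReal_pow]

/-- Fourier series converge in `L²` of the unit cell. -/
lemma tendsto_fourier_partial (hw : MemLp w 2 volQ) :
    Tendsto (fun s : Finset (Fin 3 → ℤ) => l2 volQ fun x =>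
      w x - ∑ m ∈ s, fcoef w m * expi (dvec m) x) atTop (𝓝 0) := by
  have h := monoBasis.hasSum_repr (torLp hw)
  rw [HasSum, SummationFilter.unconditional_filter, tendsto_iff_norm_sub_tendsto_zero] at h
  refine h.congr fun s => ?_
  rw [norm_torus, l2_sub_comm]
  refine l2_congr ?_
  have h1 := measurePreserving_toTorus.quasiMeasurePreserving.ae_eq_comp
    (Lp.coeFn_sub (∑ m ∈ s, monoBasis.repr (torLp hw) m • monoBasis m) (torLp hw))
  have h2 := measurePreserving_toTorus.quasiMeasurePreserving.ae_eq_comp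
    (Lp.coeFn_finsetSum s fun m => monoBasis.repr (torLp hw) m • monoBasis m)
  have h3 : ∀ᵐ x ∂volQ, ∀ m ∈ s, (monoBasis.repr (torLp hw) m • monoBasis m : Lp ℂ 2 torusM)
      (toTorus x) = fcoef w m * expi (dvec m) x := by
    rw [Finset.eventually_all]
    intro m _
    have h4 := measurePreserving_toTorus.quasiMeasurePreserving.ae_eq_comp
      (Lp.coeFn_smul (monoBasis.repr (torLp hw) m) (monoBasis m : Lp ℂ 2 torusM))
    filter_upwards [h4, monoLp_toTorus m] with x h5 h6
    refine h5.trans ?_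
    rw [Function.comp_apply, Pi.smul_apply, monoBasis_repr hw, smul_eq_mul, ← h6]
    simp [monoBasis]
  filter_upwards [h1, h2, h3, torLp_toTorus hw] with x h1 h2 h3 h4
  refine h1.trans ?_
  simp only [Function.comp_apply, Pi.sub_apply] at h2 ⊢
  rw [h2, h4]
  congr 1
  rw [Finset.sum_apply]
  exact Finset.sum_congr rfl h3

end
end

section
/-! ### Fourier integrals on `ℝ³` -/

section Fourier
open scoped FourierTransform SchwartzMap
variable {E : Type*} [NormedAddCommGroup E] [InnerProductSpace ℂ E] [CompleteSpace E]

/-- The normalising constant `(2π)^{-3/2}`. -/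
def fnc : ℂ := (((2 * Real.pi) ^ (-(3 / 2) : ℝ) : ℝ) : ℂ)

/-- The Fourier transform of an integrable function. -/
def ft (u : R3 → E) (θ : R3) : E := fnc • ∫ x, (starRingEnd ℂ) (expi θ x) • u x

/-- The Fourier synthesis of an integrable function. -/
def fs (k : R3 → E) (x : R3) : E := fnc • ∫ θ, expi θ x • k θ

/-- The pairing `⟨x, θ⟩ / 2π`. -/
def pairing : R3 →L[ℝ] R3 →L[ℝ] ℝ := (2 * Real.pi)⁻¹ • innerSL ℝ

lemma pairing_apply (x y : R3) : pairing x y = (2 * Real.pi)⁻¹ * inner ℝ x y := rfl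

lemma fourierChar_pairing (x y : R3) : (Real.fourierChar (pairing x y) : ℂ) = expi x y := by
  rw [Real.fourierChar_apply, pairing_apply, expi]
  congr 1
  have : (Real.pi : ℂ) ≠ 0 := by exact_mod_cast Real.pi_ne_zero
  push_cast
  field_simp

lemma ft_eq (u : R3 → E) (θ : R3) :
    ft u θ = fnc • VectorFourier.fourierIntegral Real.fourierChar volume pairing.toLinearMap₁₂ u θ := by
  rw [ft, VectorFourier.fourierIntegral]
  congr 2; ext x
  have := fourierChar_pairing (-x) θ
  rw [map_neg, neg_apply] at this
  change _ = (Real.fourierChar (-(pairing x θ)) : ℂ) • u x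
  rw [this, expi_neg_left, expi_comm]

lemma fs_eq (k : R3 → E) (x : R3) : fs k x =
    fnc • VectorFourier.fourierIntegral Real.fourierChar volume (-pairing).toLinearMap₁₂ k x := by
  rw [fs, VectorFourier.fourierIntegral]
  congr 2; ext θ
  have : -((-pairing) θ x) = pairing θ x := by simp
  change _ = (Real.fourierChar (-((-pairing) θ x)) : ℂ) • k θ
  rw [this, fourierChar_pairing]

lemma continuous_pairing : Continuous fun p : R3 × R3 => pairing p.1 p.2 := by
  simp only [pairing_apply]; fun_prop

lemma fs_eq_ft (k : R3 → E) (x : R3) : fs k x = ft k (-x) := by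
  rw [fs, ft]; simp_rw [expi_neg_left, Complex.conj_conj, expi_comm x]

lemma conj_fnc : (starRingEnd ℂ) fnc = fnc := Complex.conj_ofReal _

/-- Fubini's theorem for the Fourier transform. -/
lemma integral_inner_fs {u k : R3 → E} (hu : Integrable u) (hk : Integrable k) :
    ∫ x, inner ℂ (u x) (fs k x) = ∫ θ, inner ℂ (ft u θ) (k θ) := by
  have h := VectorFourier.integral_sesq_fourierIntegral_eq_neg_flip (μ := volume) (ν := volume)
    (L := pairing.toLinearMap₁₂) (innerSL ℂ) Real.continuous_fourierChar
    continuous_pairing hu hk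
  simp_rw [ft_eq, fs_eq, inner_smul_left, inner_smul_right, conj_fnc]
  rw [integral_const_mul, integral_const_mul]
  congr 1
  refine Eq.trans ?_ h.symm
  congr 1; ext x
  rw [innerSL_apply_apply]
  congr 2
  ext a b
  simp [pairing_apply, real_inner_comm]

lemma fourier_eq_ft (u : R3 → E) (θ : R3) : ft u θ = fnc • 𝓕 u ((2 * Real.pi)⁻¹ • θ) := by
  rw [ft_eq, Real.fourier_eq, VectorFourier.fourierIntegral]
  congr 2; ext x
  simp [pairing_apply, inner_smul_right]

/-- Paired with a test function `g`, both sides equal `∫ ĝ f`: the left one through the Fourier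
transform of tempered distributions, the right one by Fubini's theorem. Locally integrable functions
with equal pairings agree almost everywhere. -/
lemma fourier_Lp_eq {f : R3 → E} (h1 : Integrable f) (h2 : MemLp f 2 volume) :
    (𝓕 h2.toLp : Lp E 2 (volume : Measure R3)) =ᵐ[volume] 𝓕 f := by
  refine ae_eq_of_integral_contDiff_smul_eq ?_ ?_ fun g hg hgs => ?_
  · exact (Lp.memLp _).locallyIntegrable (by norm_num)
  · exact (VectorFourier.fourierIntegral_continuous Real.continuous_fourierChar
      continuous_inner h1).locallyIntegrable
  · have hgs' : HasCompactSupport fun x => (g x : ℂ) := hgs.comp_left (g := fun t : ℝ => (t : ℂ)) rfl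
    set G : 𝓢(R3, ℂ) := hgs'.toSchwartzMap (Complex.ofRealCLM.contDiff.comp hg) with hG
    have hGx : ∀ x, G x = (g x : ℂ) := fun x => rfl
    have key := congrArg (fun T => T G) (Lp.fourier_toTemperedDistribution_eq h2.toLp)
    simp only [TemperedDistribution.fourier_apply, Lp.toTemperedDistribution_apply] at key
    have h3 : ∫ x, g x • (𝓕 h2.toLp : Lp E 2 (volume : Measure R3)) x =
        ∫ x, G x • (𝓕 h2.toLp : Lp E 2 (volume : Measure R3)) x := by
      simp_rw [hGx, Complex.coe_smul]
    rw [h3, ← key]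
    have h4 := VectorFourier.integral_fourierIntegral_smul_eq_flip (μ := volume) (ν := volume)
      (L := innerₗ R3) (f := G) (g := f) Real.continuous_fourierChar continuous_inner
      G.integrable h1
    have h5 : ∫ x, g x • 𝓕 f x = ∫ x, G x • 𝓕 f x := by simp_rw [hGx, Complex.coe_smul]
    rw [h5]
    rw [flip_innerₗ] at h4
    refine Eq.trans ?_ h4
    refine integral_congr_ae ?_
    filter_upwards [h2.coeFn_toLp] with x hx
    rw [hx, SchwartzMap.fourier_coe]
    rfl

lemma map_dilation : (volume : Measure R3).map (fun θ => (2 * Real.pi)⁻¹ • θ) =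
    ENNReal.ofReal ((2 * Real.pi) ^ 3) • volume := by
  have h := Measure.map_addHaar_smul (volume : Measure R3) (r := (2 * Real.pi)⁻¹) (by positivity)
  have h2 : |((2 * Real.pi)⁻¹ ^ 3)⁻¹| = (2 * Real.pi) ^ 3 := by
    rw [inv_pow, inv_inv, abs_of_pos (by positivity)]
  rw [finrank_euclideanSpace_fin, h2] at h
  exact h

/-- The square of `(2π)^{-3/2}` compensates the Jacobian of the dilation by `2π`. This makes `dil`
unitary and transfers Plancherel from the kernel `e^{-2πi x·ξ}` to the kernel `e^{-iθ·x}`. -/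
lemma norm_fnc_sq : ‖fnc‖ ^ 2 * (2 * Real.pi) ^ 3 = 1 := by
  have h : (0 : ℝ) < 2 * Real.pi := by positivity
  rw [fnc, Complex.norm_of_nonneg (by positivity), ← Real.rpow_natCast, ← Real.rpow_mul h.le,
    ← Real.rpow_natCast _ 3, ← Real.rpow_add h]
  norm_num

/-- The normalised dilation `f ↦ (2π)^{-3/2} f(·/2π)`. -/
def dil (f : R3 → E) (θ : R3) : E := fnc • f ((2 * Real.pi)⁻¹ • θ)

lemma memLp_dil {f : R3 → E} (hf : MemLp f 2 volume) : MemLp (dil f) 2 volume := by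
  have h1 : MemLp f 2 ((volume : Measure R3).map (fun θ => (2 * Real.pi)⁻¹ • θ)) := by
    rw [map_dilation]; exact hf.smul_measure ENNReal.ofReal_ne_top
  exact (h1.comp_of_map (by fun_prop)).const_smul fnc

lemma integral_inner_dil (f g : R3 → E) :
    ∫ θ, inner ℂ (dil f θ) (dil g θ) = ∫ x, inner ℂ (f x) (g x) := by
  simp_rw [dil, inner_smul_left, inner_smul_right, conj_fnc]
  have h := Measure.integral_comp_smul (volume : Measure R3) (fun x => inner ℂ (f x) (g x))
    (2 * Real.pi)⁻¹
  rw [integral_const_mul, integral_const_mul, h, finrank_euclideanSpace_fin]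
  have h2 : |((2 * Real.pi)⁻¹ ^ 3)⁻¹| = (2 * Real.pi) ^ 3 := by
    rw [inv_pow, inv_inv, abs_of_pos (by positivity)]
  rw [h2, ← mul_assoc, Complex.real_smul, ← mul_assoc]
  have h3 : fnc * fnc * (((2 * Real.pi) ^ 3 : ℝ) : ℂ) = 1 := by
    have h4 := norm_fnc_sq
    have h5 : fnc = ((‖fnc‖ : ℝ) : ℂ) := by
      rw [fnc, Complex.norm_of_nonneg (by positivity)]
    rw [h5]
    rw [← Complex.ofReal_mul, ← Complex.ofReal_mul, ← sq, h4]; simp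
  rw [h3, one_mul]

/-- The Fourier transform of a square-integrable function. -/
def planch (G : Lp E 2 (volume : Measure R3)) : R3 → E := dil (𝓕 G : Lp E 2 (volume : Measure R3))

lemma memLp_planch (G : Lp E 2 (volume : Measure R3)) : MemLp (planch G) 2 volume :=
  memLp_dil (Lp.memLp _)

lemma integral_inner_planch {f g : R3 → E} (hf : MemLp f 2 volume) (hg : MemLp g 2 volume) :
    ∫ θ, inner ℂ (planch hf.toLp θ) (planch hg.toLp θ) = ∫ x, inner ℂ (f x) (g x) := by
  rw [planch, planch, integral_inner_dil, ← L2.inner_def, Lp.inner_fourier_eq, L2.inner_def]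
  refine integral_congr_ae ?_
  filter_upwards [hf.coeFn_toLp, hg.coeFn_toLp] with x h1 h2
  rw [h1, h2]

lemma l2_planch {f : R3 → E} (hf : MemLp f 2 volume) : l2 volume (planch hf.toLp) = l2 volume f := by
  have h := congrArg RCLike.re (integral_inner_planch hf hf)
  rw [integral_inner_self hf, integral_inner_self (memLp_planch _)] at h
  exact (sq_eq_sq₀ (l2_nonneg _) (l2_nonneg _)).1 h

lemma ae_comp_dilation {f g : R3 → E} (h : f =ᵐ[volume] g) : dil f =ᵐ[volume] dil g := by
  have hq : Measure.QuasiMeasurePreserving (fun θ : R3 => (2 * Real.pi)⁻¹ • θ) volume volume :=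
    ⟨by fun_prop, by rw [map_dilation]; exact Measure.smul_absolutelyContinuous⟩
  filter_upwards [hq.ae_eq_comp h] with θ hθ
  rw [dil, dil]
  exact congrArg _ hθ

lemma planch_eq_ft {f : R3 → E} (h1 : Integrable f) (h2 : MemLp f 2 volume) :
    planch h2.toLp =ᵐ[volume] ft f := by
  refine (ae_comp_dilation (fourier_Lp_eq h1 h2)).trans (.of_forall fun θ => ?_)
  rw [fourier_eq_ft]; rfl

lemma memLp_ft {f : R3 → E} (h1 : Integrable f) (h2 : MemLp f 2 volume) : MemLp (ft f) 2 volume :=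
  (memLp_congr_ae (planch_eq_ft h1 h2)).1 (memLp_planch _)

lemma l2_ft {f : R3 → E} (h1 : Integrable f) (h2 : MemLp f 2 volume) :
    l2 volume (ft f) = l2 volume f := by
  rw [← l2_congr (planch_eq_ft h1 h2), l2_planch]

lemma integral_inner_ft_planch {u g : R3 → E} (h1 : Integrable u) (h2 : MemLp u 2 volume)
    (hg : MemLp g 2 volume) :
    ∫ θ, inner ℂ (ft u θ) (planch hg.toLp θ) = ∫ x, inner ℂ (u x) (g x) := by
  rw [← integral_inner_planch h2 hg]
  refine integral_congr_ae ?_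
  filter_upwards [planch_eq_ft h1 h2] with x h
  rw [h]

lemma planch_sub {f g : R3 → E} (hf : MemLp f 2 volume) (hg : MemLp g 2 volume) :
    (fun θ => planch hf.toLp θ - planch hg.toLp θ) =ᵐ[volume] planch (hf.sub hg).toLp := by
  have h : (𝓕 (hf.sub hg).toLp : Lp E 2 (volume : Measure R3)) = 𝓕 hf.toLp - 𝓕 hg.toLp := by
    rw [MemLp.toLp_sub]
    exact (Lp.fourierTransformₗᵢ R3 E).map_sub _ _
  have h2 := ae_comp_dilation (Lp.coeFn_sub (𝓕 hf.toLp) (𝓕 hg.toLp))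
  rw [← h] at h2
  filter_upwards [h2] with θ hθ
  rw [planch, planch, planch, hθ]
  simp [dil, smul_sub]

lemma MemLp.indicator_ball {g : R3 → E} (hg : MemLp g 2 volume) (r : ℝ) :
    MemLp ((Metric.ball (0 : R3) r).indicator g) 2 volume ∧
      Integrable ((Metric.ball (0 : R3) r).indicator g) := by
  refine ⟨hg.indicator measurableSet_ball, ?_⟩
  rw [integrable_indicator_iff measurableSet_ball]
  have : IsFiniteMeasure (volume.restrict (Metric.ball (0 : R3) r)) :=
    ⟨by rw [Measure.restrict_apply_univ]; exact measure_ball_lt_top⟩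
  exact (hg.restrict _).integrable (by norm_num)

lemma tendsto_l2_indicator_ball {g : R3 → E} (hg : MemLp g 2 volume) :
    Tendsto (fun n : ℕ => l2 volume fun x => (Metric.ball (0 : R3) n).indicator g x - g x) atTop
      (𝓝 0) := by
  have hm : ∀ n : ℕ, MemLp (fun x => (Metric.ball (0 : R3) n).indicator g x - g x) 2 volume :=
    fun n => (MemLp.indicator_ball hg n).1.sub hg
  have h : Tendsto (fun n : ℕ => ∫ x, ‖(Metric.ball (0 : R3) n).indicator g x - g x‖ ^ 2) atTop
      (𝓝 (∫ _ : R3, (0 : ℝ))) := by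
    refine tendsto_integral_of_dominated_convergence (fun x => ‖g x‖ ^ 2)
      (fun n => (integrable_norm_sq (hm n)).1) (integrable_norm_sq hg) ?_ ?_
    · refine fun n => .of_forall fun x => ?_
      by_cases hx : x ∈ Metric.ball (0 : R3) n <;> simp [hx]
    · refine .of_forall fun x => ?_
      obtain ⟨N, hN⟩ := exists_nat_gt ‖x‖
      refine tendsto_const_nhds.congr' ?_
      filter_upwards [eventually_ge_atTop N] with n hn
      have : x ∈ Metric.ball (0 : R3) n := by
        simpa using hN.trans_le (by exact_mod_cast hn)
      simp [this]
  simp_rw [← l2_sq (hm _), integral_zero] at h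
  have h2 := h.sqrt
  simpa [Real.sqrt_sq (l2_nonneg _)] using h2

/-- By Plancherel the error is exactly the `L²` norm of the part of `g` outside the ball. -/
lemma tendsto_ft_ball {g : R3 → E} (hg : MemLp g 2 volume) :
    Tendsto (fun n : ℕ => eLpNorm (fun θ => ft ((Metric.ball (0 : R3) n).indicator g) θ -
      planch hg.toLp θ) 2 volume) atTop (𝓝 0) := by
  have hi := fun n : ℕ => MemLp.indicator_ball hg n
  refine tendsto_eLpNorm_of_l2 (fun n => (memLp_ft (hi n).2 (hi n).1).sub (memLp_planch _)) ?_
  refine (tendsto_l2_indicator_ball hg).congr fun n => ?_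
  refine Eq.trans ?_ (l2_congr ?_ : l2 volume (planch ((hi n).1.sub hg).toLp) = _)
  · rw [l2_planch]; rfl
  · filter_upwards [planch_eq_ft (hi n).2 (hi n).1, planch_sub (hi n).1 hg] with θ h1 h2
    rw [← h2, h1]

end Fourier

lemma isFourierTransform_planch {g : R3 → C3} (hg : MemLp g 2 volume) :
    IsFourierTransform volume g (planch hg.toLp) := by
  refine fun R => ⟨(memLp_planch _).restrict _, ?_⟩
  refine tendsto_of_tendsto_of_tendsto_of_le_of_le tendsto_const_nhds (tendsto_ft_ball hg)
    (fun n => bot_le) fun n => ?_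
  refine le_trans (le_of_eq ?_)
    (eLpNorm_mono_measure (ν := volume.restrict (Metric.ball 0 R)) _ Measure.restrict_le_self)
  congr 1; ext1 θ
  rw [ft, ← integral_indicator measurableSet_ball]
  congr 3; ext1 x
  by_cases hx : x ∈ Metric.ball (0 : R3) n <;> simp [hx]

/-- The inverse Fourier transform of a square-integrable function. -/
def synth (G : Lp C3 2 (volume : Measure R3)) (x : R3) : C3 := planch G (-x)

lemma memLp_comp_neg {E : Type*} [NormedAddCommGroup E] {f : R3 → E} (hf : MemLp f 2 volume) :
    MemLp (fun x => f (-x)) 2 volume :=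
  hf.comp_measurePreserving (Measure.measurePreserving_neg volume)

lemma l2_comp_neg {E : Type*} [NormedAddCommGroup E] {f : R3 → E} (hf : MemLp f 2 volume) :
    l2 volume (fun x => f (-x)) = l2 volume f := by
  rw [l2, l2, ← eLpNorm_comp_measurePreserving hf.1 (Measure.measurePreserving_neg volume)]; rfl

lemma memLp_synth (G : Lp C3 2 (volume : Measure R3)) : MemLp (synth G) 2 volume :=
  memLp_comp_neg (memLp_planch G)

lemma memLp_fs {E : Type*} [NormedAddCommGroup E] [InnerProductSpace ℂ E] [CompleteSpace E]
    {k : R3 → E} (h1 : Integrable k) (h2 : MemLp k 2 volume) : MemLp (fs k) 2 volume := by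
  simpa only [← fs_eq_ft] using memLp_comp_neg (memLp_ft h1 h2)

lemma l2_fs {E : Type*} [NormedAddCommGroup E] [InnerProductSpace ℂ E] [CompleteSpace E]
    {k : R3 → E} (h1 : Integrable k) (h2 : MemLp k 2 volume) :
    l2 volume (fs k) = l2 volume k := by
  rw [← l2_ft h1 h2, ← l2_comp_neg (memLp_ft h1 h2)]
  simp only [← fs_eq_ft]

lemma tendsto_fs_ball {k : R3 → C3} (hk : MemLp k 2 volume) :
    Tendsto (fun n : ℕ => eLpNorm (fun x => fs ((Metric.ball (0 : R3) n).indicator k) x -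
      synth hk.toLp x) 2 volume) atTop (𝓝 0) := by
  refine (tendsto_ft_ball hk).congr fun n => ?_
  have hi := MemLp.indicator_ball hk n
  refine (eLpNorm_comp_measurePreserving ((memLp_ft hi.2 hi.1).sub (memLp_planch hk.toLp)).1
    (Measure.measurePreserving_neg volume)).symm.trans ?_
  congr 1; ext1 x
  simp [fs_eq_ft, synth]

lemma isFourierSynthesis_synth {k : R3 → C3} (hk : MemLp k 2 volume) :
    IsFourierSynthesis volume k (synth hk.toLp) := by
  refine ⟨fun R => ?_, memLp_synth _, (tendsto_fs_ball hk).congr fun n => ?_⟩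
  · exact (integrable_indicator_iff measurableSet_ball).1 (MemLp.indicator_ball hk R).2
  · congr 1; ext1 x
    rw [fs, ← integral_indicator measurableSet_ball]
    congr 3; ext1 θ
    by_cases hx : θ ∈ Metric.ball (0 : R3) n <;> simp [hx]

/-! ### Smoothness of Fourier synthesis and derivatives -/

section Smooth
variable {E : Type*} [NormedAddCommGroup E] [InnerProductSpace ℂ E] [CompleteSpace E]

lemma integrable_pow_mul {k : R3 → E} {r : ℝ} (hk : Integrable k) (hr : ∀ θ, r ≤ ‖θ‖ → k θ = 0)
    (n : ℕ) : Integrable fun θ => ‖θ‖ ^ n * ‖k θ‖ := by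
  refine (hk.norm.const_mul (max r 0 ^ n)).mono' (by
    exact (by fun_prop : AEStronglyMeasurable (fun θ : R3 => ‖θ‖ ^ n) volume).mul hk.1.norm)
    (.of_forall fun θ => ?_)
  rw [Real.norm_of_nonneg (by positivity)]
  by_cases h : r ≤ ‖θ‖
  · simp [hr θ h]
  · gcongr; exact (not_le.1 h).le.trans (le_max_left _ _)

/-- Bounded support makes all moments of `k` integrable, so one may differentiate under the integral
any number of times. -/
lemma contDiff_fs {k : R3 → E} {r : ℝ} (hk : Integrable k) (hr : ∀ θ, r ≤ ‖θ‖ → k θ = 0) :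
    ContDiff ℝ ∞ (fs k) := by
  have h : fs k = fun x => fnc • VectorFourier.fourierIntegral Real.fourierChar volume
      (-pairing).toLinearMap₁₂ k x := funext fun x => fs_eq k x
  rw [h]
  exact (VectorFourier.contDiff_fourierIntegral (-pairing) (N := ⊤)
    fun n _ => integrable_pow_mul hk hr n).const_smul fnc

lemma fderiv_fs {k : R3 → E} {r : ℝ} (hk : Integrable k) (hr : ∀ θ, r ≤ ‖θ‖ → k θ = 0)
    (x y : R3) : fderiv ℝ (fs k) x y = fs (fun θ => (Complex.I * (inner ℝ θ y : ℝ)) • k θ) x := by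
  have h : fs k = fnc • VectorFourier.fourierIntegral Real.fourierChar volume
      (-pairing).toLinearMap₁₂ k := funext fun x => fs_eq k x
  have hd := VectorFourier.hasFDerivAt_fourierIntegral (-pairing) hk
    (by simpa using integrable_pow_mul hk hr 1) x
  rw [h, (hd.const_smul fnc).fderiv, fs_eq, smul_apply]
  congr 1
  have hi : Integrable fun v => Real.fourierChar (-(-pairing).toLinearMap₁₂ v x) •
      VectorFourier.fourierSMulRight (-pairing) k v := by
    refine (VectorFourier.fourierIntegral_convergent_iff (L := (-pairing).toLinearMap₁₂)
      Real.continuous_fourierChar continuous_pairing.neg x).2 ?_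
    refine (((integrable_pow_mul hk hr 1).const_mul (2 * Real.pi * ‖-pairing‖))).mono'
      hk.1.fourierSMulRight (.of_forall fun v => ?_)
    exact (VectorFourier.norm_fourierSMulRight_le _ _ _).trans (le_of_eq (by ring))
  rw [VectorFourier.fourierIntegral, ContinuousLinearMap.integral_apply hi,
    VectorFourier.fourierIntegral]
  congr 1; ext θ
  rw [Circle.smul_def, Circle.smul_def, smul_apply, VectorFourier.fourierSMulRight_apply]
  congr 1
  rw [← Complex.coe_smul, smul_smul]
  congr 1
  have : (Real.pi : ℂ) ≠ 0 := by exact_mod_cast Real.pi_ne_zero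
  rw [neg_apply, neg_apply, pairing_apply]
  push_cast
  field_simp

lemma ft_fderiv {u : R3 → E} (hu : ContDiff ℝ ∞ u) (hs : HasCompactSupport u) (θ y : R3) :
    ft (fun x => fderiv ℝ u x y) θ = (Complex.I * (inner ℝ θ y : ℝ)) • ft u θ := by
  have hc : Continuous (fderiv ℝ u) := hu.continuous_fderiv (by simp)
  have hi : Integrable (fderiv ℝ u) := hc.integrable_of_hasCompactSupport (hs.fderiv (𝕜 := ℝ))
  have h := congrFun (VectorFourier.fourierIntegral_fderiv pairing (μ := volume)
    (hu.continuous.integrable_of_hasCompactSupport hs) (hu.differentiable (by simp)) hi) θ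
  have h1 := congrArg (fun T => T y) h
  simp only [VectorFourier.fourierSMulRight_apply] at h1
  have hi2 : Integrable fun v => Real.fourierChar (-pairing.toLinearMap₁₂ v θ) • fderiv ℝ u v :=
    (VectorFourier.fourierIntegral_convergent_iff Real.continuous_fourierChar
      continuous_pairing θ).2 hi
  rw [VectorFourier.fourierIntegral, ContinuousLinearMap.integral_apply hi2] at h1
  rw [ft_eq, ft_eq, smul_comm]
  congr 1
  refine Eq.trans (by rfl) (h1.trans ?_)
  rw [← Complex.coe_smul, smul_smul]
  congr 1
  have : (Real.pi : ℂ) ≠ 0 := by exact_mod_cast Real.pi_ne_zero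
  rw [neg_apply, neg_apply, ContinuousLinearMap.flip_apply, pairing_apply,
    real_inner_comm]
  push_cast
  field_simp

end Smooth
end

section
/-! ### Calculus of gradients and curls -/

/-- The cross product on `ℂ³`. -/
def crs (a b : C3) : C3 :=
  WithLp.toLp 2 ![a 1 * b 2 - a 2 * b 1, a 2 * b 0 - a 0 * b 2, a 0 * b 1 - a 1 * b 0]

lemma norm_crs_le (a b : C3) : ‖crs a b‖ ≤ 6 * (‖a‖ * ‖b‖) := by
  have h : ∀ i j k l : Fin 3, ‖a i * b j - a k * b l‖ ≤ 2 * (‖a‖ * ‖b‖) := fun i j k l => by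
    refine (norm_sub_le _ _).trans ?_
    rw [norm_mul, norm_mul, two_mul]
    gcongr <;> exact norm_apply_le _ _
  refine (norm_le_sum _).trans ?_
  simp only [Fin.sum_univ_three, crs]
  have h0 := h 1 2 2 1
  have h1 := h 2 0 0 2
  have h2 := h 0 1 1 0
  simp at h0 h1 h2 ⊢
  linarith

lemma crs_smul_right (c : ℂ) (a b : C3) : crs a (c • b) = c • crs a b := by
  ext i; fin_cases i <;> simp [crs] <;> ring

lemma crs_smul_left (c : ℂ) (a b : C3) : crs (c • a) b = c • crs a b := by
  ext i; fin_cases i <;> simp [crs] <;> ring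

section
variable {f g : R3 → ℂ} {u w : R3 → C3} {x : R3}

lemma contDiff_apply (hu : ContDiff ℝ ∞ u) (i : Fin 3) : ContDiff ℝ ∞ fun x => u x i :=
  ((EuclideanSpace.proj (𝕜 := ℂ) i).restrictScalars ℝ).contDiff.comp hu

lemma contDiff_toLp {v : Fin 3 → R3 → ℂ} (h : ∀ i, ContDiff ℝ ∞ (v i)) :
    ContDiff ℝ ∞ fun x => (WithLp.toLp 2 fun i => v i x : C3) := by
  have : (fun x => (WithLp.toLp 2 fun i => v i x : C3)) = fun x => ∑ i, v i x • basisVec i := by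
    ext1 x; exact (sum_basisVec (WithLp.toLp 2 fun i => v i x)).symm
  rw [this]
  exact ContDiff.sum fun i _ => (h i).smul contDiff_const

lemma contDiff_pd (hf : ContDiff ℝ ∞ f) (j : Fin 3) : ContDiff ℝ ∞ (pd j f) :=
  (hf.fderiv_right (m := ∞) (by simp)).clm_apply contDiff_const

lemma contDiff_grad (hf : ContDiff ℝ ∞ f) : ContDiff ℝ ∞ (grad f) :=
  contDiff_toLp fun j => contDiff_pd hf j

lemma contDiff_curl (hu : ContDiff ℝ ∞ u) : ContDiff ℝ ∞ (curl u) := by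
  refine contDiff_toLp (v := fun i x => ![pd 1 (fun y => u y 2) x - pd 2 (fun y => u y 1) x,
    pd 2 (fun y => u y 0) x - pd 0 (fun y => u y 2) x,
    pd 0 (fun y => u y 1) x - pd 1 (fun y => u y 0) x] i) fun i => ?_
  have h := fun i j => contDiff_pd (contDiff_apply hu i) j
  fin_cases i
  · exact (h 2 1).sub (h 1 2)
  · exact (h 0 2).sub (h 2 0)
  · exact (h 1 0).sub (h 0 1)

lemma differentiable_apply (hu : Differentiable ℝ u) (i : Fin 3) :
    Differentiable ℝ fun x => u x i :=
  ((EuclideanSpace.proj (𝕜 := ℂ) i).restrictScalars ℝ).differentiable.comp hu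

lemma pd_add (hf : Differentiable ℝ f) (hg : Differentiable ℝ g) (j : Fin 3) :
    pd j (fun y => f y + g y) x = pd j f x + pd j g x := by
  rw [pd, fderiv_fun_add (hf x) (hg x)]; rfl

lemma pd_const_mul (hf : Differentiable ℝ f) (c : ℂ) (j : Fin 3) :
    pd j (fun y => c * f y) x = c * pd j f x := by
  rw [pd, fderiv_const_mul (hf x)]; rfl

lemma pd_mul (hf : Differentiable ℝ f) (hg : Differentiable ℝ g) (j : Fin 3) :
    pd j (fun y => f y * g y) x = f x * pd j g x + pd j f x * g x := by
  rw [pd, fderiv_fun_mul (hf x) (hg x)]; simp [pd, mul_comm]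

lemma pd_const (c : ℂ) (j : Fin 3) : pd j (fun _ => c) x = 0 := by simp [pd]

lemma pd_rescale (hf : Differentiable ℝ f) (ε : ℝ) (j : Fin 3) :
    pd j (rescale ε f) x = (ε⁻¹ : ℝ) * pd j f (ε⁻¹ • x) := by
  have h : HasFDerivAt (rescale ε f)
      ((fderiv ℝ f (ε⁻¹ • x)).comp (ε⁻¹ • ContinuousLinearMap.id ℝ R3)) x :=
    (hf _).hasFDerivAt.comp x ((ContinuousLinearMap.id ℝ R3).hasFDerivAt.const_smul ε⁻¹)
  rw [pd, h.fderiv]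
  simp [pd]

lemma pd_conj (hf : Differentiable ℝ f) (j : Fin 3) :
    pd j (fun y => (starRingEnd ℂ) (f y)) x = (starRingEnd ℂ) (pd j f x) := by
  have h : HasFDerivAt (fun y => (starRingEnd ℂ) (f y))
      ((Complex.conjCLE : ℂ →L[ℝ] ℂ).comp (fderiv ℝ f x)) x :=
    (Complex.conjCLE : ℂ →L[ℝ] ℂ).hasFDerivAt.comp x (hf x).hasFDerivAt
  rw [pd, h.fderiv]
  rfl

lemma pd_comm (hf : ContDiff ℝ ∞ f) (i j : Fin 3) : pd i (pd j f) x = pd j (pd i f) x := by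
  have h2 : DifferentiableAt ℝ (fderiv ℝ f) x :=
    ((hf.fderiv_right (m := ∞) (by simp)).differentiable (by simp)) x
  have h : ∀ i j : Fin 3, pd i (pd j f) x =
      fderiv ℝ (fderiv ℝ f) x (EuclideanSpace.single i 1) (EuclideanSpace.single j 1) := by
    intro i j
    have h3 : HasFDerivAt (pd j f) ((ContinuousLinearMap.apply ℝ ℂ
        (EuclideanSpace.single j (1 : ℝ) : R3)).comp (fderiv ℝ (fderiv ℝ f) x)) x :=
      (ContinuousLinearMap.apply ℝ ℂ (EuclideanSpace.single j (1 : ℝ) : R3)).hasFDerivAt.comp x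
        h2.hasFDerivAt
    rw [pd, h3.fderiv]; rfl
  rw [h, h]
  exact (hf.contDiffAt.isSymmSndFDerivAt (by simpa using ENat.LEInfty.out)).eq _ _

lemma grad_apply (f : R3 → ℂ) (x : R3) (j : Fin 3) : grad f x j = pd j f x := rfl

lemma grad_add (hf : Differentiable ℝ f) (hg : Differentiable ℝ g) :
    grad (fun y => f y + g y) x = grad f x + grad g x := by
  ext j; simp [grad_apply, pd_add hf hg]

lemma grad_const_mul (hf : Differentiable ℝ f) (c : ℂ) :
    grad (fun y => c * f y) x = c • grad f x := by
  ext j; simp [grad_apply, pd_const_mul hf]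

lemma grad_mul (hf : Differentiable ℝ f) (hg : Differentiable ℝ g) :
    grad (fun y => f y * g y) x = f x • grad g x + g x • grad f x := by
  ext j; simp [grad_apply, pd_mul hf hg, mul_comm]

lemma grad_rescale (hf : Differentiable ℝ f) (ε : ℝ) :
    grad (rescale ε f) x = ((ε⁻¹ : ℝ) : ℂ) • rescale ε (grad f) x := by
  ext j; simp [grad_apply, pd_rescale hf, rescale]

lemma curl_add (hu : Differentiable ℝ u) (hw : Differentiable ℝ w) :
    curl (fun y => u y + w y) x = curl u x + curl w x := by
  have hu' := differentiable_apply hu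
  have hw' := differentiable_apply hw
  ext i; fin_cases i <;> simp [curl, pd_add (hu' _) (hw' _)] <;> ring

lemma curl_zero : curl (fun _ => 0) x = 0 := by
  ext i; fin_cases i <;> simp [curl, pd_const]

lemma curl_const (c : C3) : curl (fun _ => c) x = 0 := by
  ext i; fin_cases i <;> simp [curl, pd_const]

lemma curl_sum {ι : Type*} (s : Finset ι) {v : ι → R3 → C3} (hv : ∀ i, Differentiable ℝ (v i)) :
    curl (fun y => ∑ i ∈ s, v i y) x = ∑ i ∈ s, curl (v i) x := by
  classical
  induction s using Finset.induction_on with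
  | empty => simpa using curl_zero
  | insert a s ha ih =>
    simp only [Finset.sum_insert ha]
    rw [curl_add (hv a) (.fun_sum fun i _ => hv i), ih]

lemma curl_smul (hf : Differentiable ℝ f) (hu : Differentiable ℝ u) :
    curl (fun y => f y • u y) x = f x • curl u x + crs (grad f x) (u x) := by
  have hu' := differentiable_apply hu
  ext i; fin_cases i <;> simp [curl, pd_mul hf (hu' _), crs, grad_apply] <;> ring

lemma curl_const_smul (hu : Differentiable ℝ u) (c : ℂ) :
    curl (fun y => c • u y) x = c • curl u x := by
  have hu' := differentiable_apply hu
  ext i; fin_cases i <;> simp [curl, pd_const_mul (hu' _)] <;> ring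

lemma curl_rescale (hu : Differentiable ℝ u) (ε : ℝ) :
    curl (rescale ε u) x = ((ε⁻¹ : ℝ) : ℂ) • rescale ε (curl u) x := by
  have hu' := differentiable_apply hu
  have h : ∀ i j, pd j (fun y => rescale ε u y i) x = (ε⁻¹ : ℝ) * pd j (fun y => u y i) (ε⁻¹ • x) :=
    fun i j => pd_rescale (hu' i) ε j
  have h2 : rescale ε (curl u) x = curl u (ε⁻¹ • x) := rfl
  rw [h2]
  ext i; fin_cases i <;> simp [curl, h] <;> ring

lemma curl_grad (hf : ContDiff ℝ ∞ f) : curl (grad f) x = 0 := by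
  ext i; fin_cases i <;> simp [curl, grad_apply, sub_eq_zero] <;> exact pd_comm hf _ _

lemma contDiff_rescale {E : Type*} [NormedAddCommGroup E] [NormedSpace ℝ E] {v : R3 → E}
    (hv : ContDiff ℝ ∞ v) (ε : ℝ) : ContDiff ℝ ∞ (rescale ε v) :=
  hv.comp (contDiff_const_smul ε⁻¹)

lemma hasCompactSupport_pd (hf : HasCompactSupport f) (j : Fin 3) : HasCompactSupport (pd j f) :=
  hf.fderiv_apply (𝕜 := ℝ) _

lemma hasCompactSupport_apply (hu : HasCompactSupport u) (i : Fin 3) :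
    HasCompactSupport fun x => u x i := hu.comp_left (g := fun v : C3 => v i) rfl

lemma hasCompactSupport_toLp {v : Fin 3 → R3 → ℂ} (h : ∀ i, HasCompactSupport (v i)) :
    HasCompactSupport fun x => (WithLp.toLp 2 fun i => v i x : C3) := by
  have : (fun x => (WithLp.toLp 2 fun i => v i x : C3)) =
      fun x => v 0 x • basisVec 0 + (v 1 x • basisVec 1 + v 2 x • basisVec 2) := by
    ext1 x; rw [← sum_basisVec (WithLp.toLp 2 fun i => v i x)]
    simp [Fin.sum_univ_three, add_assoc]
  rw [this]
  exact ((h 0).smul_right).add (((h 1).smul_right).add ((h 2).smul_right))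

lemma hasCompactSupport_curl (hu : HasCompactSupport u) : HasCompactSupport (curl u) := by
  have h := fun i j => hasCompactSupport_pd (hasCompactSupport_apply hu i) j
  refine hasCompactSupport_toLp (v := fun i x => ![pd 1 (fun y => u y 2) x - pd 2 (fun y => u y 1) x,
    pd 2 (fun y => u y 0) x - pd 0 (fun y => u y 2) x,
    pd 0 (fun y => u y 1) x - pd 1 (fun y => u y 0) x] i) fun i => ?_
  fin_cases i
  · exact (h 2 1).sub (h 1 2)
  · exact (h 0 2).sub (h 2 0)
  · exact (h 1 0).sub (h 0 1)

lemma memLp_of_mem_testC {E : Type*} [NormedAddCommGroup E] [NormedSpace ℝ E] {v : R3 → E}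
    (hv : v ∈ testC) : MemLp v 2 volume := hv.1.continuous.memLp_of_hasCompactSupport hv.2

lemma integrable_of_mem_testC {E : Type*} [NormedAddCommGroup E] [NormedSpace ℝ E] {v : R3 → E}
    (hv : v ∈ testC) : Integrable v := hv.1.continuous.integrable_of_hasCompactSupport hv.2

lemma curl_mem_testC (hu : u ∈ testC) : curl u ∈ testC :=
  ⟨contDiff_curl hu.1, hasCompactSupport_curl hu.2⟩

lemma integral_conj_mul_pd (hf : f ∈ testC) (hg : ContDiff ℝ ∞ g) (j : Fin 3) :
    ∫ x, (starRingEnd ℂ) (f x) * pd j g x = -∫ x, (starRingEnd ℂ) (pd j f x) * g x := by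
  have hc : HasCompactSupport fun y => (starRingEnd ℂ) (f y) :=
    hf.2.comp_left (g := starRingEnd ℂ) (map_zero _)
  have hcd : ContDiff ℝ ∞ fun y => (starRingEnd ℂ) (f y) :=
    (Complex.conjCLE : ℂ →L[ℝ] ℂ).contDiff.comp hf.1
  have hd := hf.1.differentiable (by simp)
  have h := integral_mul_fderiv_eq_neg_fderiv_mul_of_integrable (μ := (volume : Measure R3))
    (f := fun y => (starRingEnd ℂ) (f y)) (g := g) (v := EuclideanSpace.single j 1) ?_ ?_ ?_
    (fun x _ => hcd.differentiable (by simp) x) (fun x _ => hg.differentiable (by simp) x)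
  · refine h.trans ?_
    congr 2; ext x
    congr 1
    exact pd_conj hd j
  · refine Continuous.integrable_of_hasCompactSupport (Continuous.mul ?_ hg.continuous) ?_
    · exact (hcd.continuous_fderiv (by simp)).clm_apply continuous_const
    · exact HasCompactSupport.mul_right (hc.fderiv_apply (𝕜 := ℝ) _)
  · refine Continuous.integrable_of_hasCompactSupport (hcd.continuous.mul ?_) hc.mul_right
    exact (hg.continuous_fderiv (by simp)).clm_apply continuous_const
  · exact Continuous.integrable_of_hasCompactSupport (hcd.continuous.mul hg.continuous) hc.mul_right

lemma integral_sub_add_sub_add_sub {α : Type*} [MeasurableSpace α] {ν : Measure α}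
    {a b c d e h : α → ℂ} (ha : Integrable a ν) (hb : Integrable b ν) (hc : Integrable c ν)
    (hd : Integrable d ν) (he : Integrable e ν) (hh : Integrable h ν) :
    ∫ x, (a x - b x) + (c x - d x) + (e x - h x) ∂ν =
      (∫ x, a x ∂ν - ∫ x, b x ∂ν) + (∫ x, c x ∂ν - ∫ x, d x ∂ν) + (∫ x, e x ∂ν - ∫ x, h x ∂ν) := by
  have h1 : Integrable (fun x => a x - b x) ν := ha.sub hb
  have h2 : Integrable (fun x => c x - d x) ν := hc.sub hd
  have h3 : Integrable (fun x => e x - h x) ν := he.sub hh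
  have h4 : Integrable (fun x => (a x - b x) + (c x - d x)) ν := h1.add h2
  rw [integral_add h4 h3, integral_add h1 h2, integral_sub ha hb, integral_sub hc hd,
    integral_sub he hh]

/-- Scalar integration by parts enters as the hypothesis `key`, so the same algebra serves the whole
space, where one field has compact support, and the periodic cell, where there are no boundary
terms. -/
lemma integral_inner_curl_of {ν : Measure R3}
    (I1 : ∀ i j k, Integrable (fun x => (starRingEnd ℂ) (u x i) * pd j (fun y => w y k) x) ν)
    (I2 : ∀ i j k, Integrable (fun x => (starRingEnd ℂ) (pd j (fun y => u y i) x) * w x k) ν)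
    (key : ∀ i j k, ∫ x, (starRingEnd ℂ) (u x i) * pd j (fun y => w y k) x ∂ν =
      -∫ x, (starRingEnd ℂ) (pd j (fun y => u y i) x) * w x k ∂ν) :
    ∫ x, inner ℂ (u x) (curl w x) ∂ν = ∫ x, inner ℂ (curl u x) (w x) ∂ν := by
  have e1 : (fun x => inner ℂ (u x) (curl w x)) = fun x =>
      ((starRingEnd ℂ) (u x 0) * pd 1 (fun y => w y 2) x -
        (starRingEnd ℂ) (u x 0) * pd 2 (fun y => w y 1) x) +
      ((starRingEnd ℂ) (u x 1) * pd 2 (fun y => w y 0) x -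
        (starRingEnd ℂ) (u x 1) * pd 0 (fun y => w y 2) x) +
      ((starRingEnd ℂ) (u x 2) * pd 0 (fun y => w y 1) x -
        (starRingEnd ℂ) (u x 2) * pd 1 (fun y => w y 0) x) := by
    ext1 x
    simp [PiLp.inner_apply, Fin.sum_univ_three, curl]; ring
  have e2 : (fun x => inner ℂ (curl u x) (w x)) = fun x =>
      ((starRingEnd ℂ) (pd 1 (fun y => u y 2) x) * w x 0 -
        (starRingEnd ℂ) (pd 2 (fun y => u y 1) x) * w x 0) +
      ((starRingEnd ℂ) (pd 2 (fun y => u y 0) x) * w x 1 -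
        (starRingEnd ℂ) (pd 0 (fun y => u y 2) x) * w x 1) +
      ((starRingEnd ℂ) (pd 0 (fun y => u y 1) x) * w x 2 -
        (starRingEnd ℂ) (pd 1 (fun y => u y 0) x) * w x 2) := by
    ext1 x
    simp [PiLp.inner_apply, Fin.sum_univ_three, curl]; ring
  rw [e1, e2, integral_sub_add_sub_add_sub (I1 _ _ _) (I1 _ _ _) (I1 _ _ _) (I1 _ _ _) (I1 _ _ _)
    (I1 _ _ _), integral_sub_add_sub_add_sub (I2 _ _ _) (I2 _ _ _) (I2 _ _ _) (I2 _ _ _)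
    (I2 _ _ _) (I2 _ _ _)]
  simp only [key]
  ring

lemma integral_inner_curl (hu : u ∈ testC) (hw : ContDiff ℝ ∞ w) :
    ∫ x, inner ℂ (u x) (curl w x) = ∫ x, inner ℂ (curl u x) (w x) := by
  have hu' : ∀ i, (fun x => u x i) ∈ testC (E := ℂ) := fun i =>
    ⟨contDiff_apply hu.1 i, hasCompactSupport_apply hu.2 i⟩
  have hw' := contDiff_apply hw
  have I1 : ∀ i j k, Integrable fun x => (starRingEnd ℂ) (u x i) * pd j (fun y => w y k) x :=
    fun i j k => Continuous.integrable_of_hasCompactSupport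
      ((Complex.continuous_conj.comp (hu' i).1.continuous).mul (contDiff_pd (hw' k) j).continuous)
      (HasCompactSupport.mul_right ((hu' i).2.comp_left (g := starRingEnd ℂ) (map_zero _)))
  have I2 : ∀ i j k, Integrable fun x => (starRingEnd ℂ) (pd j (fun y => u y i) x) * w x k :=
    fun i j k => Continuous.integrable_of_hasCompactSupport
      ((Complex.continuous_conj.comp (contDiff_pd (hu' i).1 j).continuous).mul (hw' k).continuous)
      (HasCompactSupport.mul_right
        ((hasCompactSupport_pd (hu' i).2 j).comp_left (g := starRingEnd ℂ) (map_zero _)))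
  exact integral_inner_curl_of I1 I2 fun i j k => integral_conj_mul_pd (hu' i) (hw' k) j

lemma integral_inner_curl_grad (hu : u ∈ testC) (hf : ContDiff ℝ ∞ f) :
    ∫ x, inner ℂ (curl u x) (grad f x) = 0 := by
  rw [← integral_inner_curl hu (contDiff_grad hf)]
  simp [curl_grad hf]

lemma integrable_conj_expi_smul {E : Type*} [NormedAddCommGroup E] [NormedSpace ℂ E] {k : R3 → E}
    (hk : Integrable k) (θ : R3) : Integrable fun x => (starRingEnd ℂ) (expi θ x) • k x := by
  have h : AEStronglyMeasurable (fun x => (starRingEnd ℂ) (expi θ x)) volume :=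
    (Complex.continuous_conj.comp (continuous_expi_right θ)).aestronglyMeasurable
  refine hk.norm.mono' (h.smul hk.1) (.of_forall fun x => ?_)
  rw [norm_smul, RCLike.norm_conj, norm_expi, one_mul]

lemma ft_apply {k : R3 → C3} (hk : Integrable k) (θ : R3) (i : Fin 3) :
    ft k θ i = ft (fun x => k x i) θ := by
  have hi := integrable_conj_expi_smul hk θ
  have h := (EuclideanSpace.proj (𝕜 := ℂ) i).integral_comp_comm hi
  rw [ft, ft, PiLp.smul_apply]
  congr 1
  exact h.symm

lemma fs_apply {k : R3 → C3} (hk : Integrable k) (x : R3) (i : Fin 3) :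
    fs k x i = fs (fun θ => k θ i) x := by
  rw [fs_eq_ft, fs_eq_ft, ft_apply hk]

lemma ft_pd (hf : f ∈ testC) (θ : R3) (j : Fin 3) : ft (pd j f) θ = Complex.I * θ j * ft f θ := by
  have h := ft_fderiv hf.1 hf.2 θ (EuclideanSpace.single j 1)
  simp only [EuclideanSpace.inner_single_right, smul_eq_mul] at h
  refine Eq.trans (by rfl) (h.trans ?_)
  simp

lemma ft_sub {k l : R3 → ℂ} (hk : Integrable k) (hl : Integrable l) (θ : R3) :
    ft (fun x => k x - l x) θ = ft k θ - ft l θ := by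
  simp_rw [ft, smul_sub]
  rw [integral_sub (integrable_conj_expi_smul hk θ) (integrable_conj_expi_smul hl θ), smul_sub]

lemma ft_curl (hu : u ∈ testC) (θ : R3) : ft (curl u) θ = mv (crossI θ) (ft u θ) := by
  have hu' : ∀ i, (fun x => u x i) ∈ testC (E := ℂ) := fun i =>
    ⟨contDiff_apply hu.1 i, hasCompactSupport_apply hu.2 i⟩
  have hi : ∀ i j, Integrable (pd j fun x => u x i) := fun i j =>
    (contDiff_pd (hu' i).1 j).continuous.integrable_of_hasCompactSupport
      (hasCompactSupport_pd (hu' i).2 j)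
  ext i
  rw [ft_apply (integrable_of_mem_testC (curl_mem_testC hu)), mv_apply]
  simp only [ft_apply (integrable_of_mem_testC hu)]
  fin_cases i <;>
  · simp only [curl]
    refine (ft_sub (hi _ _) (hi _ _) θ).trans ?_
    rw [ft_pd (hu' _), ft_pd (hu' _)]
    simp [Fin.sum_univ_three, crossI, cx]
    ring

lemma pd_fs {k : R3 → ℂ} {r : ℝ} (hk : Integrable k) (hr : ∀ θ, r ≤ ‖θ‖ → k θ = 0)
    (x : R3) (j : Fin 3) : pd j (fs k) x = fs (fun θ => Complex.I * θ j * k θ) x := by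
  rw [pd, fderiv_fs hk hr]
  simp [EuclideanSpace.inner_single_right]

lemma integrable_mul_coord {k : R3 → ℂ} {r : ℝ} (hk : Integrable k) (hr : ∀ θ, r ≤ ‖θ‖ → k θ = 0)
    (j : Fin 3) : Integrable fun θ : R3 => Complex.I * θ j * k θ := by
  refine (integrable_pow_mul hk hr 1).mono' (AEStronglyMeasurable.mul ?_ hk.1)
    (.of_forall fun θ => ?_)
  · exact (by fun_prop : Continuous fun θ : R3 => Complex.I * (θ j : ℂ)).aestronglyMeasurable
  · rw [norm_mul, norm_mul, Complex.norm_I, one_mul, pow_one, Complex.norm_real]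
    gcongr
    exact PiLp.norm_apply_le θ j

lemma fs_sub {k l : R3 → ℂ} (hk : Integrable k) (hl : Integrable l) (x : R3) :
    fs (fun θ => k θ - l θ) x = fs k x - fs l x := by
  rw [fs_eq_ft, fs_eq_ft, fs_eq_ft, ft_sub hk hl]

lemma integrable_apply {k : R3 → C3} (hk : Integrable k) (i : Fin 3) :
    Integrable fun x => k x i := (EuclideanSpace.proj (𝕜 := ℂ) i).integrable_comp hk

lemma curl_fs {k : R3 → C3} {r : ℝ} (hk : Integrable k) (hr : ∀ θ, r ≤ ‖θ‖ → k θ = 0) (x : R3)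
    (hk2 : Integrable fun θ => mv (crossI θ) (k θ)) :
    curl (fs k) x = fs (fun θ => mv (crossI θ) (k θ)) x := by
  have hr' : ∀ i, ∀ θ, r ≤ ‖θ‖ → k θ i = 0 := fun i θ h => by simp [hr θ h]
  have e : ∀ i, (fun y => fs k y i) = fs fun θ => k θ i := fun i => funext fun y => fs_apply hk y i
  have hj := fun i j => integrable_mul_coord (integrable_apply hk i) (hr' i) j
  ext i
  rw [fs_apply hk2]
  fin_cases i <;>
  · simp only [curl, e]
    simp only [Fin.zero_eta, Fin.mk_one, Fin.reduceFinMk, Matrix.cons_val]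
    rw [pd_fs (integrable_apply hk _) (hr' _), pd_fs (integrable_apply hk _) (hr' _),
      ← fs_sub (hj _ _) (hj _ _)]
    congr 1; ext1 θ
    simp [mv_apply, Fin.sum_univ_three, crossI, cx]
    ring

end
end

section
/-! ### Cutoff functions and approximation by compactly supported fields -/

/-- A smooth bump function, equal to one on the unit ball. -/
def bump : ContDiffBump (0 : R3) := ⟨1, 2, one_pos, one_lt_two⟩

/-- Cutoff functions at scale `n + 1`. -/
def cut (n : ℕ) : R3 → ℂ := rescale (n + 1) fun x => ((bump x : ℝ) : ℂ)

lemma contDiff_ofReal_bump : ContDiff ℝ ∞ fun x => ((bump x : ℝ) : ℂ) :=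
  Complex.ofRealCLM.contDiff.comp bump.contDiff

lemma hasCompactSupport_ofReal_bump : HasCompactSupport fun x => ((bump x : ℝ) : ℂ) :=
  bump.hasCompactSupport.comp_left (g := fun t : ℝ => (t : ℂ)) (by simp)

lemma contDiff_cut (n : ℕ) : ContDiff ℝ ∞ (cut n) := contDiff_rescale contDiff_ofReal_bump _

lemma hasCompactSupport_rescale {E : Type*} [Zero E] {v : R3 → E} (hv : HasCompactSupport v)
    {ε : ℝ} (hε : ε ≠ 0) : HasCompactSupport (rescale ε v) :=
  hv.comp_homeomorph (Homeomorph.smulOfNeZero ε⁻¹ (inv_ne_zero hε))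

lemma hasCompactSupport_cut (n : ℕ) : HasCompactSupport (cut n) :=
  hasCompactSupport_rescale hasCompactSupport_ofReal_bump (by positivity)

lemma norm_cut_le (n : ℕ) (x : R3) : ‖cut n x‖ ≤ 1 := by
  simp only [cut, rescale, Complex.norm_real, Real.norm_eq_abs, abs_of_nonneg bump.nonneg]
  exact bump.le_one

lemma norm_cut_sub_one_le (n : ℕ) (x : R3) : ‖cut n x - 1‖ ≤ 1 := by
  have h : cut n x - 1 = ((bump (((n : ℝ) + 1)⁻¹ • x) - 1 : ℝ) : ℂ) := by simp [cut, rescale]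
  rw [h, Complex.norm_real, Real.norm_eq_abs, abs_le]
  constructor <;> linarith [bump.nonneg (x := ((n : ℝ) + 1)⁻¹ • x),
    bump.le_one (x := ((n : ℝ) + 1)⁻¹ • x)]

lemma cut_eq_one {n : ℕ} {x : R3} (hx : x ∈ Metric.ball (0 : R3) n) : cut n x = 1 := by
  have h : ((n : ℝ) + 1)⁻¹ • x ∈ Metric.closedBall (0 : R3) bump.rIn := by
    have h1 : ‖x‖ < n := by simpa using hx
    have h2 : (0 : ℝ) < (n : ℝ) + 1 := by positivity
    rw [mem_closedBall_zero_iff, norm_smul, norm_inv, Real.norm_of_nonneg h2.le, inv_mul_le_iff₀ h2]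
    simp only [bump]; linarith
  simp [cut, rescale, bump.one_of_mem_closedBall h]

lemma exists_norm_grad_cut_le :
    ∃ K : ℝ, 0 ≤ K ∧ ∀ n x, ‖grad (cut n) x‖ ≤ K / ((n : ℝ) + 1) := by
  have hc : Continuous (grad fun x => ((bump x : ℝ) : ℂ)) :=
    (contDiff_grad contDiff_ofReal_bump).continuous
  have hs : HasCompactSupport (grad fun x => ((bump x : ℝ) : ℂ)) :=
    hasCompactSupport_toLp fun j => hasCompactSupport_pd hasCompactSupport_ofReal_bump j
  obtain ⟨K, hK⟩ := hs.exists_bound_of_continuous hc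
  have hK0 : 0 ≤ K := (norm_nonneg _).trans (hK 0)
  refine ⟨K, hK0, fun n x => ?_⟩
  have hn : (0 : ℝ) < (n : ℝ) + 1 := by positivity
  rw [cut, grad_rescale (contDiff_ofReal_bump.differentiable (by simp)), norm_smul,
    Complex.norm_real, norm_inv, Real.norm_of_nonneg hn.le, inv_mul_eq_div]
  exact div_le_div_of_nonneg_right (hK _) hn.le

lemma memLp_mul_of_bound {E : Type*} [NormedAddCommGroup E] [NormedSpace ℂ E] {c : R3 → ℂ}
    {u : R3 → E} (hc : Continuous c) {K : ℝ} (hK : ∀ x, ‖c x‖ ≤ K) (hu : MemLp u 2 volume) :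
    MemLp (fun x => c x • u x) 2 volume := by
  refine (hu.norm.const_mul K).mono' (hc.aestronglyMeasurable.smul hu.1) (.of_forall fun x => ?_)
  rw [norm_smul]
  gcongr
  exact hK x

lemma tendsto_l2_cut {E : Type*} [NormedAddCommGroup E] [InnerProductSpace ℂ E] [CompleteSpace E]
    {u : R3 → E} (hu : MemLp u 2 volume) :
    Tendsto (fun n => l2 volume fun x => cut n x • u x - u x) atTop (𝓝 0) := by
  refine squeeze_zero (fun n => l2_nonneg _) (fun n => ?_) (tendsto_l2_indicator_ball hu)
  have h := l2_mono (ν := volume) (f := fun x => cut n x • u x - u x) zero_le_one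
    ((MemLp.indicator_ball hu n).1.sub hu) (.of_forall fun x => ?_)
  · rwa [one_mul] at h
  · have e : cut n x • u x - u x = (cut n x - 1) • u x := by rw [sub_smul, one_smul]
    rw [one_mul, e, Pi.sub_apply]
    by_cases hx : x ∈ Metric.ball (0 : R3) n
    · simp [cut_eq_one hx]
    · rw [Set.indicator_of_notMem hx, zero_sub, norm_neg, norm_smul]
      exact mul_le_of_le_one_left (norm_nonneg _) (norm_cut_sub_one_le n x)

lemma tendsto_const_div_nat (c : ℝ) : Tendsto (fun n : ℕ => c / ((n : ℝ) + 1)) atTop (𝓝 0) := by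
  simpa [div_eq_mul_inv, one_div] using tendsto_one_div_add_atTop_nhds_zero_nat.const_mul c

lemma aestronglyMeasurable_crs {α : Type*} [MeasurableSpace α] {ν : Measure α} {f g : α → C3}
    (hf : AEStronglyMeasurable f ν) (hg : AEStronglyMeasurable g ν) :
    AEStronglyMeasurable (fun x => crs (f x) (g x)) ν := by
  have h : ∀ i j, AEStronglyMeasurable (fun x => f x i * g x j) ν := fun i j =>
    (aestronglyMeasurable_apply hf i).mul (aestronglyMeasurable_apply hg j)
  refine aestronglyMeasurable_toLp fun i => ?_
  fin_cases i
  · exact (h 1 2).sub (h 2 1)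
  · exact (h 2 0).sub (h 0 2)
  · exact (h 0 1).sub (h 1 0)

/-- The curl commutes with the cutoff up to `∇(cut n) × u`, and `∇(cut n)` is uniformly `O(1/n)`. -/
lemma tendsto_l2_curl_cut {u : R3 → C3} (hs : ContDiff ℝ ∞ u) (hu : MemLp u 2 volume)
    (hc : MemLp (curl u) 2 volume) :
    Tendsto (fun n => l2 volume fun x => curl (fun y => cut n y • u y) x - curl u x)
      atTop (𝓝 0) := by
  obtain ⟨K, hK0, hK⟩ := exists_norm_grad_cut_le
  have hlim := (tendsto_l2_cut hc).add (tendsto_const_div_nat (6 * K * l2 volume u))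
  rw [add_zero] at hlim
  refine squeeze_zero (fun n => l2_nonneg _) (fun n => ?_) hlim
  have e : (fun x => curl (fun y => cut n y • u y) x - curl u x) = fun x =>
      (cut n x • curl u x - curl u x) + crs (grad (cut n) x) (u x) := by
    ext1 x
    rw [curl_smul ((contDiff_cut n).differentiable (by simp)) (hs.differentiable (by simp))]
    abel
  have hb : ∀ᵐ x, ‖crs (grad (cut n) x) (u x)‖ ≤ 6 * (K / ((n : ℝ) + 1)) * ‖u x‖ :=
    .of_forall fun x => (norm_crs_le _ _).trans (by rw [mul_assoc]; gcongr; exact hK n x)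
  have hm : MemLp (fun x => crs (grad (cut n) x) (u x)) 2 volume := by
    refine (hu.norm.const_mul (6 * (K / ((n : ℝ) + 1)))).mono' ?_ hb
    exact aestronglyMeasurable_crs
      (contDiff_grad (contDiff_cut n)).continuous.aestronglyMeasurable hu.1
  rw [e]
  refine (l2_add_le ((memLp_mul_of_bound (contDiff_cut n).continuous (norm_cut_le n) hc).sub hc)
    hm).trans (add_le_add le_rfl ?_)
  refine (l2_mono (by positivity) hu hb).trans (le_of_eq ?_)
  ring

lemma tendsto_l2_grad_cut {f : R3 → ℂ} (hs : ContDiff ℝ ∞ f) (hf : MemLp f 2 volume)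
    (hg : MemLp (grad f) 2 volume) :
    Tendsto (fun n => l2 volume fun x => grad (fun y => cut n y * f y) x - grad f x)
      atTop (𝓝 0) := by
  obtain ⟨K, hK0, hK⟩ := exists_norm_grad_cut_le
  have hlim := (tendsto_l2_cut hg).add (tendsto_const_div_nat (K * l2 volume f))
  rw [add_zero] at hlim
  refine squeeze_zero (fun n => l2_nonneg _) (fun n => ?_) hlim
  have e : (fun x => grad (fun y => cut n y * f y) x - grad f x) = fun x =>
      (cut n x • grad f x - grad f x) + f x • grad (cut n) x := by
    ext1 x
    rw [grad_mul ((contDiff_cut n).differentiable (by simp)) (hs.differentiable (by simp))]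
    abel
  have hb : ∀ᵐ x, ‖f x • grad (cut n) x‖ ≤ K / ((n : ℝ) + 1) * ‖f x‖ :=
    .of_forall fun x => by rw [norm_smul, mul_comm]; gcongr; exact hK n x
  have hm : MemLp (fun x => f x • grad (cut n) x) 2 volume := by
    refine (hf.norm.const_mul (K / ((n : ℝ) + 1))).mono' ?_ hb
    exact hf.1.smul (contDiff_grad (contDiff_cut n)).continuous.aestronglyMeasurable
  rw [e]
  refine (l2_add_le ((memLp_mul_of_bound (contDiff_cut n).continuous (norm_cut_le n) hg).sub hg)
    hm).trans (add_le_add le_rfl ?_)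
  refine (l2_mono (by positivity) hf hb).trans (le_of_eq ?_)
  ring

lemma cut_smul_mem_testC {E : Type*} [NormedAddCommGroup E] [NormedSpace ℂ E] {u : R3 → E}
    (hs : ContDiff ℝ ∞ u) (n : ℕ) : (fun x => cut n x • u x) ∈ testC (E := E) :=
  ⟨(contDiff_cut n).smul hs, (hasCompactSupport_cut n).smul_right⟩

/-! ### Elements of the curl space -/

lemma isElliptic_rescale {A : R3 → RMat} (hA : IsElliptic A) (ε : ℝ) : IsElliptic (rescale ε A) :=
  ⟨fun x => hA.1 _, by obtain ⟨α, β, h, h'⟩ := hA.2; exact ⟨α, β, h, fun x => h' _⟩⟩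

lemma measurable_rescale {A : R3 → RMat} (hA : ∀ i j, Measurable fun x => A x i j) (ε : ℝ)
    (i j : Fin 3) : Measurable fun x => rescale ε A x i j :=
  (hA i j).comp (measurable_const_smul ε⁻¹)

/-- A smooth square integrable field with square integrable curl belongs to the curl space. -/
lemma isCurlPair_of_contDiff {A : R3 → RMat} (hA : IsElliptic A)
    (hm : ∀ i j, Measurable fun x => A x i j) {u : R3 → C3} (hs : ContDiff ℝ ∞ u)
    (hu : MemLp u 2 volume) (hc : MemLp (curl u) 2 volume) :
    IsCurlPair volume testC (sqrtM A) (invSqrt A u) (curl u) := by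
  obtain ⟨K, hK0, -, hK⟩ := norm_sqrtM_le hA
  have e : ∀ n, (fun x => mv (cx (sqrtM A x)) (invSqrt A (fun y => cut n y • u y) x)) =
      fun x => cut n x • u x := fun n => funext fun x => mv_sqrtM_invSqrt hA _ x
  have hcut := fun n => memLp_mul_of_bound (contDiff_cut n).continuous (norm_cut_le n) hu
  refine ⟨memLp_invSqrt hA hm hu, hc, fun n => invSqrt A fun y => cut n y • u y,
    fun n => ?_, ?_, ?_⟩
  · rw [e n]; exact cut_smul_mem_testC hs n
  · refine tendsto_eLpNorm_of_l2
      (fun n => (memLp_invSqrt hA hm (hcut n)).sub (memLp_invSqrt hA hm hu)) ?_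
    have hlim := (tendsto_l2_cut hu).const_mul K
    rw [mul_zero] at hlim
    refine squeeze_zero (fun n => l2_nonneg _) (fun n => l2_mono hK0.le ((hcut n).sub hu)
      (.of_forall fun x => ?_)) hlim
    simp only [invSqrt, ← mv_sub, Pi.sub_apply]
    exact hK _ _
  · simp only [e]
    exact tendsto_eLpNorm_of_l2 (fun n => (memLp_of_mem_testC (curl_mem_testC
      (cut_smul_mem_testC hs n))).sub hc) (tendsto_l2_curl_cut hs hu hc)

/-- Approximants of an element of the curl space. -/
lemma IsCurlPair.exists_approx {A : R3 → RMat} (hA : IsElliptic A) {ν : Measure R3} {T : Set (R3 → C3)} {u v : R3 → C3} (h : IsCurlPair ν T (sqrtM A) u v) :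
    ∃ w : ℕ → R3 → C3, (∀ n, w n ∈ T) ∧
      Tendsto (fun n => eLpNorm (fun x => w n x - mv (cx (sqrtM A x)) (u x)) 2 ν) atTop (𝓝 0) ∧
      Tendsto (fun n => eLpNorm (fun x => curl (w n) x - v x) 2 ν) atTop (𝓝 0) := by
  obtain ⟨hu, hv, φ, h1, h2, h3⟩ := h
  obtain ⟨K, hK0, hK, -⟩ := norm_sqrtM_le hA
  refine ⟨fun n x => mv (cx (sqrtM A x)) (φ n x), h1, ?_, h3⟩
  have hlim := ENNReal.Tendsto.const_mul (a := ENNReal.ofReal K) h2 (Or.inr ENNReal.ofReal_ne_top)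
  rw [mul_zero] at hlim
  refine tendsto_of_tendsto_of_tendsto_of_le_of_le tendsto_const_nhds hlim (fun n => zero_le)
    fun n => ?_
  refine eLpNorm_le_mul_eLpNorm_of_ae_le_mul (.of_forall fun x => ?_) 2
  rw [← mv_sub]
  exact hK _ _

/-! ### Divergence-free fields -/

/-- For `g` truncated to a ball both functions are integrable and this is Fubini's theorem. Both
sides are continuous in `g` for the `L²` norm, which removes the truncation. -/
lemma integral_inner_fs_planch {E : Type*} [NormedAddCommGroup E] [InnerProductSpace ℂ E]
    [CompleteSpace E] {g k : R3 → E} (hg : MemLp g 2 volume) (h1 : Integrable k)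
    (h2 : MemLp k 2 volume) :
    ∫ x, inner ℂ (fs k x) (g x) = ∫ θ, inner ℂ (k θ) (planch hg.toLp θ) := by
  have hgn := fun n : ℕ => MemLp.indicator_ball hg (n : ℝ)
  have hA := tendsto_integral_inner_right (𝕜 := ℂ) (.of_forall fun n => (hgn n).1) hg
    (memLp_fs h1 h2) (tendsto_eLpNorm_of_l2 (fun n => (hgn n).1.sub hg)
      (tendsto_l2_indicator_ball hg))
  have hB := tendsto_integral_inner_right (𝕜 := ℂ)
    (.of_forall fun n => memLp_ft (hgn n).2 (hgn n).1) (memLp_planch hg.toLp) h2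
    (tendsto_ft_ball hg)
  refine tendsto_nhds_unique hA (hB.congr fun n => ?_)
  rw [integral_inner_conj, ← integral_inner_fs (hgn n).2 h1, ← integral_inner_conj]

/-- In frequency `div g = 0` says `θ · ĝ(θ) = 0`. It is obtained by testing with the gradient of the
synthesis of an arbitrary smooth compactly supported `k`, whose symbol is `iθ k(θ)`; this synthesis
is not compactly supported, so it enters as the limit of its cutoffs. -/
lemma sum_mul_planch_eq_zero {g : R3 → C3} (hg : MemLp g 2 volume) (hd : IsDivFree volume g) :
    ∀ᵐ θ, ∑ j, (θ j : ℂ) * planch hg.toLp θ j = 0 := by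
  have hloc : LocallyIntegrable (fun θ : R3 => ∑ j, (θ j : ℂ) * planch hg.toLp θ j) := by
    rw [locallyIntegrable_iff]
    intro k hk
    refine integrable_finsetSum _ fun j _ => ?_
    refine IntegrableOn.continuousOn_mul (by fun_prop) ?_ hk
    exact ((memLp_apply (memLp_planch hg.toLp) j).locallyIntegrable
      (by norm_num)).integrableOn_isCompact hk
  refine ae_eq_zero_of_integral_contDiff_smul_eq_zero hloc fun k hk hkc => ?_
  set kc : R3 → ℂ := fun θ => ((k θ : ℝ) : ℂ) with hkc_def
  have hkT : kc ∈ testC (E := ℂ) := ⟨Complex.ofRealCLM.contDiff.comp hk,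
    hkc.comp_left (g := fun t : ℝ => (t : ℂ)) (by simp)⟩
  obtain ⟨r, hr⟩ := hkT.2.isCompact.isBounded.subset_ball (0 : R3)
  have hr' : ∀ θ, r ≤ ‖θ‖ → kc θ = 0 := fun θ hθ => by
    by_contra h
    have := hr (subset_tsupport kc h)
    rw [mem_ball_zero_iff] at this
    linarith
  have hki := integrable_of_mem_testC hkT
  set K : R3 → C3 := fun θ => WithLp.toLp 2 fun j => Complex.I * θ j * kc θ with hK
  have hKT : K ∈ testC (E := C3) := by
    refine ⟨contDiff_toLp fun j => ContDiff.mul ?_ hkT.1, hasCompactSupport_toLp fun j => ?_⟩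
    · have h : ContDiff ℝ ∞ fun θ : R3 => θ j :=
        (EuclideanSpace.proj j : R3 →L[ℝ] ℝ).contDiff
      exact contDiff_const.mul (Complex.ofRealCLM.contDiff.comp h)
    · exact hkT.2.mul_left
  have hKi := integrable_of_mem_testC hKT
  have hK2 := memLp_of_mem_testC hKT
  have hgrad : grad (fs kc) = fs K := by
    ext x j
    rw [grad_apply, pd_fs hki hr', fs_apply hKi]
  have hfs := contDiff_fs hki hr'
  have hf2 := memLp_fs hki (memLp_of_mem_testC hkT)
  have hg2 : MemLp (grad (fs kc)) 2 volume := by rw [hgrad]; exact memLp_fs hKi hK2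
  have hcm : ∀ n, MemLp (grad fun y => cut n y * fs kc y) 2 volume := fun n =>
    (contDiff_grad (cut_smul_mem_testC hfs n).1).continuous.memLp_of_hasCompactSupport
      (hasCompactSupport_toLp fun j => hasCompactSupport_pd (cut_smul_mem_testC hfs n).2 j)
  have hlim := tendsto_integral_inner_left (𝕜 := ℂ) (.of_forall hcm) hg2 hg
    (tendsto_eLpNorm_of_l2 (fun n => (hcm n).sub hg2) (tendsto_l2_grad_cut hfs hf2 hg2))
  have h0 : ∫ x, inner ℂ (grad (fs kc) x) (g x) = 0 :=
    tendsto_nhds_unique hlim (tendsto_const_nhds.congr fun n =>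
      (hd _ (cut_smul_mem_testC hfs n)).symm)
  rw [hgrad, integral_inner_fs_planch hg hKi hK2] at h0
  have e : ∀ θ, inner ℂ (K θ) (planch hg.toLp θ) =
      -Complex.I * (k θ • ∑ j, (θ j : ℂ) * planch hg.toLp θ j) := fun θ => by
    simp [hK, hkc_def, PiLp.inner_apply, Fin.sum_univ_three]
    ring
  simp only [e, integral_const_mul] at h0
  simpa using h0

/-! ### The measure -/

lemma scaledMeasure_volume {ε : ℝ} (hε : 0 < ε) : scaledMeasure volume ε = volume := by
  rw [scaledMeasure, Measure.map_addHaar_smul _ hε.ne', smul_smul]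
  simp only [finrank_euclideanSpace, Fintype.card_fin]
  rw [abs_of_pos (by positivity), ← ENNReal.ofReal_mul (by positivity),
    mul_inv_cancel₀ (by positivity), ENNReal.ofReal_one, one_smul]

/-! ### Periodic smooth functions -/

section
variable {f : R3 → ℂ} {u : R3 → C3}

lemma pd_periodic (hf : IsQPeriodic f) (j : Fin 3) : IsQPeriodic (pd j f) := by
  intro x n
  have h : (fun y => f (y + WithLp.toLp 2 fun i => (n i : ℝ))) = f := funext fun y => hf y n
  rw [pd, pd, ← fderiv_comp_add_right, h]

lemma grad_mem_testP (hf : f ∈ testP) : grad f ∈ testP (E := C3) :=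
  ⟨contDiff_grad hf.1, fun x n => by ext j; exact pd_periodic hf.2 j x n⟩

lemma apply_mem_testP (hu : u ∈ testP) (i : Fin 3) : (fun x => u x i) ∈ testP (E := ℂ) :=
  ⟨contDiff_apply hu.1 i, fun x n => by simp only [hu.2 x n]⟩

lemma pd_mem_testP (hf : f ∈ testP) (j : Fin 3) : pd j f ∈ testP (E := ℂ) :=
  ⟨contDiff_pd hf.1 j, pd_periodic hf.2 j⟩

lemma curl_mem_testP (hu : u ∈ testP) : curl u ∈ testP (E := C3) := by
  refine ⟨contDiff_curl hu.1, fun x n => ?_⟩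
  have h := fun i j => pd_periodic (apply_mem_testP hu i).2 j x n
  simp only [curl, h]

lemma exists_bound_of_mem_testP {E : Type*} [NormedAddCommGroup E] [NormedSpace ℝ E]
    {v : R3 → E} (hv : v ∈ testP) : ∃ K : ℝ, 0 ≤ K ∧ ∀ x, ‖v x‖ ≤ K := by
  -- Subtracting the integer parts moves every point into the unit cell, whose points have norm at
  -- most `√3 < 3`.
  obtain ⟨K, hK⟩ := (isCompact_closedBall (0 : R3) 3).exists_bound_of_continuousOn
    hv.1.continuous.continuousOn
  have h0 : 0 ≤ K := (norm_nonneg _).trans (hK 0 (by simp))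
  refine ⟨K, h0, fun x => ?_⟩
  have h := hv.2 x fun i => -⌊x i⌋
  rw [← h]
  refine hK _ ?_
  rw [mem_closedBall_zero_iff, EuclideanSpace.norm_eq]
  have hb : ∀ i : Fin 3, ‖(x + WithLp.toLp 2 fun i => ((-⌊x i⌋ : ℤ) : ℝ) : R3) i‖ ^ 2 ≤ 1 := by
    intro i
    have : (x + WithLp.toLp 2 fun i => ((-⌊x i⌋ : ℤ) : ℝ) : R3) i = Int.fract (x i) := by
      simp [Int.fract, sub_eq_add_neg]
    rw [this, Real.norm_of_nonneg (Int.fract_nonneg _)]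
    nlinarith [Int.fract_nonneg (x i), Int.fract_lt_one (x i)]
  rw [Real.sqrt_le_left (by norm_num)]
  refine (Finset.sum_le_sum fun i _ => hb i).trans (by norm_num)

lemma memLp_of_mem_testP {E : Type*} [NormedAddCommGroup E] [NormedSpace ℝ E]
    {v : R3 → E} (hv : v ∈ testP) : MemLp v 2 volQ := by
  obtain ⟨K, -, hK⟩ := exists_bound_of_mem_testP hv
  exact MemLp.of_bound hv.1.continuous.aestronglyMeasurable K (.of_forall hK)

end
end

section
/-! ### Rescaled periodic functions times band-limited functions -/

lemma lintegral_comp_smul {ε : ℝ} (hε : 0 < ε) (f : R3 → ENNReal) :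
    ∫⁻ x, f x = ENNReal.ofReal (ε ^ 3) * ∫⁻ y, f (ε • y) := by
  have h := (Homeomorph.smulOfNeZero ε hε.ne' : R3 ≃ₜ R3).toMeasurableEquiv.measurableEmbedding
  conv_lhs => rw [← scaledMeasure_volume hε, scaledMeasure, lintegral_smul_measure]
  rw [smul_eq_mul]
  congr 1
  exact h.lintegral_map f

lemma integral_comp_smul_sub {E : Type*} [NormedAddCommGroup E] [NormedSpace ℝ E] {c : ℝ}
    (hc : 0 < c) (s₀ : R3) (f : R3 → E) :
    ∫ θ, f θ = c ^ 3 • ∫ s, f (c • (s - s₀)) := by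
  rw [integral_sub_right_eq_self (fun s => f (c • s)), Measure.integral_comp_smul]
  simp only [finrank_euclideanSpace, Fintype.card_fin]
  rw [abs_of_pos (by positivity), smul_smul, mul_inv_cancel₀ (by positivity), one_smul]

lemma measurePreserving_sub_ivec (n : Fin 3 → ℤ) :
    MeasurePreserving (fun x => x - ivec n) (volume.restrict (cellT n)) volQ :=
  (measurePreserving_sub_right volume (ivec n)).restrict_preimage measurableSet_cellQ

/-- Periodic functions that are measurable on the cell are measurable. -/
lemma IsQPeriodic.aestronglyMeasurable {E : Type*} [TopologicalSpace E]
    [TopologicalSpace.PseudoMetrizableSpace E] {w : R3 → E} (hp : IsQPeriodic w)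
    (hw : AEStronglyMeasurable w volQ) : AEStronglyMeasurable w volume := by
  rw [← Measure.restrict_univ (μ := volume), ← iUnion_cellT, aestronglyMeasurable_iUnion_iff]
  intro n
  have h := hw.comp_measurePreserving (measurePreserving_sub_ivec n)
  have e : (w ∘ fun x => x - ivec n) = w := by
    ext x
    have := hp (x - ivec n) n
    change w (x - ivec n + ivec n) = _ at this
    rw [sub_add_cancel] at this
    exact this.symm
  rwa [e] at h

lemma aestronglyMeasurable_rescale {E : Type*} [TopologicalSpace E]
    [TopologicalSpace.PseudoMetrizableSpace E] {w : R3 → E} (hw : AEStronglyMeasurable w volume)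
    {ε : ℝ} (hε : 0 < ε) : AEStronglyMeasurable (rescale ε w) volume := by
  have h := (Homeomorph.smulOfNeZero ε⁻¹ (inv_ne_zero hε.ne') :
    R3 ≃ₜ R3).toMeasurableEquiv.measurableEmbedding
  have e : volume.map (fun x : R3 => ε⁻¹ • x) = ENNReal.ofReal (ε ^ 3) • volume := by
    rw [Measure.map_addHaar_smul _ (inv_ne_zero hε.ne')]
    simp only [finrank_euclideanSpace, Fintype.card_fin]
    rw [inv_pow, inv_inv, abs_of_pos (by positivity)]
  have h2 : AEStronglyMeasurable w (volume.map (fun x : R3 => ε⁻¹ • x)) := by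
    rw [e]; exact hw.smul_measure _
  exact (h.aestronglyMeasurable_map_iff).1 h2

/-- The centre of the cell. -/
def midQ : R3 := WithLp.toLp 2 fun _ => 1 / 2

lemma mem_cellQ_of_norm_lt {s : R3} (hs : ‖s - midQ‖ < 1 / 2) : s ∈ cellQ := by
  intro i
  have h := (PiLp.norm_apply_le (s - midQ) i).trans_lt hs
  simp only [PiLp.sub_apply, midQ, Real.norm_eq_abs] at h
  rw [abs_lt] at h
  constructor <;> linarith

section
variable {ε : ℝ} {k : R3 → ℂ}

/-- The change of variables `θ = (2π/ε)(s - midQ)` maps the ball of radius `1/ε` to a ball of radius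
`1/(2π) < 1/2` about the centre of the cell. The rescaled amplitude is therefore supported inside
one cell, without overlaps between translates. -/
lemma eq_zero_of_notMem_cellQ (hε : 0 < ε) (hs : ∀ θ, ε⁻¹ ≤ ‖θ‖ → k θ = 0) {s : R3}
    (h : s ∉ cellQ) : k ((2 * Real.pi / ε) • (s - midQ)) = 0 := by
  refine hs _ ?_
  have h1 : 1 / 2 ≤ ‖s - midQ‖ := by
    by_contra hc
    exact h (mem_cellQ_of_norm_lt (not_le.1 hc))
  have h2 := Real.pi_gt_three
  rw [norm_smul, Real.norm_of_nonneg (by positivity), div_mul_eq_mul_div, inv_eq_one_div]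
  gcongr
  nlinarith

/-- In the variable `s` the exponential at the lattice point `ε(y + n)` is `e^{2πi n·s}` times a
factor depending on `y` and a constant phase. The sample is therefore, up to a phase and the
Jacobian, the Fourier coefficient of index `-n` of a function on the unit cell. -/
lemma fs_scaled_eq (hε : 0 < ε) (hs : ∀ θ, ε⁻¹ ≤ ‖θ‖ → k θ = 0) (y : R3) (n : Fin 3 → ℤ) :
    ‖fs k (ε • (y + ivec n))‖ = ‖fnc‖ * (2 * Real.pi / ε) ^ 3 *
      ‖fcoef (fun s => expi ((2 * Real.pi) • (s - midQ)) y * k ((2 * Real.pi / ε) • (s - midQ)))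
        (-n)‖ := by
  have hc : (0 : ℝ) < 2 * Real.pi / ε := by positivity
  have e : ∀ s, expi ((2 * Real.pi / ε) • (s - midQ)) (ε • (y + ivec n)) =
      expi ((2 * Real.pi) • (-midQ)) (ivec n) * ((starRingEnd ℂ) (expi (dvec (-n)) s) *
        expi ((2 * Real.pi) • (s - midQ)) y) := by
    intro s
    have h1 : (starRingEnd ℂ) (expi (dvec (-n)) s) = expi ((2 * Real.pi) • s) (ivec n) := by
      rw [← expi_neg_left, expi, expi]
      congr 3
      simp only [inner, dvec, ivec, Fin.sum_univ_three]
      simp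
      ring
    have h2 : expi ((2 * Real.pi / ε) • (s - midQ)) (ε • (y + ivec n)) =
        expi ((2 * Real.pi) • (s - midQ)) (y + ivec n) := by
      rw [expi, expi, inner_smul_left, inner_smul_right, inner_smul_left]
      congr 3
      simp only [conj_trivial]
      field_simp
    rw [h2, h1, expi_add_right, sub_eq_add_neg, smul_add, expi_add_left _ _ (ivec n)]
    ring
  have hset : ∫ s, (starRingEnd ℂ) (expi (dvec (-n)) s) *
      (expi ((2 * Real.pi) • (s - midQ)) y * k ((2 * Real.pi / ε) • (s - midQ))) =
      fcoef (fun s => expi ((2 * Real.pi) • (s - midQ)) y * k ((2 * Real.pi / ε) • (s - midQ)))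
        (-n) := by
    rw [fcoef, setIntegral_eq_integral_of_forall_compl_eq_zero]
    intro s h
    rw [eq_zero_of_notMem_cellQ hε hs h, mul_zero, mul_zero]
  rw [fs, integral_comp_smul_sub hc midQ]
  simp only [e, smul_eq_mul, mul_assoc]
  rw [integral_const_mul, hset, norm_mul, norm_smul, norm_mul, norm_expi,
    Real.norm_of_nonneg (by positivity), one_mul]

lemma memLp_scaled_cell (hε : 0 < ε) (hk : MemLp k 2 volume) (y : R3) :
    MemLp (fun s => expi ((2 * Real.pi) • (s - midQ)) y * k ((2 * Real.pi / ε) • (s - midQ)))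
      2 volQ := by
  have hc : (0 : ℝ) < ε / (2 * Real.pi) := by positivity
  have hk1 : AEStronglyMeasurable (fun s => k ((2 * Real.pi / ε) • (s - midQ))) volume := by
    have h := aestronglyMeasurable_rescale hk.1 hc
    have h2 := h.comp_measurePreserving (measurePreserving_sub_right volume midQ)
    refine h2.congr (.of_forall fun s => ?_)
    simp [rescale]
  have hk2 : MemLp (fun s => k ((2 * Real.pi / ε) • (s - midQ))) 2 volume := by
    refine ⟨hk1, ?_⟩
    have h := hk.2
    rw [eLpNorm_lt_top_iff_lintegral_rpow_enorm_lt_top two_ne_zero ENNReal.ofNat_ne_top] at h ⊢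
    have hc' : (0 : ℝ) < 2 * Real.pi / ε := by positivity
    rw [lintegral_comp_smul hc' (fun x => ‖k x‖ₑ ^ (2 : ENNReal).toReal)] at h
    rw [lintegral_sub_right_eq_self fun s => ‖k ((2 * Real.pi / ε) • s)‖ₑ ^ (2 : ENNReal).toReal]
    exact ENNReal.lt_top_of_mul_ne_top_right h.ne
      (by rw [Ne, ENNReal.ofReal_eq_zero, not_le]; positivity)
  have hcont : Continuous fun s => expi ((2 * Real.pi) • (s - midQ)) y := by
    simp only [expi]; fun_prop
  exact (memLp_mul_of_bound hcont (fun s => (norm_expi _ _).le) hk2).restrict _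

/-- Parseval on the cell, applied to the coefficients of the preceding lemma. The factor depending
on `y` is unimodular, so the sum of squares over the shifted lattice does not depend on `y`; this is
what makes products with oscillating functions tractable. -/
lemma tsum_norm_sq_fs (hε : 0 < ε) (hk : MemLp k 2 volume) (hs : ∀ θ, ε⁻¹ ≤ ‖θ‖ → k θ = 0)
    (y : R3) : ENNReal.ofReal (ε ^ 3) * ∑' n : Fin 3 → ℤ, ENNReal.ofReal
      (‖fs k (ε • (y + ivec n))‖ ^ 2) = ENNReal.ofReal (l2 volume k ^ 2) := by
  set K : R3 → ℂ :=
    fun s => expi ((2 * Real.pi) • (s - midQ)) y * k ((2 * Real.pi / ε) • (s - midQ)) with hK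
  have hKm : MemLp K 2 volQ := memLp_scaled_cell hε hk y
  have hc : (0 : ℝ) < 2 * Real.pi / ε := by positivity
  have hsum := ((Equiv.neg (Fin 3 → ℤ)).hasSum_iff (f := fun m => ‖fcoef K m‖ ^ 2)).2
    (hasSum_sq_fcoef hKm)
  have hsum2 := hsum.mul_left ((‖fnc‖ * (2 * Real.pi / ε) ^ 3) ^ 2)
  have e : (fun n => (‖fnc‖ * (2 * Real.pi / ε) ^ 3) ^ 2 *
      (((fun m => ‖fcoef K m‖ ^ 2) ∘ ⇑(Equiv.neg (Fin 3 → ℤ))) n)) =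
      fun n => ‖fs k (ε • (y + ivec n))‖ ^ 2 := by
    ext n
    rw [fs_scaled_eq hε hs, mul_pow _ ‖_‖]
    rfl
  have hl : l2 volQ K ^ 2 * (2 * Real.pi / ε) ^ 3 = l2 volume k ^ 2 := by
    rw [l2_sq hKm, l2_sq hk, integral_comp_smul_sub hc midQ, smul_eq_mul, mul_comm,
      setIntegral_eq_integral_of_forall_compl_eq_zero]
    · simp only [hK, norm_mul, norm_expi, one_mul]
    · intro s h
      simp [hK, eq_zero_of_notMem_cellQ hε hs h]
  rw [e] at hsum2
  rw [← ENNReal.ofReal_tsum_of_nonneg (fun n => by positivity) hsum2.summable, hsum2.tsum_eq,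
    ← ENNReal.ofReal_mul (by positivity)]
  congr 1
  rw [← hl]
  have h1 := norm_fnc_sq
  have h2 : ‖fnc‖ ^ 2 * (2 * Real.pi / ε) ^ 3 * ε ^ 3 = 1 := by
    rw [div_pow, ← h1]; field_simp
  linear_combination (l2 volQ K ^ 2 * (2 * Real.pi / ε) ^ 3) * h2

lemma ofReal_l2_sq {α E : Type*} [MeasurableSpace α] [NormedAddCommGroup E] {ν : Measure α}
    {f : α → E} (hf : MemLp f 2 ν) :
    ENNReal.ofReal (l2 ν f ^ 2) = ∫⁻ x, ENNReal.ofReal (‖f x‖ ^ 2) ∂ν := by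
  rw [l2_sq hf, ofReal_integral_eq_lintegral_ofReal (integrable_norm_sq hf)
    (.of_forall fun x => by positivity)]

lemma memLp_two_of_lintegral {α E : Type*} [MeasurableSpace α] [NormedAddCommGroup E]
    {ν : Measure α} {f : α → E} (hf : AEStronglyMeasurable f ν) {K : ℝ}
    (h : ∫⁻ x, ENNReal.ofReal (‖f x‖ ^ 2) ∂ν ≤ ENNReal.ofReal (K ^ 2)) (hK : 0 ≤ K) :
    MemLp f 2 ν ∧ l2 ν f ≤ K := by
  have h1 : MemLp f 2 ν := by
    refine ⟨hf, ?_⟩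
    rw [eLpNorm_lt_top_iff_lintegral_rpow_enorm_lt_top two_ne_zero ENNReal.ofNat_ne_top]
    refine lt_of_le_of_lt (le_of_eq (lintegral_congr fun x => ?_))
      (h.trans_lt ENNReal.ofReal_lt_top)
    rw [ENNReal.toReal_ofNat, ENNReal.ofReal_pow (norm_nonneg _), ofReal_norm,
      ENNReal.rpow_ofNat]
  refine ⟨h1, ?_⟩
  rw [← ofReal_l2_sq h1, ENNReal.ofReal_le_ofReal_iff (by positivity)] at h
  exact le_of_sq_le_sq h hK

/-- A rescaled periodic function times a function whose Fourier transform is supported in the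
ball of radius `1/ε` is square integrable. -/
lemma l2_fs_smul_rescale {E : Type*} [NormedAddCommGroup E] [NormedSpace ℂ E] {w : R3 → E}
    (hε : 0 < ε) (h1 : Integrable k) (hk : MemLp k 2 volume) (hs : ∀ θ, ε⁻¹ ≤ ‖θ‖ → k θ = 0)
    (hp : IsQPeriodic w) (hw : MemLp w 2 volQ) :
    MemLp (fun x => fs k x • rescale ε w x) 2 volume ∧
      l2 volume (fun x => fs k x • rescale ε w x) ≤ l2 volume k * l2 volQ w := by
  have hcont : Continuous (fs k) := (contDiff_fs h1 hs).continuous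
  have hm : AEStronglyMeasurable (fun x => fs k x • rescale ε w x) volume :=
    hcont.aestronglyMeasurable.smul
      (aestronglyMeasurable_rescale (hp.aestronglyMeasurable hw.1) hε)
  refine memLp_two_of_lintegral hm (le_of_eq ?_) (mul_nonneg (l2_nonneg _) (l2_nonneg _))
  -- Cut space into `ε`-cells. On each of them `w` depends only on the cell variable `y`, and the
  -- sum of the squared samples of `fs k` is constant in `y`, so the norm factorises, with equality.
  rw [lintegral_comp_smul hε, lintegral_eq_tsum_cellQ isLatticeInvariant_volume]
  have e : ∀ n : Fin 3 → ℤ, ∀ y, ENNReal.ofReal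
      (‖fs k (ε • (y + ivec n)) • rescale ε w (ε • (y + ivec n))‖ ^ 2) =
      ENNReal.ofReal (‖fs k (ε • (y + ivec n))‖ ^ 2) * ENNReal.ofReal (‖w y‖ ^ 2) := by
    intro n y
    have hper : w (y + ivec n) = w y := hp y n
    rw [rescale, smul_smul, inv_mul_cancel₀ hε.ne', one_smul, hper, norm_smul, mul_pow,
      ENNReal.ofReal_mul (by positivity)]
  simp only [e]
  rw [← lintegral_tsum]
  · simp only [ENNReal.tsum_mul_right]
    rw [← lintegral_const_mul' _ _ ENNReal.ofReal_ne_top]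
    simp only [← mul_assoc, tsum_norm_sq_fs hε hk hs]
    rw [lintegral_const_mul' _ _ ENNReal.ofReal_ne_top, ← ofReal_l2_sq hw,
      ← ENNReal.ofReal_mul (by positivity), mul_pow]
  · intro n
    have hc : Continuous fun y => ‖fs k (ε • (y + ivec n))‖ ^ 2 := by fun_prop
    exact hc.measurable.ennreal_ofReal.aemeasurable.mul
      (hw.1.norm.aemeasurable.pow_const 2).ennreal_ofReal

end
end

/-! ### Compactly supported weights -/

lemma exists_finset_ivec (R : ℝ) : ∃ s : Finset (Fin 3 → ℤ), ∀ n, ‖ivec n‖ ≤ R → n ∈ s := by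
  refine ⟨Finset.Icc (fun _ => -⌈R⌉) (fun _ => ⌈R⌉), fun n hn => ?_⟩
  have h : ∀ i, |(n i : ℝ)| ≤ ⌈R⌉ := fun i =>
    ((PiLp.norm_apply_le (ivec n) i).trans hn).trans (Int.le_ceil R)
  rw [Finset.mem_Icc, Pi.le_def, Pi.le_def]
  constructor <;> intro i <;> have h1 := abs_le.1 (h i)
  · exact_mod_cast h1.1
  · exact_mod_cast h1.2

lemma norm_le_of_mem_cellQ {y : R3} (hy : y ∈ cellQ) : ‖y‖ ≤ 2 := by
  rw [EuclideanSpace.norm_eq, Real.sqrt_le_left (by norm_num)]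
  refine (Finset.sum_le_sum (g := fun _ => (1 : ℝ)) fun i _ => ?_).trans (by norm_num)
  rw [Real.norm_of_nonneg (hy i).1]
  nlinarith [(hy i).1, (hy i).2]

/-- A bounded compactly supported weight times a rescaled periodic function. -/
lemma exists_l2_smul_rescale_le {ε : ℝ} (hε : 0 < ε) (R : ℝ) : ∃ N : ℝ, 0 ≤ N ∧
    ∀ (E : Type) [NormedAddCommGroup E] [NormedSpace ℝ E] (c : R3 → ℝ) (K : ℝ) (w : R3 → E),
      AEStronglyMeasurable c volume → (∀ x, |c x| ≤ K) → (∀ x, R ≤ ‖x‖ → c x = 0) →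
      IsQPeriodic w → MemLp w 2 volQ →
      MemLp (fun x => c x • rescale ε w x) 2 volume ∧
        l2 volume (fun x => c x • rescale ε w x) ≤ N * K * l2 volQ w := by
  -- Only finitely many `ε`-cells meet the ball of radius `R`; the summand `2` bounds the norm of a
  -- point of the unit cell. Each cell contributes at most `ε³ K² ‖w‖²`, whence the constant `√(ε³
  -- card s)`. It may depend on `ε`, as it only serves to justify limits.
  obtain ⟨s, hs⟩ := exists_finset_ivec (R / ε + 2)
  refine ⟨√(ε ^ 3 * s.card), Real.sqrt_nonneg _, fun E _ _ c K w hcm hK hR hp hw => ?_⟩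
  have hK0 : 0 ≤ K := (abs_nonneg _).trans (hK 0)
  have hm : AEStronglyMeasurable (fun x => c x • rescale ε w x) volume :=
    hcm.smul (aestronglyMeasurable_rescale (hp.aestronglyMeasurable hw.1) hε)
  refine memLp_two_of_lintegral hm ?_
    (mul_nonneg (mul_nonneg (Real.sqrt_nonneg _) hK0) (l2_nonneg _))
  rw [lintegral_comp_smul hε, lintegral_eq_tsum_cellQ isLatticeInvariant_volume]
  have e : ∀ n : Fin 3 → ℤ, ∀ y, ENNReal.ofReal
      (‖c (ε • (y + ivec n)) • rescale ε w (ε • (y + ivec n))‖ ^ 2) =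
      ENNReal.ofReal (|c (ε • (y + ivec n))| ^ 2 * ‖w y‖ ^ 2) := by
    intro n y
    have hper : w (y + ivec n) = w y := hp y n
    rw [rescale, smul_smul, inv_mul_cancel₀ hε.ne', one_smul, hper, norm_smul, mul_pow,
      Real.norm_eq_abs]
  simp only [e]
  have hz : ∀ n ∉ s, ∫⁻ y in cellQ, ENNReal.ofReal (|c (ε • (y + ivec n))| ^ 2 * ‖w y‖ ^ 2) = 0 := by
    intro n hn
    have h1 : R / ε + 2 < ‖ivec n‖ := not_le.1 fun h => hn (hs n h)
    rw [setLIntegral_congr_fun (g := fun _ => 0) measurableSet_cellQ, lintegral_zero]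
    intro y hy
    have h2 : ‖ivec n‖ ≤ ‖y + ivec n‖ + ‖y‖ := by
      simpa using norm_sub_le (y + ivec n) y
    have h3 : R ≤ ‖ε • (y + ivec n)‖ := by
      rw [norm_smul, Real.norm_of_nonneg hε.le]
      have h4 : R / ε ≤ ‖y + ivec n‖ := by linarith [norm_le_of_mem_cellQ hy]
      rwa [div_le_iff₀' hε] at h4
    simp only [hR _ h3]
    simp
  rw [tsum_eq_sum hz]
  have hb : ∀ n ∈ s, ∫⁻ y in cellQ, ENNReal.ofReal (|c (ε • (y + ivec n))| ^ 2 * ‖w y‖ ^ 2) ≤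
      ENNReal.ofReal (K ^ 2 * l2 volQ w ^ 2) := by
    intro n _
    rw [ENNReal.ofReal_mul (by positivity), ofReal_l2_sq hw,
      ← lintegral_const_mul' _ _ ENNReal.ofReal_ne_top]
    refine lintegral_mono fun y => ?_
    rw [← ENNReal.ofReal_mul (by positivity)]
    refine ENNReal.ofReal_le_ofReal ?_
    gcongr
    exact hK _
  refine (mul_le_mul_right (Finset.sum_le_sum hb) _).trans (le_of_eq ?_)
  rw [Finset.sum_const, nsmul_eq_mul, ← ENNReal.ofReal_natCast,
    ← ENNReal.ofReal_mul (by positivity), ← ENNReal.ofReal_mul (by positivity), mul_pow, mul_pow,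
    Real.sq_sqrt (by positivity)]
  congr 1; ring

lemma tendsto_l2_of_dominated {α E F : Type*} [MeasurableSpace α] [NormedAddCommGroup E]
    [NormedAddCommGroup F] {ν : Measure α} {f : ℕ → α → E} {g : α → F}
    (hf : ∀ n, AEStronglyMeasurable (f n) ν) (hg : MemLp g 2 ν)
    (hb : ∀ n, ∀ᵐ x ∂ν, ‖f n x‖ ≤ ‖g x‖)
    (h : ∀ᵐ x ∂ν, Tendsto (fun n => f n x) atTop (𝓝 0)) :
    Tendsto (fun n => l2 ν (f n)) atTop (𝓝 0) := by
  have hfm : ∀ n, MemLp (f n) 2 ν := fun n => hg.mono (hf n) (hb n)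
  have h1 : Tendsto (fun n => ∫ x, ‖f n x‖ ^ 2 ∂ν) atTop (𝓝 (∫ _, (0 : ℝ) ∂ν)) := by
    refine tendsto_integral_of_dominated_convergence (fun x => ‖g x‖ ^ 2)
      (fun n => (hf n).norm.pow 2) (integrable_norm_sq hg) (fun n => ?_) ?_
    · filter_upwards [hb n] with x hx
      rw [norm_pow, norm_norm]
      gcongr
    · filter_upwards [h] with x hx
      have := (hx.norm).pow 2
      simpa using this
  have h2 := h1.sqrt
  simp only [integral_zero, Real.sqrt_zero] at h2
  refine h2.congr fun n => ?_
  rw [← l2_sq (hfm n), Real.sqrt_sq (l2_nonneg _)]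

/-! ### Real gradient pairs on the cell -/

lemma gradient_comp {G : ℝ → ℝ} {φ : R3 → ℝ} (hG : Differentiable ℝ G) (hφ : Differentiable ℝ φ)
    (x : R3) : gradient (fun y => G (φ y)) x = deriv G (φ x) • gradient φ x := by
  have h : HasFDerivAt (fun y => G (φ y)) (deriv G (φ x) • fderiv ℝ φ x) x :=
    (hG (φ x)).hasDerivAt.comp_hasFDerivAt x (hφ x).hasFDerivAt
  rw [gradient, gradient, h.fderiv, map_smul]

lemma continuous_gradient {φ : R3 → ℝ} (hφ : ContDiff ℝ ∞ φ) : Continuous (gradient φ) :=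
  (InnerProductSpace.toDual ℝ R3).symm.continuous.comp (hφ.continuous_fderiv (by simp))

lemma norm_gradient (φ : R3 → ℝ) (x : R3) : ‖gradient φ x‖ = ‖fderiv ℝ φ x‖ :=
  (InnerProductSpace.toDual ℝ R3).symm.norm_map _

lemma gradient_periodic {φ : R3 → ℝ} (hφ : IsQPeriodic φ) : IsQPeriodic (gradient φ) := by
  intro x n
  have h : (fun y => φ (y + WithLp.toLp 2 fun i => (n i : ℝ))) = φ := funext fun y => hφ y n
  rw [gradient, gradient, ← fderiv_comp_add_right, h]

lemma exists_bound_gradient {φ : R3 → ℝ} (hφ : φ ∈ testP) : ∃ K : ℝ, ∀ x, ‖gradient φ x‖ ≤ K := by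
  have h : (fderiv ℝ φ) ∈ testP (E := R3 →L[ℝ] ℝ) := by
    refine ⟨hφ.1.fderiv_right (m := ∞) (by simp), fun x n => ?_⟩
    have h : (fun y => φ (y + WithLp.toLp 2 fun i => (n i : ℝ))) = φ := funext fun y => hφ.2 y n
    rw [← fderiv_comp_add_right, h]
  obtain ⟨K, -, hK⟩ := exists_bound_of_mem_testP h
  exact ⟨K, fun x => by rw [norm_gradient]; exact hK x⟩

lemma memLp_gradient {φ : R3 → ℝ} (hφ : φ ∈ testP) : MemLp (gradient φ) 2 volQ := by
  obtain ⟨K, hK⟩ := exists_bound_gradient hφ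
  exact MemLp.of_bound (continuous_gradient hφ.1).aestronglyMeasurable K (.of_forall hK)

/-- `q` is a weak gradient of the periodic function `v`, both being limits in `L²(Q)` (and the
function also almost everywhere) of smooth periodic functions and their gradients. -/
structure IsGradPair (v : R3 → ℝ) (q : R3 → R3) : Prop where
  memLp : MemLp v 2 volQ
  memLp' : MemLp q 2 volQ
  approx : ∃ φ : ℕ → R3 → ℝ, (∀ n, φ n ∈ testP) ∧
    Tendsto (fun n => l2 volQ fun x => φ n x - v x) atTop (𝓝 0) ∧
    Tendsto (fun n => l2 volQ fun x => gradient (φ n) x - q x) atTop (𝓝 0) ∧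
    ∀ᵐ x ∂volQ, Tendsto (fun n => φ n x) atTop (𝓝 (v x))

lemma IsGradPair.of_tendsto {v : R3 → ℝ} {q : R3 → R3} (hv : MemLp v 2 volQ) (hq : MemLp q 2 volQ)
    {φ : ℕ → R3 → ℝ} (hφ : ∀ n, φ n ∈ testP)
    (h1 : Tendsto (fun n => l2 volQ fun x => φ n x - v x) atTop (𝓝 0))
    (h2 : Tendsto (fun n => l2 volQ fun x => gradient (φ n) x - q x) atTop (𝓝 0)) :
    IsGradPair v q := by
  have hm := fun n => memLp_of_mem_testP (hφ n)
  have h3 : TendstoInMeasure volQ φ atTop v :=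
    tendstoInMeasure_of_tendsto_eLpNorm two_ne_zero (fun n => (hm n).1) hv.1
      (tendsto_eLpNorm_of_l2 (fun n => (hm n).sub hv) h1)
  obtain ⟨ns, hns, hae⟩ := h3.exists_seq_tendsto_ae
  exact ⟨hv, hq, fun n => φ (ns n), fun n => hφ _, h1.comp hns.tendsto_atTop,
    h2.comp hns.tendsto_atTop, hae⟩

lemma abs_sub_le_of_deriv {G : ℝ → ℝ} (hG : Differentiable ℝ G) {K : ℝ}
    (hK : ∀ t, |deriv G t| ≤ K) (s t : ℝ) : |G s - G t| ≤ K * |s - t| :=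
  Convex.norm_image_sub_le_of_norm_deriv_le (fun x _ => hG x) (fun x _ => hK x) convex_univ
    (Set.mem_univ _) (Set.mem_univ _)

/-- The approximants of a composition. -/
lemma IsGradPair.tendsto_comp {v : R3 → ℝ} {q : R3 → R3} (hv : MemLp v 2 volQ)
    (hq : MemLp q 2 volQ) {φ : ℕ → R3 → ℝ} (hφ : ∀ n, φ n ∈ testP)
    (h2 : Tendsto (fun n => l2 volQ fun x => gradient (φ n) x - q x) atTop (𝓝 0))
    (h3 : ∀ᵐ x ∂volQ, Tendsto (fun n => φ n x) atTop (𝓝 (v x))) {G : ℝ → ℝ}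
    (hG : ContDiff ℝ ∞ G) {K : ℝ} (hK : ∀ t, |deriv G t| ≤ K) :
    MemLp (fun x => deriv G (v x) • q x) 2 volQ ∧
    Tendsto (fun n => l2 volQ fun x => gradient (fun y => G (φ n y)) x - deriv G (v x) • q x)
      atTop (𝓝 0) := by
  have hd := hG.differentiable (by simp)
  have hK0 : 0 ≤ K := (abs_nonneg _).trans (hK 0)
  have hGc : Continuous (deriv G) := hG.continuous_deriv (by simp)
  have hm : ∀ {f : R3 → ℝ}, AEStronglyMeasurable f volQ →
      AEStronglyMeasurable (fun x => deriv G (f x)) volQ := fun hf =>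
    hGc.comp_aestronglyMeasurable hf
  have hqm : MemLp (fun x => deriv G (v x) • q x) 2 volQ := by
    refine (hq.norm.const_mul K).mono' ((hm hv.1).smul hq.1) (.of_forall fun x => ?_)
    rw [norm_smul]; gcongr; exact hK _
  refine ⟨hqm, ?_⟩
  have hg := fun n => memLp_gradient (hφ n)
  have hφm := fun n => (hφ n).1.continuous.aestronglyMeasurable (μ := volQ)
  have hlim2 : Tendsto (fun n => l2 volQ fun x => (deriv G (φ n x) - deriv G (v x)) • q x) atTop
      (𝓝 0) := by
    refine tendsto_l2_of_dominated (fun n => ((hm (hφm n)).sub (hm hv.1)).smul hq.1)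
      (hq.const_smul (2 * K)) (fun n => .of_forall fun x => ?_) ?_
    · rw [norm_smul, Pi.smul_apply, norm_smul, Real.norm_of_nonneg (by positivity : 0 ≤ 2 * K)]
      gcongr
      refine (norm_sub_le _ _).trans ?_
      rw [two_mul]
      exact add_le_add (hK _) (hK _)
    · filter_upwards [h3] with x hx
      have h := ((hGc.tendsto _).comp hx).sub_const (deriv G (v x))
      rw [sub_self] at h
      simpa using h.smul_const (q x)
  -- The error splits into `G'(φ_n)(∇φ_n - q)`, small because `G'` is bounded, and `(G'(φ_n) -
  -- G'(v)) q`, small by dominated convergence because `φ_n → v` almost everywhere.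
  have hlim := (h2.const_mul K).add hlim2
  rw [mul_zero, add_zero] at hlim
  refine squeeze_zero (fun n => l2_nonneg _) (fun n => ?_) hlim
  have e : (fun x => gradient (fun y => G (φ n y)) x - deriv G (v x) • q x) = fun x =>
      deriv G (φ n x) • (gradient (φ n) x - q x) + (deriv G (φ n x) - deriv G (v x)) • q x := by
    ext1 x
    rw [gradient_comp hd ((hφ n).1.differentiable (by simp)), smul_sub, sub_smul]
    abel
  have hb : ∀ᵐ x ∂volQ, ‖deriv G (φ n x) • (gradient (φ n) x - q x)‖ ≤
      K * ‖gradient (φ n) x - q x‖ := .of_forall fun x => by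
    rw [norm_smul]; gcongr; exact hK _
  have ha : MemLp (fun x => deriv G (φ n x) • (gradient (φ n) x - q x)) 2 volQ :=
    (((hg n).sub hq).norm.const_mul K).mono' ((hm (hφm n)).smul ((hg n).sub hq).1) hb
  have hc : MemLp (fun x => (deriv G (φ n x) - deriv G (v x)) • q x) 2 volQ := by
    refine (hq.norm.const_mul (2 * K)).mono' (((hm (hφm n)).sub (hm hv.1)).smul hq.1)
      (.of_forall fun x => ?_)
    rw [norm_smul]
    gcongr
    refine (norm_sub_le _ _).trans ?_
    rw [two_mul]
    exact add_le_add (hK _) (hK _)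
  rw [e]
  exact (l2_add_le ha hc).trans (add_le_add (l2_mono hK0 ((hg n).sub hq) hb) le_rfl)

lemma comp_mem_testP {φ : R3 → ℝ} (hφ : φ ∈ testP) {G : ℝ → ℝ} (hG : ContDiff ℝ ∞ G) :
    (fun x => G (φ x)) ∈ testP (E := ℝ) :=
  ⟨hG.comp hφ.1, fun x n => by simp only [hφ.2 x n]⟩

lemma IsGradPair.comp {v : R3 → ℝ} {q : R3 → R3} (h : IsGradPair v q) {G : ℝ → ℝ}
    (hG : ContDiff ℝ ∞ G) {K : ℝ} (hK : ∀ t, |deriv G t| ≤ K) :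
    IsGradPair (fun x => G (v x)) fun x => deriv G (v x) • q x := by
  obtain ⟨hv, hq, φ, hφ, h1, h2, h3⟩ := h
  have hK0 : 0 ≤ K := (abs_nonneg _).trans (hK 0)
  have hL := abs_sub_le_of_deriv (hG.differentiable (by simp)) hK
  obtain ⟨hqm, hlim⟩ := IsGradPair.tendsto_comp hv hq hφ h2 h3 hG hK
  refine ⟨?_, hqm, fun n x => G (φ n x), fun n => comp_mem_testP (hφ n) hG, ?_, hlim, ?_⟩
  · refine ((memLp_const |G 0|).add (hv.norm.const_mul K)).mono'
      (hG.continuous.comp_aestronglyMeasurable hv.1) (.of_forall fun x => ?_)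
    have h := hL (v x) 0
    rw [sub_zero] at h
    have h' := abs_add_le (G 0) (G (v x) - G 0)
    rw [add_sub_cancel] at h'
    exact h'.trans (add_le_add le_rfl h)
  · have hlim1 := h1.const_mul K
    rw [mul_zero] at hlim1
    exact squeeze_zero (fun n => l2_nonneg _) (fun n =>
      l2_mono hK0 ((memLp_of_mem_testP (hφ n)).sub hv) (.of_forall fun x => hL _ _)) hlim1
  · filter_upwards [h3] with x hx
    exact (hG.continuous.tendsto _).comp hx

/-! ### The Sobolev inequality on the cell -/

/-- Multiply by a cutoff equal to one on the cell and apply the Sobolev inequality in `ℝ³`, with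
`1/6 = 1/2 - 1/3`. Periodicity bounds the norms of the product over the support of the cutoff by
norms over a single cell. -/
lemma exists_sobolev_testP : ∃ C : ℝ, 0 ≤ C ∧ ∀ φ ∈ testP (E := ℝ), eLpNorm φ 6 volQ ≤
    ENNReal.ofReal (C * (l2 volQ φ + l2 volQ (gradient φ))) := by
  -- The cell lies in the ball of radius `2`, where `χ = 1`. The radius `4` on the next line
  -- strictly exceeds the outer radius `3`, so `χ` and its derivative both vanish beyond it.
  let χ : ContDiffBump (0 : R3) := ⟨2, 3, two_pos, by norm_num⟩
  obtain ⟨N, hN0, hN⟩ := exists_l2_smul_rescale_le one_pos 4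
  have hχ1 : ContDiff ℝ ∞ χ := χ.contDiff
  have hχd := hχ1.differentiable (by simp)
  obtain ⟨K, hK⟩ := (χ.hasCompactSupport.fderiv (𝕜 := ℝ)).exists_bound_of_continuous
    (hχ1.continuous_fderiv (by simp))
  have hK0 : 0 ≤ K := (norm_nonneg _).trans (hK 0)
  have hz : ∀ x, 4 ≤ ‖x‖ → χ x = 0 := fun x hx => χ.zero_of_le_dist (by
    rw [dist_zero_right]; exact le_trans (by norm_num [χ]) hx)
  have hz' : ∀ x, 4 ≤ ‖x‖ → fderiv ℝ χ x = 0 := fun x hx => by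
    by_contra h
    have h1 := support_fderiv_subset ℝ (Function.mem_support.2 h)
    rw [χ.tsupport_eq, mem_closedBall_zero_iff] at h1
    have : χ.rOut = 3 := rfl
    linarith
  set S := SNormLESNormFDerivOfEqConst ℝ (volume : Measure R3) 2 with hS
  refine ⟨S * (N * K + N * 1), by positivity, fun φ hφ => ?_⟩
  have hφd := hφ.1.differentiable (by simp)
  have hφm := memLp_of_mem_testP hφ
  have hgm := memLp_gradient hφ
  set u : R3 → ℝ := fun x => χ x * φ x with hu
  have hus : HasCompactSupport u := χ.hasCompactSupport.mul_right
  have hud : ContDiff ℝ 1 u := (hχ1.mul hφ.1).of_le (by simp)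
  have h1 : eLpNorm φ 6 volQ ≤ eLpNorm u 6 volume := by
    have h : φ =ᵐ[volQ] u := by
      filter_upwards [ae_restrict_mem measurableSet_cellQ] with x hx
      have : χ x = 1 := χ.one_of_mem_closedBall (by
        rw [mem_closedBall_zero_iff]; exact norm_le_of_mem_cellQ hx)
      simp [hu, this]
    rw [eLpNorm_congr_ae h]
    exact eLpNorm_restrict_le _ _ _ _
  have h2 := eLpNorm_le_eLpNorm_fderiv_of_eq (volume : Measure R3) hud hus (p := 2) (p' := 6)
    (by norm_num) (by simp) (by simp; norm_num)
  have hfd : ∀ x, fderiv ℝ u x = φ x • fderiv ℝ χ x + χ x • fderiv ℝ φ x := fun x => by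
    rw [hu, fderiv_fun_mul (hχd x) (hφd x), add_comm]
  obtain ⟨ha, ha'⟩ := hN ℝ (fun x => ‖fderiv ℝ χ x‖) K φ
    (hχ1.continuous_fderiv (by simp)).norm.aestronglyMeasurable
    (fun x => by rw [abs_of_nonneg (norm_nonneg _)]; exact hK x) (fun x hx => by simp [hz' x hx])
    hφ.2 hφm
  obtain ⟨hb, hb'⟩ := hN R3 χ 1 (gradient φ) χ.continuous.aestronglyMeasurable
    (fun x => by rw [abs_of_nonneg χ.nonneg]; exact χ.le_one) hz (gradient_periodic hφ.2) hgm
  have hfm : MemLp (fderiv ℝ u) 2 volume :=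
    (hud.continuous_fderiv (by simp)).memLp_of_hasCompactSupport (hus.fderiv (𝕜 := ℝ))
  have h3 : l2 volume (fderiv ℝ u) ≤ (N * K + N * 1) * (l2 volQ φ + l2 volQ (gradient φ)) := by
    have h := l2_mono (ν := volume) (f := fderiv ℝ u) zero_le_one (ha.norm.add hb.norm)
      (.of_forall fun x => ?_)
    · rw [one_mul] at h
      have h' := l2_add_le ha.norm hb.norm
      have e1 := l2_mono (ν := volume) zero_le_one ha
        (f := fun x => ‖‖fderiv ℝ χ x‖ • rescale 1 φ x‖) (.of_forall fun x => by simp)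
      have e2 := l2_mono (ν := volume) zero_le_one hb
        (f := fun x => ‖χ x • rescale 1 (gradient φ) x‖) (.of_forall fun x => by simp)
      rw [one_mul] at e1 e2
      refine (h.trans h').trans ((add_le_add (e1.trans ha') (e2.trans hb')).trans ?_)
      have p1 := l2_nonneg (ν := volQ) φ
      have p2 := l2_nonneg (ν := volQ) (gradient φ)
      have p3 := mul_nonneg (mul_nonneg hN0 hK0) p2
      have p4 := mul_nonneg hN0 p1
      nlinarith
    · rw [hfd, one_mul]
      refine (norm_add_le _ _).trans (le_of_eq ?_)
      simp only [Pi.add_apply, rescale, inv_one, one_smul, norm_smul, norm_norm, norm_gradient]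
      rw [Real.norm_of_nonneg (add_nonneg (by positivity) (by positivity))]
      ring
  refine h1.trans (h2.trans ?_)
  rw [show ((2 : NNReal) : ENNReal) = 2 from rfl, ← ofReal_l2 hfm, ← ENNReal.ofReal_coe_nnreal,
    ← ENNReal.ofReal_mul (by positivity), mul_assoc]
  refine ENNReal.ofReal_le_ofReal ?_
  exact mul_le_mul_of_nonneg_left h3 S.2

/-- Fatou's lemma passes the inequality to the limit; for this reason `IsGradPair` records almost
everywhere convergence of the approximants. -/
lemma IsGradPair.sobolev : ∃ C : ℝ, 0 ≤ C ∧ ∀ v q, IsGradPair v q → eLpNorm v 6 volQ ≤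
    ENNReal.ofReal (C * (l2 volQ v + l2 volQ q)) := by
  obtain ⟨C, hC0, hC⟩ := exists_sobolev_testP
  refine ⟨C, hC0, fun v q ⟨hv, hq, φ, hφ, h1, h2, h3⟩ => ?_⟩
  have hm := fun n => memLp_of_mem_testP (hφ n)
  have hg := fun n => memLp_gradient (hφ n)
  refine (Lp.eLpNorm_lim_le_liminf_eLpNorm (fun n => (hm n).1) v h3).trans ?_
  have hb : ∀ n, eLpNorm (φ n) 6 volQ ≤ ENNReal.ofReal (C * ((l2 volQ v + l2 volQ fun x =>
      φ n x - v x) + (l2 volQ q + l2 volQ fun x => gradient (φ n) x - q x))) := fun n => by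
    refine (hC _ (hφ n)).trans (ENNReal.ofReal_le_ofReal ?_)
    exact mul_le_mul_of_nonneg_left (add_le_add (l2_le_add_sub (hm n) hv)
      (l2_le_add_sub (hg n) hq)) hC0
  refine (liminf_le_liminf (.of_forall hb)).trans (le_of_eq ?_)
  have hlim := ENNReal.tendsto_ofReal (((h1.const_add (l2 volQ v)).add
    (h2.const_add (l2 volQ q))).const_mul C)
  simp only [add_zero] at hlim
  exact hlim.liminf_eq

/-! ### Boundedness of weak solutions -/

/-- De Giorgi's iteration. Along the levels `k + 1 - 2^{-i}` the superlinear power `3` beats the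
growing factors `d^{-6} = 64^{i+1}`: once `a k` is below a threshold `δ`, the values decay like `δ
8^{-i}`, and `a` vanishes at `k + 1`. -/
lemma exists_eq_zero_of_iteration {a : ℝ → ℝ} (ha : Antitone a) (h0 : ∀ k, 0 ≤ a k)
    (hlim : Tendsto a atTop (𝓝 0)) {D : ℝ} (hD : 0 ≤ D)
    (h : ∀ k d, 0 < d → d ≤ 1 → d ^ 6 * a (k + d) ≤ D * a k ^ 3) : ∃ M, a M = 0 := by
  -- The induction step gives `64 D δ³ 8^{-i}` and needs `δ 8^{-i-1}`, that is `512 D δ² ≤ 1`.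
  set δ : ℝ := 1 / (512 * (D + 1)) with hδ
  have hδ0 : 0 < δ := by positivity
  have hδ1 : 512 * D * δ ^ 2 ≤ 1 := by
    have h1 : δ ≤ 1 := by
      rw [hδ, div_le_one (by positivity)]; linarith
    have h2 : 512 * (D + 1) * δ = 1 := by rw [hδ]; field_simp
    nlinarith
  obtain ⟨k, hk⟩ := (hlim.eventually (ge_mem_nhds hδ0)).exists
  have hi : ∀ i : ℕ, a (k + (1 - (1 / 2) ^ i)) ≤ δ * (1 / 8) ^ i := by
    intro i
    induction i with
    | zero => simpa using hk
    | succ i ih =>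
      have hd := h (k + (1 - (1 / 2) ^ i)) ((1 / 2) ^ (i + 1)) (by positivity)
        (pow_le_one₀ (by norm_num) (by norm_num))
      have e : k + (1 - (1 / 2 : ℝ) ^ i) + (1 / 2) ^ (i + 1) = k + (1 - (1 / 2) ^ (i + 1)) := by
        rw [pow_succ]; ring
      rw [e] at hd
      have h3 : a (k + (1 - (1 / 2) ^ i)) ^ 3 ≤ (δ * (1 / 8) ^ i) ^ 3 :=
        pow_le_pow_left₀ (h0 _) ih 3
      have h4 : ((1 / 2 : ℝ) ^ (i + 1)) ^ 6 = (1 / 64) * (1 / 64) ^ i := by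
        rw [← pow_mul, mul_comm, pow_mul, pow_succ]; norm_num; ring
      have h5 : (δ * (1 / 8 : ℝ) ^ i) ^ 3 = δ ^ 3 * ((1 / 64) ^ i * (1 / 8) ^ i) := by
        rw [mul_pow, ← pow_mul, mul_comm i, pow_mul, ← mul_pow]; norm_num
      rw [h4] at hd
      rw [h5] at h3
      have p1 : (0 : ℝ) < (1 / 64) ^ i := by positivity
      have p2 : (0 : ℝ) < (1 / 8) ^ i := by positivity
      have h6 : (1 / 64 : ℝ) ^ i * a (k + (1 - (1 / 2) ^ (i + 1))) ≤
          (1 / 64 : ℝ) ^ i * (64 * D * δ ^ 3 * (1 / 8) ^ i) := by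
        have := mul_le_mul_of_nonneg_left h3 hD
        nlinarith
      refine (le_of_mul_le_mul_left h6 p1).trans ?_
      have h7 : 64 * D * δ ^ 3 ≤ δ * (1 / 8) := by nlinarith
      have h8 := mul_le_mul_of_nonneg_right h7 p2.le
      rw [pow_succ (1 / 8 : ℝ) i]
      linarith
  refine ⟨k + 1, le_antisymm ?_ (h0 _)⟩
  have hlim2 : Tendsto (fun i : ℕ => δ * (1 / 8 : ℝ) ^ i) atTop (𝓝 0) := by
    simpa using (tendsto_pow_atTop_nhds_zero_of_lt_one (by norm_num : (0 : ℝ) ≤ 1 / 8)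
      (by norm_num)).const_mul δ
  refine ge_of_tendsto' hlim2 fun i => (ha ?_).trans (hi i)
  have : (0 : ℝ) < (1 / 2) ^ i := by positivity
  linarith

lemma exists_deriv_smoothTransition_le : ∃ K : ℝ, ∀ t, |deriv Real.smoothTransition t| ≤ K := by
  have hc : Continuous (deriv Real.smoothTransition) :=
    (Real.smoothTransition.contDiff (n := 1)).continuous_deriv le_rfl
  obtain ⟨K, hK⟩ := isCompact_Icc.exists_bound_of_continuousOn (s := Set.Icc (0 : ℝ) 1)
    hc.continuousOn
  have hK0 : 0 ≤ K := (norm_nonneg _).trans (hK 0 (by simp))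
  refine ⟨K, fun t => ?_⟩
  rcases lt_or_ge t 0 with ht | ht
  · have h : Real.smoothTransition =ᶠ[𝓝 t] fun _ => 0 := by
      filter_upwards [gt_mem_nhds ht] with s hs
      exact Real.smoothTransition.zero_of_nonpos hs.le
    rw [h.deriv_eq]; simpa
  rcases le_or_gt t 1 with ht1 | ht1
  · exact hK t ⟨ht, ht1⟩
  · have h : Real.smoothTransition =ᶠ[𝓝 t] fun _ => 1 := by
      filter_upwards [lt_mem_nhds ht1] with s hs
      exact Real.smoothTransition.one_of_one_le hs.le
    rw [h.deriv_eq]; simpa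

/-- A smooth nondecreasing function that vanishes below `k` and equals `d` above `k + d`. -/
def step (k d t : ℝ) : ℝ := d * Real.smoothTransition ((t - k) / d)

lemma contDiff_step (k d : ℝ) : ContDiff ℝ ∞ (step k d) :=
  contDiff_const.mul ((Real.smoothTransition.contDiff (n := ⊤)).comp (by fun_prop))

lemma deriv_step {k d : ℝ} (hd : d ≠ 0) (t : ℝ) :
    deriv (step k d) t = deriv Real.smoothTransition ((t - k) / d) := by
  have h1 : HasDerivAt Real.smoothTransition (deriv Real.smoothTransition ((t - k) / d))
      ((t - k) / d) :=
    ((Real.smoothTransition.contDiff (n := 1)).differentiable (by simp) _).hasDerivAt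
  have h2 : HasDerivAt (fun s => (s - k) / d) (1 / d) t :=
    ((hasDerivAt_id t).sub_const k).div_const d
  have h12 := HasDerivAt.comp (h₂ := Real.smoothTransition) (h := fun s => (s - k) / d) t h1 h2
  have h3 : HasDerivAt (step k d) (d * (deriv Real.smoothTransition ((t - k) / d) * (1 / d))) t :=
    h12.const_mul d
  rw [h3.deriv]
  field_simp

lemma deriv_step_nonneg {k d : ℝ} (hd : 0 < d) (t : ℝ) : 0 ≤ deriv (step k d) t := by
  rw [deriv_step hd.ne']
  exact Real.smoothTransition.monotone.deriv_nonneg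

lemma deriv_step_eq_zero {k d t : ℝ} (hd : 0 < d) (ht : t < k) : deriv (step k d) t = 0 := by
  have h : step k d =ᶠ[𝓝 t] fun _ => 0 := by
    filter_upwards [gt_mem_nhds ht] with s hs
    rw [step, Real.smoothTransition.zero_of_nonpos, mul_zero]
    exact div_nonpos_of_nonpos_of_nonneg (by linarith) hd.le
  rw [h.deriv_eq]; simp

lemma step_nonneg {k d : ℝ} (hd : 0 < d) (t : ℝ) : 0 ≤ step k d t :=
  mul_nonneg hd.le (Real.smoothTransition.nonneg _)

lemma step_le {k d : ℝ} (hd : 0 < d) (t : ℝ) : step k d t ≤ d :=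
  mul_le_of_le_one_right hd.le (Real.smoothTransition.le_one _)

lemma step_eq {k d t : ℝ} (hd : 0 < d) (ht : k + d ≤ t) : step k d t = d := by
  rw [step, Real.smoothTransition.one_of_one_le, mul_one]
  rw [le_div_iff₀ hd]; linarith

lemma step_eq_zero {k d t : ℝ} (hd : 0 < d) (ht : t ≤ k) : step k d t = 0 := by
  rw [step, Real.smoothTransition.zero_of_nonpos, mul_zero]
  exact div_nonpos_of_nonpos_of_nonneg (by linarith) hd.le

lemma IsGradPair.integral_inner_eq_zero {v : R3 → ℝ} {q b : R3 → R3} (h : IsGradPair v q)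
    (hb : MemLp b 2 volQ)
    (horth : ∀ η ∈ testP (E := ℝ), ∫ x in cellQ, inner ℝ (gradient η x) (b x) = 0) :
    ∫ x in cellQ, inner ℝ (q x) (b x) = 0 := by
  obtain ⟨hv, hq, φ, hφ, h1, h2, h3⟩ := h
  have hg := fun n => memLp_gradient (hφ n)
  have hlim := tendsto_integral_inner_left (𝕜 := ℝ) (.of_forall hg) hq hb
    (tendsto_eLpNorm_of_l2 (fun n => (hg n).sub hq) h2)
  exact tendsto_nhds_unique hlim (tendsto_const_nhds.congr fun n => (horth _ (hφ n)).symm)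

/-- The function `step k d ∘ v`, a smooth substitute for the truncation `min((v - k)⁺, d)`, is an
admissible test function. With `g = (step k d)'(v)`, which satisfies `0 ≤ g ≤ K` and vanishes where
`v < k`, the equation and ellipticity give `‖g q‖² ≤ (K² L / lam) |{v ≥ k}|`. The Sobolev inequality
in `L⁶` followed by Chebyshev's inequality produces the factor `d⁶` and the cube of the measure. -/
lemma level_set_decay {v : R3 → ℝ} {q b : R3 → R3} (h : IsGradPair v q) (hb : MemLp b 2 volQ)
    (horth : ∀ η ∈ testP (E := ℝ), ∫ x in cellQ, inner ℝ (gradient η x) (b x) = 0)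
    (hvm : Measurable v) {lam L : ℝ} (hlam : 0 < lam) (hL : 0 ≤ L)
    (hell : ∀ᵐ x ∂volQ, lam * ‖q x‖ ^ 2 ≤ inner ℝ (q x) (b x) + L) :
    ∃ D : ℝ, 0 ≤ D ∧ ∀ k d, 0 < d → d ≤ 1 →
      d ^ 6 * volQ.real {x | k + d ≤ v x} ≤ D * volQ.real {x | k ≤ v x} ^ 3 := by
  obtain ⟨K, hK⟩ := exists_deriv_smoothTransition_le
  have hK0 : 0 ≤ K := (abs_nonneg _).trans (hK 0)
  obtain ⟨C, hC0, hC⟩ := IsGradPair.sobolev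
  set P : ℝ := K ^ 2 * L / lam with hP
  have hP0 : 0 ≤ P := by positivity
  refine ⟨(C * (1 + √P)) ^ 6, by positivity, fun k d hd hd1 => ?_⟩
  set A : Set R3 := {x | k ≤ v x} with hA
  have hAm : MeasurableSet A := measurableSet_le measurable_const hvm
  set a : ℝ := volQ.real A with ha
  have ha0 : 0 ≤ a := measureReal_nonneg
  have hdK : ∀ t, |deriv (step k d) t| ≤ K := fun t => by rw [deriv_step hd.ne']; exact hK _
  have hc := h.comp (contDiff_step k d) hdK
  have hz := hc.integral_inner_eq_zero hb horth
  have hind : Integrable (A.indicator fun _ => (1 : ℝ)) volQ :=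
    (integrable_const 1).indicator hAm
  have hia : ∫ x in cellQ, A.indicator (fun _ => (1 : ℝ)) x = a := by
    rw [integral_indicator_const _ hAm, smul_eq_mul, mul_one]
  have hq2 : l2 volQ (fun x => deriv (step k d) (v x) • q x) ^ 2 ≤ P * a := by
    rw [l2_sq hc.memLp']
    have hi := (integrable_inner (𝕜 := ℝ) hc.memLp' hb).const_mul (K / lam)
    have hi2 := hind.const_mul P
    -- The first summand integrates to zero by the equation. Adding it makes the comparison with `‖g
    -- q‖²` pointwise.
    have : P * a = ∫ x in cellQ, (K / lam * inner ℝ (deriv (step k d) (v x) • q x) (b x) +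
        P * A.indicator (fun _ => (1 : ℝ)) x) := by
      rw [integral_add hi hi2, integral_const_mul, integral_const_mul, hz, hia]; ring
    rw [this]
    refine integral_mono_ae (integrable_norm_sq hc.memLp') (hi.add hi2) ?_
    filter_upwards [hell] with x hx
    by_cases hxA : x ∈ A
    · rw [Set.indicator_of_mem hxA, norm_smul, mul_pow, Real.norm_eq_abs, sq_abs, inner_smul_left]
      have g0 := deriv_step_nonneg (k := k) hd (v x)
      have gK := (le_abs_self _).trans (hdK (v x))
      set g := deriv (step k d) (v x)
      have e1 : g ^ 2 * ‖q x‖ ^ 2 ≤ K / lam * (g * (lam * ‖q x‖ ^ 2)) := by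
        have : K / lam * (g * (lam * ‖q x‖ ^ 2)) = K * g * ‖q x‖ ^ 2 := by field_simp
        rw [this]
        have : g ^ 2 ≤ K * g := by nlinarith
        gcongr
      refine e1.trans ?_
      have e2 : K / lam * (g * (lam * ‖q x‖ ^ 2)) ≤ K / lam * (g * (inner ℝ (q x) (b x) + L)) := by
        gcongr
      refine e2.trans ?_
      have e3 : K / lam * (g * L) ≤ K / lam * (K * L) := by gcongr
      have e4 : K / lam * (K * L) = P := by rw [hP]; ring
      simp only [conj_trivial]
      nlinarith
    · have hlt : v x < k := not_le.1 hxA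
      rw [Set.indicator_of_notMem hxA, deriv_step_eq_zero hd hlt]
      simp
  have hv2 : l2 volQ (fun x => step k d (v x)) ^ 2 ≤ a := by
    rw [l2_sq hc.memLp, ← hia]
    refine integral_mono (integrable_norm_sq hc.memLp) hind fun x => ?_
    by_cases hxA : x ∈ A
    · rw [Set.indicator_of_mem hxA, Real.norm_of_nonneg (step_nonneg hd _)]
      have := step_le (k := k) hd (v x)
      have := step_nonneg (k := k) hd (v x)
      nlinarith
    · rw [Set.indicator_of_notMem hxA, step_eq_zero hd (not_le.1 hxA).le]
      simp
  have hsum : C * (l2 volQ (fun x => step k d (v x)) +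
      l2 volQ (fun x => deriv (step k d) (v x) • q x)) ≤ C * (1 + √P) * √a := by
    have e1 := Real.le_sqrt_of_sq_le hv2
    have e2 := Real.le_sqrt_of_sq_le hq2
    rw [Real.sqrt_mul hP0] at e2
    rw [mul_assoc]
    refine mul_le_mul_of_nonneg_left ?_ hC0
    linarith
  have h6 := (hC _ _ hc).trans (ENNReal.ofReal_le_ofReal hsum)
  -- Chebyshev: the truncation equals `d` on `{v ≥ k + d}`.
  have hch := mul_meas_ge_le_pow_eLpNorm' volQ (p := 6) (by norm_num) (by norm_num) hc.memLp.1
    (ENNReal.ofReal d)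
  simp only [ENNReal.toReal_ofNat, ENNReal.rpow_ofNat] at hch
  have hsub : {x | k + d ≤ v x} ⊆ {x | ENNReal.ofReal d ≤ ‖step k d (v x)‖ₑ} := fun x hx => by
    have hx' : k + d ≤ v x := hx
    change ENNReal.ofReal d ≤ _
    rw [step_eq hd hx', ← ofReal_norm, Real.norm_of_nonneg hd.le]
  have hch2 : ENNReal.ofReal (d ^ 6 * volQ.real {x | k + d ≤ v x}) ≤
      ENNReal.ofReal ((C * (1 + √P) * √a) ^ 6) := by
    rw [ENNReal.ofReal_mul (by positivity), ENNReal.ofReal_pow hd.le, ofReal_measureReal,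
      ENNReal.ofReal_pow (by positivity)]
    exact (mul_le_mul_right (measure_mono hsub) _).trans (hch.trans (pow_le_pow_left₀ zero_le h6 6))
  rw [ENNReal.ofReal_le_ofReal_iff (by positivity)] at hch2
  refine hch2.trans (le_of_eq ?_)
  rw [mul_pow, show (6 : ℕ) = 2 * 3 from rfl, pow_mul √a, Real.sq_sqrt ha0]

/-- Stampacchia's theorem: a weak solution is bounded above. -/
lemma IsGradPair.exists_le {v : R3 → ℝ} {q b : R3 → R3} (h : IsGradPair v q)
    (hb : MemLp b 2 volQ)
    (horth : ∀ η ∈ testP (E := ℝ), ∫ x in cellQ, inner ℝ (gradient η x) (b x) = 0)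
    {lam L : ℝ} (hlam : 0 < lam) (hL : 0 ≤ L)
    (hell : ∀ᵐ x ∂volQ, lam * ‖q x‖ ^ 2 ≤ inner ℝ (q x) (b x) + L) :
    ∃ M, ∀ᵐ x ∂volQ, v x ≤ M := by
  obtain ⟨hv, hq, φ, hφ, h1, h2, h3⟩ := h
  -- A measurable representative, so that its level sets are measurable.
  set v' := hv.1.mk v with hv'
  have hve : v =ᵐ[volQ] v' := hv.1.ae_eq_mk
  have hvm : Measurable v' := hv.1.stronglyMeasurable_mk.measurable
  have h' : IsGradPair v' q := by
    refine .of_tendsto (hv.ae_eq hve) hq hφ (h1.congr fun n => l2_congr ?_) h2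
    filter_upwards [hve] with x hx
    rw [hx]
  obtain ⟨D, hD0, hD⟩ := level_set_decay h' hb horth hvm hlam hL hell
  have hanti : Antitone fun k => volQ.real {x | k ≤ v' x} := fun k l hkl =>
    measureReal_mono fun x hx => hkl.trans hx
  have hlim : Tendsto (fun k => volQ.real {x | k ≤ v' x}) atTop (𝓝 0) := by
    have e : ⋂ k : ℝ, {x | k ≤ v' x} = ∅ := by
      ext x
      simp only [Set.mem_iInter, Set.mem_ofPred_eq, Set.mem_empty_iff_false, iff_false, not_forall,
        not_le]
      exact ⟨v' x + 1, by linarith⟩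
    have ht := tendsto_measure_iInter_atTop (μ := volQ) (s := fun k : ℝ => {x | k ≤ v' x})
      (fun k => (measurableSet_le measurable_const hvm).nullMeasurableSet)
      (fun k l hkl x hx => hkl.trans hx) ⟨0, measure_ne_top _ _⟩
    rw [e, measure_empty] at ht
    exact (ENNReal.tendsto_toReal ENNReal.zero_ne_top).comp ht
  obtain ⟨M, hM⟩ := exists_eq_zero_of_iteration hanti (fun _ => measureReal_nonneg) hlim hD0 hD
  refine ⟨M, ?_⟩
  have hM' : volQ {x | M ≤ v' x} = 0 := by
    rwa [measureReal_eq_zero_iff] at hM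
  filter_upwards [hve, measure_eq_zero_iff_ae_notMem.1 hM'] with x hx hx2
  rw [hx]
  exact (not_le.1 hx2).le

/-- Weak solutions are bounded. -/
lemma IsGradPair.exists_abs_le {v : R3 → ℝ} {q b : R3 → R3} (h : IsGradPair v q)
    (hb : MemLp b 2 volQ)
    (horth : ∀ η ∈ testP (E := ℝ), ∫ x in cellQ, inner ℝ (gradient η x) (b x) = 0)
    {lam L : ℝ} (hlam : 0 < lam) (hL : 0 ≤ L)
    (hell : ∀ᵐ x ∂volQ, lam * ‖q x‖ ^ 2 ≤ inner ℝ (q x) (b x) + L) :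
    ∃ M, ∀ᵐ x ∂volQ, |v x| ≤ M := by
  obtain ⟨M, hM⟩ := h.exists_le hb horth hlam hL hell
  have hd : ∀ t : ℝ, deriv (fun s : ℝ => -s) t = -1 := fun t => by simp
  have hn := h.comp (G := fun s => -s) contDiff_neg (K := 1) (fun t => by rw [hd]; simp)
  simp only [hd, neg_smul, one_smul] at hn
  obtain ⟨M', hM'⟩ := hn.exists_le (b := fun x => -b x) hb.neg
    (fun η hη => by simp only [inner_neg_right, integral_neg, horth η hη, neg_zero]) hlam hL
    (by simpa only [norm_neg, inner_neg_neg] using hell)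
  refine ⟨max M M', ?_⟩
  filter_upwards [hM, hM'] with x h1 h2
  rw [abs_le]
  constructor
  · linarith [le_max_right M M']
  · exact h1.trans (le_max_left _ _)

/-- Bounded smooth approximants of a bounded weak solution. -/
lemma IsGradPair.exists_bounded_approx {v : R3 → ℝ} {q : R3 → R3} (h : IsGradPair v q) {M : ℝ}
    (hM : ∀ᵐ x ∂volQ, |v x| ≤ M) : ∃ (M' : ℝ) (η : ℕ → R3 → ℝ), 0 ≤ M' ∧ (∀ n, η n ∈ testP) ∧
      (∀ n x, |η n x| ≤ M') ∧
      Tendsto (fun n => l2 volQ fun x => gradient (η n) x - q x) atTop (𝓝 0) := by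
  have hM0 : 0 ≤ max M 0 := le_max_right _ _
  let χ : ContDiffBump (0 : ℝ) := ⟨max M 0 + 1, max M 0 + 2, by linarith, by linarith⟩
  -- A smooth compactly supported function that is the identity near the values of `v`. Composing
  -- the approximants with it makes them uniformly bounded, and since `G'(v) = 1` their gradients
  -- still converge to `q`.
  set G : ℝ → ℝ := fun t => t * χ t with hG
  have hGc : ContDiff ℝ ∞ G := contDiff_id.mul χ.contDiff
  have hGs : HasCompactSupport G := χ.hasCompactSupport.mul_left
  obtain ⟨K, hK⟩ := hGs.deriv.exists_bound_of_continuous (hGc.continuous_deriv (by simp))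
  obtain ⟨M', hM'⟩ := hGs.exists_bound_of_continuous hGc.continuous
  obtain ⟨hv, hq, φ, hφ, h1, h2, h3⟩ := h
  have hlim := (IsGradPair.tendsto_comp hv hq hφ h2 h3 hGc hK).2
  refine ⟨M', fun n x => G (φ n x), (norm_nonneg _).trans (hM' 0),
    fun n => comp_mem_testP (hφ n) hGc, fun n x => hM' _, hlim.congr fun n => l2_congr ?_⟩
  filter_upwards [hM] with x hx
  have hd : deriv G (v x) = 1 := by
    have h : G =ᶠ[𝓝 (v x)] fun t => t := by
      have hx' : v x ∈ Metric.ball (0 : ℝ) χ.rIn := by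
        rw [mem_ball_zero_iff, Real.norm_eq_abs]
        exact hx.trans_lt (lt_of_le_of_lt (le_max_left _ _) (lt_add_one _))
      filter_upwards [Metric.isOpen_ball.mem_nhds hx'] with t ht
      rw [hG]
      simp only
      rw [χ.one_of_mem_closedBall (Metric.ball_subset_closedBall ht), mul_one]
    rw [h.deriv_eq]; simp
  rw [hd, one_smul]

/-! ### A multiplier inequality for rescaled periodic fields -/

lemma ae_rescale_of_ae_cell {p : R3 → Prop} (hp : ∀ x n, p (x + ivec n) ↔ p x)
    (h : ∀ᵐ x ∂volQ, p x) {ε : ℝ} (hε : 0 < ε) : ∀ᵐ x : R3, p (ε⁻¹ • x) := by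
  have h1 : ∀ᵐ x : R3, p x := by
    rw [← Measure.restrict_univ (μ := volume), ← iUnion_cellT, ae_restrict_iUnion_iff]
    intro n
    have h2 := (measurePreserving_sub_ivec n).quasiMeasurePreserving.ae h
    filter_upwards [h2] with x hx
    rw [← hp _ n, sub_add_cancel] at hx
    exact hx
  have hq : Measure.QuasiMeasurePreserving (fun x : R3 => ε⁻¹ • x) volume volume := by
    refine ⟨measurable_const_smul _, ?_⟩
    rw [Measure.map_addHaar_smul _ (inv_ne_zero hε.ne')]
    exact Measure.smul_absolutelyContinuous
  exact hq.ae h1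

lemma gradient_rescale {φ : R3 → ℝ} (hφ : Differentiable ℝ φ) (ε : ℝ) (x : R3) :
    gradient (rescale ε φ) x = ε⁻¹ • rescale ε (gradient φ) x := by
  have h : HasFDerivAt (rescale ε φ)
      ((fderiv ℝ φ (ε⁻¹ • x)).comp (ε⁻¹ • ContinuousLinearMap.id ℝ R3)) x :=
    (hφ _).hasFDerivAt.comp x ((ContinuousLinearMap.id ℝ R3).hasFDerivAt.const_smul ε⁻¹)
  have e : (fderiv ℝ φ (ε⁻¹ • x)).comp (ε⁻¹ • ContinuousLinearMap.id ℝ R3) =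
      ε⁻¹ • fderiv ℝ φ (ε⁻¹ • x) := by ext y; simp
  rw [gradient, h.fderiv, e, map_smul]
  rfl

lemma gradient_mul {φ ψ : R3 → ℝ} (hφ : Differentiable ℝ φ) (hψ : Differentiable ℝ ψ) (x : R3) :
    gradient (fun y => φ y * ψ y) x = φ x • gradient ψ x + ψ x • gradient φ x := by
  rw [gradient, fderiv_fun_mul (hφ x) (hψ x), map_add, map_smul, map_smul]
  rfl

lemma memLp_gradient_of_mem_testC {f : R3 → ℝ} (hf : f ∈ testC) : MemLp (gradient f) 2 volume := by
  refine (continuous_gradient hf.1).memLp_of_hasCompactSupport ?_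
  exact (hf.2.fderiv (𝕜 := ℝ)).comp_left (map_zero (InnerProductSpace.toDual ℝ R3).symm)

lemma le_of_sq_le_quadratic {lam L X A B : ℝ} (hlam : 0 < lam) (hL : 0 ≤ L)
    (hA : 0 ≤ A) (hB : 0 ≤ B) (h : lam * X ^ 2 ≤ A * X + L * B ^ 2) :
    X ≤ A / lam + √(L / lam) * B := by
  by_contra hc
  rw [not_le] at hc
  have e1 : lam * (A / lam) = A := by field_simp
  have hs := Real.sq_sqrt (div_nonneg hL hlam.le)
  have e2 : lam * (√(L / lam) * B) ^ 2 = L * B ^ 2 := by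
    rw [mul_pow, hs]; field_simp
  set s := √(L / lam) * B
  have hs0 : 0 ≤ s := mul_nonneg (Real.sqrt_nonneg _) hB
  have hd : 0 ≤ A / lam := by positivity
  set a := A / lam
  have h1 : X ^ 2 ≤ a * X + s ^ 2 := by
    rw [← e2, ← e1] at h
    have : lam * X ^ 2 ≤ lam * (a * X + s ^ 2) := by linarith
    exact le_of_mul_le_mul_left this hlam
  nlinarith

/-- Test `div b(·/ε) = 0` with `η(·/ε) f²`, where `η` is a bounded approximant of the potential of
`q`. The product rule gives `∫ f² ∇η(·/ε)·b(·/ε) = -2ε ∫ η(·/ε) f ∇f·b(·/ε)`, and in the limit `∫ f²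
q·b ≤ 2Mε ‖∇f‖ X` with `X = ‖f b(·/ε)‖`. Ellipticity, `lam |b|² ≤ q·b + L`, turns this into a
quadratic inequality for `X`. Compact support of `f` guarantees beforehand that `X` is finite. -/
lemma exists_multiplier_real {b q : R3 → R3} (hbp : IsQPeriodic b) (hqp : IsQPeriodic q)
    (hb : MemLp b 2 volQ) (hq : MemLp q 2 volQ) {M : ℝ} (hM : 0 ≤ M) {η : ℕ → R3 → ℝ}
    (hη : ∀ n, η n ∈ testP) (hηM : ∀ n x, |η n x| ≤ M)
    (hlim : Tendsto (fun n => l2 volQ fun x => gradient (η n) x - q x) atTop (𝓝 0))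
    (horth : ∀ ε : ℝ, 0 < ε → ∀ φ ∈ testC (E := ℝ), ∫ x, inner ℝ (gradient φ x) (rescale ε b x) = 0)
    {lam L : ℝ} (hlam : 0 < lam) (hL : 0 ≤ L)
    (hell : ∀ᵐ x ∂volQ, lam * ‖b x‖ ^ 2 ≤ inner ℝ (q x) (b x) + L) :
    ∃ C : ℝ, 0 ≤ C ∧ ∀ ε : ℝ, 0 < ε → ∀ f ∈ testC (E := ℝ),
      MemLp (fun x => f x • rescale ε b x) 2 volume ∧
      l2 volume (fun x => f x • rescale ε b x) ≤ C * (l2 volume f + ε * l2 volume (gradient f)) := by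
  refine ⟨2 * M / lam + √(L / lam), by positivity, fun ε hε f hf => ?_⟩
  obtain ⟨R, hR⟩ := hf.2.isCompact.isBounded.subset_ball (0 : R3)
  have hfR : ∀ x, R ≤ ‖x‖ → f x = 0 := fun x hx => by
    by_contra h
    have := hR (subset_tsupport f h)
    rw [mem_ball_zero_iff] at this
    linarith
  obtain ⟨N, hN0, hN⟩ := exists_l2_smul_rescale_le hε R
  obtain ⟨K, hK⟩ := hf.2.exists_bound_of_continuous hf.1.continuous
  have hfm := hf.1.continuous.aestronglyMeasurable (μ := volume)
  have hfd := hf.1.differentiable (by simp)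
  have hgf := memLp_gradient_of_mem_testC hf
  have hf2 := memLp_of_mem_testC hf
  have hX := (hN R3 f K b hfm hK hfR hbp hb).1
  have hY := (hN R3 f K q hfm hK hfR hqp hq).1
  have hgη := fun n => memLp_gradient (hη n)
  have hgp := fun n => gradient_periodic (hη n).2
  have hYn := fun n => (hN R3 f K _ hfm hK hfR (hgp n) (hgη n)).1
  refine ⟨hX, ?_⟩
  set X := l2 volume fun x => f x • rescale ε b x with hXdef
  have hlimY : Tendsto (fun n => l2 volume fun x => f x • rescale ε (gradient (η n)) x -
      f x • rescale ε q x) atTop (𝓝 0) := by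
    have h0 := hlim.const_mul (N * K)
    rw [mul_zero] at h0
    refine squeeze_zero (fun n => l2_nonneg _) (fun n => ?_) h0
    have h1 := (hN R3 f K (fun x => gradient (η n) x - q x) hfm hK hfR
      (fun x m => by simp only [hgp n x m, hqp x m]) ((hgη n).sub hq)).2
    simpa only [rescale, smul_sub] using h1
  have hlimI := tendsto_integral_inner_left (𝕜 := ℝ) (.of_forall hYn) hY hX
    (tendsto_eLpNorm_of_l2 (fun n => (hYn n).sub hY) hlimY)
  have hbn : ∀ n, ∫ x, inner ℝ (f x • rescale ε (gradient (η n)) x) (f x • rescale ε b x) ≤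
      2 * M * ε * l2 volume (gradient f) * X := by
    intro n
    have hrd := (contDiff_rescale (hη n).1 ε).differentiable (by simp)
    have hT : (fun x => rescale ε (η n) x * (f x * f x)) ∈ testC (E := ℝ) :=
      ⟨(contDiff_rescale (hη n).1 ε).mul (hf.1.mul hf.1), (hf.2.mul_left).mul_left⟩
    have h0 := horth ε hε _ hT
    have hZ : MemLp (fun x => (2 * rescale ε (η n) x) • gradient f x) 2 volume := by
      have hm : AEStronglyMeasurable (fun x => 2 * rescale ε (η n) x) volume :=
        (continuous_const.mul (contDiff_rescale (hη n).1 ε).continuous).aestronglyMeasurable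
      refine (hgf.norm.const_mul (2 * M)).mono' (hm.smul hgf.1) (.of_forall fun x => ?_)
      rw [norm_smul, norm_mul, Real.norm_eq_abs, Real.norm_eq_abs, abs_two]
      gcongr
      exact hηM n _
    have e : ∀ x, inner ℝ (gradient (fun x => rescale ε (η n) x * (f x * f x)) x) (rescale ε b x) =
        ε⁻¹ * inner ℝ (f x • rescale ε (gradient (η n)) x) (f x • rescale ε b x) +
        inner ℝ ((2 * rescale ε (η n) x) • gradient f x) (f x • rescale ε b x) := by
      intro x
      rw [gradient_mul hrd (hfd.fun_mul hfd), gradient_mul hfd hfd,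
        gradient_rescale ((hη n).1.differentiable (by simp))]
      simp only [inner_add_left, inner_smul_left, inner_smul_right, smul_add, conj_trivial]
      ring
    simp only [e] at h0
    rw [integral_add ((integrable_inner (hYn n) hX).const_mul _) (integrable_inner hZ hX),
      integral_const_mul] at h0
    have hb1 := norm_integral_inner_le (𝕜 := ℝ) hZ hX
    have hb2 : l2 volume (fun x => (2 * rescale ε (η n) x) • gradient f x) ≤
        2 * M * l2 volume (gradient f) := by
      refine l2_mono (by positivity) hgf (.of_forall fun x => ?_)
      rw [norm_smul, norm_mul, Real.norm_eq_abs, Real.norm_eq_abs, abs_two]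
      gcongr
      exact hηM n _
    have hb3 := hb1.trans (mul_le_mul_of_nonneg_right hb2 (l2_nonneg _))
    rw [Real.norm_eq_abs] at hb3
    have hb4 := (abs_le.1 hb3).1
    have hI : ∫ x, inner ℝ (f x • rescale ε (gradient (η n)) x) (f x • rescale ε b x) =
        -ε * ∫ x, inner ℝ ((2 * rescale ε (η n) x) • gradient f x) (f x • rescale ε b x) := by
      field_simp at h0
      linarith
    rw [hI]
    nlinarith
  have hYX := le_of_tendsto' hlimI hbn
  have hae := ae_rescale_of_ae_cell (p := fun x => lam * ‖b x‖ ^ 2 ≤ inner ℝ (q x) (b x) + L)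
    (fun x n => by
      have h1 : b (x + ivec n) = b x := hbp x n
      have h2 : q (x + ivec n) = q x := hqp x n
      rw [h1, h2]) hell hε
  -- Multiply the ellipticity inequality by `f²` and integrate.
  have hmain : lam * X ^ 2 ≤ (2 * M * ε * l2 volume (gradient f)) * X + L * l2 volume f ^ 2 := by
    rw [l2_sq hf2]
    refine le_trans ?_ (add_le_add hYX le_rfl)
    rw [hXdef, l2_sq hX, ← integral_const_mul, ← integral_const_mul,
      ← integral_add (integrable_inner hY hX) ((integrable_norm_sq hf2).const_mul L)]
    refine integral_mono_ae ((integrable_norm_sq hX).const_mul lam)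
      ((integrable_inner hY hX).add ((integrable_norm_sq hf2).const_mul L)) ?_
    filter_upwards [hae] with x hx
    rw [inner_smul_left, inner_smul_right, norm_smul, mul_pow, Real.norm_eq_abs, sq_abs]
    simp only [conj_trivial]
    have := mul_le_mul_of_nonneg_left hx (sq_nonneg (f x))
    simp only [rescale]
    nlinarith
  have hg0 := l2_nonneg (ν := volume) (gradient f)
  have hf0 := l2_nonneg (ν := volume) f
  have hfin := le_of_sq_le_quadratic hlam hL (by positivity) hf0 hmain
  refine hfin.trans ?_
  have p1 : 0 ≤ √(L / lam) * (ε * l2 volume (gradient f)) := by positivity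
  have p2 : 0 ≤ 2 * M / lam * l2 volume f := by positivity
  have : 2 * M * ε * l2 volume (gradient f) / lam = 2 * M / lam * (ε * l2 volume (gradient f)) := by
    ring
  rw [this]
  linarith

/-! ### Real and imaginary parts -/

/-- The real part of a complex vector. -/
def reV : C3 →L[ℝ] R3 := LinearMap.toContinuousLinearMap
  { toFun := fun v => WithLp.toLp 2 fun i => (v i).re
    map_add' := fun u v => by ext i; simp
    map_smul' := fun c v => by ext i; simp }

lemma reV_apply (v : C3) (i : Fin 3) : reV v i = (v i).re := rfl

/-- The imaginary part is the real part of `-i` times the vector. -/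
lemma reV_neg_I_smul (v : C3) (i : Fin 3) : reV (-Complex.I • v) i = (v i).im := by
  simp [reV_apply]

lemma norm_sq_eq_reV (v : C3) : ‖v‖ ^ 2 = ‖reV v‖ ^ 2 + ‖reV (-Complex.I • v)‖ ^ 2 := by
  rw [EuclideanSpace.norm_sq_eq, EuclideanSpace.norm_sq_eq, EuclideanSpace.norm_sq_eq,
    ← Finset.sum_add_distrib]
  refine Finset.sum_congr rfl fun i _ => ?_
  rw [reV_neg_I_smul, reV_apply, ← Complex.normSq_eq_norm_sq, Complex.normSq_apply]
  simp; ring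

lemma norm_reV_le (v : C3) : ‖reV v‖ ≤ ‖v‖ := by
  have h := norm_sq_eq_reV v
  exact le_of_sq_le_sq (by nlinarith [sq_nonneg ‖reV (-Complex.I • v)‖]) (norm_nonneg _)

lemma memLp_reV {α : Type*} [MeasurableSpace α] {ν : Measure α} {f : α → C3} (h : MemLp f 2 ν) :
    MemLp (fun x => reV (f x)) 2 ν := reV.comp_memLp' h

lemma gradient_apply (φ : R3 → ℝ) (x : R3) (i : Fin 3) :
    gradient φ x i = fderiv ℝ φ x (EuclideanSpace.single i 1) := by
  rw [← inner_gradient_left, EuclideanSpace.inner_single_right]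
  simp

lemma grad_ofReal {φ : R3 → ℝ} (hφ : Differentiable ℝ φ) (x : R3) (i : Fin 3) :
    grad (fun y => (φ y : ℂ)) x i = (gradient φ x i : ℝ) := by
  have h : HasFDerivAt (fun y => (φ y : ℂ)) (Complex.ofRealCLM.comp (fderiv ℝ φ x)) x :=
    Complex.ofRealCLM.hasFDerivAt.comp x (hφ x).hasFDerivAt
  rw [grad_apply, pd, h.fderiv, gradient_apply]
  rfl

lemma reV_grad {f : R3 → ℂ} (hf : Differentiable ℝ f) (x : R3) :
    reV (grad f x) = gradient (fun y => (f y).re) x := by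
  have h : HasFDerivAt (fun y => (f y).re) (Complex.reCLM.comp (fderiv ℝ f x)) x :=
    Complex.reCLM.hasFDerivAt.comp x (hf x).hasFDerivAt
  ext i
  rw [gradient_apply, h.fderiv, reV_apply, grad_apply]
  rfl

lemma inner_gradient_reV {φ : R3 → ℝ} (hφ : Differentiable ℝ φ) (x : R3) (v : C3) :
    inner ℝ (gradient φ x) (reV v) = (inner ℂ (grad (fun y => (φ y : ℂ)) x) v).re := by
  simp only [PiLp.inner_apply, grad_ofReal hφ, Complex.re_sum]
  refine Finset.sum_congr rfl fun i _ => ?_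
  simp [reV_apply]

/-! ### Solenoidal periodic fields -/

/-- `b` is periodic and `b - e` is a limit in `L²(Q)` of curls of smooth periodic fields. -/
structure IsFlux (b : R3 → C3) (e : C3) : Prop where
  per : IsQPeriodic b
  memLp : MemLp b 2 volQ
  approx : ∃ φ : ℕ → R3 → C3, (∀ n, φ n ∈ testP) ∧
    Tendsto (fun n => l2 volQ fun x => (curl (φ n) x + e) - b x) atTop (𝓝 0)

lemma const_mem_testP {E : Type*} [NormedAddCommGroup E] [NormedSpace ℝ E] (e : E) :
    (fun _ => e) ∈ testP (E := E) := ⟨contDiff_const, fun _ _ => rfl⟩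

lemma add_mem_testP {E : Type*} [NormedAddCommGroup E] [NormedSpace ℝ E] {u v : R3 → E}
    (hu : u ∈ testP) (hv : v ∈ testP) : (fun x => u x + v x) ∈ testP (E := E) :=
  ⟨hu.1.add hv.1, fun x n => by simp only [hu.2 x n, hv.2 x n]⟩

lemma mul_mem_testP {f g : R3 → ℂ} (hf : f ∈ testP) (hg : g ∈ testP) :
    (fun x => f x * g x) ∈ testP (E := ℂ) :=
  ⟨hf.1.mul hg.1, fun x n => by simp only [hf.2 x n, hg.2 x n]⟩

lemma conj_mem_testP {f : R3 → ℂ} (hf : f ∈ testP) :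
    (fun x => (starRingEnd ℂ) (f x)) ∈ testP (E := ℂ) :=
  ⟨(Complex.conjCLE : ℂ →L[ℝ] ℂ).contDiff.comp hf.1, fun x n => by simp only [hf.2 x n]⟩

lemma integrable_of_mem_testP {E : Type*} [NormedAddCommGroup E] [NormedSpace ℝ E] {v : R3 → E}
    (hv : v ∈ testP) : Integrable v volQ := (memLp_of_mem_testP hv).integrable (by norm_num)

/-- The derivative of a product of periodic functions has mean zero, so integration by parts on the
cell has no boundary terms. -/
lemma integral_cell_conj_mul_pd (hmean : GradMeanZero volume) {f g : R3 → ℂ} (hf : f ∈ testP)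
    (hg : g ∈ testP) (j : Fin 3) :
    ∫ x in cellQ, (starRingEnd ℂ) (f x) * pd j g x =
      -∫ x in cellQ, (starRingEnd ℂ) (pd j f x) * g x := by
  have h := hmean _ (mul_mem_testP (conj_mem_testP hf) hg) j
  have e : ∀ x, pd j (fun x => (starRingEnd ℂ) (f x) * g x) x =
      (starRingEnd ℂ) (f x) * pd j g x + (starRingEnd ℂ) (pd j f x) * g x := fun x => by
    rw [pd_mul ((conj_mem_testP hf).1.differentiable (by simp)) (hg.1.differentiable (by simp)),
      pd_conj (hf.1.differentiable (by simp))]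
  simp only [e] at h
  rw [integral_add] at h
  · exact eq_neg_of_add_eq_zero_left h
  · exact integrable_of_mem_testP (mul_mem_testP (conj_mem_testP hf) (pd_mem_testP hg j))
  · exact integrable_of_mem_testP (mul_mem_testP (conj_mem_testP (pd_mem_testP hf j)) hg)

lemma integral_cell_inner_curl (hmean : GradMeanZero volume) {u w : R3 → C3} (hu : u ∈ testP)
    (hw : w ∈ testP) :
    ∫ x in cellQ, inner ℂ (u x) (curl w x) = ∫ x in cellQ, inner ℂ (curl u x) (w x) :=
  integral_inner_curl_of
    (fun i j k => integrable_of_mem_testP (mul_mem_testP (conj_mem_testP (apply_mem_testP hu i))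
      (pd_mem_testP (apply_mem_testP hw k) j)))
    (fun i j k => integrable_of_mem_testP (mul_mem_testP
      (conj_mem_testP (pd_mem_testP (apply_mem_testP hu i) j)) (apply_mem_testP hw k)))
    fun i j k => integral_cell_conj_mul_pd hmean (apply_mem_testP hu i) (apply_mem_testP hw k) j

lemma integral_cell_inner_grad_curl (hmean : GradMeanZero volume) {η : R3 → ℂ} {φ : R3 → C3}
    (hη : η ∈ testP) (hφ : φ ∈ testP) :
    ∫ x in cellQ, inner ℂ (grad η x) (curl φ x) = 0 := by
  rw [integral_cell_inner_curl hmean (grad_mem_testP hη) hφ]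
  simp [curl_grad hη.1]

lemma integral_cell_grad (hmean : GradMeanZero volume) {η : R3 → ℂ} (hη : η ∈ testP) :
    ∫ x in cellQ, grad η x = 0 := by
  ext j
  have h := (EuclideanSpace.proj (𝕜 := ℂ) j).integral_comp_comm
    (integrable_of_mem_testP (grad_mem_testP hη))
  refine h.symm.trans ?_
  exact hmean _ hη j

lemma integral_cell_inner_grad_const (hmean : GradMeanZero volume) {η : R3 → ℂ}
    (hη : η ∈ testP) (e : C3) : ∫ x in cellQ, inner ℂ (grad η x) e = 0 := by
  rw [integral_inner_conj, integral_inner (integrable_of_mem_testP (grad_mem_testP hη)),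
    integral_cell_grad hmean hη]
  simp

lemma IsFlux.integral_cell (hmean : GradMeanZero volume) {b : R3 → C3} {e : C3} (h : IsFlux b e)
    {η : R3 → ℂ} (hη : η ∈ testP) : ∫ x in cellQ, inner ℂ (grad η x) (b x) = 0 := by
  obtain ⟨φ, hφ, hlim⟩ := h.approx
  have hc := fun n => memLp_of_mem_testP (curl_mem_testP (hφ n))
  have hm := fun n => memLp_of_mem_testP (add_mem_testP (curl_mem_testP (hφ n)) (const_mem_testP e))
  have hg := memLp_of_mem_testP (grad_mem_testP hη)
  have hL := tendsto_integral_inner_right (𝕜 := ℂ) (.of_forall hm) h.memLp hg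
    (tendsto_eLpNorm_of_l2 (fun n => (hm n).sub h.memLp) hlim)
  refine tendsto_nhds_unique hL (tendsto_const_nhds.congr fun n => ?_)
  rw [integral_inner_add_right hg (hc n) (memLp_const e), integral_cell_inner_grad_curl hmean hη (hφ n),
    integral_cell_inner_grad_const hmean hη, add_zero]

lemma grad_mem_testC {η : R3 → ℂ} (hη : η ∈ testC) : grad η ∈ testC (E := C3) :=
  ⟨contDiff_grad hη.1, hasCompactSupport_toLp fun j => hasCompactSupport_pd hη.2 j⟩

lemma integral_inner_grad_const {η : R3 → ℂ} (hη : η ∈ testC) (e : C3) :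
    ∫ x, inner ℂ (grad η x) e = 0 := by
  have hi := integrable_of_mem_testC (grad_mem_testC hη)
  rw [integral_inner_conj, integral_inner hi]
  have h0 : ∫ x, grad η x = 0 := by
    ext j
    have h := (EuclideanSpace.proj (𝕜 := ℂ) j).integral_comp_comm hi
    refine h.symm.trans ?_
    have h2 := integral_conj_mul_pd (g := fun _ => (1 : ℂ)) hη contDiff_const j
    simp only [pd_const, mul_zero, integral_zero, mul_one] at h2
    have h3 := (neg_eq_zero.1 h2.symm)
    rw [integral_conj] at h3
    exact (map_eq_zero _).1 h3
  rw [h0]; simp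

lemma exists_bounds_of_mem_testC {E : Type*} [NormedAddCommGroup E] [NormedSpace ℝ E] {f : R3 → E}
    (hf : f ∈ testC) : ∃ K R : ℝ, (∀ x, ‖f x‖ ≤ K) ∧ ∀ x, R ≤ ‖x‖ → f x = 0 := by
  obtain ⟨R, hR⟩ := hf.2.isCompact.isBounded.subset_ball (0 : R3)
  obtain ⟨K, hK⟩ := hf.2.exists_bound_of_continuous hf.1.continuous
  refine ⟨K, R, hK, fun x hx => ?_⟩
  by_contra h
  have := hR (subset_tsupport f h)
  rw [mem_ball_zero_iff] at this
  linarith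

/-- Since `(curl φ)(·/ε) = ε curl(φ(·/ε))`, rescaled periodic curls are curls on the whole space,
hence orthogonal to gradients of compactly supported functions. Only finitely many cells meet the
support of the test function, so convergence in `L²(Q)` is enough for the limit. -/
lemma IsFlux.integral_rescale {b : R3 → C3} {e : C3} (h : IsFlux b e) {η : R3 → ℂ}
    (hη : η ∈ testC) {ε : ℝ} (hε : 0 < ε) :
    ∫ x, inner ℂ (grad η x) (rescale ε b x) = 0 := by
  obtain ⟨φ, hφ, hlim⟩ := h.approx
  have hgT := grad_mem_testC hη
  obtain ⟨K, R, hK, hR⟩ := exists_bounds_of_mem_testC hgT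
  obtain ⟨N, hN0, hN⟩ := exists_l2_smul_rescale_le hε R
  -- a weight equal to one on the support of the test field
  set c : R3 → ℝ := (Metric.ball (0 : R3) R).indicator fun _ => 1 with hc
  have hcm : AEStronglyMeasurable c volume :=
    (stronglyMeasurable_const.indicator measurableSet_ball).aestronglyMeasurable
  have hc1 : ∀ x, |c x| ≤ 1 := fun x => by
    rw [hc]; by_cases hx : x ∈ Metric.ball (0 : R3) R <;> simp [hx]
  have hcR : ∀ x, R ≤ ‖x‖ → c x = 0 := fun x hx =>
    Set.indicator_of_notMem (by rw [mem_ball_zero_iff, not_lt]; exact hx) _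
  have hcg : ∀ (w : R3 → C3) x, inner ℂ (grad η x) (w x) = inner ℂ (grad η x) (c x • w x) := by
    intro w x
    by_cases hx : x ∈ Metric.ball (0 : R3) R
    · rw [hc, Set.indicator_of_mem hx, one_smul]
    · rw [hR x (by rwa [mem_ball_zero_iff, not_lt] at hx)]; simp
  have hbT : ∀ n, (fun x => curl (φ n) x + e) ∈ testP (E := C3) := fun n =>
    add_mem_testP (curl_mem_testP (hφ n)) (const_mem_testP e)
  have hm := fun n => memLp_of_mem_testP (hbT n)
  have hX := (hN C3 c 1 b hcm hc1 hcR h.per h.memLp).1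
  have hXn := fun n => (hN C3 c 1 _ hcm hc1 hcR (hbT n).2 (hm n)).1
  have hl : Tendsto (fun n => l2 volume fun x => c x • rescale ε (fun x => curl (φ n) x + e) x -
      c x • rescale ε b x) atTop (𝓝 0) := by
    have h0 := hlim.const_mul (N * 1)
    rw [mul_zero] at h0
    refine squeeze_zero (fun n => l2_nonneg _) (fun n => ?_) h0
    have h1 := (hN C3 c 1 (fun x => (curl (φ n) x + e) - b x) hcm hc1 hcR
      (fun x m => by simp only [(curl_mem_testP (hφ n)).2 x m, h.per x m]) ((hm n).sub h.memLp)).2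
    simpa only [rescale, smul_sub] using h1
  have hL := tendsto_integral_inner_right (𝕜 := ℂ) (.of_forall hXn) hX (memLp_of_mem_testC hgT)
    (tendsto_eLpNorm_of_l2 (fun n => (hXn n).sub hX) hl)
  simp only [← hcg] at hL
  refine tendsto_nhds_unique hL (tendsto_const_nhds.congr fun n => ?_)
  have hrs := contDiff_rescale (hφ n).1 ε
  have e1 : ∀ x, rescale ε (fun x => curl (φ n) x + e) x =
      (ε : ℂ) • curl (rescale ε (φ n)) x + e := by
    intro x
    rw [curl_rescale ((hφ n).1.differentiable (by simp)), smul_smul, ← Complex.ofReal_mul,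
      mul_inv_cancel₀ hε.ne', Complex.ofReal_one, one_smul]
    rfl
  have hi1 : Integrable fun x => inner ℂ (grad η x) ((ε : ℂ) • curl (rescale ε (φ n)) x) := by
    refine Continuous.integrable_of_hasCompactSupport (hgT.1.continuous.inner
      ((contDiff_curl hrs).continuous.const_smul (ε : ℂ))) ?_
    exact hgT.2.mono fun x hx => by
      rw [Function.mem_support] at hx ⊢
      exact fun h => hx (by rw [h, inner_zero_left])
  have hi2 : Integrable fun x => inner ℂ (grad η x) e := by
    refine Continuous.integrable_of_hasCompactSupport (hgT.1.continuous.inner continuous_const) ?_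
    exact hgT.2.mono fun x hx => by
      rw [Function.mem_support] at hx ⊢
      exact fun h => hx (by rw [h, inner_zero_left])
  simp only [e1, inner_add_right]
  rw [integral_add hi1 hi2, integral_inner_grad_const hη, add_zero]
  simp only [inner_smul_right]
  rw [integral_const_mul, integral_inner_curl hgT hrs]
  simp [curl_grad hη.1]

/-! ### The multiplier inequality for complex fields -/

/-- The complexification of a real vector. -/
def ofV (r : R3) : C3 := WithLp.toLp 2 fun i => (r i : ℂ)

lemma norm_ofV (r : R3) : ‖ofV r‖ = ‖r‖ := by
  simp [EuclideanSpace.norm_eq, ofV]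

lemma reV_mv_cx (M : RMat) (v : C3) : reV (mv (cx M) v) = reV (mv (cx M) (ofV (reV v))) := by
  ext i
  simp [reV_apply, mv_apply, cx, ofV]

lemma inner_reV_ofV (r : R3) (v : C3) : inner ℝ (reV v) r = (inner ℂ (ofV r) v).re := by
  simp only [PiLp.inner_apply, Complex.re_sum]
  refine Finset.sum_congr rfl fun i _ => ?_
  simp [reV_apply, ofV, mul_comm]

lemma Coef.norm_reV_mv_le {A : R3 → RMat} {α β : ℝ} (h : Coef (fun x => cx (A x)) α β) (x : R3)
    (v : C3) : ‖reV (mv (cx (A x)) v)‖ ≤ β * ‖reV v‖ := by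
  rw [reV_mv_cx]
  refine (norm_reV_le _).trans ((h.bdd x _).trans (le_of_eq ?_))
  rw [norm_ofV]

lemma Coef.le_inner_reV {A : R3 → RMat} {α β : ℝ} (h : Coef (fun x => cx (A x)) α β) (x : R3)
    (v : C3) : α * ‖reV v‖ ^ 2 ≤ inner ℝ (reV (mv (cx (A x)) v)) (reV v) := by
  rw [reV_mv_cx, inner_reV_ofV, ← norm_ofV]
  exact h.coer x _

/-- The real-valued form of the energy bound of `q = A b - c`. -/
lemma Coef.energy_reV {A : R3 → RMat} {α β : ℝ} (h : Coef (fun x => cx (A x)) α β) (x : R3)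
    (b c : C3) :
    α / 2 * ‖reV b‖ ^ 2 ≤ inner ℝ (reV (mv (cx (A x)) b - c)) (reV b) + ‖c‖ ^ 2 / (2 * α) ∧
    α / (4 * β ^ 2) * ‖reV (mv (cx (A x)) b - c)‖ ^ 2 ≤
      inner ℝ (reV (mv (cx (A x)) b - c)) (reV b) +
        (‖c‖ ^ 2 / (2 * α) + α / (2 * β ^ 2) * ‖c‖ ^ 2) := by
  have hα := h.pos
  have hβ := h.bdd_pos
  have h1 := h.le_inner_reV x b
  have h2 := h.norm_reV_mv_le x b
  rw [map_sub, inner_sub_left]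
  have h3 : inner ℝ (reV c) (reV b) ≤ ‖c‖ * ‖reV b‖ :=
    (real_inner_le_norm _ _).trans (by gcongr; exact norm_reV_le c)
  set r := ‖reV b‖
  set s := ‖c‖
  have hr : 0 ≤ r := norm_nonneg _
  have hs : 0 ≤ s := norm_nonneg _
  have h4 : s * r ≤ α / 2 * r ^ 2 + s ^ 2 / (2 * α) := by
    have : α / 2 * r ^ 2 + s ^ 2 / (2 * α) - s * r = (α * r - s) ^ 2 / (2 * α) := by
      field_simp; ring
    have h0 : 0 ≤ (α * r - s) ^ 2 / (2 * α) := by positivity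
    linarith
  -- The bound just proved, in terms of `b`, is the ellipticity used in the multiplier inequality;
  -- the remaining one, in terms of `q = A b - c`, is the ellipticity used in Stampacchia's
  -- argument.
  refine ⟨by linarith, ?_⟩
  have h5 : ‖reV (mv (cx (A x)) b) - reV c‖ ≤ β * r + s :=
    (norm_sub_le _ _).trans (add_le_add h2 (norm_reV_le c))
  have h6 : ‖reV (mv (cx (A x)) b) - reV c‖ ^ 2 ≤ 2 * β ^ 2 * r ^ 2 + 2 * s ^ 2 := by
    have := pow_le_pow_left₀ (norm_nonneg _) h5 2
    nlinarith [sq_nonneg (β * r - s)]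
  have h7 : α / (4 * β ^ 2) * ‖reV (mv (cx (A x)) b) - reV c‖ ^ 2 ≤
      α / (4 * β ^ 2) * (2 * β ^ 2 * r ^ 2 + 2 * s ^ 2) := by gcongr
  have h8 : α / (4 * β ^ 2) * (2 * β ^ 2 * r ^ 2 + 2 * s ^ 2) =
      α / 2 * r ^ 2 + α / (2 * β ^ 2) * s ^ 2 := by field_simp; ring
  linarith

/-! ### Real parts of gradient pairs and the multiplier inequality for complex fields -/

section
lemma IsQuasiGrad.exists_approx {p : R3 → ℂ} {q : R3 → C3} (h : IsQuasiGrad volume 0 p q) :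
    ∃ φ : ℕ → R3 → ℂ, (∀ n, φ n ∈ testP) ∧
      Tendsto (fun n => l2 volQ fun x => φ n x - p x) atTop (𝓝 0) ∧
      Tendsto (fun n => l2 volQ fun x => grad (φ n) x - q x) atTop (𝓝 0) := by
  obtain ⟨hp, hq, φ, hφ, h1, h2⟩ := h
  simp only [expi_zero_left, one_mul] at h2
  exact ⟨φ, fun n => (hφ n).1, tendsto_l2_of_eLpNorm h1, tendsto_l2_of_eLpNorm h2⟩

lemma const_mul_mem_testP {f : R3 → ℂ} (hf : f ∈ testP) (c : ℂ) :
    (fun x => c * f x) ∈ testP (E := ℂ) := mul_mem_testP (const_mem_testP c) hf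

/-- The factor `σ` treats the real part, `σ = 1`, and the imaginary part, `σ = -i`, at once. -/
lemma isGradPair_re {p : R3 → ℂ} {q : R3 → C3} (h : IsQuasiGrad volume 0 p q) (σ : ℂ) :
    IsGradPair (fun x => (σ * p x).re) fun x => reV (σ • q x) := by
  obtain ⟨φ, hφ, h1, h2⟩ := IsQuasiGrad.exists_approx h
  obtain ⟨hp, hq, -⟩ := h
  have hm := fun n => memLp_of_mem_testP (hφ n)
  have hg := fun n => memLp_of_mem_testP (grad_mem_testP (hφ n))
  have hσ := fun n => const_mul_mem_testP (hφ n) σ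
  refine .of_tendsto (φ := fun n x => (σ * φ n x).re) ?_ (memLp_reV (hq.const_smul σ))
    (fun n => ⟨Complex.reCLM.contDiff.comp (hσ n).1, fun x m => by simp only [(hφ n).2 x m]⟩) ?_ ?_
  · exact (Complex.reCLM).comp_memLp' (hp.const_mul σ)
  · have h0 := h1.const_mul ‖σ‖
    rw [mul_zero] at h0
    refine squeeze_zero (fun n => l2_nonneg _) (fun n => l2_mono (norm_nonneg _) ((hm n).sub hp)
      (.of_forall fun x => ?_)) h0
    rw [← Complex.sub_re, ← mul_sub, ← norm_mul]
    exact Complex.abs_re_le_norm _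
  · have h0 := h2.const_mul ‖σ‖
    rw [mul_zero] at h0
    refine squeeze_zero (fun n => l2_nonneg _) (fun n => l2_mono (norm_nonneg _) ((hg n).sub hq)
      (.of_forall fun x => ?_)) h0
    rw [← reV_grad ((hσ n).1.differentiable (by simp)),
      grad_const_mul ((hφ n).1.differentiable (by simp)), ← map_sub, ← smul_sub]
    refine (norm_reV_le _).trans ?_
    rw [norm_smul]
    rfl

lemma ofReal_mem_testP {η : R3 → ℝ} (hη : η ∈ testP) : (fun x => (η x : ℂ)) ∈ testP (E := ℂ) :=
  ⟨Complex.ofRealCLM.contDiff.comp hη.1, fun x n => by simp only [hη.2 x n]⟩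

lemma ofReal_mem_testC {η : R3 → ℝ} (hη : η ∈ testC) : (fun x => (η x : ℂ)) ∈ testC (E := ℂ) :=
  ⟨Complex.ofRealCLM.contDiff.comp hη.1, hη.2.comp_left (g := fun t : ℝ => (t : ℂ)) (by simp)⟩

section
variable {A : R3 → RMat} {α β : ℝ} {b : R3 → C3} {e c : C3} {p : R3 → ℂ} {q : R3 → C3}

lemma smul_periodic (hb : IsQPeriodic b) (σ : ℂ) : IsQPeriodic fun x => reV (σ • b x) :=
  fun x n => by simp only [hb x n]

/-- The coefficient is real, so the real and imaginary parts of `b` and `q` separately satisfy the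
scalar real problem: the potential is bounded by Stampacchia's theorem, and then
`exists_multiplier_real` applies. -/
lemma exists_multiplier_reV (hmean : GradMeanZero volume) (hA : Coef (fun x => cx (A x)) α β)
    (hb : IsFlux b e) (hpq : IsQuasiGrad volume 0 p q)
    (hq : ∀ᵐ x ∂volQ, q x = mv (cx (A x)) (b x) - c) (σ : ℂ) :
    ∃ C : ℝ, 0 ≤ C ∧ ∀ ε : ℝ, 0 < ε → ∀ f ∈ testC (E := ℝ),
      MemLp (fun x => f x • rescale ε (fun y => reV (σ • b y)) x) 2 volume ∧
      l2 volume (fun x => f x • rescale ε (fun y => reV (σ • b y)) x) ≤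
        C * (l2 volume f + ε * l2 volume (gradient f)) := by
  have hα := hA.pos
  have hβ := hA.bdd_pos
  have hσb : MemLp (fun x => reV (σ • b x)) 2 volQ := memLp_reV (hb.memLp.const_smul σ)
  have hQm : MemLp (fun x => mv (cx (A x)) (b x) - c) 2 volQ :=
    (hA.memLp hb.memLp).sub (memLp_const c)
  have hp0 := isGradPair_re hpq σ
  have hp : IsGradPair (fun x => (σ * p x).re) fun x => reV (σ • (mv (cx (A x)) (b x) - c)) := by
    obtain ⟨h1, h2, φ, h3, h4, h5, h6⟩ := hp0
    refine ⟨h1, memLp_reV (hQm.const_smul σ), φ, h3, h4, h5.congr fun n => l2_congr ?_, h6⟩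
    filter_upwards [hq] with x hx
    rw [hx]
  have hens := fun x => hA.energy_reV x (σ • b x) (σ • c)
  have e1 : ∀ x, mv (cx (A x)) (σ • b x) - σ • c = σ • (mv (cx (A x)) (b x) - c) := fun x => by
    rw [mv_smul, smul_sub]
  simp only [e1] at hens
  have horth : ∀ η ∈ testP (E := ℝ),
      ∫ x in cellQ, inner ℝ (gradient η x) (reV (σ • b x)) = 0 := fun η hη => by
    have hT := ofReal_mem_testP hη
    have h0 := hb.integral_cell hmean hT
    have hi := integrable_inner (𝕜 := ℂ) (memLp_of_mem_testP (grad_mem_testP hT))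
      (hb.memLp.const_smul σ)
    have h1 := integral_re hi
    simp only [inner_gradient_reV (hη.1.differentiable (by simp))]
    refine h1.trans ?_
    simp only [Pi.smul_apply, inner_smul_right]
    rw [integral_const_mul, h0]; simp
  obtain ⟨M, hM⟩ := hp.exists_abs_le hσb horth (lam := α / (4 * β ^ 2)) (by positivity)
    (by positivity) (.of_forall fun x => (hens x).2)
  obtain ⟨M', η, hM0, hη, hηM, hlim⟩ := hp.exists_bounded_approx hM
  refine exists_multiplier_real (smul_periodic hb.per σ) (q := fun x =>
    reV (σ • (mv (cx (A x)) (b x) - c))) (fun x n => ?_) hσb (memLp_reV (hQm.const_smul σ)) hM0 hη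
    hηM hlim (fun ε hε φ hφ => ?_) (half_pos hα) (L := ‖σ • c‖ ^ 2 / (2 * α)) (by positivity)
    (.of_forall fun x => (hens x).1)
  · have h1 : cx (A (x + WithLp.toLp 2 fun i => (n i : ℝ))) = cx (A x) := hA.per x n
    simp only [h1, hb.per x n]
  · have hT := ofReal_mem_testC hφ
    have h0 := hb.integral_rescale hT hε
    have hr : ∀ x, rescale ε (fun y => reV (σ • b y)) x = reV (σ • rescale ε b x) := fun _ => rfl
    simp only [hr, inner_gradient_reV (hφ.1.differentiable (by simp)), inner_smul_right]
    -- Integrability always holds, because the test function has compact support and `b` is locally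
    -- square integrable. It is needed to exchange the real part with the integral; the second
    -- branch refutes its negation.
    by_cases hi : Integrable fun x => inner ℂ (grad (fun y => (φ y : ℂ)) x) (rescale ε b x)
    · refine (integral_re (hi.const_mul σ)).trans ?_
      rw [integral_const_mul, h0]; simp
    · exfalso
      apply hi
      have hgT := grad_mem_testC hT
      obtain ⟨K, R, hK, hR⟩ := exists_bounds_of_mem_testC hgT
      obtain ⟨N, -, hN⟩ := exists_l2_smul_rescale_le hε R
      set c : R3 → ℝ := (Metric.ball (0 : R3) R).indicator fun _ => 1 with hc
      have hX := (hN C3 c 1 b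
        (stronglyMeasurable_const.indicator measurableSet_ball).aestronglyMeasurable
        (fun x => by rw [hc]; by_cases hx : x ∈ Metric.ball (0 : R3) R <;> simp [hx])
        (fun x hx => Set.indicator_of_notMem (by rw [mem_ball_zero_iff, not_lt]; exact hx) _)
        hb.per hb.memLp).1
      refine (integrable_inner (𝕜 := ℂ) (memLp_of_mem_testC hgT) hX).congr (.of_forall fun x => ?_)
      by_cases hx : x ∈ Metric.ball (0 : R3) R
      · simp only [hc, Set.indicator_of_mem hx, one_smul]
      · simp only [hR x (by rwa [mem_ball_zero_iff, not_lt] at hx), inner_zero_left]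

lemma re_mem_testC {f : R3 → ℂ} (hf : f ∈ testC) : (fun x => (f x).re) ∈ testC (E := ℝ) :=
  ⟨Complex.reCLM.contDiff.comp hf.1, hf.2.comp_left (g := Complex.re) (by simp)⟩

lemma smul_mem_testC {f : R3 → ℂ} (hf : f ∈ testC) (σ : ℂ) : (fun x => σ * f x) ∈ testC (E := ℂ) :=
  ⟨contDiff_const.mul hf.1, hf.2.mul_left⟩

lemma norm_smul_le_four (z : ℂ) (v : C3) : ‖z • v‖ ≤
    ‖z.re • reV v‖ + ‖z.re • reV (-Complex.I • v)‖ + (‖(-Complex.I * z).re • reV v‖ +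
      ‖(-Complex.I * z).re • reV (-Complex.I • v)‖) := by
  have h1 : ‖v‖ ≤ ‖reV v‖ + ‖reV (-Complex.I • v)‖ := by
    refine le_of_sq_le_sq ?_ (by positivity)
    rw [norm_sq_eq_reV]
    nlinarith [norm_nonneg (reV v), norm_nonneg (reV (-Complex.I • v))]
  have h2 := Complex.norm_le_abs_re_add_abs_im z
  have h3 : (-Complex.I * z).re = z.im := by simp
  rw [h3]
  simp only [norm_smul, Real.norm_eq_abs]
  calc ‖z‖ * ‖v‖ ≤ (|z.re| + |z.im|) * (‖reV v‖ + ‖reV (-Complex.I • v)‖) := by gcongr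
    _ = _ := by ring

/-- The multiplier inequality. -/
lemma exists_multiplier (hmean : GradMeanZero volume) (hA : Coef (fun x => cx (A x)) α β)
    (hb : IsFlux b e) (hpq : IsQuasiGrad volume 0 p q)
    (hq : ∀ᵐ x ∂volQ, q x = mv (cx (A x)) (b x) - c) :
    ∃ C : ℝ, 0 ≤ C ∧ ∀ ε : ℝ, 0 < ε → ∀ f ∈ testC (E := ℂ),
      MemLp (fun x => f x • rescale ε b x) 2 volume ∧
      l2 volume (fun x => f x • rescale ε b x) ≤
        C * (l2 volume f + ε * l2 volume (grad f)) := by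
  obtain ⟨C₁, hC₁, h₁⟩ := exists_multiplier_reV hmean hA hb hpq hq 1
  obtain ⟨C₂, hC₂, h₂⟩ := exists_multiplier_reV hmean hA hb hpq hq (-Complex.I)
  refine ⟨2 * (C₁ + C₂), by positivity, fun ε hε f hf => ?_⟩
  have hf1 := re_mem_testC hf
  have hf2 := re_mem_testC (smul_mem_testC hf (-Complex.I))
  have hf0 := memLp_of_mem_testC hf
  have hg0 := memLp_of_mem_testC (grad_mem_testC hf)
  have hfd := hf.1.differentiable (by simp)
  have k1 : l2 volume (fun x => (f x).re) + ε * l2 volume (gradient fun x => (f x).re) ≤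
      l2 volume f + ε * l2 volume (grad f) := by
    have a1 := l2_mono (ν := volume) (f := fun x => (f x).re) zero_le_one hf0
      (.of_forall fun x => by rw [one_mul]; exact Complex.abs_re_le_norm _)
    have a2 := l2_mono (ν := volume) (f := gradient fun x => (f x).re) zero_le_one hg0
      (.of_forall fun x => by rw [one_mul, ← reV_grad hfd]; exact norm_reV_le _)
    rw [one_mul] at a1 a2
    gcongr
  have k2 : l2 volume (fun x => (-Complex.I * f x).re) +
      ε * l2 volume (gradient fun x => (-Complex.I * f x).re) ≤
      l2 volume f + ε * l2 volume (grad f) := by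
    have a1 := l2_mono (ν := volume) (f := fun x => (-Complex.I * f x).re) zero_le_one hf0
      (.of_forall fun x => by
        rw [one_mul]
        exact (Complex.abs_re_le_norm _).trans (by simp))
    have a2 := l2_mono (ν := volume) (f := gradient fun x => (-Complex.I * f x).re) zero_le_one hg0
      (.of_forall fun x => by
        rw [one_mul, ← reV_grad (hfd.const_mul _), grad_const_mul hfd]
        exact (norm_reV_le _).trans (by rw [norm_smul]; simp))
    rw [one_mul] at a1 a2
    gcongr
  obtain ⟨m1, b1⟩ := h₁ ε hε _ hf1
  obtain ⟨m2, b2⟩ := h₂ ε hε _ hf1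
  obtain ⟨m3, b3⟩ := h₁ ε hε _ hf2
  obtain ⟨m4, b4⟩ := h₂ ε hε _ hf2
  have hm : AEStronglyMeasurable (fun x => f x • rescale ε b x) volume :=
    hf.1.continuous.aestronglyMeasurable.smul
      (aestronglyMeasurable_rescale (hb.per.aestronglyMeasurable hb.memLp.1) hε)
  have hS := ((m1.norm.add m2.norm).add (m3.norm.add m4.norm))
  have hbd : ∀ᵐ x, ‖f x • rescale ε b x‖ ≤ 1 * ‖((‖(f x).re • rescale ε (fun y =>
      reV ((1 : ℂ) • b y)) x‖ + ‖(f x).re • rescale ε (fun y => reV (-Complex.I • b y)) x‖) +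
      (‖(-Complex.I * f x).re • rescale ε (fun y => reV ((1 : ℂ) • b y)) x‖ +
      ‖(-Complex.I * f x).re • rescale ε (fun y => reV (-Complex.I • b y)) x‖))‖ :=
    .of_forall fun x => by
      rw [one_mul, Real.norm_of_nonneg (by positivity)]
      simp only [rescale, one_smul]
      exact norm_smul_le_four _ _
  have hML : MemLp (fun x => f x • rescale ε b x) 2 volume :=
    hS.mono hm (by simpa only [one_mul, Pi.add_apply] using hbd)
  refine ⟨hML, (l2_mono zero_le_one hS hbd).trans ?_⟩
  rw [one_mul]
  have n1 : ∀ {g : R3 → R3}, l2 volume (fun x => ‖g x‖) = l2 volume g := fun {g} => by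
    rw [l2, l2, eLpNorm_norm]
  refine (l2_add_le (m1.norm.add m2.norm) (m3.norm.add m4.norm)).trans
    ((add_le_add (l2_add_le m1.norm m2.norm) (l2_add_le m3.norm m4.norm)).trans ?_)
  rw [n1, n1, n1, n1]
  have c1 := b1.trans (mul_le_mul_of_nonneg_left k1 hC₁)
  have c2 := b2.trans (mul_le_mul_of_nonneg_left k1 hC₂)
  have c3 := b3.trans (mul_le_mul_of_nonneg_left k2 hC₁)
  have c4 := b4.trans (mul_le_mul_of_nonneg_left k2 hC₂)
  linarith

end

/-! ### Passage to the limit in the multiplier inequality -/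

/-- Fatou's lemma. It yields membership in `L²` together with the bound, so no integrability of the
limit has to be known in advance. -/
lemma l2_le_of_tendsto_ae {α E : Type*} [MeasurableSpace α] [NormedAddCommGroup E] {ν : Measure α}
    {f : ℕ → α → E} {g : α → E} {B : ℕ → ℝ} {K : ℝ} (hf : ∀ n, MemLp (f n) 2 ν)
    (hB : ∀ n, l2 ν (f n) ≤ B n) (hlim : Tendsto B atTop (𝓝 K))
    (hae : ∀ᵐ x ∂ν, Tendsto (fun n => f n x) atTop (𝓝 (g x))) :
    MemLp g 2 ν ∧ l2 ν g ≤ K := by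
  have hgm := aestronglyMeasurable_of_tendsto_ae atTop (fun n => (hf n).1) hae
  have h1 : eLpNorm g 2 ν ≤ ENNReal.ofReal K := by
    refine (Lp.eLpNorm_lim_le_liminf_eLpNorm (fun n => (hf n).1) g hae).trans ?_
    refine (liminf_le_liminf (.of_forall fun n => eLpNorm_le_of_l2_le (hf n) (hB n))).trans
      (le_of_eq (ENNReal.tendsto_ofReal hlim).liminf_eq)
  have hg : MemLp g 2 ν := ⟨hgm, h1.trans_lt ENNReal.ofReal_lt_top⟩
  refine ⟨hg, ?_⟩
  have hK : 0 ≤ K := ge_of_tendsto' hlim fun n => (l2_nonneg _).trans (hB n)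
  exact ENNReal.toReal_le_of_le_ofReal hK h1

/-- The multiplier inequality extends to smooth functions in `H¹`. -/
lemma multiplier_of_contDiff {b : R3 → C3} {ε C : ℝ} (hC : 0 ≤ C) (hε : 0 < ε)
    (h : ∀ f ∈ testC (E := ℂ), MemLp (fun x => f x • b x) 2 volume ∧
      l2 volume (fun x => f x • b x) ≤ C * (l2 volume f + ε * l2 volume (grad f)))
    {f : R3 → ℂ} (hs : ContDiff ℝ ∞ f) (hf : MemLp f 2 volume) (hg : MemLp (grad f) 2 volume) :
    MemLp (fun x => f x • b x) 2 volume ∧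
      l2 volume (fun x => f x • b x) ≤ C * (l2 volume f + ε * l2 volume (grad f)) := by
  have hT := fun n => cut_smul_mem_testC hs n
  have hm := fun n => memLp_of_mem_testC (hT n)
  have hmg := fun n => memLp_of_mem_testC (grad_mem_testC (hT n))
  have l1 := (tendsto_l2_cut hf).const_add (l2 volume f)
  have l2' := (tendsto_l2_grad_cut hs hf hg).const_add (l2 volume (grad f))
  have hlim := (l1.add (l2'.const_mul ε)).const_mul C
  simp only [add_zero] at hlim
  refine l2_le_of_tendsto_ae (fun n => (h _ (hT n)).1) (fun n => (h _ (hT n)).2.trans ?_) hlim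
    (.of_forall fun x => ?_)
  · refine mul_le_mul_of_nonneg_left (add_le_add (l2_le_add_sub (hm n) hf) ?_) hC
    exact mul_le_mul_of_nonneg_left (l2_le_add_sub (hmg n) hg) hε.le
  · obtain ⟨N, hN⟩ := exists_nat_gt ‖x‖
    refine tendsto_const_nhds.congr' ?_
    filter_upwards [eventually_ge_atTop N] with n hn
    have hx : x ∈ Metric.ball (0 : R3) n := by
      rw [mem_ball_zero_iff]; exact hN.trans_le (by exact_mod_cast hn)
    rw [cut_eq_one hx, one_smul]
end

section
/-! ### The magnetic cell problem -/

lemma integral_cell_curl (hmean : GradMeanZero volume) {φ : R3 → C3} (hφ : φ ∈ testP) (e : C3) :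
    ∫ x in cellQ, inner ℂ e (curl φ x) = 0 := by
  rw [integral_cell_inner_curl hmean (const_mem_testP e) hφ]
  simp [curl_const]

/-- Periodic curls have mean zero, so `e` is the mean of the flux. -/
lemma IsFlux.integral_inner_const (hmean : GradMeanZero volume) {b : R3 → C3} {e : C3}
    (h : IsFlux b e) (d : C3) : ∫ x in cellQ, inner ℂ d (b x) = inner ℂ d e := by
  obtain ⟨φ, hφ, hlim⟩ := h.approx
  have hc := fun n => memLp_of_mem_testP (curl_mem_testP (hφ n))
  have hm := fun n => memLp_of_mem_testP (add_mem_testP (curl_mem_testP (hφ n)) (const_mem_testP e))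
  have hd : MemLp (fun _ : R3 => d) 2 volQ := memLp_const d
  have hL := tendsto_integral_inner_right (𝕜 := ℂ) (.of_forall hm) h.memLp hd
    (tendsto_eLpNorm_of_l2 (fun n => (hm n).sub h.memLp) hlim)
  refine tendsto_nhds_unique hL (tendsto_const_nhds.congr fun n => ?_)
  rw [integral_inner_add_right hd (hc n) (memLp_const e), integral_cell_curl hmean (hφ n), zero_add]
  simp

lemma IsFlux.add {b b' : R3 → C3} {e e' : C3} (h : IsFlux b e) (h' : IsFlux b' e') :
    IsFlux (fun x => b x + b' x) (e + e') := by
  obtain ⟨hp, hm, φ, hφ, hlim⟩ := h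
  obtain ⟨hp', hm', φ', hφ', hlim'⟩ := h'
  have ha := fun n =>
    (memLp_of_mem_testP (add_mem_testP (curl_mem_testP (hφ n)) (const_mem_testP e))).sub hm
  have ha' := fun n =>
    (memLp_of_mem_testP (add_mem_testP (curl_mem_testP (hφ' n)) (const_mem_testP e'))).sub hm'
  refine ⟨fun x n => by simp only [hp x n, hp' x n], hm.add hm', fun n x => φ n x + φ' n x,
    fun n => add_mem_testP (hφ n) (hφ' n), ?_⟩
  have h0 := hlim.add hlim'
  rw [add_zero] at h0
  refine squeeze_zero (fun n => l2_nonneg _) (fun n => ?_) h0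
  refine le_trans (le_of_eq (l2_congr (.of_forall fun x => ?_))) (l2_add_le (ha n) (ha' n))
  simp only
  rw [curl_add ((hφ n).1.differentiable (by simp)) ((hφ' n).1.differentiable (by simp))]
  abel

lemma IsFlux.const_smul {b : R3 → C3} {e : C3} (h : IsFlux b e) (c : ℂ) :
    IsFlux (fun x => c • b x) (c • e) := by
  obtain ⟨hp, hm, φ, hφ, hlim⟩ := h
  refine ⟨fun x n => by simp only [hp x n], hm.const_smul c, fun n x => c • φ n x,
    fun n => ⟨(hφ n).1.const_smul c, fun x m => by simp only [(hφ n).2 x m]⟩, ?_⟩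
  have h0 := hlim.const_mul ‖c‖
  rw [mul_zero] at h0
  refine h0.congr fun n => ?_
  rw [← l2_const_smul]
  refine l2_congr (.of_forall fun x => ?_)
  simp only
  rw [curl_const_smul ((hφ n).1.differentiable (by simp)), smul_sub, smul_add]

lemma integral_inner_quasiGrad {p : R3 → ℂ} {q b : R3 → C3} (h : IsQuasiGrad volume 0 p q)
    (hb : MemLp b 2 volQ)
    (horth : ∀ η ∈ testP (E := ℂ), ∫ x in cellQ, inner ℂ (grad η x) (b x) = 0) :
    ∫ x in cellQ, inner ℂ (q x) (b x) = 0 := by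
  obtain ⟨φ, hφ, h1, h2⟩ := IsQuasiGrad.exists_approx h
  have hg := fun n => memLp_of_mem_testP (grad_mem_testP (hφ n))
  have hL := tendsto_integral_inner_left (𝕜 := ℂ) (.of_forall hg) h.2.1 hb
    (tendsto_eLpNorm_of_l2 (fun n => (hg n).sub h.2.1) h2)
  exact tendsto_nhds_unique hL (tendsto_const_nhds.congr fun n => (horth _ (hφ n)).symm)

lemma integral_eq_of_inner {f : R3 → C3} (hf : MemLp f 2 volQ) {c : C3}
    (h : ∀ d, ∫ x in cellQ, inner ℂ d (f x) = inner ℂ d c) : ∫ x in cellQ, f x = c := by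
  refine ext_inner_left ℂ fun d => ?_
  rw [← h d, integral_inner (hf.integrable (by norm_num))]

lemma inner_integral_right {f : R3 → C3} (hf : MemLp f 2 volQ) (d : C3) :
    ∫ x in cellQ, inner ℂ d (f x) = inner ℂ d (∫ x in cellQ, f x) :=
  integral_inner (hf.integrable (by norm_num)) d

section
variable {A At : R3 → RMat} {N W : R3 → CMat} {α β : ℝ}

/-- The total magnetic field `curl N + I`, column by column. -/
def fluxCol (W : R3 → CMat) (j : Fin 3) (x : R3) : C3 := col (W x) j + basisVec j

lemma exists_curl_approx (hA : IsElliptic A) (hN : IsCellSolution volume A At N W) (j : Fin 3) :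
    ∃ φ : ℕ → R3 → C3, (∀ n, φ n ∈ testP) ∧
      Tendsto (fun n => l2 volQ fun x => φ n x - mv (cx (sqrtM A x)) (col (N x) j)) atTop (𝓝 0) ∧
      Tendsto (fun n => l2 volQ fun x => curl (φ n) x - col (W x) j) atTop (𝓝 0) := by
  obtain ⟨w, h1, h2, h3⟩ := IsCurlPair.exists_approx hA (hN.2.2 j).1
  exact ⟨w, h1, tendsto_l2_of_eLpNorm h2, tendsto_l2_of_eLpNorm h3⟩

lemma isFlux_fluxCol (hA : IsElliptic A) (hN : IsCellSolution volume A At N W) (j : Fin 3) :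
    IsFlux (fluxCol W j) (basisVec j) := by
  obtain ⟨φ, h1, -, h3⟩ := exists_curl_approx hA hN j
  refine ⟨fun x n => ?_, (hN.2.2 j).1.2.1.add (memLp_const _), φ, h1, h3.congr fun n => ?_⟩
  · simp only [fluxCol, hN.2.1 x n]
  · refine l2_congr (.of_forall fun x => ?_)
    simp only [fluxCol]
    abel

lemma col_magneticHom (j : Fin 3) :
    col (magneticHom volume At W) j = ∫ x in cellQ, mv (cx (At x)) (fluxCol W j x) := by
  ext i
  simp only [col, magneticHom, Matrix.of_apply, fluxCol, ← col_one j]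
  rfl

/-- The flux `Ã(curl N + I)` is the sum of its mean and a gradient. -/
lemma exists_potential (hmean : GradMeanZero volume) (hA : IsElliptic A)
    (hm : ∀ i j, Measurable fun x => A x i j) (hAt : Coef (fun x => cx (At x)) α β)
    (hirr : IrrotationalForm volume A) (hN : IsCellSolution volume A At N W) (j : Fin 3) :
    ∃ p q, IsQuasiGrad volume 0 p q ∧ ∀ᵐ x ∂volQ, q x =
      mv (cx (At x)) (fluxCol W j x) - col (magneticHom volume At W) j := by
  have hb := isFlux_fluxCol hA hN j
  have hJ := hAt.memLp hb.memLp
  have h0 : (0 : R3) ∈ dualCell := fun i => by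
    simp only [PiLp.zero_apply, Set.mem_Ico]
    exact ⟨by linarith [Real.pi_pos], Real.pi_pos⟩
  -- Every smooth mean-zero periodic `φ` yields the admissible test field `A^{-1/2} φ`. The magnetic
  -- cell problem thus says that `Ã(curl N + I)` is orthogonal to all these `curl φ`, that is,
  -- `A^{-1/2} Ã(curl N + I)` is `0`-irrotational, and assumption (ii) supplies the potential.
  obtain ⟨p, q, c, hpq, hc⟩ := hirr 0 h0 (invSqrt A fun x => mv (cx (At x)) (fluxCol W j x))
    (memLp_invSqrt hA hm hJ) (fun φ hφ => by
      simp only [expi_zero_left, one_smul, mv_sqrtM_invSqrt hA]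
      have hcm := memLp_of_mem_testP (curl_mem_testP hφ.1)
      have hpair : IsCurlPairQ volume A (invSqrt A φ) (curl φ) := by
        refine ⟨memLp_invSqrt hA hm (memLp_of_mem_testP hφ.1), hcm, fun _ => invSqrt A φ,
          fun n => ?_, ?_, ?_⟩
        · simp only [mv_sqrtM_invSqrt hA]; exact hφ.1
        · simp
        · simp [mv_sqrtM_invSqrt hA]
      have heq := (hN.2.2 j).2.2.2 _ _ hpair (by simp only [mv_sqrtM_invSqrt hA]; exact hφ.2)
      simp only [fluxCol, mv_add]
      rw [integral_inner_add_right hcm (hAt.memLp (hN.2.2 j).1.2.1) (hAt.memLp (memLp_const _)),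
        heq, neg_add_cancel])
  have hq : ∀ᵐ x ∂volQ, mv (cx (At x)) (fluxCol W j x) = q x + c := by
    filter_upwards [hc] with x hx
    have h := congrArg (mv (cx (sqrtM A x))) hx
    rw [mv_sqrtM_invSqrt hA, expi_zero_left, map_one, one_smul, cx_inv,
      mv_inv_cancel (isUnit_sqrtM hA x)] at h
    exact h
  have hmq : ∀ d, ∫ x in cellQ, inner ℂ d (q x) = 0 := fun d => by
    rw [integral_inner_conj, integral_inner_quasiGrad hpq (memLp_const d)
      fun η hη => integral_cell_inner_grad_const hmean hη d, map_zero]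
  -- Gradients have mean zero, so the constant must be the mean of the flux, which is the column of
  -- the homogenised matrix.
  have hcm : col (magneticHom volume At W) j = c := by
    rw [col_magneticHom]
    refine integral_eq_of_inner hJ fun d => ?_
    have e : ∫ x in cellQ, inner ℂ d (mv (cx (At x)) (fluxCol W j x)) =
        ∫ x in cellQ, inner ℂ d (q x + c) := integral_congr_ae (by
      filter_upwards [hq] with x hx
      rw [hx])
    rw [e, integral_inner_add_right (memLp_const d) hpq.2.1 (memLp_const c), hmq, zero_add]
    simp
  refine ⟨p, q, hpq, ?_⟩
  filter_upwards [hq] with x hx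
  rw [hx, hcm, add_sub_cancel_right]

lemma l2_const_volQ (c : C3) : l2 volQ (fun _ => c) = ‖c‖ := by
  rw [l2, eLpNorm_const _ two_ne_zero (NeZero.ne volQ)]
  simp

/-- Cauchy–Schwarz against the constant field `c`, on a cell of measure one. -/
lemma norm_le_l2_of_mean {z : R3 → C3} (hz : MemLp z 2 volQ) {c : C3}
    (h : ∫ x in cellQ, inner ℂ c (z x) = inner ℂ c c) : ‖c‖ ≤ l2 volQ z := by
  have h1 := norm_integral_inner_le (𝕜 := ℂ) (memLp_const (μ := volQ) (p := 2) c) hz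
  rw [h, l2_const_volQ, inner_self_eq_norm_sq_to_K] at h1
  simp only [Complex.coe_algebraMap, norm_pow, Complex.norm_real, norm_norm] at h1
  rcases (norm_nonneg c).eq_or_lt with h0 | h0
  · rw [← h0]; exact l2_nonneg _
  · nlinarith

/-- The homogenised magnetic matrix is coercive. -/
lemma magneticHom_coercive (hmean : GradMeanZero volume) (hA : IsElliptic A)
    (hm : ∀ i j, Measurable fun x => A x i j) (hAt : Coef (fun x => cx (At x)) α β)
    (hirr : IrrotationalForm volume A) (hN : IsCellSolution volume A At N W) (ξ : C3) :
    α * ‖ξ‖ ^ 2 ≤ (inner ℂ ξ (mv (magneticHom volume At W) ξ)).re := by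
  have hb := isFlux_fluxCol hA hN
  have hz : IsFlux (fun x => ∑ j, ξ j • fluxCol W j x) ξ := by
    have h := (((hb 0).const_smul (ξ 0)).add ((hb 1).const_smul (ξ 1))).add ((hb 2).const_smul (ξ 2))
    have e : ξ 0 • basisVec 0 + ξ 1 • basisVec 1 + ξ 2 • basisVec 2 = ξ := by
      rw [← Fin.sum_univ_three (fun j => ξ j • basisVec j), sum_basisVec]
    rw [e] at h
    simpa only [Fin.sum_univ_three] using h
  -- The field `(curl N + I) ξ` is a flux with mean `ξ`, so its norm is at least `‖ξ‖`.
  set z : R3 → C3 := fun x => ∑ j, ξ j • fluxCol W j x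
  have hnorm : ‖ξ‖ ≤ l2 volQ z := norm_le_l2_of_mean hz.memLp (hz.integral_inner_const hmean ξ)
  have hco := hAt.coercive hz.memLp
  -- Solenoidal `z` is orthogonal to the gradient part of `Ã(curl N + I) e_j`, so only the product
  -- of the means survives. Hence the homogenised form equals the energy of `z`.
  have key : ∀ j, ∫ x in cellQ, inner ℂ (z x) (mv (cx (At x)) (fluxCol W j x)) =
      inner ℂ ξ (col (magneticHom volume At W) j) := by
    intro j
    obtain ⟨p, q, hpq, hq⟩ := exists_potential hmean hA hm hAt hirr hN j
    have e : ∫ x in cellQ, inner ℂ (z x) (mv (cx (At x)) (fluxCol W j x)) =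
        ∫ x in cellQ, inner ℂ (z x) (q x + col (magneticHom volume At W) j) :=
      integral_congr_ae (by
        filter_upwards [hq] with x hx
        rw [hx, sub_add_cancel])
    rw [e, integral_inner_add_right hz.memLp hpq.2.1 (memLp_const _), integral_inner_conj,
      integral_inner_quasiGrad hpq hz.memLp fun η hη => hz.integral_cell hmean hη, map_zero,
      zero_add, integral_inner_conj, hz.integral_inner_const hmean, inner_conj_symm]
  have hsum : ∫ x in cellQ, inner ℂ (z x) (mv (cx (At x)) (z x)) =
      inner ℂ ξ (mv (magneticHom volume At W) ξ) := by
    have e : ∀ x, inner ℂ (z x) (mv (cx (At x)) (z x)) =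
        ∑ j, ξ j * inner ℂ (z x) (mv (cx (At x)) (fluxCol W j x)) := fun x => by
      conv_lhs => rw [show mv (cx (At x)) (z x) = ∑ j, ξ j • mv (cx (At x)) (fluxCol W j x) by
        simp only [z, mv_sum, mv_smul]]
      simp only [inner_sum, inner_smul_right]
    simp only [e]
    rw [integral_finsetSum _ fun j _ => (integrable_inner hz.memLp
      (hAt.memLp (hb j).memLp)).const_mul _, mv_eq_sum_col]
    simp only [integral_const_mul, key, inner_sum, inner_smul_right]
  rw [← hsum]
  refine le_trans ?_ hco
  have := hAt.pos
  gcongr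

/-- Smooth approximants for the magnetic cell problem. -/
lemma exists_magnetic_approx (hmean : GradMeanZero volume) (hA : IsElliptic A)
    (hm : ∀ i j, Measurable fun x => A x i j) (hAt : Coef (fun x => cx (At x)) α β)
    (hirr : IrrotationalForm volume A) (hN : IsCellSolution volume A At N W) (j : Fin 3) :
    ∃ K : ℝ, 0 ≤ K ∧ ∀ δ : ℝ, 0 < δ → ∃ φ ∈ testP (E := C3), ∃ p ∈ testP (E := ℂ),
      l2 volQ φ ≤ K ∧ l2 volQ p ≤ K ∧ l2 volQ (fun x => curl φ x - col (W x) j) ≤ δ ∧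
      l2 volQ (fun x => mv (cx (At x)) (fluxCol W j x) -
        (col (magneticHom volume At W) j + grad p x)) ≤ δ := by
  obtain ⟨φ, hφ, h1, h2⟩ := exists_curl_approx hA hN j
  obtain ⟨p, q, hpq, hq⟩ := exists_potential hmean hA hm hAt hirr hN j
  obtain ⟨η, hη, h3, h4⟩ := IsQuasiGrad.exists_approx hpq
  have hSN : MemLp (fun x => mv (cx (sqrtM A x)) (col (N x) j)) 2 volQ := by
    obtain ⟨K, -, hK, -⟩ := norm_sqrtM_le hA
    exact memLp_mv (fun i k => (measurable_cx_sqrtM hA hm i k).aestronglyMeasurable) hK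
      (hN.2.2 j).1.1
  -- The approximants are taken within distance one of their limits, so their norms are bounded
  -- independently of `δ`; only the errors in the curl and in the gradient are made small.
  refine ⟨max (l2 volQ (fun x => mv (cx (sqrtM A x)) (col (N x) j)) + 1) (l2 volQ p + 1),
    le_max_of_le_right (add_nonneg (l2_nonneg _) zero_le_one), fun δ hδ => ?_⟩
  obtain ⟨n, e1, e2, e3, e4⟩ := ((h1.eventually (ge_mem_nhds one_pos)).and
    ((h2.eventually (ge_mem_nhds hδ)).and ((h3.eventually (ge_mem_nhds one_pos)).and
      (h4.eventually (ge_mem_nhds hδ))))).exists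
  refine ⟨φ n, hφ n, η n, hη n, ?_, ?_, e2, ?_⟩
  · refine (l2_le_add_sub (memLp_of_mem_testP (hφ n)) hSN).trans (le_max_of_le_left ?_)
    linarith
  · refine (l2_le_add_sub (memLp_of_mem_testP (hη n)) hpq.1).trans (le_max_of_le_right ?_)
    linarith
  · rw [l2_sub_comm] at e4
    refine le_trans (le_of_eq (l2_congr ?_)) e4
    filter_upwards [hq] with x hx
    rw [hx]
    abel

end
end

section
/-! ### The electric cell problem -/

/-- The vector `iκ`. -/
def ikv (κ : R3) : C3 := WithLp.toLp 2 fun j => Complex.I * κ j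

lemma norm_ikv (κ : R3) : ‖ikv κ‖ = ‖κ‖ := by
  simp [EuclideanSpace.norm_eq, ikv]

lemma ikv_zero : ikv 0 = 0 := by ext j; simp [ikv]

/-- The shifted gradient `∇φ + iκφ`. -/
def dk (κ : R3) (φ : R3 → ℂ) (x : R3) : C3 := grad φ x + φ x • ikv κ

lemma grad_expi_mul {φ : R3 → ℂ} (hφ : Differentiable ℝ φ) (κ x : R3) :
    grad (fun y => expi κ y * φ y) x = expi κ x • dk κ φ x := by
  rw [grad_mul ((contDiff_expi κ).differentiable (by simp)) hφ, dk, smul_add]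
  congr 1
  ext j
  simp [grad_apply, pd_expi, ikv]
  ring

lemma inner_expi_smul (κ x : R3) (u v : C3) : inner ℂ (expi κ x • u) (expi κ x • v) = inner ℂ u v := by
  rw [inner_smul_left, inner_smul_right, ← mul_assoc, conj_expi_mul, one_mul]

lemma expi_smul_conj_expi_smul (κ x : R3) (v : C3) :
    expi κ x • (starRingEnd ℂ) (expi κ x) • v = v := by
  rw [smul_smul, mul_comm, conj_expi_mul, one_smul]

lemma dk_mem_testP {φ : R3 → ℂ} (hφ : φ ∈ testP) (κ : R3) : dk κ φ ∈ testP (E := C3) :=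
  add_mem_testP (grad_mem_testP hφ)
    ⟨hφ.1.smul contDiff_const, fun x n => by simp only [hφ.2 x n]⟩

lemma dk_add {φ η : R3 → ℂ} (hφ : Differentiable ℝ φ) (hη : Differentiable ℝ η) (κ x : R3) :
    dk κ (fun y => φ y + η y) x = dk κ φ x + dk κ η x := by
  rw [dk, dk, dk, grad_add hφ hη, add_smul]
  abel

lemma dk_const_mul {φ : R3 → ℂ} (hφ : Differentiable ℝ φ) (c : ℂ) (κ x : R3) :
    dk κ (fun y => c * φ y) x = c • dk κ φ x := by
  rw [dk, dk, grad_const_mul hφ, smul_add, mul_smul]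

/-- The cell problem `(∇ + iκ)* T (r + c) = 0`, `r = (∇ + iκ) ψ`. -/
structure IsHatSol (T : R3 → CMat) (κ : R3) (c : C3) (ψ : R3 → ℂ) (r : R3 → C3) : Prop where
  memLp : MemLp ψ 2 volQ
  memLp' : MemLp r 2 volQ
  approx : ∃ φ : ℕ → R3 → ℂ, (∀ n, φ n ∈ testP0 volume) ∧
    Tendsto (fun n => l2 volQ fun x => φ n x - ψ x) atTop (𝓝 0) ∧
    Tendsto (fun n => l2 volQ fun x => dk κ (φ n) x - r x) atTop (𝓝 0)
  eq : ∀ φ ∈ testP0 (E := ℂ) volume,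
    ∫ x in cellQ, inner ℂ (dk κ φ x) (mv (T x) (r x + c)) = 0

section
variable {T : R3 → CMat} {α β : ℝ} {κ : R3} {c d : C3} {ψ η : R3 → ℂ} {r s : R3 → C3}

lemma IsHatSol.memLp_add (h : IsHatSol T κ c ψ r) : MemLp (fun x => r x + c) 2 volQ :=
  h.memLp'.add (memLp_const c)

lemma IsHatSol.add (hT : Coef T α β) (h : IsHatSol T κ c ψ r) (h' : IsHatSol T κ d η s) :
    IsHatSol T κ (c + d) (fun x => ψ x + η x) (fun x => r x + s x) := by
  have hz := h.memLp_add
  have hz' := h'.memLp_add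
  obtain ⟨hψ, hr, ⟨φ, hφ, h1, h2⟩, heq⟩ := h
  obtain ⟨hη, hs, ⟨φ', hφ', h1', h2'⟩, heq'⟩ := h'
  have hm := fun n => memLp_of_mem_testP (hφ n).1
  have hm' := fun n => memLp_of_mem_testP (hφ' n).1
  have hg := fun n => memLp_of_mem_testP (dk_mem_testP (hφ n).1 κ)
  have hg' := fun n => memLp_of_mem_testP (dk_mem_testP (hφ' n).1 κ)
  refine ⟨hψ.add hη, hr.add hs, ⟨fun n x => φ n x + φ' n x, fun n => ⟨add_mem_testP (hφ n).1 (hφ' n).1,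
    ?_⟩, ?_, ?_⟩, fun χ hχ => ?_⟩
  · rw [integral_add (integrable_of_mem_testP (hφ n).1) (integrable_of_mem_testP (hφ' n).1),
      (hφ n).2, (hφ' n).2, add_zero]
  · have h0 := h1.add h1'
    rw [add_zero] at h0
    refine squeeze_zero (fun n => l2_nonneg _) (fun n => ?_) h0
    refine le_trans (le_of_eq (l2_congr (.of_forall fun x => ?_)))
      (l2_add_le ((hm n).sub hψ) ((hm' n).sub hη))
    simp only
    ring
  · have h0 := h2.add h2'
    rw [add_zero] at h0
    refine squeeze_zero (fun n => l2_nonneg _) (fun n => ?_) h0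
    refine le_trans (le_of_eq (l2_congr (.of_forall fun x => ?_)))
      (l2_add_le ((hg n).sub hr) ((hg' n).sub hs))
    simp only
    rw [dk_add ((hφ n).1.1.differentiable (by simp)) ((hφ' n).1.1.differentiable (by simp))]
    abel
  · have e : ∀ x, mv (T x) (r x + s x + (c + d)) = mv (T x) (r x + c) + mv (T x) (s x + d) :=
      fun x => by rw [← mv_add]; congr 1; abel
    simp only [e]
    rw [integral_inner_add_right (memLp_of_mem_testP (dk_mem_testP hχ.1 κ)) (hT.memLp hz)
      (hT.memLp hz'), heq χ hχ, heq' χ hχ, add_zero]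

lemma IsHatSol.const_smul (h : IsHatSol T κ c ψ r) (a : ℂ) :
    IsHatSol T κ (a • c) (fun x => a * ψ x) (fun x => a • r x) := by
  obtain ⟨hψ, hr, ⟨φ, hφ, h1, h2⟩, heq⟩ := h
  refine ⟨hψ.const_mul a, hr.const_smul a, ⟨fun n x => a * φ n x, fun n =>
    ⟨const_mul_mem_testP (hφ n).1 a, ?_⟩, ?_, ?_⟩, fun χ hχ => ?_⟩
  · rw [integral_const_mul, (hφ n).2, mul_zero]
  · have h0 := h1.const_mul ‖a‖
    rw [mul_zero] at h0
    refine h0.congr fun n => ?_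
    rw [← l2_const_smul]
    refine l2_congr (.of_forall fun x => ?_)
    simp only [smul_eq_mul]
    ring
  · have h0 := h2.const_mul ‖a‖
    rw [mul_zero] at h0
    refine h0.congr fun n => ?_
    rw [← l2_const_smul]
    refine l2_congr (.of_forall fun x => ?_)
    simp only
    rw [dk_const_mul ((hφ n).1.1.differentiable (by simp)), smul_sub]
  · have e : ∀ x, mv (T x) (a • r x + a • c) = a • mv (T x) (r x + c) := fun x => by
      rw [← smul_add, mv_smul]
    simp only [e, inner_smul_right]
    rw [integral_const_mul, heq χ hχ, mul_zero]

lemma IsHatSol.tendsto_inner (h : IsHatSol T κ c ψ r) {g : R3 → C3} (hg : MemLp g 2 volQ)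
    {φ : ℕ → R3 → ℂ} (hφ : ∀ n, φ n ∈ testP0 volume)
    (h2 : Tendsto (fun n => l2 volQ fun x => dk κ (φ n) x - r x) atTop (𝓝 0)) :
    Tendsto (fun n => ∫ x in cellQ, inner ℂ (dk κ (φ n) x) (g x)) atTop
      (𝓝 (∫ x in cellQ, inner ℂ (r x) (g x))) := by
  have hm := fun n => memLp_of_mem_testP (dk_mem_testP (hφ n).1 κ)
  exact tendsto_integral_inner_left (.of_forall hm) h.memLp' hg
    (tendsto_eLpNorm_of_l2 (fun n => (hm n).sub h.memLp') h2)

lemma IsHatSol.integral_inner (h : IsHatSol T κ c ψ r) {g : R3 → C3} (hg : MemLp g 2 volQ)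
    (horth : ∀ φ ∈ testP0 (E := ℂ) volume, ∫ x in cellQ, inner ℂ (dk κ φ x) (g x) = 0) :
    ∫ x in cellQ, inner ℂ (r x) (g x) = 0 := by
  obtain ⟨φ, hφ, h1, h2⟩ := h.approx
  exact tendsto_nhds_unique (h.tendsto_inner hg hφ h2)
    (tendsto_const_nhds.congr fun n => (horth _ (hφ n)).symm)

lemma integral_dk_const (hmean : GradMeanZero volume) {φ : R3 → ℂ} (hφ : φ ∈ testP0 volume)
    (d : C3) : ∫ x in cellQ, inner ℂ (dk κ φ x) d = 0 := by
  have hi : MemLp (fun x => φ x • ikv κ) 2 volQ :=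
    memLp_of_mem_testP ⟨hφ.1.1.smul contDiff_const, fun x n => by simp only [hφ.1.2 x n]⟩
  simp only [dk]
  rw [integral_inner_add_left (memLp_of_mem_testP (grad_mem_testP hφ.1)) hi (memLp_const d),
    integral_cell_inner_grad_const hmean hφ.1, zero_add]
  simp only [inner_smul_left]
  rw [integral_mul_const, integral_conj, hφ.2, map_zero, zero_mul]

/-- For a trial function of mean zero both `∇φ` and `iκφ` have mean zero. -/
lemma IsHatSol.mean (hmean : GradMeanZero volume) (h : IsHatSol T κ c ψ r) (d : C3) :
    ∫ x in cellQ, inner ℂ d (r x) = 0 := by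
  rw [integral_inner_conj, h.integral_inner (memLp_const d) fun φ hφ => integral_dk_const hmean hφ d,
    map_zero]

lemma IsHatSol.inner_mean (hmean : GradMeanZero volume) (h : IsHatSol T κ c ψ r) (d : C3) :
    ∫ x in cellQ, inner ℂ d (r x + c) = inner ℂ d c := by
  rw [integral_inner_add_right (memLp_const d) h.memLp' (memLp_const c), h.mean hmean, zero_add]
  simp

/-- The effective flux of a solution of the cell problem. -/
def hatFlux (T : R3 → CMat) (c : C3) (r : R3 → C3) : C3 := ∫ x in cellQ, mv (T x) (r x + c)

lemma IsHatSol.inner_flux (hT : Coef T α β) (h : IsHatSol T κ c ψ r) (d : C3) :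
    inner ℂ d (hatFlux T c r) = ∫ x in cellQ, inner ℂ d (mv (T x) (r x + c)) :=
  (inner_integral_right (hT.memLp h.memLp_add) d).symm

/-- The flux of one solution is orthogonal to the shifted gradient of the other, so the effective
matrix is represented by a symmetric energy form. Symmetry, coercivity and boundedness are read off
from it. -/
lemma IsHatSol.form (hT : Coef T α β) (h : IsHatSol T κ c ψ r) (h' : IsHatSol T κ d η s) :
    inner ℂ d (hatFlux T c r) = ∫ x in cellQ, inner ℂ (s x + d) (mv (T x) (r x + c)) := by
  rw [h.inner_flux hT, integral_inner_add_left h'.memLp' (memLp_const d) (hT.memLp h.memLp_add),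
    h'.integral_inner (hT.memLp h.memLp_add) h.eq, zero_add]

lemma IsHatSol.form_comm (hT : Coef T α β) (h : IsHatSol T κ c ψ r) (h' : IsHatSol T κ d η s) :
    inner ℂ d (hatFlux T c r) = inner ℂ (hatFlux T d s) c := by
  rw [h.form hT h', ← inner_conj_symm, h'.form hT h, ← integral_conj]
  refine integral_congr_ae (.of_forall fun x => ?_)
  simp only [inner_conj_symm]
  rw [hT.inner_comm]

lemma IsHatSol.coercive (hT : Coef T α β) (h : IsHatSol T κ c ψ r) :
    α * l2 volQ (fun x => r x + c) ^ 2 ≤ (inner ℂ c (hatFlux T c r)).re := by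
  rw [h.form hT h]
  exact hT.coercive h.memLp_add

lemma IsHatSol.norm_le (hmean : GradMeanZero volume) (h : IsHatSol T κ c ψ r) :
    ‖c‖ ≤ l2 volQ fun x => r x + c := norm_le_l2_of_mean h.memLp_add (h.inner_mean hmean c)

lemma IsHatSol.norm_flux_le (hT : Coef T α β) (h : IsHatSol T κ c ψ r) :
    ‖hatFlux T c r‖ ≤ β * l2 volQ fun x => r x + c := by
  have hz := hT.memLp h.memLp_add
  refine (norm_le_l2_of_mean hz ?_).trans (hT.l2_le h.memLp_add)
  exact inner_integral_right hz _

lemma IsHatSol.l2_le (hT : Coef T α β) (h : IsHatSol T κ c ψ r) :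
    l2 volQ (fun x => r x + c) ≤ β / α * ‖c‖ := by
  have h1 := h.coercive hT
  have h2 := h.norm_flux_le hT
  have h3 : (inner ℂ c (hatFlux T c r)).re ≤ ‖c‖ * ‖hatFlux T c r‖ :=
    (Complex.re_le_norm _).trans (norm_inner_le_norm _ _)
  have hα := hT.pos
  have hβ := hT.bdd_pos
  set z := l2 volQ fun x => r x + c
  have hz : 0 ≤ z := l2_nonneg _
  rcases hz.eq_or_lt with h0 | h0
  · rw [← h0]; positivity
  rw [div_mul_eq_mul_div, le_div_iff₀ hα]
  have h4 : α * z ^ 2 ≤ ‖c‖ * (β * z) :=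
    h1.trans (h3.trans (mul_le_mul_of_nonneg_left h2 (norm_nonneg _)))
  nlinarith

lemma l2_sq_eq_sum {f : R3 → C3} (hf : MemLp f 2 volQ) :
    l2 volQ f ^ 2 = ∑ j, l2 volQ (fun x => f x j) ^ 2 := by
  have h := fun j => memLp_apply hf j
  simp only [l2_sq hf, l2_sq (h _)]
  rw [← integral_finsetSum _ fun j _ => integrable_norm_sq (h j)]
  refine integral_congr_ae (.of_forall fun x => ?_)
  exact EuclideanSpace.norm_sq_eq _

lemma fcoef_pd (hmean : GradMeanZero volume) {φ : R3 → ℂ} (hφ : φ ∈ testP) (m : Fin 3 → ℤ)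
    (j : Fin 3) : fcoef (pd j φ) m = Complex.I * dvec m j * fcoef φ m := by
  rw [fcoef, integral_cell_conj_mul_pd hmean (expi_dvec_mem_testP m) hφ, fcoef,
    ← integral_const_mul, ← integral_neg]
  refine integral_congr_ae (.of_forall fun x => ?_)
  simp only [pd_expi, map_mul, Complex.conj_I, Complex.conj_ofReal]
  ring

/-- A nonzero dual lattice vector has norm at least `2π`, and `2π - 1 ≥ 1`. -/
lemma one_le_norm_dvec_add {κ : R3} (hκ : ‖κ‖ ≤ 1) {m : Fin 3 → ℤ} (hm : m ≠ 0) :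
    1 ≤ ‖dvec m + κ‖ := by
  obtain ⟨i, hi⟩ := Function.ne_iff.1 hm
  have h1 : (1 : ℝ) ≤ |(m i : ℝ)| := by
    rw [← Int.cast_abs]; exact_mod_cast Int.one_le_abs hi
  have h2 : |dvec m i| ≤ ‖dvec m‖ := PiLp.norm_apply_le (dvec m) i
  have h3 : |dvec m i| = 2 * Real.pi * |(m i : ℝ)| := by
    simp [dvec, abs_mul, abs_of_pos Real.pi_pos]
  have h4 := Real.pi_gt_three
  have h5 : ‖dvec m‖ ≤ ‖dvec m + κ‖ + ‖κ‖ := by simpa using norm_sub_le (dvec m + κ) κ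
  nlinarith

/-- The Poincaré inequality for the shifted gradient. -/
lemma l2_le_l2_dk (hmean : GradMeanZero volume) (hκ : ‖κ‖ ≤ 1) {φ : R3 → ℂ}
    (hφ : φ ∈ testP0 volume) : l2 volQ φ ≤ l2 volQ (dk κ φ) := by
  refine le_of_sq_le_sq ?_ (l2_nonneg _)
  have hd := memLp_of_mem_testP (dk_mem_testP hφ.1 κ)
  have h1 := hasSum_sq_fcoef (memLp_of_mem_testP hφ.1)
  have h2 := hasSum_sum (s := Finset.univ) fun j _ => hasSum_sq_fcoef (memLp_apply hd j)
  rw [← l2_sq_eq_sum hd] at h2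
  refine hasSum_le (fun m => ?_) h1 h2
  have e : ∀ j, fcoef (fun x => dk κ φ x j) m = Complex.I * ((dvec m + κ) j : ℝ) * fcoef φ m := by
    intro j
    have e1 : fcoef (fun x => dk κ φ x j) m =
        fcoef (pd j φ) m + Complex.I * κ j * fcoef φ m := by
      have hi1 : Integrable (fun x => (starRingEnd ℂ) (expi (dvec m) x) * pd j φ x) volQ :=
        integrable_of_mem_testP (mul_mem_testP (conj_mem_testP (expi_dvec_mem_testP m))
          (pd_mem_testP hφ.1 j))
      have hi2 : Integrable (fun x => (starRingEnd ℂ) (expi (dvec m) x) * φ x) volQ :=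
        integrable_of_mem_testP (mul_mem_testP (conj_mem_testP (expi_dvec_mem_testP m)) hφ.1)
      simp only [fcoef]
      rw [← integral_const_mul, ← integral_add hi1 (hi2.const_mul _)]
      refine integral_congr_ae (.of_forall fun x => ?_)
      simp only [dk, PiLp.add_apply, grad_apply, PiLp.smul_apply, ikv, smul_eq_mul]
      ring
    rw [e1, fcoef_pd hmean hφ.1]
    simp
    ring
  simp only [e, norm_mul, mul_pow, Complex.norm_I, Complex.norm_real, one_mul]
  rw [← Finset.sum_mul, ← EuclideanSpace.norm_sq_eq]
  -- The shifted gradient multiplies the mode `m` by `i(2πm + κ)`, of norm at least one unless `m =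
  -- 0`; that mode is absent because the mean is zero.
  by_cases hm : m = 0
  · have h0 : fcoef φ m = 0 := by
      rw [hm, fcoef]
      have : dvec 0 = 0 := by ext i; simp [dvec]
      simp only [this, expi_zero_left, map_one, one_mul]
      exact hφ.2
    simp [h0]
  · exact le_mul_of_one_le_left (sq_nonneg _) (one_le_pow₀ (one_le_norm_dvec_add hκ hm))

lemma IsHatSol.l2_potential_le (hmean : GradMeanZero volume) (hκ : ‖κ‖ ≤ 1)
    (h : IsHatSol T κ c ψ r) : l2 volQ ψ ≤ l2 volQ r := by
  obtain ⟨φ, hφ, h1, h2⟩ := h.approx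
  have hm := fun n => memLp_of_mem_testP (hφ n).1
  have hg := fun n => memLp_of_mem_testP (dk_mem_testP (hφ n).1 κ)
  have hlim := h1.add (h2.const_add (l2 volQ r))
  rw [zero_add, add_zero] at hlim
  refine ge_of_tendsto' hlim fun n => ?_
  have a1 := l2_le_add_sub h.memLp (hm n)
  have a2 := l2_le_add_sub (hg n) h.memLp'
  have a3 := l2_le_l2_dk hmean hκ (hφ n)
  rw [l2_sub_comm] at a1
  linarith

/-- The dependence of the effective flux on the quasimomentum. -/
lemma IsHatSol.flux_sub_le (hmean : GradMeanZero volume) (hT : Coef T α β) (hκ : ‖κ‖ ≤ 1)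
    (h : IsHatSol T κ c ψ r) (h' : IsHatSol T 0 d η s) :
    ‖inner ℂ d (hatFlux T c r) - inner ℂ (hatFlux T d s) c‖ ≤
      2 * (β * (β / α) * (β / α + 1)) * ‖κ‖ * ‖c‖ * ‖d‖ := by
  have hα := hT.pos
  have hβ := hT.bdd_pos
  have hz := hT.memLp h.memLp_add
  have hz' := hT.memLp h'.memLp_add
  have hψk : ∀ {f : R3 → ℂ}, MemLp f 2 volQ → MemLp (fun x => f x • ikv κ) 2 volQ := fun hf => by
    refine (hf.norm.const_mul ‖ikv κ‖).mono' (hf.1.smul_const _) (.of_forall fun x => ?_)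
    rw [norm_smul, mul_comm]
  have hbd : ∀ {f : R3 → ℂ} (_ : MemLp f 2 volQ),
      l2 volQ (fun x => f x • ikv κ) ≤ ‖κ‖ * l2 volQ f := fun hf =>
    l2_mono (norm_nonneg _) hf (.of_forall fun x => by rw [norm_smul, norm_ikv, mul_comm])
  have conv : ∀ {f : R3 → ℂ} {φ : ℕ → R3 → ℂ} (_ : MemLp f 2 volQ) (_ : ∀ n, φ n ∈ testP0 volume)
      (_ : Tendsto (fun n => l2 volQ fun x => φ n x - f x) atTop (𝓝 0)) {g : R3 → C3}
      (_ : MemLp g 2 volQ), Tendsto (fun n => ∫ x in cellQ, inner ℂ (φ n x • ikv κ) (g x)) atTop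
        (𝓝 (∫ x in cellQ, inner ℂ (f x • ikv κ) (g x))) := by
    intro f φ hf hφ hl g hg
    have hm := fun n => memLp_of_mem_testP (hφ n).1
    refine tendsto_integral_inner_left (.of_forall fun n => hψk (hm n)) (hψk hf) hg
      (tendsto_eLpNorm_of_l2 (fun n => (hψk (hm n)).sub (hψk hf)) ?_)
    have h0 := hl.const_mul ‖κ‖
    rw [mul_zero] at h0
    refine squeeze_zero (fun n => l2_nonneg _) (fun n => ?_) h0
    refine le_trans (le_of_eq (l2_congr (.of_forall fun x => ?_))) (hbd ((hm n).sub hf))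
    simp only [sub_smul]
  -- The gradients at `κ` and at `0` differ by a term of order zero. Each solution is therefore a
  -- test function for the other equation up to `‖κ‖` times the `L²` norm of its potential.
  have hgr : ∀ φ : R3 → ℂ, ∀ x, dk κ φ x = dk 0 φ x + φ x • ikv κ := fun φ x => by
    simp [dk, ikv_zero]
  -- the gradient part of the solution at zero
  have e1 : ∫ x in cellQ, inner ℂ (s x) (mv (T x) (r x + c)) =
      -∫ x in cellQ, inner ℂ (η x • ikv κ) (mv (T x) (r x + c)) := by
    obtain ⟨φ, hφ, h1, h2⟩ := h'.approx
    refine tendsto_nhds_unique (h'.tendsto_inner hz hφ h2)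
      ((conv h'.memLp hφ h1 hz).neg.congr fun n => ?_)
    have h0 := h.eq _ (hφ n)
    simp only [hgr] at h0
    rw [integral_inner_add_left (memLp_of_mem_testP (dk_mem_testP (hφ n).1 0))
      (hψk (memLp_of_mem_testP (hφ n).1)) hz] at h0
    exact (eq_neg_of_add_eq_zero_left h0).symm
  have e2 : ∫ x in cellQ, inner ℂ (r x) (mv (T x) (s x + d)) =
      ∫ x in cellQ, inner ℂ (ψ x • ikv κ) (mv (T x) (s x + d)) := by
    obtain ⟨φ, hφ, h1, h2⟩ := h.approx
    refine tendsto_nhds_unique (h.tendsto_inner hz' hφ h2)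
      ((conv h.memLp hφ h1 hz').congr fun n => ?_)
    simp only [hgr]
    rw [integral_inner_add_left (memLp_of_mem_testP (dk_mem_testP (hφ n).1 0))
      (hψk (memLp_of_mem_testP (hφ n).1)) hz', h'.eq _ (hφ n), zero_add]
  have e3 : ∫ x in cellQ, inner ℂ (s x + d) (mv (T x) (r x + c)) =
      -(∫ x in cellQ, inner ℂ (η x • ikv κ) (mv (T x) (r x + c))) + inner ℂ d (hatFlux T c r) := by
    rw [integral_inner_add_left h'.memLp' (memLp_const d) hz, e1, h.inner_flux hT]
  have e4 : ∫ x in cellQ, inner ℂ (s x + d) (mv (T x) (r x + c)) =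
      (starRingEnd ℂ) (∫ x in cellQ, inner ℂ (ψ x • ikv κ) (mv (T x) (s x + d))) +
        inner ℂ (hatFlux T d s) c := by
    have : ∫ x in cellQ, inner ℂ (s x + d) (mv (T x) (r x + c)) =
        ∫ x in cellQ, inner ℂ (mv (T x) (s x + d)) (r x + c) :=
      integral_congr_ae (.of_forall fun x => (hT.inner_comm x _ _).symm)
    rw [this, integral_inner_add_right hz' h.memLp' (memLp_const c), integral_inner_conj, e2]
    congr 1
    rw [integral_inner_conj, ← h'.inner_flux hT, inner_conj_symm]
  have e5 : inner ℂ d (hatFlux T c r) - inner ℂ (hatFlux T d s) c =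
      (∫ x in cellQ, inner ℂ (η x • ikv κ) (mv (T x) (r x + c))) +
      (starRingEnd ℂ) (∫ x in cellQ, inner ℂ (ψ x • ikv κ) (mv (T x) (s x + d))) := by
    linear_combination e4 - e3
  -- The potentials are bounded through the Poincaré inequality, which is where `‖κ‖ ≤ 1` is used.
  have b1 : ∀ {c' : C3} {κ' : R3} {ψ' : R3 → ℂ} {r' : R3 → C3}, ‖κ'‖ ≤ 1 →
      IsHatSol T κ' c' ψ' r' → l2 volQ ψ' ≤ (β / α + 1) * ‖c'‖ := by
    intro c' κ' ψ' r' hκ' h''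
    have a1 := h''.l2_potential_le hmean hκ'
    have a2 := l2_sub_le h''.memLp_add (memLp_const c')
    simp only [add_sub_cancel_right] at a2
    rw [l2_const_volQ] at a2
    have a3 := h''.l2_le hT
    linarith
  have n1 := norm_integral_inner_le (𝕜 := ℂ) (hψk h'.memLp) hz
  have n2 := norm_integral_inner_le (𝕜 := ℂ) (hψk h.memLp) hz'
  have m1 : l2 volQ (fun x => η x • ikv κ) * l2 volQ (fun x => mv (T x) (r x + c)) ≤
      (‖κ‖ * ((β / α + 1) * ‖d‖)) * (β * (β / α * ‖c‖)) := by
    refine mul_le_mul ((hbd h'.memLp).trans ?_) ((hT.l2_le h.memLp_add).trans ?_) (l2_nonneg _)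
      (by positivity)
    · gcongr; exact b1 (by simp) h'
    · gcongr; exact h.l2_le hT
  have m2 : l2 volQ (fun x => ψ x • ikv κ) * l2 volQ (fun x => mv (T x) (s x + d)) ≤
      (‖κ‖ * ((β / α + 1) * ‖c‖)) * (β * (β / α * ‖d‖)) := by
    refine mul_le_mul ((hbd h.memLp).trans ?_) ((hT.l2_le h'.memLp_add).trans ?_) (l2_nonneg _)
      (by positivity)
    · gcongr; exact b1 hκ h
    · gcongr; exact h'.l2_le hT
  rw [e5]
  refine (norm_add_le _ _).trans ?_
  rw [RCLike.norm_conj]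
  linarith

end
end

/-! ### The electric homogenised matrix as a function of the quasimomentum -/

section
section
variable {A : R3 → RMat} {T : R3 → CMat} {α β : ℝ} {κ : R3} {c : C3} {ψ : R3 → ℂ} {r : R3 → C3}
  {M : CMat}

lemma expi_smul_memLp {f : R3 → C3} (hf : MemLp f 2 volQ) (κ : R3) :
    MemLp (fun x => (starRingEnd ℂ) (expi κ x) • f x) 2 volQ := by
  have hm : AEStronglyMeasurable (fun x => (starRingEnd ℂ) (expi κ x)) volQ :=
    (Complex.continuous_conj.comp (continuous_expi_right κ)).aestronglyMeasurable
  refine hf.of_le (hm.smul hf.1) (.of_forall fun x => le_of_eq ?_)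
  rw [norm_smul, RCLike.norm_conj, norm_expi, one_mul]

/-- The columns of the homogenised matrix are fluxes of solutions of the cell problem. -/
lemma IsHatHom.exists_sol_col (h : IsHatHom volume A κ M) (hT : Coef (fun x => cx (A x)⁻¹) α β)
    (j : Fin 3) : ∃ ψ r, IsHatSol (fun x => cx (A x)⁻¹) κ (basisVec j) ψ r ∧
      col M j = hatFlux (fun x => cx (A x)⁻¹) (basisVec j) r := by
  obtain ⟨ψ, q, h1, h2, h3⟩ := h
  obtain ⟨hψ, hq, φ, hφ, l1, l2'⟩ := h1 j
  have hr := expi_smul_memLp hq κ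
  refine ⟨ψ j, fun x => (starRingEnd ℂ) (expi κ x) • q j x, ⟨hψ, hr,
    ⟨φ, hφ, tendsto_l2_of_eLpNorm l1, ?_⟩, fun η hη => ?_⟩, h3 j⟩
  · refine (tendsto_l2_of_eLpNorm l2').congr fun n => ?_
    have e : ∀ x, ‖dk κ (φ n) x - (starRingEnd ℂ) (expi κ x) • q j x‖ =
        ‖grad (fun y => expi κ y * φ n y) x - q j x‖ := fun x => by
      rw [grad_expi_mul ((hφ n).1.1.differentiable (by simp))]
      conv_rhs => rw [← expi_smul_conj_expi_smul κ x (q j x), ← smul_sub, norm_smul, norm_expi,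
        one_mul]
    rw [l2, l2]
    congr 1
    exact eLpNorm_congr_norm_ae (.of_forall fun x => (e x).symm)
  · have hd := memLp_of_mem_testP (dk_mem_testP hη.1 κ)
    have heq := h2 j η hη
    simp only [grad_expi_mul (hη.1.1.differentiable (by simp)), mv_smul, inner_expi_smul] at heq
    have e : ∀ x, inner ℂ (expi κ x • dk κ η x) (mv (cx (A x)⁻¹) (q j x)) =
        inner ℂ (dk κ η x) (mv (cx (A x)⁻¹) ((starRingEnd ℂ) (expi κ x) • q j x)) := fun x => by
      conv_lhs => rw [← expi_smul_conj_expi_smul κ x (q j x), mv_smul, inner_expi_smul]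
    simp only [e] at heq
    simp only [mv_add]
    rw [integral_inner_add_right hd (hT.memLp hr) (hT.memLp (memLp_const _)), heq, neg_add_cancel]

lemma hatFlux_add (hT : Coef T α β) {c d : C3} {r s : R3 → C3} (hr : MemLp r 2 volQ)
    (hs : MemLp s 2 volQ) :
    hatFlux T (c + d) (fun x => r x + s x) = hatFlux T c r + hatFlux T d s := by
  have h1 : Integrable (fun x => mv (T x) (r x + c)) volQ :=
    (hT.memLp (hr.add (memLp_const c))).integrable (by norm_num)
  have h2 : Integrable (fun x => mv (T x) (s x + d)) volQ :=
    (hT.memLp (hs.add (memLp_const d))).integrable (by norm_num)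
  rw [hatFlux, hatFlux, hatFlux, ← integral_add h1 h2]
  refine integral_congr_ae (.of_forall fun x => ?_)
  simp only [← mv_add]
  congr 1
  abel

lemma hatFlux_const_smul (a : ℂ) (c : C3) (r : R3 → C3) :
    hatFlux T (a • c) (fun x => a • r x) = a • hatFlux T c r := by
  simp only [hatFlux, ← smul_add, mv_smul]
  exact integral_smul a _

lemma IsHatHom.exists_sol (h : IsHatHom volume A κ M) (hT : Coef (fun x => cx (A x)⁻¹) α β)
    (c : C3) : ∃ ψ r, IsHatSol (fun x => cx (A x)⁻¹) κ c ψ r ∧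
      mv M c = hatFlux (fun x => cx (A x)⁻¹) c r := by
  choose ψ r hs hc using h.exists_sol_col hT
  have h' := fun j => (hs j).const_smul (c j)
  have hs2 := ((h' 0).add hT (h' 1)).add hT (h' 2)
  have e : c 0 • basisVec 0 + c 1 • basisVec 1 + c 2 • basisVec 2 = c := by
    rw [← Fin.sum_univ_three (fun j => c j • basisVec j), sum_basisVec]
  have hf : mv M c = hatFlux (fun x => cx (A x)⁻¹)
      (c 0 • basisVec 0 + c 1 • basisVec 1 + c 2 • basisVec 2)
      (fun x => c 0 • r 0 x + c 1 • r 1 x + c 2 • r 2 x) := by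
    have hsum : MemLp (fun x => c 0 • r 0 x + c 1 • r 1 x) 2 volQ :=
      (h' 0).memLp'.add (h' 1).memLp'
    rw [hatFlux_add hT hsum (h' 2).memLp',
      hatFlux_add hT (h' 0).memLp' (h' 1).memLp', hatFlux_const_smul, hatFlux_const_smul,
      hatFlux_const_smul, mv_eq_sum_col, Fin.sum_univ_three, hc, hc, hc]
  rw [e] at hs2 hf
  exact ⟨_, _, hs2, hf⟩

lemma IsHatHom.inner_comm (h : IsHatHom volume A κ M) (hT : Coef (fun x => cx (A x)⁻¹) α β)
    (c d : C3) : inner ℂ d (mv M c) = inner ℂ (mv M d) c := by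
  obtain ⟨ψ, r, h1, e1⟩ := h.exists_sol hT c
  obtain ⟨η, s, h2, e2⟩ := h.exists_sol hT d
  rw [e1, e2]
  exact h1.form_comm hT h2

lemma IsHatHom.coercive (hmean : GradMeanZero volume) (h : IsHatHom volume A κ M)
    (hT : Coef (fun x => cx (A x)⁻¹) α β) (c : C3) :
    α * ‖c‖ ^ 2 ≤ (inner ℂ c (mv M c)).re := by
  obtain ⟨ψ, r, h1, e1⟩ := h.exists_sol hT c
  rw [e1]
  have := hT.pos
  refine le_trans ?_ (h1.coercive hT)
  gcongr
  exact h1.norm_le hmean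

lemma IsHatHom.norm_le (h : IsHatHom volume A κ M) (hT : Coef (fun x => cx (A x)⁻¹) α β) (c : C3) :
    ‖mv M c‖ ≤ β * (β / α) * ‖c‖ := by
  obtain ⟨ψ, r, h1, e1⟩ := h.exists_sol hT c
  rw [e1, mul_assoc]
  have := hT.bdd_pos
  refine (h1.norm_flux_le hT).trans ?_
  gcongr
  exact h1.l2_le hT

lemma IsHatHom.norm_sub_le (hmean : GradMeanZero volume) {M₀ : CMat} (h : IsHatHom volume A κ M)
    (h₀ : IsHatHom volume A 0 M₀) (hT : Coef (fun x => cx (A x)⁻¹) α β) (hκ : ‖κ‖ ≤ 1) (c : C3) :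
    ‖mv M c - mv M₀ c‖ ≤ 2 * (β * (β / α) * (β / α + 1)) * ‖κ‖ * ‖c‖ := by
  -- Taking the difference itself as the second direction turns the bilinear estimate into one for
  -- `‖d‖²`.
  set d := mv M c - mv M₀ c with hd
  obtain ⟨ψ, r, h1, e1⟩ := h.exists_sol hT c
  obtain ⟨η, s, h2, e2⟩ := h₀.exists_sol hT d
  have key := h1.flux_sub_le hmean hT hκ h2
  rw [← e1, ← e2, ← h₀.inner_comm hT, ← inner_sub_right, ← hd, inner_self_eq_norm_sq_to_K] at key
  simp only [Complex.coe_algebraMap, norm_pow, Complex.norm_real, norm_norm] at key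
  have hα := hT.pos
  have hβ := hT.bdd_pos
  rcases (norm_nonneg d).eq_or_lt with h0 | h0
  · rw [← h0]; positivity
  · rw [sq] at key
    exact le_of_mul_le_mul_right key h0

/-! ### Measurability in the quasimomentum -/

/-- The energy of a trial function. -/
def hatEnergy (T : R3 → CMat) (c : C3) (φ : R3 → ℂ) (κ : R3) : ℝ :=
  (∫ x in cellQ, inner ℂ (dk κ φ x + c) (mv (T x) (dk κ φ x + c))).re

lemma continuous_ikv : Continuous ikv :=
  (PiLp.continuous_toLp 2 _).comp (continuous_pi fun j => by fun_prop)

lemma continuous_hatEnergy (hT : Coef T α β) (c : C3) {φ : R3 → ℂ} (hφ : φ ∈ testP) :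
    Continuous (hatEnergy T c φ) := by
  obtain ⟨K, hK0, hK⟩ := exists_bound_of_mem_testP hφ
  obtain ⟨K', hK0', hK'⟩ := exists_bound_of_mem_testP (grad_mem_testP hφ)
  have hm : ∀ κ, MemLp (fun x => dk κ φ x + c) 2 volQ := fun κ =>
    memLp_of_mem_testP (add_mem_testP (dk_mem_testP hφ κ) (const_mem_testP c))
  have hβ := hT.bdd_pos
  set f : R3 → R3 → ℂ := fun κ x => inner ℂ (dk κ φ x + c) (mv (T x) (dk κ φ x + c)) with hf
  have hfm : ∀ κ, AEStronglyMeasurable (f κ) volQ := fun κ =>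
    (integrable_inner (hm κ) (hT.memLp (hm κ))).1
  have hfc : ∀ x, Continuous fun κ => f κ x := by
    intro x
    have hc : Continuous fun κ => dk κ φ x + c := by
      have h1 : Continuous fun κ => φ x • ikv κ := continuous_ikv.const_smul (φ x)
      have h2 : Continuous fun κ => grad φ x + φ x • ikv κ := by fun_prop
      have h3 : Continuous fun κ => (grad φ x + φ x • ikv κ) + c := by fun_prop
      exact h3
    have hc2 : Continuous fun κ => mv (T x) (dk κ φ x + c) := (mvL (T x)).continuous.comp hc
    exact continuous_inner.comp (hc.prodMk hc2)
  have hfb : ∀ κ₀ κ : R3, ‖κ‖ ≤ ‖κ₀‖ + 1 → ∀ x, ‖f κ x‖ ≤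
      (K' + K * (‖κ₀‖ + 1) + ‖c‖) * (β * (K' + K * (‖κ₀‖ + 1) + ‖c‖)) := by
    intro κ₀ κ hκ x
    have hb : ‖dk κ φ x + c‖ ≤ K' + K * (‖κ₀‖ + 1) + ‖c‖ := by
      refine (norm_add_le _ _).trans (add_le_add ((norm_add_le _ _).trans
        (add_le_add (hK' x) ?_)) le_rfl)
      rw [norm_smul, norm_ikv]
      exact mul_le_mul (hK x) hκ (norm_nonneg _) hK0
    refine (norm_inner_le_norm _ _).trans ?_
    exact mul_le_mul hb ((hT.bdd x _).trans (mul_le_mul_of_nonneg_left hb hβ.le)) (norm_nonneg _)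
      ((norm_nonneg _).trans hb)
  have hcont : Continuous fun κ => ∫ x in cellQ, f κ x := by
    refine continuous_iff_continuousAt.2 fun κ₀ => ?_
    refine continuousAt_of_dominated (.of_forall hfm) ?_
      (integrable_const ((K' + K * (‖κ₀‖ + 1) + ‖c‖) * (β * (K' + K * (‖κ₀‖ + 1) + ‖c‖))))
      (.of_forall fun x => (hfc x).continuousAt)
    filter_upwards [Metric.ball_mem_nhds κ₀ one_pos] with κ hκ
    refine .of_forall (hfb κ₀ κ ?_)
    have h1 : ‖κ - κ₀‖ < 1 := by rwa [← dist_eq_norm]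
    have h2 := norm_le_insert' κ κ₀
    linarith
  exact Complex.continuous_re.comp hcont

/-- Pythagoras: the cross terms vanish by the cell equation. The quadratic form of the homogenised
matrix is thus the infimum of the energies of trial functions. -/
lemma IsHatSol.hatEnergy_eq (hT : Coef T α β) (h : IsHatSol T κ c ψ r) {φ : R3 → ℂ}
    (hφ : φ ∈ testP0 volume) : hatEnergy T c φ κ = (inner ℂ c (hatFlux T c r)).re +
      (∫ x in cellQ, inner ℂ (dk κ φ x - r x) (mv (T x) (dk κ φ x - r x))).re := by
  have hm := memLp_of_mem_testP (dk_mem_testP hφ.1 κ)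
  have hf : MemLp (fun x => dk κ φ x - r x) 2 volQ := hm.sub h.memLp'
  have hz := h.memLp_add
  have hTf := hT.memLp hf
  have hTz := hT.memLp hz
  have hfz : MemLp (fun x => (dk κ φ x - r x) + (r x + c)) 2 volQ := hf.add hz
  have hcross : ∫ x in cellQ, inner ℂ (dk κ φ x - r x) (mv (T x) (r x + c)) = 0 := by
    rw [integral_inner_sub_left hm h.memLp' hTz, h.eq φ hφ, h.integral_inner hTz h.eq, sub_zero]
  have hcross' : ∫ x in cellQ, inner ℂ (r x + c) (mv (T x) (dk κ φ x - r x)) = 0 := by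
    simp only [← hT.inner_comm]
    rw [integral_inner_conj, hcross, map_zero]
  have e : ∀ x, dk κ φ x + c = (dk κ φ x - r x) + (r x + c) := fun x => by abel
  rw [hatEnergy, h.form hT h, ← Complex.add_re]
  congr 1
  simp only [e, mv_add (T _) (dk κ φ _ - r _)]
  rw [integral_inner_add_right hfz hTf hTz, integral_inner_add_left hf hz hTf,
    integral_inner_add_left hf hz hTz, hcross, hcross']
  ring

/-- The quadratic form is an infimum of functions continuous in `κ`, taken over a class of trial
functions independent of `κ`. Its strict sublevel sets are unions of open sets, so the
uncountability of the class is harmless. No measurable selection of the solutions is needed. -/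
lemma measurable_form {M : R3 → CMat} (hT : Coef (fun x => cx (A x)⁻¹) α β)
    (h : ∀ κ, IsHatHom volume A κ (M κ)) (c : C3) :
    Measurable fun κ => (inner ℂ c (mv (M κ) c)).re := by
  refine measurable_of_Iio fun t => ?_
  have e : (fun κ => (inner ℂ c (mv (M κ) c)).re) ⁻¹' Set.Iio t =
      ⋃ φ ∈ testP0 (E := ℂ) volume, {κ | hatEnergy (fun x => cx (A x)⁻¹) c φ κ < t} := by
    ext κ
    simp only [Set.mem_preimage, Set.mem_Iio, Set.mem_iUnion, Set.mem_ofPred_eq, exists_prop]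
    obtain ⟨ψ, r, hs, hf⟩ := (h κ).exists_sol hT c
    rw [hf]
    constructor
    · intro ht
      obtain ⟨φ, hφ, h1, h2⟩ := hs.approx
      have hlim : Tendsto (fun n => (inner ℂ c (hatFlux (fun x => cx (A x)⁻¹) c r)).re +
          β * (l2 volQ fun x => dk κ (φ n) x - r x) ^ 2) atTop
          (𝓝 (inner ℂ c (hatFlux (fun x => cx (A x)⁻¹) c r)).re) := by
        have := ((h2.pow 2).const_mul β).const_add
          (inner ℂ c (hatFlux (fun x => cx (A x)⁻¹) c r)).re
        simpa using this
      obtain ⟨n, hn⟩ := (hlim.eventually (gt_mem_nhds ht)).exists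
      refine ⟨φ n, hφ n, lt_of_le_of_lt ?_ hn⟩
      rw [hs.hatEnergy_eq hT (hφ n)]
      have hm : MemLp (fun x => dk κ (φ n) x - r x) 2 volQ :=
        (memLp_of_mem_testP (dk_mem_testP (hφ n).1 κ)).sub hs.memLp'
      refine add_le_add le_rfl ((Complex.re_le_norm _).trans
        ((norm_integral_inner_le hm (hT.memLp hm)).trans ?_))
      rw [sq, mul_left_comm]
      exact mul_le_mul_of_nonneg_left (hT.l2_le hm) (l2_nonneg _)
    · rintro ⟨φ, hφ, ht⟩
      refine lt_of_le_of_lt ?_ ht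
      rw [hs.hatEnergy_eq hT hφ]
      have hm : MemLp (fun x => dk κ φ x - r x) 2 volQ :=
        (memLp_of_mem_testP (dk_mem_testP hφ.1 κ)).sub hs.memLp'
      have h0 := hT.coercive hm
      have hα := hT.pos
      have : 0 ≤ α * l2 volQ (fun x => dk κ φ x - r x) ^ 2 := by positivity
      linarith
  rw [e]
  exact (isOpen_biUnion fun φ hφ =>
    isOpen_lt (continuous_hatEnergy hT c hφ.1) continuous_const).measurableSet

lemma inner_basisVec_mv (M : CMat) (i j : Fin 3) :
    inner ℂ (basisVec i) (mv M (basisVec j)) = M i j := by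
  rw [mv_basisVec, basisVec, EuclideanSpace.inner_single_left]
  simp [col]

/-- The homogenised matrix depends measurably on the quasimomentum. -/
lemma measurable_hatHom {M : R3 → CMat} (hT : Coef (fun x => cx (A x)⁻¹) α β)
    (h : ∀ κ, IsHatHom volume A κ (M κ)) (i j : Fin 3) : Measurable fun κ => M κ i j := by
  have hq := measurable_form hT h
  -- Polarisation: the matrix is Hermitian, so real parts of the form recover the real part of each
  -- entry, and a factor `i` in the second argument recovers the imaginary part.
  have hre : ∀ κ (c d : C3), (inner ℂ (c + d) (mv (M κ) (c + d))).re =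
      (inner ℂ c (mv (M κ) c)).re + (inner ℂ d (mv (M κ) d)).re +
        2 * (inner ℂ c (mv (M κ) d)).re := by
    intro κ c d
    have h1 : (inner ℂ d (mv (M κ) c)).re = (inner ℂ c (mv (M κ) d)).re := by
      rw [(h κ).inner_comm hT c d, ← inner_conj_symm, Complex.conj_re]
    rw [mv_add, inner_add_left, inner_add_right, inner_add_right, Complex.add_re, Complex.add_re,
      Complex.add_re, h1]
    ring
  have hm : ∀ c d : C3, Measurable fun κ => (inner ℂ c (mv (M κ) d)).re := by
    intro c d
    have e : (fun κ => (inner ℂ c (mv (M κ) d)).re) = fun κ =>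
        ((inner ℂ (c + d) (mv (M κ) (c + d))).re - (inner ℂ c (mv (M κ) c)).re -
          (inner ℂ d (mv (M κ) d)).re) / 2 := by
      ext κ; rw [hre]; ring
    rw [e]
    exact (((hq _).sub (hq _)).sub (hq _)).div_const 2
  have e : (fun κ => M κ i j) = fun κ =>
      (((inner ℂ (basisVec i) (mv (M κ) (basisVec j))).re : ℝ) : ℂ) -
      (((inner ℂ (basisVec i) (mv (M κ) (Complex.I • basisVec j))).re : ℝ) : ℂ) * Complex.I := by
    ext κ
    rw [mv_smul, inner_smul_right, inner_basisVec_mv]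
    apply Complex.ext <;> simp
  rw [e]
  exact (Complex.measurable_ofReal.comp (hm _ _)).sub
    ((Complex.measurable_ofReal.comp (hm _ _)).mul_const _)

end

/-! ### Solenoidal fields of mean zero are approximated by curls -/

/-- The vector potential of a Fourier mode. -/
def potCoef (m : Fin 3 → ℤ) (v : C3) : C3 :=
  ((‖dvec m‖ ^ 2 : ℝ) : ℂ)⁻¹ • crs (ikv (dvec m)) v

/-- For `k · v = 0` one has `ik × (ik × v) = |k|² v`, so `|k|⁻² ik × v` is a vector potential of the
mode. -/
lemma crs_ikv_potCoef {m : Fin 3 → ℤ} (hm : m ≠ 0) {v : C3}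
    (hv : ∑ j, (dvec m j : ℂ) * v j = 0) : crs (ikv (dvec m)) (potCoef m v) = v := by
  have hn : dvec m ≠ 0 := by
    have h := one_le_norm_dvec_add (κ := 0) (by simp) hm
    rw [add_zero] at h
    exact norm_pos_iff.1 (by linarith)
  have hne : ((‖dvec m‖ ^ 2 : ℝ) : ℂ) ≠ 0 := by
    rw [Complex.ofReal_ne_zero]; exact pow_ne_zero _ (norm_ne_zero_iff.2 hn)
  rw [potCoef, crs_smul_right, inv_smul_eq_iff₀ hne]
  have hsq : ((‖dvec m‖ ^ 2 : ℝ) : ℂ) = (dvec m 0 : ℂ) ^ 2 + (dvec m 1 : ℂ) ^ 2 +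
      (dvec m 2 : ℂ) ^ 2 := by
    rw [EuclideanSpace.norm_sq_eq, Fin.sum_univ_three]
    simp
  rw [hsq]
  rw [Fin.sum_univ_three] at hv
  ext i
  fin_cases i <;> simp [crs, ikv]
  · linear_combination (-(dvec m 0 : ℂ)) * hv + ((dvec m 0 : ℂ) * (dvec m 1 : ℂ) * v 1 + (dvec m 0 : ℂ) * (dvec m 2 : ℂ) * v 2 - ((dvec m 1 : ℂ) ^ 2 + (dvec m 2 : ℂ) ^ 2) * v 0) * Complex.I_sq
  · linear_combination (-(dvec m 1 : ℂ)) * hv + ((dvec m 1 : ℂ) * (dvec m 0 : ℂ) * v 0 + (dvec m 1 : ℂ) * (dvec m 2 : ℂ) * v 2 - ((dvec m 0 : ℂ) ^ 2 + (dvec m 2 : ℂ) ^ 2) * v 1) * Complex.I_sq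
  · linear_combination (-(dvec m 2 : ℂ)) * hv + ((dvec m 2 : ℂ) * (dvec m 0 : ℂ) * v 0 + (dvec m 2 : ℂ) * (dvec m 1 : ℂ) * v 1 - ((dvec m 0 : ℂ) ^ 2 + (dvec m 1 : ℂ) ^ 2) * v 2) * Complex.I_sq

lemma norm_potCoef_le (m : Fin 3 → ℤ) (v : C3) : ‖potCoef m v‖ ≤ 6 * ‖v‖ := by
  by_cases hm : m = 0
  · have : dvec m = 0 := by rw [hm]; ext i; simp [dvec]
    simp [potCoef, this]
  have h1 := one_le_norm_dvec_add (κ := 0) (by simp) hm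
  rw [add_zero] at h1
  set t := ‖dvec m‖ with ht
  have h2 := norm_crs_le (ikv (dvec m)) v
  rw [norm_ikv, ← ht] at h2
  rw [potCoef, norm_smul, norm_inv, Complex.norm_real, Real.norm_of_nonneg (by positivity),
    inv_mul_le_iff₀ (by positivity), ← ht]
  refine h2.trans ?_
  have : t ≤ t ^ 2 := by nlinarith
  nlinarith [norm_nonneg v]

lemma fcoef_sum (s : Finset (Fin 3 → ℤ)) (a : (Fin 3 → ℤ) → ℂ) (n : Fin 3 → ℤ) :
    fcoef (fun x => ∑ m ∈ s, a m * expi (dvec m) x) n = if n ∈ s then a n else 0 := by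
  have hi : ∀ m ∈ s, Integrable (fun x => (starRingEnd ℂ) (expi (dvec n) x) *
      (a m * expi (dvec m) x)) volQ := fun m _ =>
    integrable_of_mem_testP (mul_mem_testP (conj_mem_testP (expi_dvec_mem_testP n))
      (const_mul_mem_testP (expi_dvec_mem_testP m) (a m)))
  have e : ∀ m, ∫ x in cellQ, (starRingEnd ℂ) (expi (dvec n) x) * (a m * expi (dvec m) x) =
      if m = n then a m else 0 := by
    intro m
    have h1 : ∀ x, (starRingEnd ℂ) (expi (dvec n) x) * (a m * expi (dvec m) x) =
        a m * expi (dvec (m - n)) x := fun x => by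
      have : dvec (m - n) = dvec m + -dvec n := by ext i; simp [dvec]; ring
      rw [this, expi_add_left, expi_neg_left]; ring
    simp only [h1]
    rw [integral_const_mul, integral_volQ_expi]
    simp only [sub_eq_zero, mul_ite, mul_one, mul_zero]
  simp only [fcoef, Finset.mul_sum]
  rw [integral_finsetSum _ hi]
  simp only [e, Finset.sum_ite_eq']

/-- The vector Fourier coefficient. -/
def vcoef (v : R3 → C3) (m : Fin 3 → ℤ) : C3 := WithLp.toLp 2 fun j => fcoef (fun x => v x j) m

/-- A partial sum of the Fourier series of the vector potential. -/
def potSum (v : R3 → C3) (s : Finset (Fin 3 → ℤ)) (x : R3) : C3 :=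
  ∑ m ∈ s, expi (dvec m) x • potCoef m (vcoef v m)

lemma potSum_mem_testP (v : R3 → C3) (s : Finset (Fin 3 → ℤ)) : potSum v s ∈ testP (E := C3) :=
  ⟨ContDiff.sum fun m _ => (contDiff_expi _).smul contDiff_const, fun x n => by
    simp only [potSum, (expi_dvec_mem_testP _).2 x n]⟩

lemma curl_expi_smul (κ : R3) (a : C3) (x : R3) :
    curl (fun y => expi κ y • a) x = expi κ x • crs (ikv κ) a := by
  rw [curl_smul ((contDiff_expi κ).differentiable (by simp)) (differentiable_const a), curl_const,
    smul_zero, zero_add, ← crs_smul_left]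
  congr 1
  ext j
  simp [grad_apply, pd_expi, ikv]
  ring

/-- Nonzero frequencies have norm at least `2π`, so inverting the curl is bounded mode by mode. The
uniformity in `s` keeps the vector potential bounded while its curl approaches `v`. -/
lemma l2_potSum_le {v : R3 → C3} (hv : MemLp v 2 volQ) (s : Finset (Fin 3 → ℤ)) :
    l2 volQ (potSum v s) ≤ 6 * l2 volQ v := by
  refine le_of_sq_le_sq ?_ (mul_nonneg (by norm_num) (l2_nonneg _))
  have hp := memLp_of_mem_testP (potSum_mem_testP v s)
  have h1 := hasSum_sum (s := Finset.univ) fun j _ => hasSum_sq_fcoef (memLp_apply hp j)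
  rw [← l2_sq_eq_sum hp] at h1
  have h2 := (hasSum_sum (s := Finset.univ) fun j _ => hasSum_sq_fcoef (memLp_apply hv j)).mul_left
    36
  rw [← l2_sq_eq_sum hv] at h2
  refine (hasSum_le (fun m => ?_) h1 h2).trans (le_of_eq (by ring))
  have e : ∀ j, fcoef (fun x => potSum v s x j) m =
      if m ∈ s then potCoef m (vcoef v m) j else 0 := fun j => by
    rw [← fcoef_sum s (fun m => potCoef m (vcoef v m) j)]
    congr 1; ext x
    simp [potSum, mul_comm]
  simp only [e]
  have h3 : ∑ j, ‖fcoef (fun x => v x j) m‖ ^ 2 = ‖vcoef v m‖ ^ 2 :=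
    (EuclideanSpace.norm_sq_eq (vcoef v m)).symm
  rw [h3]
  by_cases hm : m ∈ s
  · simp only [hm, if_true]
    rw [← EuclideanSpace.norm_sq_eq]
    have := pow_le_pow_left₀ (norm_nonneg _) (norm_potCoef_le m (vcoef v m)) 2
    linarith
  · simp only [hm, if_false]
    simp only [norm_zero]
    rw [Finset.sum_eq_zero fun j _ => by norm_num]
    positivity

/-- The curl of a partial sum of the potential is the corresponding partial sum of `v`; the two
hypotheses on the coefficients are exactly what makes each mode a curl. -/
lemma tendsto_l2_curl_potSum {v : R3 → C3} (hv : MemLp v 2 volQ) (h0 : vcoef v 0 = 0)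
    (hdiv : ∀ m, ∑ j, (dvec m j : ℂ) * vcoef v m j = 0) :
    Tendsto (fun s => l2 volQ fun x => v x - curl (potSum v s) x) atTop (𝓝 0) := by
  have hlim : Tendsto (fun s : Finset (Fin 3 → ℤ) => ∑ j, l2 volQ fun x =>
      v x j - ∑ m ∈ s, fcoef (fun y => v y j) m * expi (dvec m) x) atTop (𝓝 (∑ _ : Fin 3, 0)) :=
    tendsto_finsetSum _ fun j _ => tendsto_fourier_partial (memLp_apply hv j)
  rw [Finset.sum_const_zero] at hlim
  refine squeeze_zero (fun n => l2_nonneg _) (fun s => ?_) hlim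
  have hm : MemLp (fun x => v x - curl (potSum v s) x) 2 volQ :=
    hv.sub (memLp_of_mem_testP (curl_mem_testP (potSum_mem_testP v s)))
  refine (l2_le_sum_apply hm).trans (le_of_eq (Finset.sum_congr rfl fun j _ => ?_))
  congr 1; ext x
  have e : curl (potSum v s) x = ∑ m ∈ s, expi (dvec m) x • vcoef v m := by
    have : potSum v s = fun y => ∑ m ∈ s, expi (dvec m) y • potCoef m (vcoef v m) := rfl
    have hdiff : ∀ m, Differentiable ℝ fun y => expi (dvec m) y • potCoef m (vcoef v m) := fun m =>
      ((contDiff_expi (dvec m)).smul contDiff_const).differentiable (by simp)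
    rw [this, curl_sum s hdiff]
    refine Finset.sum_congr rfl fun m _ => ?_
    rw [curl_expi_smul]
    by_cases hm : m = 0
    · rw [hm, h0]
      have : ∀ a : C3, crs a 0 = 0 := fun a => by ext i; fin_cases i <;> simp [crs]
      simp [potCoef, this]
    · rw [crs_ikv_potCoef hm (hdiv m)]
  rw [PiLp.sub_apply, e]
  simp [vcoef, mul_comm]

section
variable {A : R3 → RMat} {α β : ℝ} {M : CMat}

/-- Smooth approximants for the electric cell problem at zero quasimomentum. -/
lemma exists_electric_approx (hmean : GradMeanZero volume) (h : IsHatHom volume A 0 M)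
    (hT : Coef (fun x => cx (A x)⁻¹) α β) (j : Fin 3) :
    ∃ K : ℝ, 0 ≤ K ∧ ∀ δ : ℝ, 0 < δ → ∃ ψ ∈ testP (E := ℂ), ∃ G ∈ testP (E := C3),
      l2 volQ ψ ≤ K ∧ l2 volQ G ≤ K ∧ l2 volQ (fun x => grad ψ x + basisVec j) ≤ K ∧
      l2 volQ (fun x => mv (cx (A x)⁻¹) (grad ψ x + basisVec j) - (col M j + curl G x)) ≤ δ := by
  obtain ⟨ψ, r, hs, hc⟩ := h.exists_sol_col hT j
  have hz := hT.memLp hs.memLp_add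
  set v : R3 → C3 := fun x => mv (cx (A x)⁻¹) (r x + basisVec j) - col M j with hv
  have hvm : MemLp v 2 volQ := hz.sub (memLp_const _)
  have hdk : ∀ φ : R3 → ℂ, dk 0 φ = grad φ := fun φ => by ext1 x; simp [dk, ikv_zero]
  have hgradv : ∀ φ ∈ testP (E := ℂ), ∫ x in cellQ, inner ℂ (grad φ x) (v x) = 0 := by
    intro φ hφ
    rw [integral_inner_sub_right (memLp_of_mem_testP (grad_mem_testP hφ)) hz (memLp_const _),
      integral_cell_inner_grad_const hmean hφ, sub_zero]
    -- subtracting the mean does not change the gradient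
    set a := ∫ x in cellQ, φ x with ha
    have h1 : (fun x => φ x + -a) ∈ testP0 (E := ℂ) volume := by
      refine ⟨add_mem_testP hφ (const_mem_testP _), ?_⟩
      rw [integral_add (integrable_of_mem_testP hφ) (integrable_const _)]
      simp [ha]
    have h2 := hs.eq _ h1
    rw [hdk] at h2
    have h3 : ∀ x, grad (fun x => φ x + -a) x = grad φ x := fun x => by
      rw [grad_add (hφ.1.differentiable (by simp)) (differentiable_const _)]
      ext j; simp [grad_apply, pd_const]
    simpa only [h3] using h2
  have hvc : ∀ m d, inner ℂ d (vcoef v m) = ∫ x in cellQ, inner ℂ (expi (dvec m) x • d) (v x) := by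
    intro m d
    have hi : ∀ i, Integrable (fun x => (starRingEnd ℂ) (expi (dvec m) x) * v x i) volQ := fun i =>
      integrable_inner (𝕜 := ℂ) (memLp_expi (dvec m)) (memLp_apply hvm i) |>.congr
        (.of_forall fun x => by simp [mul_comm])
    have e : ∀ x, inner ℂ (expi (dvec m) x • d) (v x) =
        ∑ i, (starRingEnd ℂ) (d i) * ((starRingEnd ℂ) (expi (dvec m) x) * v x i) := fun x => by
      simp only [PiLp.inner_apply, PiLp.smul_apply, RCLike.inner_apply, smul_eq_mul, map_mul]
      refine Finset.sum_congr rfl fun i _ => ?_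
      ring
    simp only [e]
    rw [integral_finsetSum _ fun i _ => (hi i).const_mul _]
    simp only [integral_const_mul, PiLp.inner_apply, vcoef, fcoef, RCLike.inner_apply]
    exact Finset.sum_congr rfl fun i _ => mul_comm _ _
  -- The column of the homogenised matrix is the mean of the flux, so the difference `v` has mean
  -- zero.
  have h0 : vcoef v 0 = 0 := by
    refine ext_inner_left ℂ fun d => ?_
    have : dvec 0 = 0 := by ext i; simp [dvec]
    rw [hvc, this]
    simp only [expi_zero_left, one_smul, inner_zero_right]
    rw [integral_inner_sub_right (memLp_const d) hz (memLp_const _), hc, ← hs.inner_flux hT]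
    simp
  -- The cell equation tested with `e_{2πm}`.
  have hdiv : ∀ m, ∑ i, (dvec m i : ℂ) * vcoef v m i = 0 := by
    intro m
    have h1 := hgradv _ (expi_dvec_mem_testP m)
    have h2 : ∀ x, grad (expi (dvec m)) x = expi (dvec m) x • ikv (dvec m) := fun x => by
      ext i; simp [grad_apply, pd_expi, ikv]; ring
    simp only [h2] at h1
    rw [← hvc] at h1
    simp only [PiLp.inner_apply, ikv, RCLike.inner_apply, map_mul, Complex.conj_I,
      Complex.conj_ofReal] at h1
    have h3 : ∑ i, (dvec m i : ℂ) * vcoef v m i =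
        Complex.I * ∑ i, vcoef v m i * (-Complex.I * (dvec m i : ℂ)) := by
      rw [Finset.mul_sum]
      refine Finset.sum_congr rfl fun i _ => ?_
      linear_combination ((dvec m i : ℂ) * vcoef v m i) * Complex.I_sq
    rw [h3, h1, mul_zero]
  have hlim := tendsto_l2_curl_potSum hvm h0 hdiv
  obtain ⟨φ, hφ, h1, h2⟩ := hs.approx
  rw [show (fun n => l2 volQ fun x => dk 0 (φ n) x - r x) =
    fun n => l2 volQ fun x => grad (φ n) x - r x by simp only [hdk]] at h2
  have hβ := hT.bdd_pos
  refine ⟨max (max (l2 volQ ψ + 1) (6 * l2 volQ v)) (l2 volQ (fun x => r x + basisVec j) + 1),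
    le_max_of_le_right (add_nonneg (l2_nonneg _) zero_le_one), fun δ hδ => ?_⟩
  -- Half of `δ` is spent on the truncation of the vector potential, and half on the smooth
  -- approximation of the scalar one, whose gradient error is amplified by `β`.
  obtain ⟨s, hs'⟩ := (hlim.eventually (ge_mem_nhds (half_pos hδ))).exists
  obtain ⟨n, e1, e2, e3⟩ := ((h1.eventually (ge_mem_nhds one_pos)).and
    ((h2.eventually (ge_mem_nhds (show 0 < δ / (2 * β) by positivity))).and
      (h2.eventually (ge_mem_nhds one_pos)))).exists
  have hφm := memLp_of_mem_testP (hφ n).1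
  have hgm := memLp_of_mem_testP (grad_mem_testP (hφ n).1)
  have hGT := potSum_mem_testP v s
  have hd : MemLp (fun x => grad (φ n) x - r x) 2 volQ := hgm.sub hs.memLp'
  refine ⟨φ n, (hφ n).1, potSum v s, hGT, ?_, ?_, ?_, ?_⟩
  · refine (l2_le_add_sub hφm hs.memLp).trans (le_max_of_le_left (le_max_of_le_left ?_))
    linarith
  · exact (l2_potSum_le hvm s).trans (le_max_of_le_left (le_max_right _ _))
  · have hgb : MemLp (fun x => grad (φ n) x + basisVec j) 2 volQ := hgm.add (memLp_const _)
    refine (l2_le_add_sub hgb hs.memLp_add).trans (le_max_of_le_right ?_)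
    have : (fun x => (grad (φ n) x + basisVec j) - (r x + basisVec j)) =
        fun x => grad (φ n) x - r x := by
      ext1 x; abel
    rw [this]
    linarith
  · have e : ∀ x, mv (cx (A x)⁻¹) (grad (φ n) x + basisVec j) - (col M j + curl (potSum v s) x) =
        mv (cx (A x)⁻¹) (grad (φ n) x - r x) + (v x - curl (potSum v s) x) := fun x => by
      simp only [hv, mv_add, mv_sub]
      abel
    simp only [e]
    have hvG : MemLp (fun x => v x - curl (potSum v s) x) 2 volQ :=
      hvm.sub (memLp_of_mem_testP (curl_mem_testP hGT))
    refine (l2_add_le (hT.memLp hd) hvG).trans ?_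
    have h5 := (hT.l2_le hd).trans (mul_le_mul_of_nonneg_left e2 hβ.le)
    have h6 : β * (δ / (2 * β)) = δ / 2 := by field_simp
    linarith

end
end

section
/-! ### The homogenised symbol -/

lemma mv_crossI (θ : R3) (v : C3) : mv (crossI θ) v = crs (ikv θ) v := by
  ext i
  fin_cases i <;> simp [mv_apply, Fin.sum_univ_three, crossI, cx, crs, ikv] <;> ring

lemma norm_mv_crossI_le (θ : R3) (v : C3) : ‖mv (crossI θ) v‖ ≤ 6 * (‖θ‖ * ‖v‖) := by
  rw [mv_crossI]
  exact (norm_crs_le _ _).trans_eq (by rw [norm_ikv])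

lemma crossI_isHermitian (θ : R3) : (crossI θ).IsHermitian := by
  ext i j
  fin_cases i <;> fin_cases j <;> simp [crossI, cx, Matrix.conjTranspose_apply]

lemma inner_crossI (θ : R3) (u v : C3) :
    inner ℂ (mv (crossI θ) u) v = inner ℂ u (mv (crossI θ) v) :=
  inner_mv_of_isHermitian (crossI_isHermitian θ) u v

/-- The frequency as a complex vector. -/
def cvec (θ : R3) : C3 := WithLp.toLp 2 fun j => (θ j : ℂ)

lemma inner_cvec (θ : R3) (v : C3) : inner ℂ (cvec θ) v = ∑ j, (θ j : ℂ) * v j := by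
  simp [PiLp.inner_apply, cvec, mul_comm]

lemma ofReal_norm_sq (θ : R3) :
    ((‖θ‖ ^ 2 : ℝ) : ℂ) = (θ 0 : ℂ) ^ 2 + (θ 1 : ℂ) ^ 2 + (θ 2 : ℂ) ^ 2 := by
  rw [EuclideanSpace.norm_sq_eq, Fin.sum_univ_three]
  simp

lemma crossI_crossI (θ : R3) (v : C3) : mv (crossI θ) (mv (crossI θ) v) =
    ((‖θ‖ ^ 2 : ℝ) : ℂ) • v - inner ℂ (cvec θ) v • cvec θ := by
  rw [ofReal_norm_sq, inner_cvec, mv_crossI, mv_crossI, Fin.sum_univ_three]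
  ext i
  fin_cases i <;> simp [crs, ikv, cvec]
  · linear_combination ((θ 0 : ℂ) * (θ 1 : ℂ) * v 1 + (θ 0 : ℂ) * (θ 2 : ℂ) * v 2 - ((θ 1 : ℂ) ^ 2 + (θ 2 : ℂ) ^ 2) * v 0) * Complex.I_sq
  · linear_combination ((θ 1 : ℂ) * (θ 0 : ℂ) * v 0 + (θ 1 : ℂ) * (θ 2 : ℂ) * v 2 - ((θ 0 : ℂ) ^ 2 + (θ 2 : ℂ) ^ 2) * v 1) * Complex.I_sq
  · linear_combination ((θ 2 : ℂ) * (θ 0 : ℂ) * v 0 + (θ 2 : ℂ) * (θ 1 : ℂ) * v 1 - ((θ 0 : ℂ) ^ 2 + (θ 1 : ℂ) ^ 2) * v 2) * Complex.I_sq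

lemma inner_cvec_crossI (θ : R3) (v : C3) : inner ℂ (cvec θ) (mv (crossI θ) v) = 0 := by
  rw [inner_cvec, mv_crossI, Fin.sum_univ_three]
  simp [crs, ikv]
  ring

/-- On transversal vectors, `θ ↦ iθ×` gains a power of the frequency in the duality pairing. -/
lemma norm_sq_mul_inner {θ : R3} {r : C3} (hr : inner ℂ (cvec θ) r = 0) (u : C3) :
    ((‖θ‖ ^ 2 : ℝ) : ℂ) * inner ℂ u r = inner ℂ (mv (crossI θ) u) (mv (crossI θ) r) := by
  rw [inner_crossI, crossI_crossI, hr, zero_smul, sub_zero, inner_smul_right]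

/-- The homogenised matrices: both are coercive, and the electric one is bounded. -/
structure HomPair (Mt M : CMat) (α β : ℝ) : Prop where
  pos : 0 < α
  bdd_pos : 0 < β
  coer : ∀ v, α * ‖v‖ ^ 2 ≤ (inner ℂ v (mv M v)).re
  bdd : ∀ v, ‖mv M v‖ ≤ β * ‖v‖
  coer' : ∀ v, α * ‖v‖ ^ 2 ≤ (inner ℂ v (mv Mt v)).re

/-- The homogenised operator in the frequency domain. -/
def homMat (Mt M : CMat) (θ : R3) : CMat := crossI θ * Mt * crossI θ + M

/-- The solution of the homogenised problem in the frequency domain. -/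
def homSol (Mt M : CMat) (θ : R3) (r : C3) : C3 := mv (homMat Mt M θ)⁻¹ r

section
variable {Mt M : CMat} {α β : ℝ} {θ : R3} {r : C3}

lemma inner_homMat (v : C3) : inner ℂ v (mv (homMat Mt M θ) v) =
    inner ℂ (mv (crossI θ) v) (mv Mt (mv (crossI θ) v)) + inner ℂ v (mv M v) := by
  rw [homMat, add_mv, mv_mul, mv_mul, inner_add_right, ← inner_crossI]

lemma HomPair.coer_homMat (h : HomPair Mt M α β) (v : C3) :
    α * ‖mv (crossI θ) v‖ ^ 2 + α * ‖v‖ ^ 2 ≤ (inner ℂ v (mv (homMat Mt M θ) v)).re := by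
  rw [inner_homMat, Complex.add_re]
  exact add_le_add (h.coer' _) (h.coer _)

lemma HomPair.isUnit_homMat (h : HomPair Mt M α β) : IsUnit (homMat Mt M θ).det := by
  refine isUnit_det_of_coercive h.pos fun v => le_trans ?_ (h.coer_homMat v)
  have := h.pos
  have : 0 ≤ α * ‖mv (crossI θ) v‖ ^ 2 := by positivity
  linarith

lemma HomPair.isUnit (h : HomPair Mt M α β) : IsUnit M.det := isUnit_det_of_coercive h.pos h.coer

lemma HomPair.homSol_eq (h : HomPair Mt M α β) :
    mv (crossI θ) (mv Mt (mv (crossI θ) (homSol Mt M θ r))) + mv M (homSol Mt M θ r) = r := by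
  rw [← mv_mul, ← mv_mul, ← add_mv]
  exact mv_inv_cancel h.isUnit_homMat r

/-- The symbol written with the inverse of the electric matrix is the inverse of `homMat`. -/
lemma HomPair.symbol_eq (h : HomPair Mt M α β) :
    crossI θ * M⁻¹ * (frakA Mt M θ + 1)⁻¹ = crossI θ * (homMat Mt M θ)⁻¹ := by
  have h1 : frakA Mt M θ + 1 = homMat Mt M θ * M⁻¹ := by
    rw [frakA, homMat, Matrix.add_mul, Matrix.mul_nonsing_inv _ h.isUnit]
  rw [h1, Matrix.mul_inv_rev, Matrix.nonsing_inv_nonsing_inv _ h.isUnit, mul_assoc, ← mul_assoc M⁻¹,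
    Matrix.nonsing_inv_mul _ h.isUnit, one_mul]

lemma HomPair.energy (h : HomPair Mt M α β) :
    α * ‖mv (crossI θ) (homSol Mt M θ r)‖ ^ 2 + α * ‖homSol Mt M θ r‖ ^ 2 ≤
      ‖homSol Mt M θ r‖ * ‖r‖ := by
  refine (h.coer_homMat (θ := θ) _).trans ((Complex.re_le_norm _).trans
    ((norm_inner_le_norm _ _).trans_eq ?_))
  rw [homSol, mv_inv_cancel h.isUnit_homMat]

lemma HomPair.norm_homSol_le (h : HomPair Mt M α β) : ‖homSol Mt M θ r‖ ≤ α⁻¹ * ‖r‖ := by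
  have h1 := h.energy (θ := θ) (r := r)
  have hα := h.pos
  have h0 : 0 ≤ α * ‖mv (crossI θ) (homSol Mt M θ r)‖ ^ 2 := by positivity
  rw [le_inv_mul_iff₀ hα]
  rcases (norm_nonneg (homSol Mt M θ r)).eq_or_lt with h2 | h2
  · rw [← h2]; simp
  · refine le_of_mul_le_mul_left ?_ h2
    nlinarith

lemma HomPair.norm_cross_homSol_le (h : HomPair Mt M α β) :
    ‖mv (crossI θ) (homSol Mt M θ r)‖ ≤ α⁻¹ * ‖r‖ := by
  have h1 := h.energy (θ := θ) (r := r)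
  have hα := h.pos
  have h2 := h.norm_homSol_le (θ := θ) (r := r)
  rw [le_inv_mul_iff₀ hα] at h2 ⊢
  refine le_of_sq_le_sq ?_ (norm_nonneg _)
  have h3 : α * (‖homSol Mt M θ r‖ * ‖r‖) ≤ ‖r‖ ^ 2 := by
    rw [sq, ← mul_assoc]; exact mul_le_mul_of_nonneg_right h2 (norm_nonneg _)
  have h4 : 0 ≤ α * ‖homSol Mt M θ r‖ ^ 2 := by positivity
  have h5 := mul_le_mul_of_nonneg_left (le_of_add_le_of_nonneg_left h1 h4) hα.le
  calc (α * ‖mv (crossI θ) (homSol Mt M θ r)‖) ^ 2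
      = α * (α * ‖mv (crossI θ) (homSol Mt M θ r)‖ ^ 2) := by ring
    _ ≤ _ := h5.trans h3

lemma le_of_sq_mul_le {a b c : ℝ} (ha : 0 ≤ a) (hc : 0 ≤ c)
    (h : a ^ 2 * b ≤ a * c) : a * b ≤ c := by
  rcases ha.eq_or_lt with h0 | h0
  · rw [← h0]; simpa using hc
  · refine le_of_mul_le_mul_left ?_ h0
    rwa [← mul_assoc, ← sq]

/-- Pair the equation with `θ`: the curl term is orthogonal to `θ`, so `M h` inherits transversality
from `r`. The solution `h` itself need not be transversal. -/
lemma HomPair.inner_cvec_mv (h : HomPair Mt M α β) (hr : inner ℂ (cvec θ) r = 0) :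
    inner ℂ (cvec θ) (mv M (homSol Mt M θ r)) = 0 := by
  have h1 := congrArg (fun v => inner ℂ (cvec θ) v) (h.homSol_eq (θ := θ) (r := r))
  simp only [inner_add_right, inner_cvec_crossI, zero_add] at h1
  rw [h1, hr]

/-- As `M h` is transversal, `|θ|² ⟨h, M h⟩ = ⟨iθ×h, iθ×M h⟩`, which is at most a multiple of `|θ|
|iθ×h| |h|`. Coercivity of `M` then lets `|iθ×h|` control `|θ| |h|`, although `h` has a longitudinal
part. -/
lemma HomPair.norm_mul_homSol_le (h : HomPair Mt M α β) (hr : inner ℂ (cvec θ) r = 0) :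
    α * (‖θ‖ * ‖homSol Mt M θ r‖) ≤ 6 * β * ‖mv (crossI θ) (homSol Mt M θ r)‖ := by
  set v := homSol Mt M θ r with hv
  have hα := h.pos
  have hβ := h.bdd_pos
  have h1 : ‖θ‖ ^ 2 * (α * ‖v‖ ^ 2) ≤ ‖θ‖ * ((6 * β * ‖mv (crossI θ) v‖) * ‖v‖) := by
    have h2 := norm_sq_mul_inner (h.inner_cvec_mv hr) v
    have h3 : ‖θ‖ ^ 2 * (inner ℂ v (mv M v)).re ≤ ‖mv (crossI θ) v‖ * (6 * (‖θ‖ * (β * ‖v‖))) := by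
      rw [← Complex.re_ofReal_mul, h2]
      refine (Complex.re_le_norm _).trans ((norm_inner_le_norm _ _).trans ?_)
      refine mul_le_mul_of_nonneg_left ((norm_mv_crossI_le _ _).trans ?_) (norm_nonneg _)
      gcongr
      exact h.bdd _
    refine (mul_le_mul_of_nonneg_left (h.coer v) (by positivity)).trans (h3.trans_eq (by ring))
  have h4 := le_of_sq_mul_le (norm_nonneg θ) (by positivity) h1
  rcases (norm_nonneg v).eq_or_lt with h0 | h0
  · rw [← h0]; simp only [mul_zero]; positivity
  · refine le_of_mul_le_mul_right ?_ h0
    linarith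

/-- The same device with `y = iθ×h`, which is transversal by construction, and the coercive matrix
`Mt`; the equation bounds `iθ×Mt y = r - M h`. -/
lemma HomPair.norm_mul_cross_homSol_le (h : HomPair Mt M α β) :
    α * (‖θ‖ * ‖mv (crossI θ) (homSol Mt M θ r)‖) ≤ 6 * (1 + β * α⁻¹) * ‖r‖ := by
  set v := homSol Mt M θ r with hv
  set y := mv (crossI θ) v with hy
  have hα := h.pos
  have hβ := h.bdd_pos
  have hs : ‖mv (crossI θ) (mv Mt y)‖ ≤ (1 + β * α⁻¹) * ‖r‖ := by
    have h1 : mv (crossI θ) (mv Mt y) = r - mv M v := by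
      rw [eq_sub_iff_add_eq]; exact h.homSol_eq
    rw [h1]
    refine (norm_sub_le _ _).trans ?_
    rw [add_mul, one_mul, mul_assoc]
    gcongr
    exact (h.bdd _).trans (mul_le_mul_of_nonneg_left h.norm_homSol_le hβ.le)
  have h1 : ‖θ‖ ^ 2 * (α * ‖y‖ ^ 2) ≤ ‖θ‖ * ((6 * ((1 + β * α⁻¹) * ‖r‖)) * ‖y‖) := by
    have h2 : ((‖θ‖ ^ 2 : ℝ) : ℂ) * inner ℂ (mv Mt y) y =
        inner ℂ (mv (crossI θ) (mv Mt y)) (mv (crossI θ) y) :=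
      norm_sq_mul_inner (inner_cvec_crossI θ v) _
    have h3 : ‖θ‖ ^ 2 * (inner ℂ y (mv Mt y)).re ≤
        ((1 + β * α⁻¹) * ‖r‖) * (6 * (‖θ‖ * ‖y‖)) := by
      rw [← inner_conj_symm, Complex.conj_re, ← Complex.re_ofReal_mul, h2]
      refine (Complex.re_le_norm _).trans ((norm_inner_le_norm _ _).trans ?_)
      exact mul_le_mul hs (norm_mv_crossI_le _ _) (norm_nonneg _) (by positivity)
    refine (mul_le_mul_of_nonneg_left (h.coer' y) (by positivity)).trans (h3.trans_eq (by ring))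
  have h4 := le_of_sq_mul_le (norm_nonneg θ) (by positivity) h1
  rcases (norm_nonneg y).eq_or_lt with h0 | h0
  · rw [← h0]; simp only [mul_zero]; positivity
  · refine le_of_mul_le_mul_right ?_ h0
    linarith

/-- All the weighted bounds for the homogenised solution, with one constant. -/
lemma exists_homSol_bound (hα : 0 < α) (hβ : 0 < β) : ∃ K : ℝ, 0 < K ∧
    ∀ {Mt M : CMat} {θ : R3} {r : C3}, HomPair Mt M α β → inner ℂ (cvec θ) r = 0 →
      ‖homSol Mt M θ r‖ ≤ K * ‖r‖ ∧ ‖θ‖ * ‖homSol Mt M θ r‖ ≤ K * ‖r‖ ∧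
      ‖mv (crossI θ) (homSol Mt M θ r)‖ ≤ K * ‖r‖ ∧
      ‖θ‖ * ‖mv (crossI θ) (homSol Mt M θ r)‖ ≤ K * ‖r‖ := by
  refine ⟨α⁻¹ + α⁻¹ * (6 * β * α⁻¹) + α⁻¹ * (6 * (1 + β * α⁻¹)), by positivity,
    fun {Mt M θ r} h hr => ?_⟩
  have a1 : 0 ≤ α⁻¹ * ‖r‖ := by positivity
  have a2 : 0 ≤ α⁻¹ * (6 * β * α⁻¹) * ‖r‖ := by positivity
  have a3 : 0 ≤ α⁻¹ * (6 * (1 + β * α⁻¹)) * ‖r‖ := by positivity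
  have b1 := h.norm_homSol_le (θ := θ) (r := r)
  have b2 := h.norm_cross_homSol_le (θ := θ) (r := r)
  have b3 : ‖θ‖ * ‖homSol Mt M θ r‖ ≤ α⁻¹ * (6 * β * α⁻¹) * ‖r‖ := by
    rw [mul_assoc, le_inv_mul_iff₀ hα, mul_assoc]
    exact (h.norm_mul_homSol_le hr).trans (mul_le_mul_of_nonneg_left b2 (by positivity))
  have b4 : ‖θ‖ * ‖mv (crossI θ) (homSol Mt M θ r)‖ ≤ α⁻¹ * (6 * (1 + β * α⁻¹)) * ‖r‖ := by
    rw [mul_assoc, le_inv_mul_iff₀ hα]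
    exact h.norm_mul_cross_homSol_le
  refine ⟨?_, ?_, ?_, ?_⟩ <;> rw [add_mul, add_mul] <;> linarith

end

lemma measurable_crossI (i j : Fin 3) : Measurable fun θ => crossI θ i j := by
  fin_cases i <;> fin_cases j <;> simp [crossI, cx] <;> fun_prop

lemma measurable_homMat {Mt : CMat} {M : R3 → CMat} (hM : ∀ i j, Measurable fun θ => M θ i j)
    (i j : Fin 3) : Measurable fun θ => homMat Mt (M θ) θ i j := by
  simp only [homMat, Matrix.add_apply, Matrix.mul_apply]
  refine Measurable.add ?_ (hM i j)
  refine Finset.measurable_fun_sum _ fun k _ => ?_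
  refine (Finset.measurable_fun_sum _ fun l _ => ?_).mul (measurable_crossI k j)
  exact (measurable_crossI i l).mul_const _

lemma aestronglyMeasurable_homSol {Mt : CMat} {M : R3 → CMat}
    (hM : ∀ i j, Measurable fun θ => M θ i j) {r : R3 → C3} (hr : AEStronglyMeasurable r volume) :
    AEStronglyMeasurable (fun θ => homSol Mt (M θ) θ (r θ)) volume :=
  aestronglyMeasurable_mv (fun i j =>
    (measurable_inv_entries (measurable_homMat hM) i j).aestronglyMeasurable) hr

lemma aestronglyMeasurable_crossI {r : R3 → C3} (hr : AEStronglyMeasurable r volume) :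
    AEStronglyMeasurable (fun θ => mv (crossI θ) (r θ)) volume :=
  aestronglyMeasurable_mv (fun i j => (measurable_crossI i j).aestronglyMeasurable) hr
end

section
/-! ### Products of band-limited functions and oscillating periodic functions -/

/-- A square-integrable amplitude supported in the ball of radius `ε⁻¹`, bounded together with its
first moment. -/
structure IsLow (ε L : ℝ) (a : R3 → ℂ) : Prop where
  integrable : Integrable a
  memLp : MemLp a 2 volume
  supp : ∀ θ, ε⁻¹ ≤ ‖θ‖ → a θ = 0
  le : l2 volume a ≤ L
  moment_le : l2 volume (fun θ => ((‖θ‖ : ℝ) : ℂ) * a θ) ≤ L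

lemma MemLp.smul_left {α E : Type*} [MeasurableSpace α] {ν : Measure α} [NormedAddCommGroup E]
    [NormedSpace ℂ E] {f : α → E} (hf : MemLp f 2 ν) (c : ℂ) : MemLp (fun x => c • f x) 2 ν :=
  hf.const_smul c

section
variable {ε L : ℝ} {a : R3 → ℂ}

lemma IsLow.contDiff (h : IsLow ε L a) : ContDiff ℝ ∞ (fs a) := contDiff_fs h.integrable h.supp

lemma IsLow.differentiable (h : IsLow ε L a) : Differentiable ℝ (fs a) :=
  h.contDiff.differentiable (by simp)

lemma IsLow.nonneg (h : IsLow ε L a) : 0 ≤ L := (l2_nonneg _).trans h.le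

lemma IsLow.fs_smul {E : Type*} [NormedAddCommGroup E] [NormedSpace ℂ E] {w : R3 → E}
    (hε : 0 < ε) (h : IsLow ε L a) (hp : IsQPeriodic w) (hw : MemLp w 2 volQ) :
    MemLp (fun x => fs a x • rescale ε w x) 2 volume ∧
      l2 volume (fun x => fs a x • rescale ε w x) ≤ L * l2 volQ w := by
  have h1 := l2_fs_smul_rescale hε h.integrable h.memLp h.supp hp hw
  exact ⟨h1.1, h1.2.trans (mul_le_mul_of_nonneg_right h.le (l2_nonneg _))⟩

lemma IsLow.moment (h : IsLow ε L a) (i : Fin 3) :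
    Integrable (fun θ => Complex.I * θ i * a θ) ∧ MemLp (fun θ => Complex.I * θ i * a θ) 2 volume ∧
      l2 volume (fun θ => Complex.I * θ i * a θ) ≤ L := by
  have hm : AEStronglyMeasurable (fun θ : R3 => Complex.I * (θ i : ℂ)) volume := by
    have : Continuous fun θ : R3 => Complex.I * (θ i : ℂ) := by fun_prop
    exact this.aestronglyMeasurable
  have hn : AEStronglyMeasurable (fun θ : R3 => ((‖θ‖ : ℝ) : ℂ)) volume := by
    have : Continuous fun θ : R3 => ((‖θ‖ : ℝ) : ℂ) := by fun_prop
    exact this.aestronglyMeasurable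
  have hi : ∀ θ : R3, ‖Complex.I * (θ i : ℂ)‖ ≤ ‖θ‖ := fun θ => by
    rw [norm_mul, Complex.norm_I, one_mul, Complex.norm_real]
    exact PiLp.norm_apply_le θ i
  have hb : ∀ θ, ‖Complex.I * θ i * a θ‖ ≤ ε⁻¹ * ‖a θ‖ := fun θ => by
    rw [norm_mul]
    rcases le_or_gt ε⁻¹ ‖θ‖ with h1 | h1
    · rw [h.supp θ h1]; simp
    · exact mul_le_mul_of_nonneg_right ((hi θ).trans h1.le) (norm_nonneg _)
  have hb' : ∀ θ, ‖((‖θ‖ : ℝ) : ℂ) * a θ‖ ≤ ε⁻¹ * ‖a θ‖ := fun θ => by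
    rw [norm_mul, Complex.norm_real, norm_norm]
    rcases le_or_gt ε⁻¹ ‖θ‖ with h1 | h1
    · rw [h.supp θ h1]; simp
    · exact mul_le_mul_of_nonneg_right h1.le (norm_nonneg _)
  refine ⟨(h.integrable.norm.const_mul ε⁻¹).mono' (hm.mul h.memLp.1) (.of_forall hb),
    h.memLp.of_le_mul (hm.mul h.memLp.1) (.of_forall hb), ?_⟩
  have h2 : MemLp (fun θ => ((‖θ‖ : ℝ) : ℂ) * a θ) 2 volume :=
    h.memLp.of_le_mul (hn.mul h.memLp.1) (.of_forall hb')
  have h3 := l2_mono (f := fun θ => Complex.I * θ i * a θ) zero_le_one h2 (.of_forall fun θ => by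
    rw [one_mul, norm_mul, norm_mul _ (a θ), Complex.norm_real, norm_norm]
    exact mul_le_mul_of_nonneg_right (hi θ) (norm_nonneg _))
  exact (h3.trans_eq (one_mul _)).trans h.moment_le

lemma IsLow.pd_smul {E : Type*} [NormedAddCommGroup E] [NormedSpace ℂ E] {w : R3 → E}
    (hε : 0 < ε) (h : IsLow ε L a) (hp : IsQPeriodic w) (hw : MemLp w 2 volQ) (i : Fin 3) :
    MemLp (fun x => pd i (fs a) x • rescale ε w x) 2 volume ∧
      l2 volume (fun x => pd i (fs a) x • rescale ε w x) ≤ L * l2 volQ w := by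
  obtain ⟨m1, m2, m3⟩ := h.moment i
  have h1 := l2_fs_smul_rescale hε m1 m2 (fun θ hθ => by rw [h.supp θ hθ, mul_zero]) hp hw
  simp only [pd_fs h.integrable h.supp]
  exact ⟨h1.1, h1.2.trans (mul_le_mul_of_nonneg_right m3 (l2_nonneg _))⟩

lemma IsLow.sum_pd_smul (hε : 0 < ε) (h : IsLow ε L a) {w : Fin 3 → R3 → C3} {K : ℝ}
    (hp : ∀ i, IsQPeriodic (w i)) (hw : ∀ i, MemLp (w i) 2 volQ) (hK : ∀ i, l2 volQ (w i) ≤ K) :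
    MemLp (fun x => ∑ i, pd i (fs a) x • rescale ε (w i) x) 2 volume ∧
      l2 volume (fun x => ∑ i, pd i (fs a) x • rescale ε (w i) x) ≤ 3 * (L * K) := by
  have h1 := fun i => h.pd_smul hε (hp i) (hw i) i
  refine ⟨memLp_finsetSum _ fun i _ => (h1 i).1, (l2_sum_le _ fun i _ => (h1 i).1).trans ?_⟩
  have h2 := Finset.sum_le_sum fun i (_ : i ∈ Finset.univ) =>
    (h1 i).2.trans (mul_le_mul_of_nonneg_left (hK i) h.nonneg)
  refine h2.trans (le_of_eq ?_)
  simp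

lemma grad_eq_sum (f : R3 → ℂ) (x : R3) : grad f x = ∑ i, pd i f x • basisVec i :=
  (sum_basisVec (grad f x)).symm

lemma crs_sum_left {ι : Type*} (s : Finset ι) (c : ι → C3) (b : C3) :
    crs (∑ i ∈ s, c i) b = ∑ i ∈ s, crs (c i) b := by
  have h : ∀ c d : C3, crs (c + d) b = crs c b + crs d b := fun c d => by
    ext i; fin_cases i <;> simp [crs] <;> ring
  have h0 : crs 0 b = 0 := by ext i; fin_cases i <;> simp [crs]
  classical
  induction s using Finset.induction_on with
  | empty => simpa using h0
  | insert i s hi ih => rw [Finset.sum_insert hi, Finset.sum_insert hi, h, ih]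

lemma IsLow.crs_grad (hε : 0 < ε) (h : IsLow ε L a) {φ : R3 → C3} (hφ : φ ∈ testP) {K : ℝ}
    (hK : l2 volQ φ ≤ K) :
    MemLp (fun x => crs (grad (fs a) x) (rescale ε φ x)) 2 volume ∧
      l2 volume (fun x => crs (grad (fs a) x) (rescale ε φ x)) ≤ 18 * (L * K) := by
  have hm := memLp_of_mem_testP hφ
  have e : ∀ x, crs (grad (fs a) x) (rescale ε φ x) =
      ∑ i, pd i (fs a) x • rescale ε (fun y => crs (basisVec i) (φ y)) x := fun x => by
    rw [grad_eq_sum, crs_sum_left]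
    simp only [crs_smul_left, rescale]
  have hb : ∀ (i : Fin 3) y, ‖crs (basisVec i) (φ y)‖ ≤ 6 * ‖φ y‖ := fun i y => by
    simpa [norm_basisVec] using norm_crs_le (basisVec i) (φ y)
  have hcm : ∀ i : Fin 3, MemLp (fun y => crs (basisVec i) (φ y)) 2 volQ := fun i =>
    hm.of_le_mul (aestronglyMeasurable_crs aestronglyMeasurable_const hm.1) (.of_forall (hb i))
  simp only [e]
  have h1 := h.sum_pd_smul hε (w := fun i y => crs (basisVec i) (φ y)) (K := 6 * K)
    (fun i x n => by simp only [hφ.2 x n]) hcm fun i =>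
      (l2_mono (by norm_num) hm (.of_forall (hb i))).trans (by linarith)
  exact ⟨h1.1, h1.2.trans_eq (by ring)⟩

lemma IsLow.smul_grad (hε : 0 < ε) (h : IsLow ε L a) {p : R3 → ℂ} (hp : p ∈ testP) {K : ℝ}
    (hK : l2 volQ p ≤ K) :
    MemLp (fun x => rescale ε p x • grad (fs a) x) 2 volume ∧
      l2 volume (fun x => rescale ε p x • grad (fs a) x) ≤ 3 * (L * K) := by
  have hm := memLp_of_mem_testP hp
  have e : ∀ x, rescale ε p x • grad (fs a) x =
      ∑ i, pd i (fs a) x • rescale ε (fun y => p y • basisVec i) x := fun x => by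
    rw [grad_eq_sum, Finset.smul_sum]
    exact Finset.sum_congr rfl fun i _ => by simp only [rescale]; rw [smul_comm]
  have hb : ∀ (i : Fin 3) y, ‖p y • basisVec i‖ ≤ 1 * ‖p y‖ := fun i y => by
    rw [norm_smul, norm_basisVec, mul_one, one_mul]
  have hcm : ∀ i : Fin 3, MemLp (fun y => p y • basisVec i) 2 volQ := fun i =>
    hm.of_le_mul (hm.1.smul_const _) (.of_forall (hb i))
  simp only [e]
  exact h.sum_pd_smul hε (w := fun i y => p y • basisVec i)
    (fun i x n => by simp only [hp.2 x n]) hcm fun i =>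
      (l2_mono zero_le_one hm (.of_forall (hb i))).trans (by linarith)

end

/-! ### Correctors -/

/-- Smooth approximate solutions of the electric and magnetic cell problems in the direction `e`. -/
structure IsCorrector (T S : R3 → CMat) (ε K : ℝ) (e m₀ m₁ : C3) (ψ p : R3 → ℂ)
    (φ G : R3 → C3) : Prop where
  hψ : ψ ∈ testP
  hp : p ∈ testP
  hφ : φ ∈ testP
  hG : G ∈ testP
  leψ : l2 volQ ψ ≤ K
  lep : l2 volQ p ≤ K
  leφ : l2 volQ φ ≤ K
  leG : l2 volQ G ≤ K
  le₀ : l2 volQ (fun x => mv (T x) (grad ψ x + e) - (m₀ + curl G x)) ≤ K * ε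
  le₁ : l2 volQ (fun x => mv (S x) (e + curl φ x) - (m₁ + grad p x)) ≤ K * ε

/-- The two-scale field. -/
def corrField (ε : ℝ) (e : C3) (ψ : R3 → ℂ) (φ : R3 → C3) (H F : R3 → ℂ) (x : R3) : C3 :=
  H x • rescale ε (fun y => grad ψ y + e) x +
    (ε : ℂ) • (rescale ε ψ x • grad H x + F x • rescale ε φ x)

/-- The two-scale flux. -/
def corrCurl (ε : ℝ) (e : C3) (φ : R3 → C3) (F : R3 → ℂ) (x : R3) : C3 :=
  F x • rescale ε (fun y => e + curl φ y) x + (ε : ℂ) • crs (grad F x) (rescale ε φ x)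

section
variable {T S : R3 → CMat} {ε K L α β α' β' : ℝ} {e m₀ m₁ : C3} {ψ p : R3 → ℂ} {φ G : R3 → C3}
  {a b : R3 → ℂ}

/-- The terms containing `ψ` combine into the total gradient `ε ∇(ψ(·/ε) H)`, so the curl does not
see them. This is why `ψ ∇H` is part of the definition of the field. -/
lemma corrField_eq (hε : 0 < ε) (h : IsCorrector T S ε K e m₀ m₁ ψ p φ G) (ha : IsLow ε L a)
    (x : R3) : corrField ε e ψ φ (fs a) (fs b) x = fs a x • e +
      ((ε : ℂ) • grad (fun y => rescale ε ψ y * fs a y) x + (ε : ℂ) • (fs b x • rescale ε φ x)) := by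
  have hε' : (ε : ℂ) ≠ 0 := by exact_mod_cast hε.ne'
  rw [grad_mul ((contDiff_rescale h.hψ.1 ε).differentiable (by simp)) ha.differentiable,
    grad_rescale (h.hψ.1.differentiable (by simp))]
  simp only [corrField, rescale, smul_add, smul_smul]
  push_cast
  rw [show (ε : ℂ) * (fs a x * (ε : ℂ)⁻¹) = fs a x by field_simp]
  abel

lemma contDiff_corrField (hε : 0 < ε) (h : IsCorrector T S ε K e m₀ m₁ ψ p φ G) (ha : IsLow ε L a)
    (hb : IsLow ε L b) : ContDiff ℝ ∞ (corrField ε e ψ φ (fs a) (fs b)) := by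
  have h1 : corrField ε e ψ φ (fs a) (fs b) = _ := funext fun x => corrField_eq (b := b) hε h ha x
  rw [h1]
  have h2 : ContDiff ℝ ∞ (grad fun y => rescale ε ψ y * fs a y) :=
    contDiff_grad ((contDiff_rescale h.hψ.1 ε).mul ha.contDiff)
  have h3 : ContDiff ℝ ∞ (rescale ε φ) := contDiff_rescale h.hφ.1 ε
  have h4 : ContDiff ℝ ∞ fun x => fs b x • rescale ε φ x := hb.contDiff.smul h3
  have h5 : ContDiff ℝ ∞ fun x => (ε : ℂ) • grad (fun y => rescale ε ψ y * fs a y) x :=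
    h2.const_smul (ε : ℂ)
  have h6 : ContDiff ℝ ∞ fun x => (ε : ℂ) • (fs b x • rescale ε φ x) := h4.const_smul (ε : ℂ)
  exact (ha.contDiff.smul contDiff_const).add (h5.add h6)

/-- For one direction the terms `∇a × e` and `b e` do not match. They cancel after summation over
the three directions, because the `b` are the components of the curl of the field with components
`a`. -/
lemma curl_corrField (hε : 0 < ε) (h : IsCorrector T S ε K e m₀ m₁ ψ p φ G) (ha : IsLow ε L a)
    (hb : IsLow ε L b) (x : R3) : curl (corrField ε e ψ φ (fs a) (fs b)) x =
      crs (grad (fs a) x) e - fs b x • e + corrCurl ε e φ (fs b) x := by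
  have hε' : (ε : ℂ) ≠ 0 := by exact_mod_cast hε.ne'
  have h1 : corrField ε e ψ φ (fs a) (fs b) = _ := funext fun x => corrField_eq (b := b) hε h ha x
  have hs := (contDiff_rescale h.hψ.1 ε).mul ha.contDiff
  have h2 : ContDiff ℝ ∞ (grad fun y => rescale ε ψ y * fs a y) := contDiff_grad hs
  have h3 : ContDiff ℝ ∞ (rescale ε φ) := contDiff_rescale h.hφ.1 ε
  have d1 : Differentiable ℝ fun y => fs a y • e := ha.differentiable.smul_const e
  have d2 : Differentiable ℝ (grad fun y => rescale ε ψ y * fs a y) := h2.differentiable (by simp)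
  have d2' : Differentiable ℝ fun x => (ε : ℂ) • grad (fun y => rescale ε ψ y * fs a y) x :=
    d2.const_smul (ε : ℂ)
  have d3' : Differentiable ℝ (rescale ε φ) := h3.differentiable (by simp)
  have d3 : Differentiable ℝ fun y => fs b y • rescale ε φ y := hb.differentiable.smul d3'
  have d3'' : Differentiable ℝ fun x => (ε : ℂ) • (fs b x • rescale ε φ x) := d3.const_smul (ε : ℂ)
  have d4 : Differentiable ℝ fun x => (ε : ℂ) • grad (fun y => rescale ε ψ y * fs a y) x +
      (ε : ℂ) • (fs b x • rescale ε φ x) := d2'.add d3''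
  rw [h1, curl_add d1 d4, curl_add d2' d3'', curl_const_smul d2, curl_const_smul d3, curl_grad hs,
    curl_smul ha.differentiable (differentiable_const e), curl_const, curl_smul hb.differentiable d3',
    curl_rescale (h.hφ.1.differentiable (by simp))]
  simp only [corrCurl, rescale, smul_add, smul_zero, zero_add, smul_smul]
  push_cast
  rw [show (ε : ℂ) * (fs b x * (ε : ℂ)⁻¹) = fs b x by field_simp]
  abel

lemma memLp_corrField (hε : 0 < ε) (h : IsCorrector T S ε K e m₀ m₁ ψ p φ G) (ha : IsLow ε L a)
    (hb : IsLow ε L b) : MemLp (corrField ε e ψ φ (fs a) (fs b)) 2 volume := by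
  have hw : (fun y => grad ψ y + e) ∈ testP (E := C3) :=
    add_mem_testP (grad_mem_testP h.hψ) (const_mem_testP e)
  exact (ha.fs_smul hε hw.2 (memLp_of_mem_testP hw)).1.add
    (((ha.smul_grad hε h.hψ h.leψ).1.add (hb.fs_smul hε h.hφ.2 (memLp_of_mem_testP h.hφ)).1).const_smul
      (ε : ℂ))

lemma memLp_corrCurl (hε : 0 < ε) (h : IsCorrector T S ε K e m₀ m₁ ψ p φ G)
    (hb : IsLow ε L b) : MemLp (corrCurl ε e φ (fs b)) 2 volume := by
  have hw : (fun y => e + curl φ y) ∈ testP (E := C3) :=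
    add_mem_testP (const_mem_testP e) (curl_mem_testP h.hφ)
  exact (hb.fs_smul hε hw.2 (memLp_of_mem_testP hw)).1.add
    ((hb.crs_grad hε h.hφ h.leφ).1.const_smul (ε : ℂ))

lemma Coef.memLp_rescale (hS : Coef S α β) {f : R3 → C3} (hf : MemLp f 2 volume) :
    MemLp (fun x => mv (rescale ε S x) (f x)) 2 volume ∧
      l2 volume (fun x => mv (rescale ε S x) (f x)) ≤ β * l2 volume f := by
  have hm : ∀ i j, Measurable fun x => rescale ε S x i j := fun i j =>
    (hS.meas i j).comp (measurable_const_smul ε⁻¹)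
  exact ⟨memLp_mv (fun i j => (hm i j).aestronglyMeasurable) (fun x => hS.bdd _) hf,
    l2_mono hS.bdd_pos.le hf (.of_forall fun x => hS.bdd _ _)⟩

/-- The remainder in the expansion of the magnetic flux. -/
lemma exists_magnetic_remainder (hε : 0 < ε) (hS : Coef S α β)
    (h : IsCorrector T S ε K e m₀ m₁ ψ p φ G) (ha : IsLow ε L a) (hb : IsLow ε L b) :
    ∃ X : R3 → C3, MemLp X 2 volume ∧ l2 volume X ≤ ε * (L * K * (5 + 18 * β)) ∧
      ∀ x, mv (rescale ε S x) (corrCurl ε e φ (fs b) x) = fs b x • m₁ +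
        ((ε : ℂ) • grad (fun y => rescale ε p y * fs b y) x + X x) -
          (ε : ℂ) • (fs a x • rescale ε G x) := by
  have hε' : (ε : ℂ) ≠ 0 := by exact_mod_cast hε.ne'
  have hβ := hS.bdd_pos
  set E : R3 → C3 := fun x => mv (S x) (e + curl φ x) - (m₁ + grad p x) with hE
  have hw : (fun y => e + curl φ y) ∈ testP (E := C3) :=
    add_mem_testP (const_mem_testP e) (curl_mem_testP h.hφ)
  have hw' : (fun y => m₁ + grad p y) ∈ testP (E := C3) :=
    add_mem_testP (const_mem_testP m₁) (grad_mem_testP h.hp)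
  have hEm : MemLp E 2 volQ := (hS.memLp (memLp_of_mem_testP hw)).sub (memLp_of_mem_testP hw')
  have hEp : IsQPeriodic E := fun x n => by
    have e1 := hw.2 x n
    have e2 := hw'.2 x n
    simp only at e1 e2
    simp only [hE, e1, e2, hS.per x n]
  obtain ⟨m1, l1⟩ := hb.fs_smul hε hEp hEm
  obtain ⟨m2, l2'⟩ := hb.crs_grad hε h.hφ h.leφ
  obtain ⟨m3, l3⟩ := hb.smul_grad hε h.hp h.lep
  obtain ⟨m4, l4⟩ := ha.fs_smul hε h.hG.2 (memLp_of_mem_testP h.hG)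
  obtain ⟨m5, l5⟩ := hS.memLp_rescale (ε := ε) m2
  have m6 : MemLp (fun x => mv (rescale ε S x) (crs (grad (fs b) x) (rescale ε φ x)) -
      rescale ε p x • grad (fs b) x) 2 volume := m5.sub m3
  have m7 : MemLp (fun x => mv (rescale ε S x) (crs (grad (fs b) x) (rescale ε φ x)) -
      rescale ε p x • grad (fs b) x + fs a x • rescale ε G x) 2 volume := m6.add m4
  -- The remainder collects the corrector error `E`, the commutator terms from `∇F × φ` and `p ∇F`,
  -- and the term with `G`. The latter is also subtracted outside `X`, where it will cancel the curl
  -- part of the electric expansion.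
  refine ⟨fun x => fs b x • rescale ε E x + (ε : ℂ) •
    (mv (rescale ε S x) (crs (grad (fs b) x) (rescale ε φ x)) - rescale ε p x • grad (fs b) x +
      fs a x • rescale ε G x), m1.add (MemLp.smul_left m7 (ε : ℂ)), ?_, fun x => ?_⟩
  · have hL := ha.nonneg
    refine (l2_add_le m1 (MemLp.smul_left m7 (ε : ℂ))).trans ?_
    rw [l2_const_smul, Complex.norm_real, Real.norm_of_nonneg hε.le]
    have a1 := l1.trans (mul_le_mul_of_nonneg_left h.le₁ hL)
    have a2 := (l2_add_le m6 m4).trans (add_le_add (l2_sub_le m5 m3) le_rfl)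
    have a4 := l4.trans (mul_le_mul_of_nonneg_left h.leG hL)
    have a5 := l5.trans (mul_le_mul_of_nonneg_left l2' hβ.le)
    have a6 := a2.trans (add_le_add (add_le_add a5 l3) a4)
    calc _ ≤ L * (K * ε) + ε * (β * (18 * (L * K)) + 3 * (L * K) + L * K) :=
          add_le_add a1 (mul_le_mul_of_nonneg_left a6 hε.le)
      _ = _ := by ring
  · rw [grad_mul ((contDiff_rescale h.hp.1 ε).differentiable (by simp)) hb.differentiable,
      grad_rescale (h.hp.1.differentiable (by simp))]
    simp only [corrCurl, hE, rescale, mv_add, mv_smul, smul_add, smul_sub, smul_smul]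
    push_cast
    rw [show (ε : ℂ) * (fs b x * (ε : ℂ)⁻¹) = fs b x by field_simp]
    abel

/-- The remainder in the expansion of the electric field. -/
lemma exists_electric_remainder (hε : 0 < ε) (hT : Coef T α β)
    (h : IsCorrector T S ε K e m₀ m₁ ψ p φ G) (ha : IsLow ε L a) (hb : IsLow ε L b) :
    ∃ Y : R3 → C3, MemLp Y 2 volume ∧ l2 volume Y ≤ ε * (L * K * (19 + 4 * β)) ∧
      ∀ x, mv (rescale ε T x) (corrField ε e ψ φ (fs a) (fs b) x) = fs a x • m₀ +
        ((ε : ℂ) • curl (fun y => fs a y • rescale ε G y) x + Y x) := by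
  have hε' : (ε : ℂ) ≠ 0 := by exact_mod_cast hε.ne'
  have hβ := hT.bdd_pos
  set E : R3 → C3 := fun x => mv (T x) (grad ψ x + e) - (m₀ + curl G x) with hE
  have hw : (fun y => grad ψ y + e) ∈ testP (E := C3) :=
    add_mem_testP (grad_mem_testP h.hψ) (const_mem_testP e)
  have hw' : (fun y => m₀ + curl G y) ∈ testP (E := C3) :=
    add_mem_testP (const_mem_testP m₀) (curl_mem_testP h.hG)
  have hEm : MemLp E 2 volQ := (hT.memLp (memLp_of_mem_testP hw)).sub (memLp_of_mem_testP hw')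
  have hEp : IsQPeriodic E := fun x n => by
    have e1 := hw.2 x n
    have e2 := hw'.2 x n
    simp only at e1 e2
    simp only [hE, e1, e2, hT.per x n]
  obtain ⟨m1, l1⟩ := ha.fs_smul hε hEp hEm
  obtain ⟨m2, l2'⟩ := ha.smul_grad hε h.hψ h.leψ
  obtain ⟨m3, l3⟩ := hb.fs_smul hε h.hφ.2 (memLp_of_mem_testP h.hφ)
  obtain ⟨m4, l4⟩ := ha.crs_grad hε h.hG h.leG
  have m23 : MemLp (fun x => rescale ε ψ x • grad (fs a) x + fs b x • rescale ε φ x) 2 volume :=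
    m2.add m3
  obtain ⟨m5, l5⟩ := hT.memLp_rescale (ε := ε) m23
  have m6 : MemLp (fun x => mv (rescale ε T x) (rescale ε ψ x • grad (fs a) x +
      fs b x • rescale ε φ x) - crs (grad (fs a) x) (rescale ε G x)) 2 volume := m5.sub m4
  -- The flux corrector `curl G` is written as `ε curl(H G(·/ε))` minus the commutator `ε ∇H ×
  -- G(·/ε)`; the other contributions are the corrector error and the terms of order `ε` in the
  -- field.
  refine ⟨fun x => fs a x • rescale ε E x + (ε : ℂ) •
    (mv (rescale ε T x) (rescale ε ψ x • grad (fs a) x + fs b x • rescale ε φ x) -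
      crs (grad (fs a) x) (rescale ε G x)), m1.add (MemLp.smul_left m6 (ε : ℂ)), ?_, fun x => ?_⟩
  · have hL := ha.nonneg
    refine (l2_add_le m1 (MemLp.smul_left m6 (ε : ℂ))).trans ?_
    rw [l2_const_smul, Complex.norm_real, Real.norm_of_nonneg hε.le]
    have a1 := l1.trans (mul_le_mul_of_nonneg_left h.le₀ hL)
    have a3 := l3.trans (mul_le_mul_of_nonneg_left h.leφ hL)
    have a23 := (l2_add_le m2 m3).trans (add_le_add l2' a3)
    have a5 := l5.trans (mul_le_mul_of_nonneg_left a23 hβ.le)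
    have a6 := (l2_sub_le m5 m4).trans (add_le_add a5 l4)
    calc _ ≤ L * (K * ε) + ε * (β * (3 * (L * K) + L * K) + 18 * (L * K)) :=
          add_le_add a1 (mul_le_mul_of_nonneg_left a6 hε.le)
      _ = _ := by ring
  · rw [curl_smul ha.differentiable ((contDiff_rescale h.hG.1 ε).differentiable (by simp)),
      curl_rescale (h.hG.1.differentiable (by simp))]
    simp only [corrField, hE, rescale, mv_add, mv_smul, smul_add, smul_sub, smul_smul]
    push_cast
    rw [show (ε : ℂ) * (fs a x * (ε : ℂ)⁻¹) = fs a x by field_simp]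
    abel

/-- The two-scale field solves the homogenised equation up to terms of order `ε`. -/
lemma corrector_residual (hε : 0 < ε) (hT : Coef T α β) (hS : Coef S α' β')
    (h : IsCorrector T S ε K e m₀ m₁ ψ p φ G) (ha : IsLow ε L a) (hb : IsLow ε L b)
    {u : R3 → C3} (hu : u ∈ testC) :
    ‖(∫ x, inner ℂ (curl u x) (mv (rescale ε S x) (corrCurl ε e φ (fs b) x))) +
      (∫ x, inner ℂ (u x) (mv (rescale ε T x) (corrField ε e ψ φ (fs a) (fs b) x))) -
      ((∫ x, inner ℂ (curl u x) (fs b x • m₁)) + ∫ x, inner ℂ (u x) (fs a x • m₀))‖ ≤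
    ε * (L * K * (19 + 4 * β + 18 * β')) * (l2 volume u + l2 volume (curl u)) := by
  obtain ⟨X, hX, lX, eX⟩ := exists_magnetic_remainder hε hS h ha hb
  obtain ⟨Y, hY, lY, eY⟩ := exists_electric_remainder hε hT h ha hb
  have hum := memLp_of_mem_testC hu
  have hcm := memLp_of_mem_testC (curl_mem_testC hu)
  have hm : ∀ {a : R3 → ℂ}, IsLow ε L a → ∀ m : C3, MemLp (fun x => fs a x • m) 2 volume :=
    fun ha m => (ha.fs_smul (w := fun _ => m) hε (fun _ _ => rfl) (memLp_const m)).1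
  have hGm := (ha.fs_smul hε h.hG.2 (memLp_of_mem_testP h.hG)).1
  have hGs : ContDiff ℝ ∞ fun y => fs a y • rescale ε G y :=
    ha.contDiff.smul (contDiff_rescale h.hG.1 ε)
  have hps : ContDiff ℝ ∞ fun y => rescale ε p y * fs b y :=
    (contDiff_rescale h.hp.1 ε).mul hb.contDiff
  have hpm : MemLp (grad fun y => rescale ε p y * fs b y) 2 volume := by
    have e1 : (grad fun y => rescale ε p y * fs b y) = fun x => rescale ε p x • grad (fs b) x +
        fs b x • (((ε⁻¹ : ℝ) : ℂ) • rescale ε (grad p) x) := funext fun x => by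
      rw [grad_mul ((contDiff_rescale h.hp.1 ε).differentiable (by simp)) hb.differentiable,
        grad_rescale (h.hp.1.differentiable (by simp))]
    rw [e1]
    simp only [smul_comm _ ((ε⁻¹ : ℝ) : ℂ)]
    have hgp := grad_mem_testP h.hp
    exact (hb.smul_grad hε h.hp h.lep).1.add
      (MemLp.smul_left (hb.fs_smul hε hgp.2 (memLp_of_mem_testP hgp)).1 _)
  have hcG : MemLp (curl fun y => fs a y • rescale ε G y) 2 volume := by
    have e1 : (curl fun y => fs a y • rescale ε G y) = fun x =>
        fs a x • (((ε⁻¹ : ℝ) : ℂ) • rescale ε (curl G) x) + crs (grad (fs a) x) (rescale ε G x) :=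
      funext fun x => by
        rw [curl_smul ha.differentiable ((contDiff_rescale h.hG.1 ε).differentiable (by simp)),
          curl_rescale (h.hG.1.differentiable (by simp))]
    rw [e1]
    simp only [smul_comm _ ((ε⁻¹ : ℝ) : ℂ)]
    have hcg := curl_mem_testP h.hG
    exact (MemLp.smul_left (ha.fs_smul hε hcg.2 (memLp_of_mem_testP hcg)).1 _).add
      (ha.crs_grad hε h.hG h.leG).1
  have n1 : MemLp (fun x => (ε : ℂ) • grad (fun y => rescale ε p y * fs b y) x) 2 volume :=
    MemLp.smul_left hpm (ε : ℂ)
  have n2 : MemLp (fun x => (ε : ℂ) • grad (fun y => rescale ε p y * fs b y) x + X x) 2 volume :=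
    n1.add hX
  have n3 : MemLp (fun x => (ε : ℂ) • (fs a x • rescale ε G x)) 2 volume :=
    MemLp.smul_left hGm (ε : ℂ)
  have n4 : MemLp (fun x => fs b x • m₁ +
      ((ε : ℂ) • grad (fun y => rescale ε p y * fs b y) x + X x)) 2 volume := (hm hb m₁).add n2
  have n5 : MemLp (fun x => (ε : ℂ) • curl (fun y => fs a y • rescale ε G y) x) 2 volume :=
    MemLp.smul_left hcG (ε : ℂ)
  have n6 : MemLp (fun x => (ε : ℂ) • curl (fun y => fs a y • rescale ε G y) x + Y x) 2 volume :=
    n5.add hY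
  -- The gradient in the flux drops out, since it is paired with a curl.
  have k1 : ∫ x, inner ℂ (curl u x) (mv (rescale ε S x) (corrCurl ε e φ (fs b) x)) =
      (∫ x, inner ℂ (curl u x) (fs b x • m₁)) + (∫ x, inner ℂ (curl u x) (X x)) -
        ε * ∫ x, inner ℂ (curl u x) (fs a x • rescale ε G x) := by
    simp only [eX]
    rw [integral_inner_sub_right hcm n4 n3, integral_inner_add_right hcm (hm hb m₁) n2,
      integral_inner_add_right hcm n1 hX]
    simp only [inner_smul_right _ _ (ε : ℂ)]
    rw [integral_const_mul, integral_const_mul, integral_inner_curl_grad hu hps, mul_zero, zero_add]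
  -- The curl is moved onto `u`; the result cancels the last term of `k1`.
  have k2 : ∫ x, inner ℂ (u x) (mv (rescale ε T x) (corrField ε e ψ φ (fs a) (fs b) x)) =
      (∫ x, inner ℂ (u x) (fs a x • m₀)) +
        (ε * (∫ x, inner ℂ (curl u x) (fs a x • rescale ε G x)) + ∫ x, inner ℂ (u x) (Y x)) := by
    simp only [eY]
    rw [integral_inner_add_right hum (hm ha m₀) n6, integral_inner_add_right hum n5 hY]
    simp only [inner_smul_right _ _ (ε : ℂ)]
    rw [integral_const_mul, integral_inner_curl hu hGs]
  rw [k1, k2]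
  have hL := ha.nonneg
  have hK : 0 ≤ K := (l2_nonneg _).trans h.leψ
  have hβ := hT.bdd_pos
  have hβ' := hS.bdd_pos
  have b1 : ‖∫ x, inner ℂ (curl u x) (X x)‖ ≤ l2 volume (curl u) * (ε * (L * K * (5 + 18 * β'))) :=
    (norm_integral_inner_le hcm hX).trans (mul_le_mul_of_nonneg_left lX (l2_nonneg _))
  have b2 : ‖∫ x, inner ℂ (u x) (Y x)‖ ≤ l2 volume u * (ε * (L * K * (19 + 4 * β))) :=
    (norm_integral_inner_le hum hY).trans (mul_le_mul_of_nonneg_left lY (l2_nonneg _))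
  have hc := l2_nonneg (ν := volume) (curl u)
  have hu0 := l2_nonneg (ν := volume) u
  calc _ = ‖(∫ x, inner ℂ (curl u x) (X x)) + ∫ x, inner ℂ (u x) (Y x)‖ := by congr 1; ring
    _ ≤ l2 volume (curl u) * (ε * (L * K * (5 + 18 * β'))) +
        l2 volume u * (ε * (L * K * (19 + 4 * β))) := (norm_add_le _ _).trans (add_le_add b1 b2)
    _ ≤ l2 volume (curl u) * (ε * (L * K * (19 + 4 * β + 18 * β'))) +
        l2 volume u * (ε * (L * K * (19 + 4 * β + 18 * β'))) := by
      have hLK : 0 ≤ L * K := mul_nonneg hL hK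
      refine add_le_add (mul_le_mul_of_nonneg_left (mul_le_mul_of_nonneg_left
        (mul_le_mul_of_nonneg_left ?_ hLK) hε.le) hc) (mul_le_mul_of_nonneg_left
        (mul_le_mul_of_nonneg_left (mul_le_mul_of_nonneg_left ?_ hLK) hε.le) hu0) <;> linarith
    _ = _ := by ring

end
end

section
/-! ### The low-frequency part of the homogenised solution -/

/-- `h` is the solution of the homogenised problem with data `r`, in the frequency domain, with the
bounds that it satisfies. -/
structure IsHomField (Mt M₀ : CMat) (M : R3 → CMat) (ε K : ℝ) (r h : R3 → C3) : Prop where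
  memLp : MemLp r 2 volume
  meas : AEStronglyMeasurable h volume
  nonneg : 0 ≤ K
  transversal : ∀ᵐ θ, inner ℂ (cvec θ) (r θ) = 0
  eq : ∀ᵐ θ, mv (crossI θ) (mv Mt (mv (crossI θ) (h θ))) + mv (M θ) (h θ) = r θ
  bound : ∀ᵐ θ, ‖h θ‖ ≤ K * ‖r θ‖ ∧ ‖θ‖ * ‖h θ‖ ≤ K * ‖r θ‖ ∧
    ‖mv (crossI θ) (h θ)‖ ≤ K * ‖r θ‖ ∧ ‖θ‖ * ‖mv (crossI θ) (h θ)‖ ≤ K * ‖r θ‖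
  lip : ∀ θ, ‖θ‖ < ε⁻¹ → ∀ c, ‖mv (M θ) c - mv M₀ c‖ ≤ K * (ε * ‖θ‖) * ‖c‖

/-- Truncation to the frequencies below `ε⁻¹`. -/
def lowPart (ε : ℝ) (h : R3 → C3) : R3 → C3 := (Metric.ball (0 : R3) ε⁻¹).indicator h

lemma lowPart_of_lt {ε : ℝ} {h : R3 → C3} {θ : R3} (hθ : ‖θ‖ < ε⁻¹) : lowPart ε h θ = h θ :=
  Set.indicator_of_mem (mem_ball_zero_iff.2 hθ) h

lemma lowPart_of_le {ε : ℝ} {h : R3 → C3} {θ : R3} (hθ : ε⁻¹ ≤ ‖θ‖) : lowPart ε h θ = 0 :=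
  Set.indicator_of_notMem (fun h' => absurd (mem_ball_zero_iff.1 h') hθ.not_gt) h

lemma crossI_lowPart {ε : ℝ} {h : R3 → C3} (θ : R3) :
    mv (crossI θ) (lowPart ε h θ) = lowPart ε (fun θ => mv (crossI θ) (h θ)) θ := by
  rcases lt_or_ge ‖θ‖ ε⁻¹ with h1 | h1
  · rw [lowPart_of_lt h1, lowPart_of_lt h1]
  · rw [lowPart_of_le h1, lowPart_of_le h1, mv_zero]

lemma isLow_lowPart {ε K : ℝ} {r v : R3 → C3} (hr : MemLp r 2 volume)
    (hv : AEStronglyMeasurable v volume) (hK : 0 ≤ K)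
    (h : ∀ᵐ θ, ‖v θ‖ ≤ K * ‖r θ‖ ∧ ‖θ‖ * ‖v θ‖ ≤ K * ‖r θ‖) (j : Fin 3) :
    IsLow ε (K * l2 volume r) (fun θ => lowPart ε v θ j) := by
  have hm : MemLp v 2 volume := hr.of_le_mul hv (h.mono fun θ h => h.1)
  have hi := MemLp.indicator_ball hm ε⁻¹
  have hle : ∀ θ, ‖lowPart ε v θ j‖ ≤ ‖v θ‖ := fun θ => by
    refine (norm_apply_le _ _).trans ?_
    rcases lt_or_ge ‖θ‖ ε⁻¹ with h1 | h1
    · rw [lowPart_of_lt h1]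
    · rw [lowPart_of_le h1, norm_zero]; exact norm_nonneg _
  refine ⟨integrable_apply hi.2 j, memLp_apply hi.1 j, fun θ hθ => by simp [lowPart_of_le hθ],
    l2_mono hK hr ?_, l2_mono hK hr ?_⟩
  · filter_upwards [h] with θ h1
    exact (hle θ).trans h1.1
  · filter_upwards [h] with θ h1
    rw [norm_mul, Complex.norm_real, norm_norm]
    exact (mul_le_mul_of_nonneg_left (hle θ) (norm_nonneg _)).trans h1.2

lemma fs_smul_const {b : R3 → ℂ} (hb : Integrable b) (m : C3) (x : R3) :
    fs (fun θ => b θ • m) x = fs b x • m := by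
  ext i
  rw [fs_apply (hb.smul_const m)]
  simp only [PiLp.smul_apply, smul_eq_mul, fs, ← mul_assoc]
  rw [integral_mul_const, mul_assoc]

lemma integral_inner_fs_smul {u : R3 → C3} (hu : u ∈ testC) {b : R3 → ℂ} (hb : Integrable b)
    (m : C3) : ∫ x, inner ℂ (u x) (fs b x • m) = ∫ θ, inner ℂ (ft u θ) (b θ • m) := by
  simp only [← fs_smul_const hb]
  exact integral_inner_fs (integrable_of_mem_testC hu) (hb.smul_const m)

section
variable {Mt M₀ : CMat} {M : R3 → CMat} {ε K : ℝ} {r h g : R3 → C3}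

lemma IsHomField.isLow (H : IsHomField Mt M₀ M ε K r h) (j : Fin 3) :
    IsLow ε (K * l2 volume r) (fun θ => lowPart ε h θ j) :=
  isLow_lowPart H.memLp H.meas H.nonneg (H.bound.mono fun _ h => ⟨h.1, h.2.1⟩) j

lemma IsHomField.isLow_crossI (H : IsHomField Mt M₀ M ε K r h) (j : Fin 3) :
    IsLow ε (K * l2 volume r) (fun θ => lowPart ε (fun θ => mv (crossI θ) (h θ)) θ j) :=
  isLow_lowPart H.memLp (aestronglyMeasurable_crossI H.meas) H.nonneg
    (H.bound.mono fun _ h => ⟨h.2.2.1, h.2.2.2⟩) j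

/-- Below `1/ε` the only error is the replacement of `M θ` by `M₀`, of size `ε |θ| |h|`, absorbed by
the bound on `|θ| |h|`. Above `1/ε` the field is absent and the datum itself is the error:
transversality gives `|θ| |⟨v, r⟩| ≤ 6 |iθ×v| |r|`, and `1 ≤ ε|θ|` supplies the factor `ε`. -/
lemma IsHomField.norm_form_le (hε : 0 < ε) (H : IsHomField Mt M₀ M ε K r h) (v : R3 → C3) :
    ∀ᵐ θ, ‖inner ℂ (mv (crossI θ) (v θ)) (mv Mt (mv (crossI θ) (lowPart ε h θ))) +
      inner ℂ (v θ) (mv M₀ (lowPart ε h θ)) - inner ℂ (v θ) (r θ)‖ ≤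
      ε * (6 + K * K) * ((‖v θ‖ + ‖mv (crossI θ) (v θ)‖) * ‖r θ‖) := by
  filter_upwards [H.transversal, H.eq, H.bound] with θ h1 h2 h3
  have hK := H.nonneg
  rcases lt_or_ge ‖θ‖ ε⁻¹ with hθ | hθ
  · rw [lowPart_of_lt hθ]
    have e : inner ℂ (mv (crossI θ) (v θ)) (mv Mt (mv (crossI θ) (h θ))) +
        inner ℂ (v θ) (mv M₀ (h θ)) - inner ℂ (v θ) (r θ) =
        -inner ℂ (v θ) (mv (M θ) (h θ) - mv M₀ (h θ)) := by
      rw [← h2, inner_crossI, inner_add_right, inner_sub_right]; ring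
    rw [e, norm_neg]
    calc _ ≤ ‖v θ‖ * (K * (ε * ‖θ‖) * ‖h θ‖) :=
          (norm_inner_le_norm _ _).trans (mul_le_mul_of_nonneg_left (H.lip θ hθ _) (norm_nonneg _))
      _ = ε * K * ‖v θ‖ * (‖θ‖ * ‖h θ‖) := by ring
      _ ≤ ε * K * ‖v θ‖ * (K * ‖r θ‖) := mul_le_mul_of_nonneg_left h3.2.1 (by positivity)
      _ = ε * (K * K) * (‖v θ‖ * ‖r θ‖) := by ring
      _ ≤ _ := by
        gcongr
        · linarith
        · exact le_add_of_nonneg_right (norm_nonneg _)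
  · have hpos : 0 < ‖θ‖ := (inv_pos.2 hε).trans_le hθ
    rw [lowPart_of_le hθ]
    simp only [mv_zero, inner_zero_right, zero_add, zero_sub, norm_neg]
    have h4 := congrArg norm (norm_sq_mul_inner h1 (v θ))
    rw [norm_mul, Complex.norm_real, Real.norm_of_nonneg (by positivity)] at h4
    have h5 : ‖θ‖ ^ 2 * ‖inner ℂ (v θ) (r θ)‖ ≤ ‖θ‖ * (6 * (‖mv (crossI θ) (v θ)‖ * ‖r θ‖)) := by
      rw [h4]
      refine (norm_inner_le_norm _ _).trans ((mul_le_mul_of_nonneg_left (norm_mv_crossI_le _ _)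
        (norm_nonneg _)).trans_eq (by ring))
    have h6 := le_of_sq_mul_le (norm_nonneg θ) (by positivity) h5
    have h7 : 1 ≤ ε * ‖θ‖ := by rwa [inv_le_iff_one_le_mul₀' hε] at hθ
    calc _ ≤ ε * ‖θ‖ * ‖inner ℂ (v θ) (r θ)‖ := le_mul_of_one_le_left (norm_nonneg _) h7
      _ = ε * (‖θ‖ * ‖inner ℂ (v θ) (r θ)‖) := by ring
      _ ≤ ε * (6 * (‖mv (crossI θ) (v θ)‖ * ‖r θ‖)) := mul_le_mul_of_nonneg_left h6 hε.le
      _ = ε * 6 * (‖mv (crossI θ) (v θ)‖ * ‖r θ‖) := by ring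
      _ ≤ _ := by
        gcongr
        · nlinarith
        · exact le_add_of_nonneg_left (norm_nonneg _)

/-- The homogenised equation for the low-frequency part, in weak form. -/
lemma IsHomField.residual (hε : 0 < ε) (hg : MemLp g 2 volume)
    (H : IsHomField Mt M₀ M ε K (planch hg.toLp) h) {u : R3 → C3} (hu : u ∈ testC) :
    ‖(∑ j, ((∫ x, inner ℂ (curl u x)
        (fs (fun θ => lowPart ε (fun θ => mv (crossI θ) (h θ)) θ j) x • col Mt j)) +
        ∫ x, inner ℂ (u x) (fs (fun θ => lowPart ε h θ j) x • col M₀ j))) -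
      ∫ x, inner ℂ (u x) (g x)‖ ≤
    ε * (6 + K * K) * l2 volume g * (l2 volume u + l2 volume (curl u)) := by
  have hum := memLp_of_mem_testC hu
  have hui := integrable_of_mem_testC hu
  have hcu := curl_mem_testC hu
  have hcm := memLp_of_mem_testC hcu
  have hci := integrable_of_mem_testC hcu
  have fu := memLp_ft hui hum
  have fc := memLp_ft hci hcm
  have lu := l2_ft hui hum
  have lc := l2_ft hci hcm
  have hsm : ∀ {b : R3 → ℂ}, IsLow ε (K * l2 volume (planch hg.toLp)) b → ∀ m : C3,
      MemLp (fun θ => b θ • m) 2 volume := fun hb m =>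
    hb.memLp.of_le_mul (c := ‖m‖) (hb.memLp.1.smul_const m) (.of_forall fun θ => by
      rw [norm_smul, mul_comm])
  have i1 := fun j => integrable_inner (𝕜 := ℂ) fc (hsm (H.isLow_crossI j) (col Mt j))
  have i2 := fun j => integrable_inner (𝕜 := ℂ) fu (hsm (H.isLow j) (col M₀ j))
  have i12 : ∀ j, Integrable (fun θ => inner ℂ (ft (curl u) θ)
      (lowPart ε (fun θ => mv (crossI θ) (h θ)) θ j • col Mt j) +
      inner ℂ (ft u θ) (lowPart ε h θ j • col M₀ j)) := fun j => (i1 j).add (i2 j)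
  have i3 := integrable_inner (𝕜 := ℂ) fu H.memLp
  have e1 : (∑ j, ((∫ x, inner ℂ (curl u x)
        (fs (fun θ => lowPart ε (fun θ => mv (crossI θ) (h θ)) θ j) x • col Mt j)) +
        ∫ x, inner ℂ (u x) (fs (fun θ => lowPart ε h θ j) x • col M₀ j))) -
      ∫ x, inner ℂ (u x) (g x) = ∫ θ, (inner ℂ (mv (crossI θ) (ft u θ))
        (mv Mt (mv (crossI θ) (lowPart ε h θ))) + inner ℂ (ft u θ) (mv M₀ (lowPart ε h θ)) -
          inner ℂ (ft u θ) (planch hg.toLp θ)) := by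
    -- Summing over the columns reassembles the matrices, and the Fourier transform of `curl u` is
    -- `iθ × û`.
    have e2 : ∀ θ, inner ℂ (mv (crossI θ) (ft u θ)) (mv Mt (mv (crossI θ) (lowPart ε h θ))) +
        inner ℂ (ft u θ) (mv M₀ (lowPart ε h θ)) - inner ℂ (ft u θ) (planch hg.toLp θ) =
        (∑ j, (inner ℂ (ft (curl u) θ)
          (lowPart ε (fun θ => mv (crossI θ) (h θ)) θ j • col Mt j) +
          inner ℂ (ft u θ) (lowPart ε h θ j • col M₀ j))) - inner ℂ (ft u θ) (planch hg.toLp θ) :=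
      fun θ => by
        rw [Finset.sum_add_distrib, ← inner_sum, ← inner_sum, ← mv_eq_sum_col, ← mv_eq_sum_col,
          ← crossI_lowPart, ft_curl hu]
    simp only [e2]
    rw [integral_sub (integrable_finsetSum _ fun j _ => i12 j) i3,
      integral_finsetSum _ fun j _ => i12 j, integral_inner_ft_planch hui hum]
    congr 1
    refine Finset.sum_congr rfl fun j _ => ?_
    rw [integral_add (i1 j) (i2 j), integral_inner_fs_smul hcu (H.isLow_crossI j).integrable,
      integral_inner_fs_smul hu (H.isLow j).integrable]
  rw [e1]
  have hb := H.norm_form_le hε (ft u)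
  simp only [← ft_curl hu] at hb ⊢
  have m1 : MemLp (fun θ => ‖ft u θ‖ + ‖ft (curl u) θ‖) 2 volume := fu.norm.add fc.norm
  have m2 : MemLp (fun θ => ‖planch hg.toLp θ‖) 2 volume := H.memLp.norm
  have i4 : Integrable (fun θ => (‖ft u θ‖ + ‖ft (curl u) θ‖) * ‖planch hg.toLp θ‖) volume :=
    m1.integrable_mul m2
  refine (norm_integral_le_of_norm_le (i4.const_mul _) hb).trans ?_
  rw [integral_const_mul, mul_assoc _ (l2 volume g)]
  have hK := H.nonneg
  refine mul_le_mul_of_nonneg_left ?_ (by positivity)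
  have h1 := norm_integral_inner_le (𝕜 := ℝ) m2 m1
  simp only [RCLike.inner_apply, conj_trivial] at h1
  refine (Real.le_norm_self _).trans (h1.trans ?_)
  have h2 : l2 volume (fun θ => ‖planch hg.toLp θ‖) = l2 volume g := by
    rw [l2, eLpNorm_norm, ← l2, l2_planch]
  rw [h2]
  refine mul_le_mul_of_nonneg_left ?_ (l2_nonneg _)
  refine (l2_add_le fu.norm fc.norm).trans (le_of_eq ?_)
  rw [← lu, ← lc, l2, l2, eLpNorm_norm, eLpNorm_norm, ← l2, ← l2]

end
end

section
/-! ### The energy estimate -/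

lemma Coef.coercive_rescale {S : R3 → CMat} {α β ε : ℝ} (hS : Coef S α β) {f : R3 → C3}
    (h : MemLp f 2 volume) :
    α * l2 volume f ^ 2 ≤ (∫ x, inner ℂ (f x) (mv (rescale ε S x) (f x))).re := by
  rw [l2_sq h, ← integral_const_mul]
  have hi := integrable_inner (𝕜 := ℂ) h (hS.memLp_rescale (ε := ε) h).1
  have e : (∫ x, inner ℂ (f x) (mv (rescale ε S x) (f x))).re =
      ∫ x, (inner ℂ (f x) (mv (rescale ε S x) (f x))).re := (integral_re hi).symm
  rw [e]
  exact integral_mono ((integrable_norm_sq h).const_mul α) hi.re fun x => hS.coer _ _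

lemma add_mem_testC {u v : R3 → C3} (hu : u ∈ testC) (hv : v ∈ testC) :
    (fun x => u x + v x) ∈ testC (E := C3) := ⟨hu.1.add hv.1, hu.2.add hv.2⟩

section
variable {A : R3 → RMat} {α β : ℝ}

lemma Coef.cx_inv (hA : Coef (fun x => cx (A x)) α β) :
    Coef (fun x => cx (A x)⁻¹) (α / β ^ 2) α⁻¹ := by
  simp only [MaxwellHom.cx_inv]; exact hA.inv

lemma inv_mv_sqrtM (hA : IsElliptic A) (hAc : Coef (fun x => cx (A x)) α β) (x : R3) (v : C3) :
    mv (cx (sqrtM A x)) (mv (cx (A x)⁻¹) (mv (cx (sqrtM A x)) v)) = v := by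
  have h1 : mv (cx (sqrtM A x)) v = mv (cx (A x)) (mv (cx (sqrtM A x))⁻¹ v) := by
    rw [← mv_sqrtM_sqrtM hA, mv_inv_cancel (isUnit_sqrtM hA x)]
  rw [h1, MaxwellHom.cx_inv, inv_mv_cancel (hAc.isUnit x), mv_inv_cancel (isUnit_sqrtM hA x)]

end

/-- If a smooth field solves the equation up to a residual of size `δ`, then its curl is
`δ`-close to that of the exact solution. -/
lemma l2_sub_le_of_residual {A At : R3 → RMat} {α β α' β' ε δ : ℝ} (hA : IsElliptic A)
    (hm : ∀ i j, Measurable fun x => A x i j) (hAc : Coef (fun x => cx (A x)) α β)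
    (hAt : Coef (fun x => cx (At x)) α' β') {g Dd B U V : R3 → C3}
    (hμ : scaledMeasure volume ε = volume) (hsol : IsMaxwellSolution volume A At ε g Dd B)
    (hU : ContDiff ℝ ∞ U) (hUm : MemLp U 2 volume) (hVm : MemLp V 2 volume)
    (hUV : curl U = V) (hδ : 0 ≤ δ)
    (hres : ∀ u ∈ testC (E := C3),
      ‖(∫ x, inner ℂ (curl u x) (mv (rescale ε (fun x => cx (At x)) x) (V x))) +
        (∫ x, inner ℂ (u x) (mv (rescale ε (fun x => cx (A x)⁻¹) x) (U x))) -
        ∫ x, inner ℂ (u x) (g x)‖ ≤ δ * (l2 volume u + l2 volume (curl u))) :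
    MemLp B 2 volume ∧
      l2 volume (fun x => V x - B x) ≤ 2 * (min α' (α / β ^ 2))⁻¹ * δ := by
  have hAε := isElliptic_rescale hA ε
  have hmε := measurable_rescale hm ε
  have hT := hAc.cx_inv
  simp only [IsMaxwellSolution, hμ] at hsol
  obtain ⟨hpair, htest⟩ := hsol
  have hS : rescale ε (sqrtM A) = sqrtM (rescale ε A) := rfl
  rw [hS] at hpair htest
  set s : R3 → CMat := fun x => cx (sqrtM (rescale ε A) x) with hs
  set D : R3 → C3 := fun x => mv (s x) (Dd x) with hD
  have hDm : MemLp D 2 volume := hpair.1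
  have hBm : MemLp B 2 volume := by
    have h := hpair.2.1.neg
    have e : -(fun x => -B x) = B := by ext1 x; simp
    rwa [e] at h
  obtain ⟨K, hK0, hK, -⟩ := norm_sqrtM_le hAε
  have hsD : MemLp (fun x => mv (s x) (D x)) 2 volume :=
    memLp_mv (fun i j => (measurable_cx_sqrtM hAε hmε i j).aestronglyMeasurable) hK hDm
  obtain ⟨w, hw, hw1, hw2⟩ := hpair.exists_approx hAε
  obtain ⟨w', hw', hw1', hw2'⟩ := (isCurlPair_of_contDiff hAε hmε hU hUm
    (hUV ▸ hVm)).exists_approx hAε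
  simp only [mv_sqrtM_invSqrt hAε, hUV] at hw1' hw2'
  -- The weak formulation has `-g` on the right while `U` is built for `+g`, so `U` approximates
  -- `-A^{1/2} D`. The error is the sum `q`, with curl `ζ = V - B`.
  set q : R3 → C3 := fun x => mv (s x) (D x) + U x with hq
  set ζ : R3 → C3 := fun x => -B x + V x with hζ
  have hqm : MemLp q 2 volume := hsD.add hUm
  have hζm : MemLp ζ 2 volume := hpair.2.1.add hVm
  have hu : ∀ n, (fun x => w n x + w' n x) ∈ testC (E := C3) := fun n => add_mem_testC (hw n) (hw' n)
  have hum := fun n => memLp_of_mem_testC (hu n)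
  have hcm := fun n => memLp_of_mem_testC (curl_mem_testC (hu n))
  have t1 : Tendsto (fun n => l2 volume fun x => (w n x + w' n x) - q x) atTop (𝓝 0) := by
    have h1 := fun n => (memLp_of_mem_testC (hw n)).sub hsD
    have h2 := fun n => (memLp_of_mem_testC (hw' n)).sub hUm
    have h3 := (tendsto_l2_of_eLpNorm hw1).add (tendsto_l2_of_eLpNorm hw1')
    rw [add_zero] at h3
    refine squeeze_zero (fun n => l2_nonneg _) (fun n => ?_) h3
    refine le_trans (le_of_eq (l2_congr (.of_forall fun x => ?_))) (l2_add_le (h1 n) (h2 n))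
    simp only [hq]
    abel
  have t2 : Tendsto (fun n => l2 volume fun x => curl (fun x => w n x + w' n x) x - ζ x) atTop
      (𝓝 0) := by
    have h1 := fun n => (memLp_of_mem_testC (curl_mem_testC (hw n))).sub hpair.2.1
    have h2 := fun n => (memLp_of_mem_testC (curl_mem_testC (hw' n))).sub hVm
    have h3 := (tendsto_l2_of_eLpNorm hw2).add (tendsto_l2_of_eLpNorm hw2')
    rw [add_zero] at h3
    refine squeeze_zero (fun n => l2_nonneg _) (fun n => ?_) h3
    refine le_trans (le_of_eq (l2_congr (.of_forall fun x => ?_))) (l2_add_le (h1 n) (h2 n))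
    simp only [hζ]
    rw [curl_add ((hw n).1.differentiable (by simp)) ((hw' n).1.differentiable (by simp))]
    abel
  have mS : ∀ {f : R3 → C3}, MemLp f 2 volume →
      MemLp (fun x => mv (rescale ε (fun x => cx (At x)) x) (f x)) 2 volume := fun hf =>
    (hAt.memLp_rescale hf).1
  have mT : ∀ {f : R3 → C3}, MemLp f 2 volume →
      MemLp (fun x => mv (rescale ε (fun x => cx (A x)⁻¹) x) (f x)) 2 volume := fun hf =>
    (hT.memLp_rescale hf).1
  have hform : ∀ u ∈ testC (E := C3),
      ‖(∫ x, inner ℂ (curl u x) (mv (rescale ε (fun x => cx (At x)) x) (ζ x))) +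
        ∫ x, inner ℂ (u x) (mv (rescale ε (fun x => cx (A x)⁻¹) x) (q x))‖ ≤
      δ * (l2 volume u + l2 volume (curl u)) := by
    intro u hu
    have hum := memLp_of_mem_testC hu
    have hcm := memLp_of_mem_testC (curl_mem_testC hu)
    -- Testing with `A^{-1/2} u` rewrites the weak formulation for the field `A^{1/2} D`, with
    -- coefficient `A⁻¹` in the term of order zero.
    have h1 : (∫ x, inner ℂ (curl u x) (mv (rescale ε (fun x => cx (At x)) x) (-B x))) +
        (∫ x, inner ℂ (invSqrt (rescale ε A) u x) (D x)) =
        -∫ x, inner ℂ (invSqrt (rescale ε A) u x) (mv (s x) (g x)) :=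
      htest _ _ (isCurlPair_of_contDiff hAε hmε hu.1 hum hcm)
    have e1 : ∀ x, inner ℂ (invSqrt (rescale ε A) u x) (mv (s x) (g x)) = inner ℂ (u x) (g x) :=
      fun x => by rw [← inner_sqrtM, mv_sqrtM_invSqrt hAε]
    have e2 : ∀ x, inner ℂ (invSqrt (rescale ε A) u x) (D x) =
        inner ℂ (u x) (mv (rescale ε (fun x => cx (A x)⁻¹) x) (mv (s x) (D x))) := fun x => by
      conv_lhs => rw [← inv_mv_sqrtM hA hAc (ε⁻¹ • x) (D x)]
      conv_rhs => rw [← mv_sqrtM_invSqrt hAε u x, inner_sqrtM]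
      rfl
    simp only [e1, e2] at h1
    refine le_trans (le_of_eq ?_) (hres u hu)
    congr 1
    simp only [hζ, hq, mv_add]
    rw [integral_inner_add_right hcm (mS hpair.2.1) (mS hVm),
      integral_inner_add_right hum (mT hsD) (mT hUm)]
    linear_combination h1
  -- The error `(q, ζ)` is itself a limit of smooth compactly supported fields with their curls, so
  -- it may be used as test field.
  have hlim1 := (tendsto_integral_inner_left (𝕜 := ℂ) (.of_forall hcm) hζm (mS hζm)
    (tendsto_eLpNorm_of_l2 (fun n => (hcm n).sub hζm) t2)).add
    (tendsto_integral_inner_left (𝕜 := ℂ) (.of_forall hum) hqm (mT hqm)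
      (tendsto_eLpNorm_of_l2 (fun n => (hum n).sub hqm) t1))
  have hlim2 := (((t1.const_add (l2 volume q)).add (t2.const_add (l2 volume ζ))).const_mul δ)
  simp only [add_zero] at hlim2
  have key := le_of_tendsto_of_tendsto' hlim1.norm hlim2 fun n => (hform _ (hu n)).trans
    (mul_le_mul_of_nonneg_left (add_le_add (l2_le_add_sub (hum n) hqm)
      (l2_le_add_sub (hcm n) hζm)) hδ)
  refine ⟨hBm, ?_⟩
  have hVB : l2 volume (fun x => V x - B x) = l2 volume ζ := by
    congr 1; ext1 x; simp only [hζ]; abel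
  rw [hVB]
  have c1 := hAt.coercive_rescale (ε := ε) hζm
  have c2 := hT.coercive_rescale (ε := ε) hqm
  have c3 := (Complex.re_le_norm _).trans key
  rw [Complex.add_re] at c3
  set a := l2 volume ζ
  set b := l2 volume q
  set m := min α' (α / β ^ 2) with hm'
  have ha : 0 ≤ a := l2_nonneg _
  have hb : 0 ≤ b := l2_nonneg _
  have hmpos : 0 < m := lt_min hAt.pos hT.pos
  have d1 : m * a ^ 2 ≤ α' * a ^ 2 := mul_le_mul_of_nonneg_right (min_le_left _ _) (sq_nonneg a)
  have d2 : m * b ^ 2 ≤ α / β ^ 2 * b ^ 2 :=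
    mul_le_mul_of_nonneg_right (min_le_right _ _) (sq_nonneg b)
  have d3 : m * (a ^ 2 + b ^ 2) ≤ δ * (b + a) := by linarith
  -- The factor two in the constant comes from `(a + b)² ≤ 2(a² + b²)`.
  have d4 : (a + b) ^ 2 * (m / 2) ≤ (a + b) * δ := by
    have : m * (a + b) ^ 2 ≤ m * (2 * (a ^ 2 + b ^ 2)) :=
      mul_le_mul_of_nonneg_left (by nlinarith [sq_nonneg (a - b)]) hmpos.le
    linarith
  have d5 := le_of_sq_mul_le (add_nonneg ha hb) hδ d4
  have d6 : a + b ≤ 2 * m⁻¹ * δ := by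
    rw [mul_assoc, ← div_le_iff₀' two_pos, le_inv_mul_iff₀ hmpos]; linarith
  linarith
end

section
/-! ### The low-frequency two-scale field -/

/-- The curl of the homogenised solution, in the frequency domain. -/
def crossField (h : R3 → C3) (θ : R3) : C3 := mv (crossI θ) (h θ)

/-- The two-scale field of the low-frequency part of the homogenised solution. -/
def lowField (ε : ℝ) (ψ : Fin 3 → R3 → ℂ) (φ : Fin 3 → R3 → C3) (h : R3 → C3) (x : R3) : C3 :=
  ∑ j, corrField ε (basisVec j) (ψ j) (φ j) (fs fun θ => lowPart ε h θ j)
    (fs fun θ => lowPart ε (crossField h) θ j) x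

/-- The two-scale curl of the low-frequency part of the homogenised solution. -/
def lowCurl (ε : ℝ) (φ : Fin 3 → R3 → C3) (h : R3 → C3) (x : R3) : C3 :=
  ∑ j, corrCurl ε (basisVec j) (φ j) (fs fun θ => lowPart ε (crossField h) θ j) x

lemma fs_eq_sum {k : R3 → C3} (hk : Integrable k) (x : R3) :
    fs k x = ∑ j, (fs fun θ => k θ j) x • basisVec j := by
  conv_lhs => rw [← sum_basisVec (fs k x)]
  exact Finset.sum_congr rfl fun j _ => by rw [fs_apply hk]

section
variable {Mt M₀ : CMat} {M : R3 → CMat} {ε K K₁ α β α' β' : ℝ} {r h g : R3 → C3}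
  {T S : R3 → CMat} {ψ p : Fin 3 → R3 → ℂ} {φ G : Fin 3 → R3 → C3}

/-- Both `∑ ∇H_j × e_j` and `∑ F_j e_j` are the curl of `∑ H_j e_j`, because its symbol is `iθ × h`.
The unmatched terms of `curl_corrField` cancel, and only the two-scale curl remains. -/
lemma IsHomField.curl_lowField (hε : 0 < ε) (H : IsHomField Mt M₀ M ε K r h)
    (hc : ∀ j, IsCorrector T S ε K₁ (basisVec j) (col M₀ j) (col Mt j) (ψ j) (p j) (φ j) (G j)) :
    curl (lowField ε ψ φ h) = lowCurl ε φ h := by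
  have ha := H.isLow
  have hb : ∀ j, IsLow ε (K * l2 volume r) fun θ => lowPart ε (crossField h) θ j := H.isLow_crossI
  have hm : MemLp h 2 volume := H.memLp.of_le_mul H.meas (H.bound.mono fun θ h => h.1)
  have hm' : MemLp (crossField h) 2 volume :=
    H.memLp.of_le_mul (aestronglyMeasurable_crossI H.meas) (H.bound.mono fun θ h => h.2.2.1)
  have hi : Integrable (lowPart ε h) := (MemLp.indicator_ball hm ε⁻¹).2
  have hi' : Integrable (lowPart ε (crossField h)) := (MemLp.indicator_ball hm' ε⁻¹).2
  have e1 : (fun θ => mv (crossI θ) (lowPart ε h θ)) = lowPart ε (crossField h) :=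
    funext fun θ => crossI_lowPart θ
  ext1 x
  have hd : ∀ j, Differentiable ℝ (corrField ε (basisVec j) (ψ j) (φ j)
      (fs fun θ => lowPart ε h θ j) (fs fun θ => lowPart ε (crossField h) θ j)) := fun j =>
    (contDiff_corrField hε (hc j) (ha j) (hb j)).differentiable (by simp)
  have h0 : ∑ j, crs (grad (fs fun θ => lowPart ε h θ j) x) (basisVec j) =
      ∑ j, (fs fun θ => lowPart ε (crossField h) θ j) x • basisVec j := by
    rw [← fs_eq_sum hi', ← e1, ← curl_fs hi (fun θ hθ => lowPart_of_le hθ) x (e1 ▸ hi')]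
    have e2 : fs (lowPart ε h) = fun x => ∑ j, (fs fun θ => lowPart ε h θ j) x • basisVec j :=
      funext fun x => fs_eq_sum hi x
    have hd' : ∀ j, Differentiable ℝ fun x => (fs fun θ => lowPart ε h θ j) x • basisVec j :=
      fun j => (ha j).differentiable.smul_const _
    rw [e2, curl_sum Finset.univ hd']
    refine Finset.sum_congr rfl fun j _ => ?_
    rw [curl_smul (ha j).differentiable (differentiable_const _), curl_const, smul_zero, zero_add]
  unfold lowField lowCurl
  rw [curl_sum Finset.univ hd]
  simp only [curl_corrField hε (hc _) (ha _) (hb _)]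
  rw [Finset.sum_add_distrib, Finset.sum_sub_distrib, h0, sub_self, zero_add]

lemma IsHomField.contDiff_lowField (hε : 0 < ε) (H : IsHomField Mt M₀ M ε K r h)
    (hc : ∀ j, IsCorrector T S ε K₁ (basisVec j) (col M₀ j) (col Mt j) (ψ j) (p j) (φ j) (G j)) :
    ContDiff ℝ ∞ (lowField ε ψ φ h) :=
  ContDiff.sum fun j _ => contDiff_corrField hε (hc j) (H.isLow j) (H.isLow_crossI j)

lemma IsHomField.memLp_lowField (hε : 0 < ε) (H : IsHomField Mt M₀ M ε K r h)
    (hc : ∀ j, IsCorrector T S ε K₁ (basisVec j) (col M₀ j) (col Mt j) (ψ j) (p j) (φ j) (G j)) :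
    MemLp (lowField ε ψ φ h) 2 volume :=
  memLp_finsetSum _ fun j _ => memLp_corrField hε (hc j) (H.isLow j) (H.isLow_crossI j)

lemma IsHomField.memLp_lowCurl (hε : 0 < ε) (H : IsHomField Mt M₀ M ε K r h)
    (hc : ∀ j, IsCorrector T S ε K₁ (basisVec j) (col M₀ j) (col Mt j) (ψ j) (p j) (φ j) (G j)) :
    MemLp (lowCurl ε φ h) 2 volume :=
  memLp_finsetSum _ fun j _ => memLp_corrCurl hε (hc j) (H.isLow_crossI j)

/-- The residual of the two-scale field. -/
lemma IsHomField.lowField_residual (hε : 0 < ε) (hg : MemLp g 2 volume)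
    (H : IsHomField Mt M₀ M ε K (planch hg.toLp) h) (hT : Coef T α β) (hS : Coef S α' β')
    (hc : ∀ j, IsCorrector T S ε K₁ (basisVec j) (col M₀ j) (col Mt j) (ψ j) (p j) (φ j) (G j))
    {u : R3 → C3} (hu : u ∈ testC) :
    ‖(∫ x, inner ℂ (curl u x) (mv (rescale ε S x) (lowCurl ε φ h x))) +
      (∫ x, inner ℂ (u x) (mv (rescale ε T x) (lowField ε ψ φ h x))) -
      ∫ x, inner ℂ (u x) (g x)‖ ≤
    ε * (3 * (K * K₁ * (19 + 4 * β + 18 * β')) + (6 + K * K)) * l2 volume g *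
      (l2 volume u + l2 volume (curl u)) := by
  have ha := H.isLow
  have hb : ∀ j, IsLow ε (K * l2 volume (planch hg.toLp)) fun θ =>
    lowPart ε (crossField h) θ j := H.isLow_crossI
  have hum := memLp_of_mem_testC hu
  have hcm := memLp_of_mem_testC (curl_mem_testC hu)
  have i1 := fun j => integrable_inner (𝕜 := ℂ) hcm
    (hS.memLp_rescale (ε := ε) (memLp_corrCurl hε (hc j) (hb j))).1
  have i2 := fun j => integrable_inner (𝕜 := ℂ) hum
    (hT.memLp_rescale (ε := ε) (memLp_corrField hε (hc j) (ha j) (hb j))).1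
  have e1 : (∫ x, inner ℂ (curl u x) (mv (rescale ε S x) (lowCurl ε φ h x))) +
      (∫ x, inner ℂ (u x) (mv (rescale ε T x) (lowField ε ψ φ h x))) =
      ∑ j, ((∫ x, inner ℂ (curl u x) (mv (rescale ε S x) (corrCurl ε (basisVec j) (φ j)
        (fs fun θ => lowPart ε (crossField h) θ j) x))) +
        ∫ x, inner ℂ (u x) (mv (rescale ε T x) (corrField ε (basisVec j) (ψ j) (φ j)
          (fs fun θ => lowPart ε h θ j) (fs fun θ => lowPart ε (crossField h) θ j) x))) := by
    simp only [lowCurl, lowField, mv_sum, inner_sum]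
    rw [integral_finsetSum _ fun j _ => i1 j, integral_finsetSum _ fun j _ => i2 j,
      Finset.sum_add_distrib]
  have h1 := fun j => corrector_residual hε hT hS (hc j) (ha j) (hb j) hu
  have h2 := H.residual hε hg hu
  rw [l2_planch] at h1
  rw [e1]
  refine le_trans ?_ ((add_le_add (Finset.sum_le_sum fun j (_ : j ∈ Finset.univ) => h1 j) h2).trans
    (le_of_eq (by simp only [Finset.sum_const, Finset.card_univ, Fintype.card_fin]; ring)))
  refine le_trans (le_of_eq ?_) ((norm_add_le _ _).trans (add_le_add (norm_sum_le _ _) le_rfl))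
  congr 1
  rw [Finset.sum_sub_distrib]
  have hcf : crossField h = fun θ => mv (crossI θ) (h θ) := rfl
  rw [hcf]
  ring

/-- The two-scale curl is close to the product of the homogenised field and the cell fluxes. -/
lemma IsHomField.lowCurl_sub_le (hε : 0 < ε) (H : IsHomField Mt M₀ M ε K r h) {W : R3 → CMat}
    (hc : ∀ j, IsCorrector T S ε K₁ (basisVec j) (col M₀ j) (col Mt j) (ψ j) (p j) (φ j) (G j))
    (hW : ∀ j, IsQPeriodic (fluxCol W j)) (hWm : ∀ j, MemLp (fluxCol W j) 2 volQ)
    (hφ : ∀ j, l2 volQ (fun x => curl (φ j) x - col (W x) j) ≤ K₁ * ε) :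
    MemLp (fun x => lowCurl ε φ h x - ∑ j, (fs fun θ => lowPart ε (crossField h) θ j) x •
        rescale ε (fluxCol W j) x) 2 volume ∧
      l2 volume (fun x => lowCurl ε φ h x - ∑ j, (fs fun θ => lowPart ε (crossField h) θ j) x •
        rescale ε (fluxCol W j) x) ≤ ε * (57 * (K * K₁)) * l2 volume r := by
  have hb : ∀ j, IsLow ε (K * l2 volume r) fun θ => lowPart ε (crossField h) θ j := H.isLow_crossI
  have e1 : ∀ x, lowCurl ε φ h x - ∑ j, (fs fun θ => lowPart ε (crossField h) θ j) x •
      rescale ε (fluxCol W j) x = ∑ j, ((fs fun θ => lowPart ε (crossField h) θ j) x •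
        rescale ε (fun y => (basisVec j + curl (φ j) y) - fluxCol W j y) x +
        (ε : ℂ) • crs (grad (fs fun θ => lowPart ε (crossField h) θ j) x) (rescale ε (φ j) x)) :=
    fun x => by
      rw [lowCurl, ← Finset.sum_sub_distrib]
      refine Finset.sum_congr rfl fun j _ => ?_
      simp only [corrCurl, rescale, smul_sub]
      abel
  have hw : ∀ j, (fun y => basisVec j + curl (φ j) y) ∈ testP (E := C3) := fun j =>
    add_mem_testP (const_mem_testP _) (curl_mem_testP (hc j).hφ)
  have hper : ∀ j, IsQPeriodic fun y => (basisVec j + curl (φ j) y) - fluxCol W j y :=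
    fun j x n => by
      have h1 := (hw j).2 x n
      have h2 := hW j x n
      simp only at h1
      simp only [h1, h2]
  have hmem : ∀ j, MemLp (fun y => (basisVec j + curl (φ j) y) - fluxCol W j y) 2 volQ := fun j =>
    (memLp_of_mem_testP (hw j)).sub (hWm j)
  have m1 := fun j => (hb j).fs_smul hε (hper j) (hmem j)
  have m2 := fun j => (hb j).crs_grad hε (hc j).hφ (hc j).leφ
  have m3 := fun j => MemLp.smul_left (m2 j).1 (ε : ℂ)
  have hl : ∀ j, l2 volQ (fun y => (basisVec j + curl (φ j) y) - fluxCol W j y) ≤ K₁ * ε :=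
    fun j => by
      refine le_trans (le_of_eq ?_) (hφ j)
      congr 1; ext1 y; simp only [fluxCol]; abel
  simp only [e1]
  refine ⟨memLp_finsetSum _ fun j _ => (m1 j).1.add (m3 j),
    (l2_sum_le _ fun j _ => (m1 j).1.add (m3 j)).trans ?_⟩
  have hb0 : ∀ j, _ ≤ K * l2 volume r * (K₁ * ε) + ε * (18 * (K * l2 volume r * K₁)) := fun j =>
    (l2_add_le (m1 j).1 (m3 j)).trans (add_le_add
      ((m1 j).2.trans (mul_le_mul_of_nonneg_left (hl j) (hb j).nonneg))
      ((l2_const_smul _ _).le.trans (by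
        rw [Complex.norm_real, Real.norm_of_nonneg hε.le]
        exact mul_le_mul_of_nonneg_left (m2 j).2 hε.le)))
  refine (Finset.sum_le_sum fun j _ => hb0 j).trans (le_of_eq ?_)
  simp only [Finset.sum_const, Finset.card_univ, Fintype.card_fin]
  ring

end

/-! ### The high-frequency part -/

lemma memLp_fs_moment {k : R3 → ℂ} {r : R3 → C3} {R K : ℝ} (hr : MemLp r 2 volume) (hK : 0 ≤ K)
    (hk : Integrable k) (hs : ∀ θ, R ≤ ‖θ‖ → k θ = 0) (hb : ∀ᵐ θ, ‖θ‖ * ‖k θ‖ ≤ K * ‖r θ‖) :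
    MemLp (grad (fs k)) 2 volume ∧ l2 volume (grad (fs k)) ≤ 3 * (K * l2 volume r) := by
  have hi := fun i => integrable_mul_coord hk hs i
  have hb' : ∀ i : Fin 3, ∀ᵐ θ, ‖Complex.I * θ i * k θ‖ ≤ K * ‖r θ‖ := fun i => by
    filter_upwards [hb] with θ h
    refine le_trans ?_ h
    rw [norm_mul, norm_mul, Complex.norm_I, one_mul, Complex.norm_real]
    exact mul_le_mul_of_nonneg_right (PiLp.norm_apply_le θ i) (norm_nonneg _)
  have hm : ∀ i : Fin 3, MemLp (fun θ => Complex.I * θ i * k θ) 2 volume := fun i =>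
    hr.of_le_mul (hi i).1 (hb' i)
  have e : ∀ i, (fun x => grad (fs k) x i) = fs fun θ => Complex.I * θ i * k θ := fun i => by
    ext1 x; rw [grad_apply, pd_fs hk hs]
  have hg : MemLp (grad (fs k)) 2 volume := memLp_of_apply fun i => by
    rw [e]; exact memLp_fs (hi i) (hm i)
  refine ⟨hg, (l2_le_sum_apply hg).trans ?_⟩
  have h1 : ∀ i : Fin 3, l2 volume (fun x => grad (fs k) x i) ≤ K * l2 volume r := fun i => by
    rw [e, l2_fs (hi i) (hm i)]
    exact l2_mono hK hr (hb' i)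
  refine (Finset.sum_le_sum fun i _ => h1 i).trans (le_of_eq ?_)
  simp

/-- Above `1/ε` the moment bound gives `|v| ≤ ε K |r|`, while the gradient is bounded by `K |r|`
without gain. The multiplier inequality weights the gradient by `ε`, so both contributions are
`O(ε)`; the constant `12` is `3 · (1 + 3)`. The frequencies are truncated at `n` to keep the
functions smooth, and Fatou's lemma removes this truncation. -/
lemma l2_high_le {ε K C : ℝ} {b : Fin 3 → R3 → C3} {r v : R3 → C3} (hε : 0 < ε) (hC : 0 ≤ C)
    (hb : ∀ j, ∀ f ∈ testC (E := ℂ), MemLp (fun x => f x • b j x) 2 volume ∧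
      l2 volume (fun x => f x • b j x) ≤ C * (l2 volume f + ε * l2 volume (grad f)))
    (hr : MemLp r 2 volume) (hv : MemLp v 2 volume) (hK : 0 ≤ K)
    (hvr : ∀ᵐ θ, ‖θ‖ * ‖v θ‖ ≤ K * ‖r θ‖) :
    MemLp (fun x => ∑ j, (synth hv.toLp x j - fs (fun θ => lowPart ε v θ j) x) • b j x) 2 volume ∧
      l2 volume (fun x => ∑ j, (synth hv.toLp x j - fs (fun θ => lowPart ε v θ j) x) • b j x) ≤
        ε * (12 * (C * K)) * l2 volume r := by
  -- From `N` on the ball of radius `n` contains the whole low band, so `k n` lives on `1/ε ≤ |θ| <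
  -- n`.
  obtain ⟨N, hN⟩ := exists_nat_ge ε⁻¹
  have hlow := MemLp.indicator_ball hv ε⁻¹
  have hball := fun n : ℕ => MemLp.indicator_ball hv (n : ℝ)
  -- the middle frequencies
  set k : ℕ → R3 → C3 := fun n θ => (Metric.ball (0 : R3) n).indicator v θ - lowPart ε v θ with hk
  have hkm : ∀ n, MemLp (k n) 2 volume := fun n => (hball n).1.sub hlow.1
  have hki : ∀ n, Integrable (k n) := fun n => (hball n).2.sub hlow.2
  have hk1 : ∀ n, N ≤ n → ∀ θ, (n : ℝ) ≤ ‖θ‖ → k n θ = 0 := fun n hn θ hθ => by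
    have h1 : ε⁻¹ ≤ ‖θ‖ := hN.trans ((Nat.cast_le.2 hn).trans hθ)
    have h2 : θ ∉ Metric.ball (0 : R3) n := fun h => absurd (mem_ball_zero_iff.1 h) hθ.not_gt
    simp only [hk, lowPart_of_le h1, Set.indicator_of_notMem h2, sub_self]
  have hk2 : ∀ n, N ≤ n → ∀ θ, ‖k n θ‖ ≤ ‖v θ‖ ∧ (‖θ‖ < ε⁻¹ → k n θ = 0) := fun n hn θ => by
    have h3 : ‖θ‖ < ε⁻¹ → k n θ = 0 := fun h1 => by
      have h2 : θ ∈ Metric.ball (0 : R3) n :=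
        mem_ball_zero_iff.2 (h1.trans_le (hN.trans (Nat.cast_le.2 hn)))
      simp only [hk, lowPart_of_lt h1, Set.indicator_of_mem h2, sub_self]
    refine ⟨?_, h3⟩
    rcases lt_or_ge ‖θ‖ ε⁻¹ with h1 | h1
    · rw [h3 h1, norm_zero]; exact norm_nonneg _
    · simp only [hk, lowPart_of_le h1, sub_zero]
      exact norm_indicator_le_norm_self _ _
  have hk3 : ∀ n, N ≤ n → ∀ j : Fin 3, ∀ᵐ θ, ‖θ‖ * ‖k n θ j‖ ≤ K * ‖r θ‖ := fun n hn j => by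
    filter_upwards [hvr] with θ h
    exact (mul_le_mul_of_nonneg_left ((norm_apply_le _ _).trans (hk2 n hn θ).1)
      (norm_nonneg _)).trans h
  have hk4 : ∀ n, N ≤ n → ∀ j : Fin 3, l2 volume (fun θ => k n θ j) ≤ ε * K * l2 volume r :=
    fun n hn j => by
      refine l2_mono (by positivity) hr ?_
      filter_upwards [hk3 n hn j] with θ h
      rcases lt_or_ge ‖θ‖ ε⁻¹ with h1 | h1
      · rw [(hk2 n hn θ).2 h1]; simp only [PiLp.zero_apply, norm_zero]; positivity
      · have h7 : 1 ≤ ε * ‖θ‖ := by rwa [inv_le_iff_one_le_mul₀' hε] at h1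
        calc ‖k n θ j‖ ≤ ε * ‖θ‖ * ‖k n θ j‖ := le_mul_of_one_le_left (norm_nonneg _) h7
          _ = ε * (‖θ‖ * ‖k n θ j‖) := by ring
          _ ≤ ε * (K * ‖r θ‖) := mul_le_mul_of_nonneg_left h hε.le
          _ = _ := by ring
  have hmul : ∀ n, N ≤ n → ∀ j, MemLp (fun x => fs (fun θ => k n θ j) x • b j x) 2 volume ∧
      l2 volume (fun x => fs (fun θ => k n θ j) x • b j x) ≤
        C * (ε * K * l2 volume r + ε * (3 * (K * l2 volume r))) := fun n hn j => by
    have hs : ∀ θ, (n : ℝ) ≤ ‖θ‖ → k n θ j = 0 := fun θ hθ => by rw [hk1 n hn θ hθ]; rfl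
    have hij := integrable_apply (hki n) j
    have hmj := memLp_apply (hkm n) j
    obtain ⟨g1, g2⟩ := memLp_fs_moment hr hK hij hs (hk3 n hn j)
    have h1 := multiplier_of_contDiff hC hε (hb j) (contDiff_fs hij hs) (memLp_fs hij hmj) g1
    refine ⟨h1.1, h1.2.trans (mul_le_mul_of_nonneg_left (add_le_add ?_
      (mul_le_mul_of_nonneg_left g2 hε.le)) hC)⟩
    rw [l2_fs hij hmj]
    exact hk4 n hn j
  -- The full synthesis is only an `L²` limit; a subsequence converges almost everywhere.
  obtain ⟨σ, hσ, hae⟩ := (tendstoInMeasure_of_tendsto_eLpNorm (by norm_num)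
    (fun n => (memLp_fs (hball n).2 (hball n).1).1) (memLp_synth hv.toLp).1
    (tendsto_fs_ball hv)).exists_seq_tendsto_ae
  have hσN : ∀ n, N ≤ σ (n + N) := fun n => (Nat.le_add_left N n).trans (hσ.id_le _)
  refine l2_le_of_tendsto_ae (f := fun n x => ∑ j, fs (fun θ => k (σ (n + N)) θ j) x • b j x)
    (B := fun _ => ε * (12 * (C * K)) * l2 volume r)
    (fun n => memLp_finsetSum _ fun j _ => (hmul _ (hσN n) j).1) (fun n => ?_) tendsto_const_nhds ?_
  · refine (l2_sum_le _ fun j _ => (hmul _ (hσN n) j).1).trans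
      ((Finset.sum_le_sum fun j _ => (hmul _ (hσN n) j).2).trans (le_of_eq ?_))
    simp only [Finset.sum_const, Finset.card_univ, Fintype.card_fin]
    ring
  · filter_upwards [hae] with x hx
    refine tendsto_finsetSum _ fun j _ => Tendsto.smul_const ?_ _
    have h1 : ∀ n, fs (fun θ => k n θ j) x =
        fs ((Metric.ball (0 : R3) n).indicator v) x j - fs (fun θ => lowPart ε v θ j) x :=
      fun n => by
        rw [fs_apply (hball n).2]
        exact fs_sub (integrable_apply (hball n).2 j) (integrable_apply hlow.2 j) x
    simp only [h1]
    have h2 := ((PiLp.continuous_apply 2 _ j).tendsto _).comp hx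
    exact (h2.comp (tendsto_add_atTop_nat N)).sub_const _
end

section
/-! ### The homogenisation estimate -/

lemma IsCorrector.mono {T S : R3 → CMat} {ε K K' : ℝ} {e m₀ m₁ : C3} {ψ p : R3 → ℂ}
    {φ G : R3 → C3} (hε : 0 < ε) (hK : K ≤ K') (h : IsCorrector T S ε K e m₀ m₁ ψ p φ G) :
    IsCorrector T S ε K' e m₀ m₁ ψ p φ G :=
  ⟨h.hψ, h.hp, h.hφ, h.hG, h.leψ.trans hK, h.lep.trans hK, h.leφ.trans hK, h.leG.trans hK,
    h.le₀.trans (mul_le_mul_of_nonneg_right hK hε.le),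
    h.le₁.trans (mul_le_mul_of_nonneg_right hK hε.le)⟩

section
variable {A At : R3 → RMat} {N W : R3 → CMat} {Ahat : R3 → CMat} {α β α' β' : ℝ} {M₀ : CMat}

/-- The approximation lemmas are used with `δ = ε`, their norm bounds being independent of `δ`.
Replacing `curl N` by `curl φ` in the magnetic flux costs a further `β' ε`, which explains the
summand `1 + β'`. -/
lemma exists_corrector (hmean : GradMeanZero volume) (hA : IsElliptic A)
    (hm : ∀ i j, Measurable fun x => A x i j) (hAc : Coef (fun x => cx (A x)) α β)
    (hAt : Coef (fun x => cx (At x)) α' β') (hirr : IrrotationalForm volume A)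
    (hN : IsCellSolution volume A At N W) (h₀ : IsHatHom volume A 0 M₀) (j : Fin 3) :
    ∃ K : ℝ, 0 ≤ K ∧ ∀ ε : ℝ, 0 < ε → ∃ ψ p φ G,
      IsCorrector (fun x => cx (A x)⁻¹) (fun x => cx (At x)) ε K (basisVec j) (col M₀ j)
        (col (magneticHom volume At W) j) ψ p φ G ∧
      l2 volQ (fun x => curl φ x - col (W x) j) ≤ K * ε := by
  obtain ⟨K₁, hK₁, h1⟩ := exists_magnetic_approx hmean hA hm hAt hirr hN j
  obtain ⟨K₂, hK₂, h2⟩ := exists_electric_approx hmean h₀ hAc.cx_inv j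
  have hβ' := hAt.bdd_pos
  refine ⟨K₁ + K₂ + (1 + β'), by positivity, fun ε hε => ?_⟩
  obtain ⟨φ, hφ, p, hp, a1, a2, a3, a4⟩ := h1 ε hε
  obtain ⟨ψ, hψ, G, hG, b1, b2, -, b4⟩ := h2 ε hε
  have c1 : ε ≤ (K₁ + K₂ + (1 + β')) * ε := le_mul_of_one_le_left hε.le (by linarith)
  refine ⟨ψ, p, φ, G, ⟨hψ, hp, hφ, hG, by linarith, by linarith, by linarith, by linarith,
    b4.trans c1, ?_⟩, a3.trans c1⟩
  have hfl := isFlux_fluxCol hA hN j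
  have hcm := memLp_of_mem_testP (curl_mem_testP hφ)
  have hWm : MemLp (fun x => curl φ x - col (W x) j) 2 volQ := by
    have h3 := hcm.sub (hfl.memLp.sub (memLp_const (basisVec j)))
    refine (memLp_congr_ae (.of_forall fun x => ?_)).1 h3
    simp only [Pi.sub_apply, fluxCol]
    abel
  have hpm := memLp_of_mem_testP (add_mem_testP
    (const_mem_testP (col (magneticHom volume At W) j)) (grad_mem_testP hp))
  have m1 := hAt.memLp hWm
  have m2 : MemLp (fun x => mv (cx (At x)) (fluxCol W j x) -
      (col (magneticHom volume At W) j + grad p x)) 2 volQ := (hAt.memLp hfl.memLp).sub hpm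
  have e : ∀ x, mv (cx (At x)) (basisVec j + curl φ x) -
      (col (magneticHom volume At W) j + grad p x) =
      mv (cx (At x)) (curl φ x - col (W x) j) + (mv (cx (At x)) (fluxCol W j x) -
        (col (magneticHom volume At W) j + grad p x)) := fun x => by
    simp only [fluxCol, mv_add, mv_sub]
    abel
  simp only [e]
  have h5 := (hAt.l2_le hWm).trans (mul_le_mul_of_nonneg_left a3 hβ'.le)
  refine (l2_add_le m1 m2).trans ((add_le_add h5 a4).trans ?_)
  have : 0 ≤ (K₁ + K₂) * ε := by positivity
  linarith

lemma exists_correctors (hmean : GradMeanZero volume) (hA : IsElliptic A)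
    (hm : ∀ i j, Measurable fun x => A x i j) (hAc : Coef (fun x => cx (A x)) α β)
    (hAt : Coef (fun x => cx (At x)) α' β') (hirr : IrrotationalForm volume A)
    (hN : IsCellSolution volume A At N W) (h₀ : IsHatHom volume A 0 M₀) :
    ∃ K : ℝ, 0 ≤ K ∧ ∀ ε : ℝ, 0 < ε → ∃ (ψ p : Fin 3 → R3 → ℂ) (φ G : Fin 3 → R3 → C3),
      (∀ j, IsCorrector (fun x => cx (A x)⁻¹) (fun x => cx (At x)) ε K (basisVec j) (col M₀ j)
        (col (magneticHom volume At W) j) (ψ j) (p j) (φ j) (G j)) ∧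
      ∀ j, l2 volQ (fun x => curl (φ j) x - col (W x) j) ≤ K * ε := by
  choose K hK h using exists_corrector hmean hA hm hAc hAt hirr hN h₀
  have hle : ∀ j, K j ≤ ∑ i, K i := fun j =>
    Finset.single_le_sum (fun i _ => hK i) (Finset.mem_univ j)
  refine ⟨∑ i, K i, Finset.sum_nonneg fun i _ => hK i, fun ε hε => ?_⟩
  choose ψ p φ G h1 h2 using fun j => h j ε hε
  exact ⟨ψ, p, φ, G, fun j => (h1 j).mono hε (hle j), fun j =>
    (h2 j).trans (mul_le_mul_of_nonneg_right (hle j) hε.le)⟩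

lemma exists_homPair (hmean : GradMeanZero volume) (hA : IsElliptic A)
    (hm : ∀ i j, Measurable fun x => A x i j) (hAc : Coef (fun x => cx (A x)) α β)
    (hAt : Coef (fun x => cx (At x)) α' β') (hirr : IrrotationalForm volume A)
    (hN : IsCellSolution volume A At N W) (hAhat : ∀ κ, IsHatHom volume A κ (Ahat κ)) :
    ∃ a b : ℝ, 0 < a ∧ 0 < b ∧ ∀ κ, HomPair (magneticHom volume At W) (Ahat κ) a b := by
  have hT := hAc.cx_inv
  have hp := hT.pos
  have hq := hT.bdd_pos
  set c := α⁻¹ * (α⁻¹ / (α / β ^ 2)) with hc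
  have hc0 : 0 < c := by positivity
  have ha : 0 < min (α / β ^ 2) α' := lt_min hT.pos hAt.pos
  refine ⟨_, c, ha, hc0, fun κ => ⟨ha, hc0, fun v => ?_, (hAhat κ).norm_le hT, fun v => ?_⟩⟩
  · exact (mul_le_mul_of_nonneg_right (min_le_left _ _) (sq_nonneg _)).trans
      ((hAhat κ).coercive hmean hT v)
  · exact (mul_le_mul_of_nonneg_right (min_le_right _ _) (sq_nonneg _)).trans
      (magneticHom_coercive hmean hA hm hAt hirr hN v)

/-- The homogenised solution in the frequency domain. -/
def homField (At : R3 → RMat) (W Ahat : R3 → CMat) (ε : ℝ) (r : R3 → C3) (θ : R3) : C3 :=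
  homSol (magneticHom volume At W) (Ahat (ε • θ)) θ (r θ)

/-- The constant must not depend on `ε`: coercivity and boundedness of `Ahat κ` are uniform in `κ`,
and for `|θ| < 1/ε` the quasimomentum `εθ` lies in the unit ball, where the Lipschitz bound at zero
holds. -/
lemma exists_isHomField (hmean : GradMeanZero volume) (hA : IsElliptic A)
    (hm : ∀ i j, Measurable fun x => A x i j) (hAc : Coef (fun x => cx (A x)) α β)
    (hAt : Coef (fun x => cx (At x)) α' β') (hirr : IrrotationalForm volume A)
    (hN : IsCellSolution volume A At N W) (hAhat : ∀ κ, IsHatHom volume A κ (Ahat κ)) :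
    ∃ K : ℝ, 0 ≤ K ∧ ∀ ε : ℝ, 0 < ε → ∀ (g : R3 → C3) (hg : MemLp g 2 volume),
      IsDivFree volume g → IsHomField (magneticHom volume At W) (Ahat 0) (fun θ => Ahat (ε • θ)) ε K
        (planch hg.toLp) (homField At W Ahat ε (planch hg.toLp)) := by
  obtain ⟨a, b, ha, hb, hpair⟩ := exists_homPair hmean hA hm hAc hAt hirr hN hAhat
  obtain ⟨K, hK, hbound⟩ := exists_homSol_bound ha hb
  have hT := hAc.cx_inv
  have hp := hT.pos
  have hq := hT.bdd_pos
  set Λ := 2 * (α⁻¹ * (α⁻¹ / (α / β ^ 2)) * (α⁻¹ / (α / β ^ 2) + 1)) with hΛ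
  have hΛ0 : 0 ≤ Λ := by positivity
  refine ⟨K + Λ, by positivity, fun ε hε g hg hd => ?_⟩
  have htr : ∀ᵐ θ, inner ℂ (cvec θ) (planch hg.toLp θ) = 0 := by
    filter_upwards [sum_mul_planch_eq_zero hg hd] with θ h
    rw [inner_cvec, h]
  have hmeas : ∀ i j, Measurable fun θ : R3 => Ahat (ε • θ) i j := fun i j =>
    (measurable_hatHom hT hAhat i j).comp (measurable_const_smul ε)
  refine ⟨memLp_planch _, aestronglyMeasurable_homSol hmeas (memLp_planch _).1, by positivity, htr,
    .of_forall fun θ => (hpair _).homSol_eq, ?_, fun θ hθ c => ?_⟩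
  · filter_upwards [htr] with θ h
    obtain ⟨b1, b2, b3, b4⟩ := hbound (hpair (ε • θ)) h
    have h0 : K * ‖planch hg.toLp θ‖ ≤ (K + Λ) * ‖planch hg.toLp θ‖ :=
      mul_le_mul_of_nonneg_right (le_add_of_nonneg_right hΛ0) (norm_nonneg _)
    exact ⟨b1.trans h0, b2.trans h0, b3.trans h0, b4.trans h0⟩
  · have hn : ‖ε • θ‖ = ε * ‖θ‖ := by rw [norm_smul, Real.norm_of_nonneg hε.le]
    have h1 : ‖ε • θ‖ ≤ 1 := by
      rw [hn, ← mul_inv_cancel₀ hε.ne']; exact mul_le_mul_of_nonneg_left hθ.le hε.le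
    have h2 := (hAhat (ε • θ)).norm_sub_le hmean (hAhat 0) hT h1 c
    rw [hn] at h2
    refine h2.trans ?_
    gcongr
    exact le_add_of_nonneg_left hK.le

lemma exists_fluxCol_multiplier (hmean : GradMeanZero volume) (hA : IsElliptic A)
    (hm : ∀ i j, Measurable fun x => A x i j) (hAt : Coef (fun x => cx (At x)) α' β')
    (hirr : IrrotationalForm volume A) (hN : IsCellSolution volume A At N W) :
    ∃ C : ℝ, 0 ≤ C ∧ ∀ ε : ℝ, 0 < ε → ∀ j, ∀ f ∈ testC (E := ℂ),
      MemLp (fun x => f x • rescale ε (fluxCol W j) x) 2 volume ∧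
      l2 volume (fun x => f x • rescale ε (fluxCol W j) x) ≤
        C * (l2 volume f + ε * l2 volume (grad f)) := by
  have h : ∀ j, ∃ C : ℝ, 0 ≤ C ∧ ∀ ε : ℝ, 0 < ε → ∀ f ∈ testC (E := ℂ),
      MemLp (fun x => f x • rescale ε (fluxCol W j) x) 2 volume ∧
      l2 volume (fun x => f x • rescale ε (fluxCol W j) x) ≤
        C * (l2 volume f + ε * l2 volume (grad f)) := fun j => by
    obtain ⟨p, q, hpq, hq⟩ := exists_potential hmean hA hm hAt hirr hN j
    exact exists_multiplier hmean hAt (isFlux_fluxCol hA hN j) hpq hq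
  choose C hC h using h
  refine ⟨∑ j, C j, Finset.sum_nonneg fun j _ => hC j, fun ε hε j f hf =>
    ⟨(h j ε hε f hf).1, (h j ε hε f hf).2.trans (mul_le_mul_of_nonneg_right
      (Finset.single_le_sum (fun i _ => hC i) (Finset.mem_univ j)) ?_)⟩⟩
  exact add_nonneg (l2_nonneg _) (mul_nonneg hε.le (l2_nonneg _))

lemma mv_rescale_add_one (ε : ℝ) (x : R3) (v : C3) :
    mv (rescale ε W x + 1) v = ∑ j, v j • rescale ε (fluxCol W j) x := by
  rw [mv_eq_sum_col]
  refine Finset.sum_congr rfl fun j _ => ?_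
  rw [col_add, col_one]
  rfl

/-- Three errors add up: the residual of the low-frequency two-scale field, converted by the energy
estimate; the passage from smooth correctors to `curl N`, controlled by Parseval; and the
high-frequency part of `F_ε`, controlled by the multiplier inequality. -/
theorem exists_homogenisation_estimate (hA : IsElliptic A) (hAper : IsQPeriodic A)
    (hm : ∀ i j, Measurable fun x => A x i j) (hAt : Coef (fun x => cx (At x)) α' β')
    (hmean : GradMeanZero volume) (hirr : IrrotationalForm volume A)
    (hN : IsCellSolution volume A At N W) (hAhat : ∀ κ, IsHatHom volume A κ (Ahat κ)) :
    ∃ C : ℝ, 0 ≤ C ∧ ∀ ε : ℝ, 0 < ε → ∀ (g Dd B : R3 → C3) (hg : MemLp g 2 volume),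
      IsDivFree volume g → IsMaxwellSolution volume A At ε g Dd B →
      ∃ hF : MemLp (crossField (homField At W Ahat ε (planch hg.toLp))) 2 volume,
        MemLp (fun x => B x - mv (rescale ε W x + 1) (synth hF.toLp x)) 2 volume ∧
        l2 volume (fun x => B x - mv (rescale ε W x + 1) (synth hF.toLp x)) ≤
          C * ε * l2 volume g := by
  obtain ⟨α, β, hAc⟩ := Coef.of_isElliptic hA hAper hm
  have hT := hAc.cx_inv
  obtain ⟨K, hK, hhom⟩ := exists_isHomField hmean hA hm hAc hAt hirr hN hAhat
  obtain ⟨K₁, hK₁, hcor⟩ := exists_correctors hmean hA hm hAc hAt hirr hN (hAhat 0)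
  obtain ⟨C, hC, hmul⟩ := exists_fluxCol_multiplier hmean hA hm hAt hirr hN
  have hβ' := hAt.bdd_pos
  have hTβ := hT.bdd_pos
  have hmin : 0 < min α' (α / β ^ 2) := lt_min hAt.pos hT.pos
  set R := 3 * (K * K₁ * (19 + 4 * α⁻¹ + 18 * β')) + (6 + K * K) with hR
  have hR0 : 0 ≤ R := by positivity
  refine ⟨2 * (min α' (α / β ^ 2))⁻¹ * R + 57 * (K * K₁) + 12 * (C * K), by positivity,
    fun ε hε g Dd B hg hd hsol => ?_⟩
  have H := hhom ε hε g hg hd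
  obtain ⟨ψ, p, φ, G, hc, hφ⟩ := hcor ε hε
  set h := homField At W Ahat ε (planch hg.toLp) with hh
  have hF : MemLp (crossField h) 2 volume :=
    H.memLp.of_le_mul (aestronglyMeasurable_crossI H.meas) (H.bound.mono fun θ h => h.2.2.1)
  obtain ⟨mB, lB⟩ := l2_sub_le_of_residual (δ := ε * R * l2 volume g) hA hm hAc hAt
    (scaledMeasure_volume hε) hsol (H.contDiff_lowField hε hc) (H.memLp_lowField hε hc)
    (H.memLp_lowCurl hε hc) (H.curl_lowField hε hc)
    (mul_nonneg (mul_nonneg hε.le hR0) (l2_nonneg _))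
    fun u hu => H.lowField_residual hε hg hT hAt hc hu
  have hfl := isFlux_fluxCol hA hN
  obtain ⟨mL, lL⟩ := H.lowCurl_sub_le hε hc (fun j => (hfl j).per) (fun j => (hfl j).memLp) hφ
  obtain ⟨mH, lH⟩ := l2_high_le hε hC (hmul ε hε) H.memLp hF hK (H.bound.mono fun θ h => h.2.2.2)
  rw [l2_planch] at lL lH
  refine ⟨hF, ?_⟩
  have mV := (H.memLp_lowCurl hε hc).sub mB
  -- Insert the two-scale curl and the low-frequency part of `F_ε` between the solution and its
  -- approximation.
  have e : (fun x => B x - mv (rescale ε W x + 1) (synth hF.toLp x)) = fun x =>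
      ((lowCurl ε φ h x - ∑ j, (fs fun θ => lowPart ε (crossField h) θ j) x •
        rescale ε (fluxCol W j) x) - (lowCurl ε φ h x - B x)) -
      ∑ j, (synth hF.toLp x j - fs (fun θ => lowPart ε (crossField h) θ j) x) •
        rescale ε (fluxCol W j) x := by
    ext1 x
    rw [mv_rescale_add_one]
    simp only [sub_smul, Finset.sum_sub_distrib]
    abel
  have mLV : MemLp (fun x => (lowCurl ε φ h x - ∑ j, (fs fun θ => lowPart ε (crossField h) θ j) x •
      rescale ε (fluxCol W j) x) - (lowCurl ε φ h x - B x)) 2 volume := mL.sub mV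
  rw [e]
  refine ⟨mLV.sub mH, (l2_sub_le mLV mH).trans
    ((add_le_add ((l2_sub_le mL mV).trans (add_le_add lL lB)) lH).trans (le_of_eq ?_))⟩
  ring

end
end

end MaxwellHom

end

theorem mainTheorem9 (μ : Measure R3) (A At : R3 → RMat) (N W : R3 → CMat) (Ahat : R3 → CMat)
    (hμ : IsPeriodicMeasure μ)
    (hA : IsElliptic A) (hAper : IsQPeriodic A)
    (hAdiff : ∀ i j, Differentiable ℝ (fun x => A x i j))
    (hAt : IsElliptic At) (hAtper : IsQPeriodic At)
    (hAtmeas : ∀ i j, Measurable (fun x => At x i j))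
    (hmean : GradMeanZero μ) (hirr : IrrotationalForm μ A) (hpoinc : CurlPoincare μ)
    (hcomp : CompactCurlEmbedding μ A)
    (hN : IsCellSolution μ A At N W)
    (hAhat : ∀ κ : R3, IsHatHom μ A κ (Ahat κ)) :
    ∃ C : ℝ, 0 < C ∧ ∀ ε : ℝ, 0 < ε → ∀ g Dd B : R3 → C3,
      MemLp g 2 (scaledMeasure μ ε) → IsDivFree (scaledMeasure μ ε) g →
      IsMaxwellSolution μ A At ε g Dd B →
      ∃ gh F : R3 → C3,
        IsFourierTransform (scaledMeasure μ ε) g gh ∧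
        IsFourierSynthesis (scaledMeasure μ ε)
          (fun θ => mv (crossI θ * (Ahat (ε • θ))⁻¹ *
            (frakA (magneticHom μ At W) (Ahat (ε • θ)) θ + 1)⁻¹) (gh θ)) F ∧
        eLpNorm (fun x => B x - mv (rescale ε W x + 1) (F x)) 2 (scaledMeasure μ ε) ≤
          ENNReal.ofReal (C * ε) * eLpNorm g 2 (scaledMeasure μ ε) ∧
        eLpNorm (fun x => mv (cx (rescale ε At x)) (B x) -
            mv (cx (rescale ε At x)) (mv (rescale ε W x + 1) (F x))) 2 (scaledMeasure μ ε) ≤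
          ENNReal.ofReal (C * ε) * eLpNorm g 2 (scaledMeasure μ ε) := by
  obtain rfl := eq_volume_of_gradMeanZero hμ hmean
  have hm : ∀ i j, Measurable fun x => A x i j := fun i j => (hAdiff i j).continuous.measurable
  obtain ⟨α', β', hAtc⟩ := Coef.of_isElliptic hAt hAtper hAtmeas
  have hβ' := hAtc.bdd_pos
  obtain ⟨a, b, -, -, hpair⟩ := exists_homPair hmean hA hm
    (Coef.of_isElliptic hA hAper hm).choose_spec.choose_spec hAtc hirr hN hAhat
  obtain ⟨C, hC, h⟩ := exists_homogenisation_estimate hA hAper hm hAtc hmean hirr hN hAhat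
  -- The factor `1 + β'` covers the estimate for `ℋ_ε`, where `Ã` costs `β'`; the summand `1` makes
  -- the constant strictly positive.
  refine ⟨C * (1 + β') + 1, by positivity, fun ε hε g Dd B hg hd hsol => ?_⟩
  simp only [scaledMeasure_volume hε] at hg hd ⊢
  obtain ⟨hF, hm1, hl1⟩ := h ε hε g Dd B hg hd hsol
  -- The symbol in the theorem, written with two inverses, is the curl symbol applied to the
  -- solution of the homogenised equation.
  have hsym : (fun θ => mv (crossI θ * (Ahat (ε • θ))⁻¹ *
      (frakA (magneticHom volume At W) (Ahat (ε • θ)) θ + 1)⁻¹) (planch hg.toLp θ)) =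
      crossField (homField At W Ahat ε (planch hg.toLp)) := funext fun θ => by
    rw [(hpair (ε • θ)).symbol_eq, mv_mul]
    rfl
  have hconv : ∀ {f : R3 → C3} {K : ℝ}, MemLp f 2 volume → 0 ≤ K → K ≤ C * (1 + β') + 1 →
      l2 volume f ≤ K * ε * l2 volume g →
      eLpNorm f 2 volume ≤ ENNReal.ofReal ((C * (1 + β') + 1) * ε) * eLpNorm g 2 volume := by
    intro f K hf hK0 hK hle
    rw [← ofReal_l2 hg, ← ENNReal.ofReal_mul (by positivity)]
    refine eLpNorm_le_of_l2_le hf (hle.trans ?_)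
    exact mul_le_mul_of_nonneg_right (mul_le_mul_of_nonneg_right hK hε.le) (l2_nonneg _)
  have hCβ : 0 ≤ C * β' := by positivity
  refine ⟨planch hg.toLp, synth hF.toLp, isFourierTransform_planch hg, ?_,
    hconv hm1 hC (by linarith) hl1, ?_⟩
  · rw [hsym]
    exact isFourierSynthesis_synth hF
  · obtain ⟨m2, hl2⟩ := hAtc.memLp_rescale (ε := ε) hm1
    simp only [mv_sub] at m2 hl2
    refine hconv (K := β' * C) m2 (by positivity) (by linarith) (hl2.trans ?_)
    rw [mul_assoc β', mul_assoc β']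
    exact mul_le_mul_of_nonneg_left (hl1.trans_eq (by ring)) hβ'.le
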